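/- **RelCost relational embedding.** RelCost is taken without recursive functions; RHOL is relational higher-order logic over simply typed PCF. *Index terms and constraints.* Index terms are $I::= i\mid n\in\mathbb N\mid\infty\mid I+I\mid I-I\mid I\cdot I\mid\min(I,I)\mid\max(I,I)$. Index variables have sort $\mathrm{nat}$ (ranging over $\mathbb N$) or $\mathrm{real}$ (ranging over the extended reals); an index term has sort $\mathrm{nat}$ if it is built without $\infty$ and subtraction from variables of sort $\mathrm{nat}$, and every index term over $\Delta$ has sort $\mathrm{real}$. Constraints are $C::=I=I\mid I\le I\mid I<I\mid\neg C$. For an index context $\Delta$ and a list $\Phi$ of constraints, $\Delta;\Phi\models C$ means that every valuation of $\Delta$ that satisfies $\Phi$ satisfies $C$. *RelCost syntax.* Expressions: $t::=x\mid \mathsf n\mid\lambda x.t\mid t\,t\mid\Lambda.t\mid t[\,]\mid\mathsf{nil}\mid\mathsf{cons}(t,t)\mid \mathsf{case}\ t\ \mathsf{of}\ \mathsf{nil}\to t\mid h{::}tl\to t$. Unary types: $A::=\mathbb N\mid \mathrm{list}[n]A\mid A\xrightarrow{\mathrm{exec}(k,l)}A\mid\forall i{::}S\overset{\mathrm{exec}(k,l)}{.}A$.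 Relational types: $\tau::=\mathbb N_r\mid\mathrm{list}[n]^\alpha\tau\mid\tau\xrightarrow{\mathrm{diff}(l)}\tau\mid\forall i{::}S\overset{\mathrm{diff}(l)}{.}\tau\mid U A\mid\Box\tau$, with $n,\alpha$ of sort $\mathrm{nat}$ and $k,l$ of sort $\mathrm{real}$. Natural numbers $c_{app},c_{iapp},c_{case}$ (the costs of the eliminations) are fixed and arbitrary. The erasure $\overline\tau$ to unary types is $\overline{\mathbb N_r}=\mathbb N$, $\overline{\mathrm{list}[n]^\alpha\tau}=\mathrm{list}[n]\overline\tau$, $\overline{\tau\xrightarrow{\mathrm{diff}(l)}\sigma}=\overline\tau\xrightarrow{\mathrm{exec}(0,\infty)}\overline\sigma$, $\overline{\forall i\overset{\mathrm{diff}(l)}{.}\tau}=\forall i\overset{\mathrm{exec}(0,\infty)}{.}\overline\tau$, $\overline{UA}=A$, $\overline{\Box\tau}=\overline\tau$. *Subtyping.* Unary $\Delta;\Phi\vdash A\sqsubseteq A'$ is generated by reflexivity, transitivity, covariance of lists (with $\Delta;\Phi\models n=n'$), contra/covariance of arrows, and covariance of $\forall$, where an interval $(k,l)$ may be widened to $(k',l')$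 when $k'\le k$, $l\le l'$ are entailed. Relational $\Delta;\Phi\vdash\tau\sqsubseteq\tau'$ is generated by reflexivity; transitivity; lists ($n=n'$, $\alpha\le\alpha'$ entailed, covariant); arrows ($l\le l'$, contra/covariant); $\forall$ ($l\le l'$, covariant); monotonicity of $U$ and $\Box$; $\mathrm{list}[n]^\alpha\tau\sqsubseteq\mathrm{list}[n]^\alpha\Box\tau$ if $\Delta;\Phi\models\alpha= 0$; $\mathrm{list}[n]^\alpha\Box\tau\sqsubseteq\Box\,\mathrm{list}[n]^\alpha\tau$; $\Box(\tau\xrightarrow{\mathrm{diff}(l)}\sigma)\sqsubseteq\Box\tau\xrightarrow{\mathrm{diff}(0)}\Box\sigma$; $U(A\xrightarrow{\mathrm{exec}(k,l)}B)\sqsubseteq UA\xrightarrow{\mathrm{diff}(l-k)}UB$; $U(\forall i\overset{\mathrm{exec}(k,l)}{.}A)\sqsubseteq\forall i\overset{\mathrm{diff}(l-k)}{.}UA$; $\tau\sqsubseteq U\overline\tau$; $\mathbb N_r\sqsubseteq\Box\mathbb N_r$; $\Box\tau\sqsubseteq\tau$; $\Box\tau\sqsubseteq\Box\Box\tau$.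 Intermediate types are well formed. *Unary typing* $\Delta;\Phi;\Omega\vdash^l_k t:A$ has the following rules; types that a rule introduces are well formed. Variables, constants ($\mathsf n:\mathbb N$), abstractions ($A_1\xrightarrow{\mathrm{exec}(k,l)}A_2$, when the body has type $A_2$ with bounds $k,l$), $\mathsf{nil}:\mathrm{list}[0]A$, and $\Lambda.t:\forall i{::}S\overset{\mathrm{exec}(k,l)}{.}A$ (when $t:A$ with bounds $k,l$ over $i{::}S,\Delta$, with $i$ not free in $\Phi,\Omega$) have bounds $0,0$. If $t_1:A_1\xrightarrow{\mathrm{exec}(k,l)}A_2$ with bounds $k_1,l_1$ and $t_2:A_1$ with bounds $k_2,l_2$, then $t_1t_2:A_2$ with bounds $k_1+k_2+k+c_{app}$, $l_1+l_2+l+c_{app}$. If $t:\forall i{::}S\overset{\mathrm{exec}(k',l')}{.}A$ with bounds $k,l$ and $\Delta\vdash J:S$, then $t[\,]:A\{J/i\}$ with bounds $k+k'[J/i]+c_{iapp}$, $l+l'[J/i]+c_{iapp}$. A $\mathsf{cons}$ of $A$ and $\mathrm{list}[n]A$ has type $\mathrm{list}[n+1]A$ and adds bounds. A case on $t:\mathrm{list}[n]A$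 has type $A'$ if the nil branch does under $n=0$, and the cons branch does under a new $i{::}\mathrm{nat}$, $n=i+1$, $h:A$, $tl:\mathrm{list}[i]A$, both with bounds $k',l'$; its bounds are $k+k'+c_{case}$, $l+l'+c_{case}$. Subsumption passes to a supertype and to entailed weaker bounds. *Relational typing* $\Delta;\Phi;\Gamma\vdash t_1\ominus t_2\lesssim l:\tau$ has these rules. - $x\ominus x\lesssim0:\Gamma(x)$; $\mathsf n\ominus\mathsf n\lesssim 0:\mathbb N_r$; $\mathsf{nil}\ominus\mathsf{nil}\lesssim0:\mathrm{list}[0]^\alpha\tau$. - If $t_1\ominus t_1'\lesssim l_1:\tau$ and $t_2\ominus t_2'\lesssim l_2:\mathrm{list}[n]^\alpha\tau$, then $\mathsf{cons}(t_1,t_2)\ominus\mathsf{cons}(t_1',t_2')\lesssim l_1+l_2:\mathrm{list}[n+1]^{\alpha+1}\tau$; if moreover the heads have type $\Box\tau$, the type $\mathrm{list}[n+1]^{\alpha}\tau$ may be concluded. - Case: from $t\ominus t'\lesssim l:\mathrm{list}[n]^\alpha\tau$; $t_1\ominus t_1'\lesssim l':\tau'$ under $n=0$; $t_2\ominus t_2'\lesssim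 l':\tau'$ under $i{::}\mathrm{nat}$, $n=i+1$, $h:\Box\tau$, $tl:\mathrm{list}[i]^\alpha\tau$; and $t_2\ominus t_2'\lesssim l':\tau'$ under $i,\beta{::}\mathrm{nat}$, $n=i+1$, $\alpha=\beta+1$, $h:\tau$, $tl:\mathrm{list}[i]^\beta\tau$, the two cases are related at $\tau'$ with bound $l+l'$. - If $t_1\ominus t_2\lesssim l:\tau_2$ under $x:\tau_1$, then $\lambda x.t_1\ominus\lambda x.t_2\lesssim0:\tau_1\xrightarrow{\mathrm{diff}(l)}\tau_2$. If $t_1\ominus t_1'\lesssim l_1:\tau_1\xrightarrow{\mathrm{diff}(l)}\tau_2$ and $t_2\ominus t_2'\lesssim l_2:\tau_1$, then $t_1t_2\ominus t_1't_2'\lesssim l_1+l_2+l:\tau_2$. - If $t\ominus t'\lesssim l:\tau$ over $i{::}S,\Delta$ with $i$ not free in $\Phi,\Gamma$, then $\Lambda.t\ominus\Lambda.t'\lesssim0:\forall i{::}S\overset{\mathrm{diff}(l)}{.}\tau$. If $t\ominus t'\lesssim l:\forall i{::}S\overset{\mathrm{diff}(l')}{.}\tau$ and $\Delta\vdash J:S$,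 then $t[\,]\ominus t'[\,]\lesssim l+l'[J/i]:\tau\{J/i\}$. - No-change: if $t\ominus t\lesssim l:\tau$ under $\Gamma$ and $\Delta;\Phi\vdash\Gamma(x)\sqsubseteq\Box\Gamma(x)$ for all $x$ in $\Gamma$, then $t\ominus t\lesssim0:\Box\tau$ under every context that contains $\Gamma$. - Switch: if $\Delta;\Phi;\overline\Gamma\vdash^{l_i}_{k_i}t_i:A$ for $i=1,2$, then $t_1\ominus t_2\lesssim l_1-k_2:UA$. - Subsumption: the type may be replaced by a well-formed supertype and $l$ by $l'$ with $\Delta;\Phi\models l\le l'$. *Translations.* The erasure $|\cdot|$ to simple types maps $\mathbb N,\mathbb N_r$ to $\mathbb N$, lists to lists, arrows to arrows, $\forall i.A$ to $\mathbb N\to|A|$, $UA$ to $|A|$ and $\Box\tau$ to $|\tau|$. On simple types $(\mathbb N)_v=\mathbb N$, $(\mathrm{list}\,A)_v=\mathrm{list}\,(A)_v$, $(A\to B)_v=(A)_v\to(B)_e$, $(A)_e=(A)_v\times\mathbb N$. The cost-instrumented translation of expressions is $(x)=(x,0)$, $(\mathsf n)=(n,0)$, $(\lambda x.t)=(\lambda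 x.(t),0)$, $(\Lambda.t)=(\lambda\_.(t),0)$, $(\mathsf{nil})=(\mathsf{nil},0)$, $(tu)=\mathsf{let}\,x=(t)\,\mathsf{in}\,\mathsf{let}\,y=(u)\,\mathsf{in}\,\mathsf{let}\,z=\pi_1x\,(\pi_1y)\,\mathsf{in}\,(\pi_1z,\pi_2x+\pi_2y+\pi_2z+c_{app})$, $(t[\,])=\mathsf{let}\,x=(t)\,\mathsf{in}\,\mathsf{let}\,y=\pi_1x\,0\,\mathsf{in}\,(\pi_1y,\pi_2x+\pi_2y+c_{iapp})$, $(\mathsf{cons}(t,u))=\mathsf{let}\,x=(t)\,\mathsf{in}\,\mathsf{let}\,y=(u)\,\mathsf{in}\,(\pi_1x::\pi_1y,\pi_2x+\pi_2y)$, and $(\mathsf{case}\ t\ \mathsf{of}\ \mathsf{nil}\to t_1\mid h{::}tl\to t_2)=\mathsf{let}\,x=(t)\,\mathsf{in}\,\mathsf{case}\,\pi_1x\,\mathsf{of}\,\mathsf{nil}\to e_1\mid h{::}tl\to e_2$ with $e_j=\mathsf{let}\,y=(t_j)\,\mathsf{in}\,(\pi_1y,\pi_2x+\pi_2y+c_{case})$.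 Write $(t)_j$ for $(t)$ with every free variable $x$ replaced by its copy $x_j$. *Formulas.* $\mathsf{listU}$ and $\mathsf{listR}$ are predicates with the axioms $\mathsf{listU}(0,l,P)\Leftrightarrow l=[]$; $\mathsf{listU}(n+1,l,P)\Leftrightarrow\exists w_1w_2.\,l=w_1::w_2\wedge P(w_1)\wedge\mathsf{listU}(n,w_2,P)$; $\mathsf{listR}(0,l_1,l_2,a,P)\Leftrightarrow l_1=[]\wedge l_2=[]$; and $\mathsf{listR}(n+1,l_1,l_2,a,P)\Leftrightarrow\exists w_1z_1w_2z_2.\,l_1=w_1::w_2\wedge l_2=z_1::z_2\wedge P(w_1,z_1)\wedge\big((w_1=z_1\wedge\mathsf{listR}(n,w_2,z_2,a,P))\vee(a>0\wedge\exists b.\,a=b+1\wedge\mathsf{listR}(n,w_2,z_2,b,P))\big)$. For unary types: $\lfloor\mathbb N\rfloor_v(x)=\top$, $\lfloor\mathrm{list}[n]A\rfloor_v(x)=\mathsf{listU}(n,x,\lfloor A\rfloor_v)$, $\lfloor A\xrightarrow{\mathrm{exec}(k,l)}B\rfloor_v(x)=\forall y.\lfloor A\rfloor_v(y)\Rightarrow\lfloor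 B\rfloor^{k,l}_e(xy)$, $\lfloor\forall i\overset{\mathrm{exec}(k,l)}{.}A\rfloor_v(x)=\forall y.\top\Rightarrow\forall i.\lfloor A\rfloor_e^{k,l}(xy)$, where $\lfloor A\rfloor_e^{k,l}(x)=\lfloor A\rfloor_v(\pi_1x)\wedge k\le\pi_2x\le l$. For relational types: $\lfloor\mathbb N_r\rfloor_v(x,y)=(x=y)$; $\lfloor UA\rfloor_v(x,y)=\lfloor A\rfloor_v(x)\wedge\lfloor A\rfloor_v(y)$; $\lfloor\Box\tau\rfloor_v(x,y)=(x=y)\wedge\lfloor\tau\rfloor_v(x,y)$; $\lfloor\mathrm{list}[n]^\alpha\tau\rfloor_v(x,y)=\mathsf{listR}(n,x,y,\alpha,\lfloor\tau\rfloor_v)$; $\lfloor\rho\rfloor_v(x,y)=\lfloor\overline\rho\rfloor_v(x)\wedge\lfloor\overline\rho\rfloor_v(y)\wedge\forall z_1z_2.\lfloor\tau\rfloor_v(z_1,z_2)\Rightarrow\lfloor\sigma\rfloor_e^l(xz_1,yz_2)$ for $\rho=\tau\xrightarrow{\mathrm{diff}(l)}\sigma$; $\lfloor\rho\rfloor_v(x,y)=\lfloor\overline\rho\rfloor_v(x)\wedge\lfloor\overline\rho\rfloor_v(y)\wedge\forall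 z_1z_2.\top\Rightarrow\forall i.\lfloor\tau\rfloor_e^l(xz_1,yz_2)$ for $\rho=\forall i\overset{\mathrm{diff}(l)}{.}\tau$; and $\lfloor\tau\rfloor^l_e(x,y)=\lfloor\tau\rfloor_v(\pi_1x,\pi_1y)\wedge\pi_2x-\pi_2y\le l$ (difference of integers). For $\Gamma=x^1:\tau_1,\dots,x^n:\tau_n$ let $(\Gamma)$ be the context with $x^j_1,x^j_2:(|\tau_j|)_v$ and $\lfloor\Gamma\rfloor=\lfloor\tau_1\rfloor_v(x^1_1,x^1_2),\dots,\lfloor\tau_n\rfloor_v(x^n_1,x^n_2)$. *The logics.* HOL is natural deduction over the typed terms of PCF (booleans, natural numbers, lists, products, functions, case analysis, guarded structural recursion, $\beta\iota\mu$-conversion), with equality, induction for booleans, naturals and lists, disjointness and injectivity of constructors, the axioms above, quantification over index variables, and as arithmetic: every valid entailment of index constraints, induction on index variables of sort $\mathrm{nat}$, substitution of equal index terms, and the identification of terms of type $\mathbb N$ with index terms. UHOL and RHOL are the unary and relational refinement systems over HOL: RHOL derives $\Gamma\mid\Psi\vdash t_1:\sigma_1\sim t_2:\sigma_2\mid\phi(\mathbf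 r_1,\mathbf r_2)$ by its two-sided rules (variables, constructors, abstraction, application, projections, synchronous case analysis and recursion), its one-sided rules on the left and on the right, and its structural rules (subsumption, $\wedge$- and $\Rightarrow$-introduction, and passage from UHOL). **Theorem.** Let $\Phi$ and $\Gamma$ be well formed over $\Delta$, and suppose RelCost derives $\Delta;\Phi;\Gamma\vdash t_1\ominus t_2\lesssim l:\tau$. Then: 1. RHOL derives $$(\Gamma),\Delta\mid\Phi,\lfloor\Gamma\rfloor\ \vdash\ (t_1)_1:(|\tau|)_e\ \sim\ (t_2)_2:(|\tau|)_e\ \mid\ \lfloor\tau\rfloor_e^l(\mathbf r_1,\mathbf r_2).$$ 2. (Type soundness.) If $\Gamma$ is empty and $\delta$ is a valuation of $\Delta$ satisfying $\Phi$, then under call-by-value big-step evaluation, in which each application, index application and case analysis costs $c_{app}$, $c_{iapp}$, $c_{case}$ respectively, both $t_1$ and $t_2$ evaluate, and whenever $t_1$ evaluates to $v_1$ with cost $c_1$ and $t_2$ to $v_2$ with cost $c_2$, one has $(v_1,v_2)\in[\![\tau]\!]_\delta$ and $c_1-c_2\le l[\delta]$. Here $[\![A]\!]_\delta$ and $[\![\tau]\!]_\delta$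 are the sets of values and pairs of values defined by induction on types. $[\![\mathbb N]\!]$ is the set of numerals, and $[\![\mathrm{list}[n]A]\!]_\delta$ consists of the lists of length $n[\delta]$ of elements of $[\![A]\!]_\delta$. $[\![A\xrightarrow{\mathrm{exec}(k,l)}B]\!]_\delta$ consists of the $\lambda x.t$ such that for all $w\in[\![A]\!]_\delta$, $t[w/x]$ evaluates to an element of $[\![B]\!]_\delta$ with cost between $k[\delta]$ and $l[\delta]$; $[\![\forall i{::}S\overset{\mathrm{exec}(k,l)}{.}A]\!]_\delta$ consists of the $\Lambda.t$ such that for all $a$ of sort $S$, $t$ evaluates to an element of $[\![A]\!]_{\delta[i\mapsto a]}$ with cost between the values of $k$ and $l$ at $\delta[i\mapsto a]$. $[\![\mathbb N_r]\!]$ is equality of numerals; $[\![\mathrm{list}[n]^\alpha\tau]\!]_\delta$ consists of the pairs of lists of length $n[\delta]$ that are elementwise in $[\![\tau]\!]_\delta$ and differ in at most $\alpha[\delta]$ positions; $[\![UA]\!]_\delta=[\![A]\!]_\delta\times[\![A]\!]_\delta$; $[\![\Box\tau]\!]_\delta$ is the diagonal part of $[\![\tau]\!]_\delta$. For $\rho$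 a $\mathrm{diff}(l)$-arrow $\tau\to\sigma$ (resp. a $\mathrm{diff}(l)$-quantifier $\forall i{::}S.\tau$), $[\![\rho]\!]_\delta$ consists of the pairs with both components in $[\![\overline\rho]\!]_\delta$ whose bodies, instantiated with any pair of $[\![\tau]\!]_\delta$ (resp. for any $a$ of sort $S$), evaluate to a pair in $[\![\sigma]\!]_\delta$ (resp. $[\![\tau]\!]_{\delta[i\mapsto a]}$) with difference of costs at most the value of $l$. -/

import Mathlib

namespace RelCost

/-! ## Index terms and constraints -/

/-- Prepend a value to a sequence (used for de Bruijn substitutions). -/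
def scons {α : Type} (a : α) (f : ℕ → α) : ℕ → α
  | 0 => a
  | n + 1 => f n

infixr:60 " ;; " => scons

/-- Sorts of index variables: natural numbers and (extended) real numbers. -/
inductive Srt
  | nat
  | real

/-- Index terms with leaves in `L`. -/
inductive Ix (L : Type) : Type
  | leaf (x : L)
  | num (n : ℕ)
  | inf
  | add (I J : Ix L)
  | sub (I J : Ix L)
  | mul (I J : Ix L)
  | min (I J : Ix L)
  | max (I J : Ix L)

namespace Ix

def bind {L M : Type} (f : L → Ix M) : Ix L → Ix M
  | leaf x => f x
  | num n => num n
  | inf => inf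
  | add I J => add (I.bind f) (J.bind f)
  | sub I J => sub (I.bind f) (J.bind f)
  | mul I J => mul (I.bind f) (J.bind f)
  | min I J => min (I.bind f) (J.bind f)
  | max I J => max (I.bind f) (J.bind f)

def map {L M : Type} (f : L → M) (I : Ix L) : Ix M := I.bind (fun x => leaf (f x))

noncomputable def eval {L : Type} (ρ : L → EReal) : Ix L → EReal
  | leaf x => ρ x
  | num n => (n : EReal)
  | inf => ⊤
  | add I J => I.eval ρ + J.eval ρ
  | sub I J => I.eval ρ - J.eval ρ
  | mul I J => I.eval ρ * J.eval ρ
  | min I J => Min.min (I.eval ρ) (J.eval ρ)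
  | max I J => Max.max (I.eval ρ) (J.eval ρ)

/-- All leaves satisfy `p`. -/
def AllLeaves {L : Type} (p : L → Prop) : Ix L → Prop
  | leaf x => p x
  | num _ => True
  | inf => True
  | add I J => I.AllLeaves p ∧ J.AllLeaves p
  | sub I J => I.AllLeaves p ∧ J.AllLeaves p
  | mul I J => I.AllLeaves p ∧ J.AllLeaves p
  | min I J => I.AllLeaves p ∧ J.AllLeaves p
  | max I J => I.AllLeaves p ∧ J.AllLeaves p

/-- Built without `∞` and subtraction, from leaves of sort `nat`: a natural number. -/
def IsNat {L : Type} (p : L → Prop) : Ix L → Prop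
  | leaf x => p x
  | num _ => True
  | inf => False
  | add I J => I.IsNat p ∧ J.IsNat p
  | sub _ _ => False
  | mul I J => I.IsNat p ∧ J.IsNat p
  | min I J => I.IsNat p ∧ J.IsNat p
  | max I J => I.IsNat p ∧ J.IsNat p

end Ix

/-- Constraints over index terms. -/
inductive Cst (L : Type) : Type
  | eq (I J : Ix L)
  | le (I J : Ix L)
  | lt (I J : Ix L)
  | not (C : Cst L)

namespace Cst

def bind {L M : Type} (f : L → Ix M) : Cst L → Cst M
  | eq I J => eq (I.bind f) (J.bind f)
  | le I J => le (I.bind f) (J.bind f)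
  | lt I J => lt (I.bind f) (J.bind f)
  | not C => not (C.bind f)

def map {L M : Type} (f : L → M) (C : Cst L) : Cst M := C.bind (fun x => Ix.leaf (f x))

def Holds {L : Type} (ρ : L → EReal) : Cst L → Prop
  | eq I J => I.eval ρ = J.eval ρ
  | le I J => I.eval ρ ≤ J.eval ρ
  | lt I J => I.eval ρ < J.eval ρ
  | not C => ¬ C.Holds ρ

def AllLeaves {L : Type} (p : L → Prop) : Cst L → Prop
  | eq I J => I.AllLeaves p ∧ J.AllLeaves p
  | le I J => I.AllLeaves p ∧ J.AllLeaves p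
  | lt I J => I.AllLeaves p ∧ J.AllLeaves p
  | not C => C.AllLeaves p

end Cst

/-- Index terms and constraints over index variables (de Bruijn indices). -/
abbrev Idx := Ix ℕ
abbrev ICst := Cst ℕ

/-- An index context lists the sorts of the index variables. -/
abbrev ICtx := List Srt

/-- `Δ ⊢ J : S`. -/
def Idx.HasSort (Δ : ICtx) (J : Idx) : Srt → Prop
  | .nat => J.IsNat (fun i => Δ[i]? = some Srt.nat)
  | .real => J.AllLeaves (fun i => i < Δ.length)

def ICst.WF (Δ : ICtx) (C : ICst) : Prop := C.AllLeaves (fun i => i < Δ.length)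

def Srt.Mem : Srt → EReal → Prop
  | .nat, x => ∃ n : ℕ, x = (n : EReal)
  | .real, _ => True

/-- `δ` is a valuation of the index context `Δ`. -/
def ICtx.Valid (Δ : ICtx) (δ : ℕ → EReal) : Prop :=
  ∀ (i : ℕ) (S : Srt), Δ[i]? = some S → S.Mem (δ i)

/-- `Δ; Φ ⊨ C`: entailment of constraints in the standard model. -/
def Entails (Δ : ICtx) (Φ : List ICst) (C : ICst) : Prop :=
  ∀ δ : ℕ → EReal, Δ.Valid δ → (∀ D ∈ Φ, D.Holds δ) → C.Holds δ

def Idx.shift (k : ℕ) (I : Idx) : Idx := I.map (· + k)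
def ICst.shift (k : ℕ) (C : ICst) : ICst := C.map (· + k)

/-- Lift an index substitution under an index binder. -/
def iup (θ : ℕ → Idx) : ℕ → Idx := Ix.leaf 0 ;; fun n => (θ n).shift 1

/-! ## The object language of the logics: PCF with simple types, à la Curry -/

inductive Ty
  | bool
  | nat
  | list (τ : Ty)
  | prod (σ τ : Ty)
  | arr (σ τ : Ty)

/-- Terms with de Bruijn indices. `letrec e` binds in `e` the argument (index 0) and the
function (index 1). -/
inductive Tm
  | var (n : ℕ)
  | pair (t u : Tm)
  | fst (t : Tm)
  | snd (t : Tm)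
  | app (t u : Tm)
  | lam (t : Tm)
  | tt
  | ff
  | zero
  | nil
  | succ (t : Tm)
  | cons (t u : Tm)
  | natCase (t u v : Tm)
  | boolCase (t u v : Tm)
  | listCase (t u v : Tm)
  | letrec (e : Tm)

/-- Lift a renaming under a binder. -/
def upr (ξ : ℕ → ℕ) : ℕ → ℕ := 0 ;; fun n => ξ n + 1

namespace Tm

def rename : Tm → (ℕ → ℕ) → Tm
  | var n, ξ => var (ξ n)
  | pair t u, ξ => pair (t.rename ξ) (u.rename ξ)
  | fst t, ξ => fst (t.rename ξ)
  | snd t, ξ => snd (t.rename ξ)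
  | app t u, ξ => app (t.rename ξ) (u.rename ξ)
  | lam t, ξ => lam (t.rename (upr ξ))
  | tt, _ => tt
  | ff, _ => ff
  | zero, _ => zero
  | nil, _ => nil
  | succ t, ξ => succ (t.rename ξ)
  | cons t u, ξ => cons (t.rename ξ) (u.rename ξ)
  | natCase t u v, ξ => natCase (t.rename ξ) (u.rename ξ) (v.rename ξ)
  | boolCase t u v, ξ => boolCase (t.rename ξ) (u.rename ξ) (v.rename ξ)
  | listCase t u v, ξ => listCase (t.rename ξ) (u.rename ξ) (v.rename ξ)
  | letrec e, ξ => letrec (e.rename (upr (upr ξ)))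

/-- Weakening by `k` variables. -/
def shift (k : ℕ) (t : Tm) : Tm := t.rename (· + k)

/-- Lift a substitution under a binder. -/
def up (σ : ℕ → Tm) : ℕ → Tm := var 0 ;; fun n => (σ n).shift 1

/-- Simultaneous (capture-free) substitution. -/
def subst : Tm → (ℕ → Tm) → Tm
  | var n, σ => σ n
  | pair t u, σ => pair (t.subst σ) (u.subst σ)
  | fst t, σ => fst (t.subst σ)
  | snd t, σ => snd (t.subst σ)
  | app t u, σ => app (t.subst σ) (u.subst σ)
  | lam t, σ => lam (t.subst (up σ))
  | tt, _ => tt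
  | ff, _ => ff
  | zero, _ => zero
  | nil, _ => nil
  | succ t, σ => succ (t.subst σ)
  | cons t u, σ => cons (t.subst σ) (u.subst σ)
  | natCase t u v, σ => natCase (t.subst σ) (u.subst σ) (v.subst σ)
  | boolCase t u v, σ => boolCase (t.subst σ) (u.subst σ) (v.subst σ)
  | listCase t u v, σ => listCase (t.subst σ) (u.subst σ) (v.subst σ)
  | letrec e, σ => letrec (e.subst (up (up σ)))

/-- The substitution that sends the variable `n` to the variable `n + k`. -/
def sh (k : ℕ) : ℕ → Tm := fun n => var (n + k)

/-- Instantiate the variable 0 by `u`. -/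
def inst (t u : Tm) : Tm := t.subst (u ;; var)

/-- Terms with a constructor of an inductive type in head position. -/
inductive IsCon : Tm → Prop
  | tt : IsCon tt
  | ff : IsCon ff
  | zero : IsCon zero
  | succ (t : Tm) : IsCon (succ t)
  | nil : IsCon nil
  | cons (t u : Tm) : IsCon (cons t u)

/-- `Conv t u` is the equality `t =_{βιμ} u`: the least congruence that contains the reduction
rules. -/
inductive Conv : Tm → Tm → Prop
  | refl (t) : Conv t t
  | symm {t u} : Conv t u → Conv u t
  | trans {t u v} : Conv t u → Conv u v → Conv t v
  | beta (t u) : Conv (app (lam t) u) (t.inst u)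
  | fst_pair (t u) : Conv (fst (pair t u)) t
  | snd_pair (t u) : Conv (snd (pair t u)) u
  | natCase_zero (u v) : Conv (natCase zero u v) u
  | natCase_succ (t u v) : Conv (natCase (succ t) u v) (app v t)
  | boolCase_tt (u v) : Conv (boolCase tt u v) u
  | boolCase_ff (u v) : Conv (boolCase ff u v) v
  | listCase_nil (u v) : Conv (listCase nil u v) u
  | listCase_cons (h t u v) : Conv (listCase (cons h t) u v) (app (app v h) t)
  | mu (e c) : IsCon c → Conv (app (letrec e) c) (e.subst (c ;; letrec e ;; var))
  | pair {t t' u u'} : Conv t t' → Conv u u' → Conv (pair t u) (pair t' u')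
  | fst {t t'} : Conv t t' → Conv (fst t) (fst t')
  | snd {t t'} : Conv t t' → Conv (snd t) (snd t')
  | app {t t' u u'} : Conv t t' → Conv u u' → Conv (app t u) (app t' u')
  | lam {t t'} : Conv t t' → Conv (lam t) (lam t')
  | succ {t t'} : Conv t t' → Conv (succ t) (succ t')
  | cons {t t' u u'} : Conv t t' → Conv u u' → Conv (cons t u) (cons t' u')
  | natCase {t t' u u' v v'} : Conv t t' → Conv u u' → Conv v v' →
      Conv (natCase t u v) (natCase t' u' v')
  | boolCase {t t' u u' v v'} : Conv t t' → Conv u u' → Conv v v' →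
      Conv (boolCase t u v) (boolCase t' u' v')
  | listCase {t t' u u' v v'} : Conv t t' → Conv u u' → Conv v v' →
      Conv (listCase t u v) (listCase t' u' v')
  | letrec {e e'} : Conv e e' → Conv (letrec e) (letrec e')

/-- Syntactic guard for recursive definitions: in the term, the function variable `f` occurs only
applied to a variable of the list `sm`; these variables are bound by case analysis on the argument
`x` or on another variable of `sm`, and therefore stand for strictly smaller values than `x`. -/
inductive Guarded : ℕ → ℕ → List ℕ → Tm → Prop
  | var {f x sm n} : n ≠ f → Guarded f x sm (var n)
  | call {f x sm y} : y ∈ sm → Guarded f x sm (app (var f) (var y))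
  | pair {f x sm t u} : Guarded f x sm t → Guarded f x sm u → Guarded f x sm (pair t u)
  | fst {f x sm t} : Guarded f x sm t → Guarded f x sm (fst t)
  | snd {f x sm t} : Guarded f x sm t → Guarded f x sm (snd t)
  | app {f x sm t u} : Guarded f x sm t → Guarded f x sm u → Guarded f x sm (app t u)
  | lam {f x sm t} : Guarded (f + 1) (x + 1) (sm.map (· + 1)) t → Guarded f x sm (lam t)
  | tt {f x sm} : Guarded f x sm tt
  | ff {f x sm} : Guarded f x sm ff
  | zero {f x sm} : Guarded f x sm zero
  | nil {f x sm} : Guarded f x sm nil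
  | succ {f x sm t} : Guarded f x sm t → Guarded f x sm (succ t)
  | cons {f x sm t u} : Guarded f x sm t → Guarded f x sm u → Guarded f x sm (cons t u)
  | natCase {f x sm t u v} : Guarded f x sm t → Guarded f x sm u → Guarded f x sm v →
      Guarded f x sm (natCase t u v)
  | boolCase {f x sm t u v} : Guarded f x sm t → Guarded f x sm u → Guarded f x sm v →
      Guarded f x sm (boolCase t u v)
  | listCase {f x sm t u v} : Guarded f x sm t → Guarded f x sm u → Guarded f x sm v →
      Guarded f x sm (listCase t u v)
  | natCaseVar {f x sm y u v} : y ∈ x :: sm → Guarded f x sm u →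
      Guarded (f + 1) (x + 1) (0 :: sm.map (· + 1)) v →
      Guarded f x sm (natCase (var y) u (lam v))
  | listCaseVar {f x sm y u v} : y ∈ x :: sm → Guarded f x sm u →
      Guarded (f + 2) (x + 2) (0 :: sm.map (· + 2)) v →
      Guarded f x sm (listCase (var y) u (lam (lam v)))
  | letrec {f x sm e} : Guarded (f + 2) (x + 2) (sm.map (· + 2)) e → Guarded f x sm (letrec e)

/-- Addition on natural numbers, `letrec f x = λ y. case x of 0 ↦ y; S z ↦ S (f z y)`. -/
def addFun : Tm :=
  letrec (lam (natCase (var 1) (var 0) (lam (succ (app (app (var 3) (var 0)) (var 1))))))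

def add (t u : Tm) : Tm := app (app addFun t) u

/-- List length, `letrec f l = case l of [] ↦ 0; h :: t ↦ S (f t)`. -/
def lenFun : Tm :=
  letrec (listCase (var 0) zero (lam (lam (succ (app (var 3) (var 0))))))

def numeral : ℕ → Tm
  | 0 => zero
  | n + 1 => succ (numeral n)

/-- `let x = t in u`. -/
def letIn (t u : Tm) : Tm := app (lam u) t

end Tm

abbrev Ctx := List Ty

/-- The domains of recursive functions. -/
def Ty.IsInd (I : Ty) : Prop := I = Ty.nat ∨ ∃ τ, I = Ty.list τ

/-- `Γ ⊢ t : τ`. -/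
inductive HasTy : Ctx → Tm → Ty → Prop
  | var {Γ n τ} : Γ[n]? = some τ → HasTy Γ (.var n) τ
  | pair {Γ t u σ τ} : HasTy Γ t σ → HasTy Γ u τ → HasTy Γ (.pair t u) (.prod σ τ)
  | fst {Γ t σ τ} : HasTy Γ t (.prod σ τ) → HasTy Γ (.fst t) σ
  | snd {Γ t σ τ} : HasTy Γ t (.prod σ τ) → HasTy Γ (.snd t) τ
  | app {Γ t u σ τ} : HasTy Γ t (.arr σ τ) → HasTy Γ u σ → HasTy Γ (.app t u) τ
  | lam {Γ t σ τ} : HasTy (σ :: Γ) t τ → HasTy Γ (.lam t) (.arr σ τ)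
  | tt {Γ} : HasTy Γ .tt .bool
  | ff {Γ} : HasTy Γ .ff .bool
  | zero {Γ} : HasTy Γ .zero .nat
  | nil {Γ τ} : HasTy Γ .nil (.list τ)
  | succ {Γ t} : HasTy Γ t .nat → HasTy Γ (.succ t) .nat
  | cons {Γ t u τ} : HasTy Γ t τ → HasTy Γ u (.list τ) → HasTy Γ (.cons t u) (.list τ)
  | natCase {Γ t u v σ} : HasTy Γ t .nat → HasTy Γ u σ → HasTy Γ v (.arr .nat σ) →
      HasTy Γ (.natCase t u v) σ
  | boolCase {Γ t u v σ} : HasTy Γ t .bool → HasTy Γ u σ → HasTy Γ v σ →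
      HasTy Γ (.boolCase t u v) σ
  | listCase {Γ t u v τ σ} : HasTy Γ t (.list τ) → HasTy Γ u σ →
      HasTy Γ v (.arr τ (.arr (.list τ) σ)) → HasTy Γ (.listCase t u v) σ
  | letrec {Γ e I σ} : I.IsInd → HasTy (I :: .arr I σ :: Γ) e σ → Tm.Guarded 1 0 [] e →
      HasTy Γ (.letrec e) (.arr I σ)

/-! ## Higher-order logic -/

/-- Index terms of the logic: their leaves are index variables or terms of type `nat`. -/
abbrev HIx := Ix (ℕ ⊕ Tm)
abbrev HCst := Cst (ℕ ⊕ Tm)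

namespace HIx

def ivar (i : ℕ) : HIx := Ix.leaf (Sum.inl i)
def tm (t : Tm) : HIx := Ix.leaf (Sum.inr t)

/-- The substitution that sends the index variable `i` to the index variable `i + k`. -/
def ish (k : ℕ) : ℕ → HIx := fun i => ivar (i + k)

/-- Action of a term substitution and an index substitution on the leaves. -/
def leafSub (σ : ℕ → Tm) (θ : ℕ → HIx) : ℕ ⊕ Tm → HIx
  | .inl i => θ i
  | .inr t => tm (t.subst σ)

def sub (I : HIx) (σ : ℕ → Tm) (θ : ℕ → HIx) : HIx := I.bind (leafSub σ θ)

/-- Weakening by `k` term variables and `j` index variables. -/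
def shift (k j : ℕ) (I : HIx) : HIx := I.sub (Tm.sh k) (ish j)

def HasSort (Δ : ICtx) (Γ : Ctx) (I : HIx) : Srt → Prop
  | .nat => I.IsNat (Sum.elim (fun i => Δ[i]? = some Srt.nat) (fun t => HasTy Γ t .nat))
  | .real => I.AllLeaves (Sum.elim (fun i => i < Δ.length) (fun t => HasTy Γ t .nat))

end HIx

def Idx.toH (I : Idx) : HIx := I.map Sum.inl
def ICst.toH (C : ICst) : HCst := C.map Sum.inl

/-- Assertions. Besides equality, the basic predicates are the index constraints, `listU` and
`listR`. In `listU τ n l P` the assertion `P` binds one variable of type `τ`; in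
`listR τ n l₁ l₂ a P` it binds two, the left one being the variable 1 and the right one the
variable 0. `alli`, `exi` quantify over index variables. -/
inductive Fml
  | top
  | bot
  | and (φ ψ : Fml)
  | or (φ ψ : Fml)
  | imp (φ ψ : Fml)
  | all (τ : Ty) (φ : Fml)
  | ex (τ : Ty) (φ : Fml)
  | alli (S : Srt) (φ : Fml)
  | exi (S : Srt) (φ : Fml)
  | eq (τ : Ty) (t u : Tm)
  | cst (C : HCst)
  | listU (τ : Ty) (n : HIx) (l : Tm) (P : Fml)
  | listR (τ : Ty) (n : HIx) (l₁ l₂ : Tm) (a : HIx) (P : Fml)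

namespace Fml

/-- Simultaneous substitution of term variables and of index variables. -/
def sub : Fml → (ℕ → Tm) → (ℕ → HIx) → Fml
  | top, _, _ => top
  | bot, _, _ => bot
  | and φ ψ, σ, θ => and (φ.sub σ θ) (ψ.sub σ θ)
  | or φ ψ, σ, θ => or (φ.sub σ θ) (ψ.sub σ θ)
  | imp φ ψ, σ, θ => imp (φ.sub σ θ) (ψ.sub σ θ)
  | all τ φ, σ, θ => all τ (φ.sub (Tm.up σ) (fun i => (θ i).shift 1 0))
  | ex τ φ, σ, θ => ex τ (φ.sub (Tm.up σ) (fun i => (θ i).shift 1 0))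
  | alli S φ, σ, θ => alli S (φ.sub σ (HIx.ivar 0 ;; fun i => (θ i).shift 0 1))
  | exi S φ, σ, θ => exi S (φ.sub σ (HIx.ivar 0 ;; fun i => (θ i).shift 0 1))
  | eq τ t u, σ, _ => eq τ (t.subst σ) (u.subst σ)
  | cst C, σ, θ => cst (C.bind (HIx.leafSub σ θ))
  | listU τ n l P, σ, θ =>
      listU τ (n.sub σ θ) (l.subst σ) (P.sub (Tm.up σ) (fun i => (θ i).shift 1 0))
  | listR τ n l₁ l₂ a P, σ, θ =>
      listR τ (n.sub σ θ) (l₁.subst σ) (l₂.subst σ) (a.sub σ θ)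
        (P.sub (Tm.up (Tm.up σ)) (fun i => (θ i).shift 2 0))

/-- Substitution of term variables only. -/
def tsub (φ : Fml) (σ : ℕ → Tm) : Fml := φ.sub σ HIx.ivar

/-- Substitution of index variables only. -/
def isub (φ : Fml) (θ : ℕ → HIx) : Fml := φ.sub Tm.var θ

/-- `φ[t/x]` for the variable 0. -/
def inst (φ : Fml) (t : Tm) : Fml := φ.tsub (t ;; Tm.var)

/-- `φ[I/i]` for the index variable 0. -/
def iinst (φ : Fml) (I : HIx) : Fml := φ.isub (I ;; HIx.ivar)

/-- Weakening by `k` term variables. -/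
def shift (k : ℕ) (φ : Fml) : Fml := φ.tsub (Tm.sh k)

/-- Weakening by `k` index variables. -/
def ishift (k : ℕ) (φ : Fml) : Fml := φ.isub (HIx.ish k)

def iff (φ ψ : Fml) : Fml := and (imp φ ψ) (imp ψ φ)

/-- `Γ ⊢ φ`: well-typed assertions. -/
def WF : ICtx → Ctx → Fml → Prop
  | _, _, top => True
  | _, _, bot => True
  | Δ, Γ, and φ ψ => WF Δ Γ φ ∧ WF Δ Γ ψ
  | Δ, Γ, or φ ψ => WF Δ Γ φ ∧ WF Δ Γ ψ
  | Δ, Γ, imp φ ψ => WF Δ Γ φ ∧ WF Δ Γ ψ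
  | Δ, Γ, all τ φ => WF Δ (τ :: Γ) φ
  | Δ, Γ, ex τ φ => WF Δ (τ :: Γ) φ
  | Δ, Γ, alli S φ => WF (S :: Δ) Γ φ
  | Δ, Γ, exi S φ => WF (S :: Δ) Γ φ
  | _, Γ, eq τ t u => HasTy Γ t τ ∧ HasTy Γ u τ
  | Δ, Γ, cst C =>
      C.AllLeaves (Sum.elim (fun i => i < Δ.length) (fun t => HasTy Γ t .nat))
  | Δ, Γ, listU τ n l P => n.HasSort Δ Γ .nat ∧ HasTy Γ l (.list τ) ∧ WF Δ (τ :: Γ) P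
  | Δ, Γ, listR τ n l₁ l₂ a P =>
      n.HasSort Δ Γ .nat ∧ HasTy Γ l₁ (.list τ) ∧ HasTy Γ l₂ (.list τ) ∧
        a.HasSort Δ Γ .nat ∧ WF Δ (τ :: τ :: Γ) P

end Fml

/-- A valid set of assertions. -/
def CWF (Δ : ICtx) (Γ : Ctx) (Ψ : List Fml) : Prop := ∀ ψ ∈ Ψ, ψ.WF Δ Γ

/-- The right-hand side of the axiom for `listU (n+1, l, P)`:
`∃ w₁ w₂, l = w₁ :: w₂ ∧ P(w₁) ∧ listU(n, w₂, P)`. -/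
def listUSucc (τ : Ty) (n : HIx) (l : Tm) (P : Fml) : Fml :=
  .ex τ (.ex (.list τ) (.and
    (.eq (.list τ) (l.shift 2) (.cons (.var 1) (.var 0)))
    (.and (P.tsub (.var 1 ;; Tm.sh 2))
      (.listU τ (n.shift 2 0) (.var 0) (P.tsub (.var 0 ;; Tm.sh 3))))))

/-- The right-hand side of the axiom for `listR (n+1, l₁, l₂, a, P)`:
`∃ w₁ z₁ w₂ z₂, l₁ = w₁ :: w₂ ∧ l₂ = z₁ :: z₂ ∧ P(w₁, z₁) ∧ ((w₁ = z₁ ∧ listR(n, w₂, z₂, a, P)) ∨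
(a > 0 ∧ ∃ b, a = b + 1 ∧ listR(n, w₂, z₂, b, P)))`. -/
def listRSucc (τ : Ty) (n : HIx) (l₁ l₂ : Tm) (a : HIx) (P : Fml) : Fml :=
  .ex τ (.ex τ (.ex (.list τ) (.ex (.list τ) (.and
    (.eq (.list τ) (l₁.shift 4) (.cons (.var 3) (.var 1)))
    (.and (.eq (.list τ) (l₂.shift 4) (.cons (.var 2) (.var 0)))
    (.and (P.tsub (.var 2 ;; .var 3 ;; Tm.sh 4))
      (.or
        (.and (.eq τ (.var 3) (.var 2))
          (.listR τ (n.shift 4 0) (.var 1) (.var 0) (a.shift 4 0)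
            (P.tsub (.var 0 ;; .var 1 ;; Tm.sh 6))))
        (.and (.cst (.lt (.num 0) (a.shift 4 0)))
          (.exi .nat (.and
            (.cst (.eq (a.shift 4 1) (.add (HIx.ivar 0) (.num 1))))
            (.listR τ (n.shift 4 1) (.var 1) (.var 0) (HIx.ivar 0)
              (P.sub (.var 0 ;; .var 1 ;; Tm.sh 6) (HIx.ish 1)))))))))))))

/-- `HOL Δ Γ Ψ φ` is the judgment `Γ, Δ | Ψ ⊢ φ` of higher-order logic; the index variables `Δ` are
kept in a separate zone of the context. -/
inductive HOL : ICtx → Ctx → List Fml → Fml → Prop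
  | ax {Δ Γ Ψ φ} : CWF Δ Γ Ψ → φ ∈ Ψ → HOL Δ Γ Ψ φ
  | conv {Δ Γ Ψ t t' τ} : CWF Δ Γ Ψ → HasTy Γ t τ → HasTy Γ t' τ → Tm.Conv t t' →
      HOL Δ Γ Ψ (.eq τ t t')
  | subst {Δ Γ Ψ φ τ t u} : Fml.WF Δ (τ :: Γ) φ → HOL Δ Γ Ψ (φ.inst t) →
      HOL Δ Γ Ψ (.eq τ t u) → HOL Δ Γ Ψ (φ.inst u)
  | impI {Δ Γ Ψ φ ψ} : HOL Δ Γ (ψ :: Ψ) φ → HOL Δ Γ Ψ (.imp ψ φ)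
  | impE {Δ Γ Ψ φ ψ} : HOL Δ Γ Ψ (.imp ψ φ) → HOL Δ Γ Ψ ψ → HOL Δ Γ Ψ φ
  | allI {Δ Γ Ψ φ σ} : CWF Δ Γ Ψ → HOL Δ (σ :: Γ) (Ψ.map (Fml.shift 1)) φ →
      HOL Δ Γ Ψ (.all σ φ)
  | allE {Δ Γ Ψ φ σ t} : HOL Δ Γ Ψ (.all σ φ) → HasTy Γ t σ → HOL Δ Γ Ψ (φ.inst t)
  | exI {Δ Γ Ψ φ σ t} : Fml.WF Δ (σ :: Γ) φ → HasTy Γ t σ → HOL Δ Γ Ψ (φ.inst t) →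
      HOL Δ Γ Ψ (.ex σ φ)
  | exE {Δ Γ Ψ φ χ σ} : HOL Δ Γ Ψ (.ex σ φ) → Fml.WF Δ Γ χ →
      HOL Δ (σ :: Γ) (φ :: Ψ.map (Fml.shift 1)) (χ.shift 1) → HOL Δ Γ Ψ χ
  | topI {Δ Γ Ψ} : CWF Δ Γ Ψ → HOL Δ Γ Ψ .top
  | botE {Δ Γ Ψ φ} : HOL Δ Γ Ψ .bot → Fml.WF Δ Γ φ → HOL Δ Γ Ψ φ
  | andI {Δ Γ Ψ φ ψ} : HOL Δ Γ Ψ φ → HOL Δ Γ Ψ ψ → HOL Δ Γ Ψ (.and φ ψ)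
  | andE₁ {Δ Γ Ψ φ ψ} : HOL Δ Γ Ψ (.and φ ψ) → HOL Δ Γ Ψ φ
  | andE₂ {Δ Γ Ψ φ ψ} : HOL Δ Γ Ψ (.and φ ψ) → HOL Δ Γ Ψ ψ
  | orI₁ {Δ Γ Ψ φ ψ} : HOL Δ Γ Ψ φ → Fml.WF Δ Γ ψ → HOL Δ Γ Ψ (.or φ ψ)
  | orI₂ {Δ Γ Ψ φ ψ} : Fml.WF Δ Γ φ → HOL Δ Γ Ψ ψ → HOL Δ Γ Ψ (.or φ ψ)
  | orE {Δ Γ Ψ φ ψ χ} : HOL Δ Γ Ψ (.or φ ψ) → HOL Δ Γ (φ :: Ψ) χ → HOL Δ Γ (ψ :: Ψ) χ →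
      HOL Δ Γ Ψ χ
  -- quantifiers over index variables
  | alliI {Δ Γ Ψ φ S} : CWF Δ Γ Ψ → HOL (S :: Δ) Γ (Ψ.map (Fml.ishift 1)) φ →
      HOL Δ Γ Ψ (.alli S φ)
  | alliE {Δ Γ Ψ φ S I} : HOL Δ Γ Ψ (.alli S φ) → HIx.HasSort Δ Γ I S → HOL Δ Γ Ψ (φ.iinst I)
  | exiI {Δ Γ Ψ φ S I} : Fml.WF (S :: Δ) Γ φ → HIx.HasSort Δ Γ I S → HOL Δ Γ Ψ (φ.iinst I) →
      HOL Δ Γ Ψ (.exi S φ)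
  | exiE {Δ Γ Ψ φ χ S} : HOL Δ Γ Ψ (.exi S φ) → Fml.WF Δ Γ χ →
      HOL (S :: Δ) Γ (φ :: Ψ.map (Fml.ishift 1)) (χ.ishift 1) → HOL Δ Γ Ψ χ
  -- inductive types
  | list {Δ Γ Ψ φ τ} : Fml.WF Δ (.list τ :: Γ) φ → HOL Δ Γ Ψ (φ.inst .nil) →
      HOL Δ (.list τ :: τ :: Γ) (φ.tsub (.var 0 ;; Tm.sh 2) :: Ψ.map (Fml.shift 2))
        (φ.tsub (.cons (.var 1) (.var 0) ;; Tm.sh 2)) →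
      HOL Δ Γ Ψ (.all (.list τ) φ)
  | nat {Δ Γ Ψ φ} : Fml.WF Δ (.nat :: Γ) φ → HOL Δ Γ Ψ (φ.inst .zero) →
      HOL Δ (.nat :: Γ) (φ :: Ψ.map (Fml.shift 1)) (φ.tsub (.succ (.var 0) ;; Tm.sh 1)) →
      HOL Δ Γ Ψ (.all .nat φ)
  | bool {Δ Γ Ψ φ} : Fml.WF Δ (.bool :: Γ) φ → HOL Δ Γ Ψ (φ.inst .tt) → HOL Δ Γ Ψ (φ.inst .ff) →
      HOL Δ Γ Ψ (.all .bool φ)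
  | nilCons {Δ Γ Ψ h t τ} : CWF Δ Γ Ψ → HasTy Γ (.cons h t) (.list τ) →
      HOL Δ Γ Ψ (.imp (.eq (.list τ) .nil (.cons h t)) .bot)
  | cons₁ {Δ Γ Ψ h t h' t' τ} : HOL Δ Γ Ψ (.eq (.list τ) (.cons h t) (.cons h' t')) →
      HOL Δ Γ Ψ (.eq τ h h')
  | cons₂ {Δ Γ Ψ h t h' t' τ} : HOL Δ Γ Ψ (.eq (.list τ) (.cons h t) (.cons h' t')) →
      HOL Δ Γ Ψ (.eq (.list τ) t t')
  | zeroSucc {Δ Γ Ψ t} : CWF Δ Γ Ψ → HasTy Γ t .nat →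
      HOL Δ Γ Ψ (.imp (.eq .nat .zero (.succ t)) .bot)
  | succInj {Δ Γ Ψ t t'} : HOL Δ Γ Ψ (.eq .nat (.succ t) (.succ t')) → HOL Δ Γ Ψ (.eq .nat t t')
  | ttff {Δ Γ Ψ} : CWF Δ Γ Ψ → HOL Δ Γ Ψ (.imp (.eq .bool .tt .ff) .bot)
  -- index constraints: equality, induction over index variables of sort `nat`, every entailment
  -- that is valid in the standard model, and the link with the terms of type `nat`
  | isubst {Δ Γ Ψ φ S I J} : Fml.WF (S :: Δ) Γ φ → HIx.HasSort Δ Γ I S → HIx.HasSort Δ Γ J S →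
      HOL Δ Γ Ψ (φ.iinst I) → HOL Δ Γ Ψ (.cst (.eq I J)) → HOL Δ Γ Ψ (φ.iinst J)
  | inat {Δ Γ Ψ φ} : Fml.WF (.nat :: Δ) Γ φ → HOL Δ Γ Ψ (φ.iinst (.num 0)) →
      HOL (.nat :: Δ) Γ (φ :: Ψ.map (Fml.ishift 1))
        (φ.isub (.add (HIx.ivar 0) (.num 1) ;; HIx.ish 1)) →
      HOL Δ Γ Ψ (.alli .nat φ)
  | arith {Δ Γ Ψ} (Δ' : ICtx) (Cs : List ICst) (C : ICst) (θ : ℕ → HIx) : CWF Δ Γ Ψ →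
      (∀ D ∈ Cs, D.WF Δ') → C.WF Δ' → Entails Δ' Cs C →
      (∀ i S, Δ'[i]? = some S → HIx.HasSort Δ Γ (θ i) S) →
      (∀ D ∈ Cs, HOL Δ Γ Ψ (.cst (D.bind θ))) → HOL Δ Γ Ψ (.cst (C.bind θ))
  | cstNot {Δ Γ Ψ C} : HOL Δ Γ Ψ (.cst (.not C)) → HOL Δ Γ Ψ (.cst C) → HOL Δ Γ Ψ .bot
  | tmZero {Δ Γ Ψ} : CWF Δ Γ Ψ → HOL Δ Γ Ψ (.cst (.eq (HIx.tm .zero) (.num 0)))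
  | tmSucc {Δ Γ Ψ t} : CWF Δ Γ Ψ → HasTy Γ t .nat →
      HOL Δ Γ Ψ (.cst (.eq (HIx.tm (.succ t)) (.add (HIx.tm t) (.num 1))))
  | tmEq {Δ Γ Ψ t u} : HOL Δ Γ Ψ (.cst (.eq (HIx.tm t) (HIx.tm u))) → HOL Δ Γ Ψ (.eq .nat t u)
  -- axioms of the predicates on lists
  | listU_zero {Δ Γ Ψ τ l P} : CWF Δ Γ Ψ → HasTy Γ l (.list τ) → Fml.WF Δ (τ :: Γ) P →
      HOL Δ Γ Ψ (.iff (.listU τ (.num 0) l P) (.eq (.list τ) l .nil))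
  | listU_succ {Δ Γ Ψ τ n l P} : CWF Δ Γ Ψ → HIx.HasSort Δ Γ n .nat → HasTy Γ l (.list τ) →
      Fml.WF Δ (τ :: Γ) P →
      HOL Δ Γ Ψ (.iff (.listU τ (.add n (.num 1)) l P) (listUSucc τ n l P))
  | listR_zero {Δ Γ Ψ τ l₁ l₂ a P} : CWF Δ Γ Ψ → HasTy Γ l₁ (.list τ) → HasTy Γ l₂ (.list τ) →
      HIx.HasSort Δ Γ a .nat → Fml.WF Δ (τ :: τ :: Γ) P →
      HOL Δ Γ Ψ (.iff (.listR τ (.num 0) l₁ l₂ a P)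
        (.and (.eq (.list τ) l₁ .nil) (.eq (.list τ) l₂ .nil)))
  | listR_succ {Δ Γ Ψ τ n l₁ l₂ a P} : CWF Δ Γ Ψ → HIx.HasSort Δ Γ n .nat →
      HasTy Γ l₁ (.list τ) → HasTy Γ l₂ (.list τ) → HIx.HasSort Δ Γ a .nat →
      Fml.WF Δ (τ :: τ :: Γ) P →
      HOL Δ Γ Ψ (.iff (.listR τ (.add n (.num 1)) l₁ l₂ a P) (listRSucc τ n l₁ l₂ a P))

/-! ## Unary higher-order logic -/

/-- The size of a natural number or list, as an index term. -/
def sizeOf : Ty → Tm → HIx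
  | .list _, t => HIx.tm (.app Tm.lenFun t)
  | _, t => HIx.tm t

/-- `∀ x : τ, φ' ⇒ φ[r x / r]`, for `φ'` over `Γ, x` and `φ` over `Γ, x, r`. -/
def funSpec (τ : Ty) (φ' φ : Fml) : Fml :=
  .all τ (.imp (φ'.tsub (.var 0 ;; Tm.sh 2)) (φ.tsub (.app (.var 1) (.var 0) ;; .var 0 ;; Tm.sh 2)))

/-- `UHOL Δ Γ Ψ t σ φ` is the judgment `Γ, Δ | Ψ ⊢ t : σ | φ`. The variable `r` of `φ` is the
variable 0. -/
inductive UHOL : ICtx → Ctx → List Fml → Tm → Ty → Fml → Prop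
  | var {Δ Γ Ψ n σ φ} : HasTy Γ (.var n) σ → Fml.WF Δ (σ :: Γ) φ → HOL Δ Γ Ψ (φ.inst (.var n)) →
      UHOL Δ Γ Ψ (.var n) σ φ
  | abs {Δ Γ Ψ t τ σ φ' φ} : CWF Δ Γ Ψ → UHOL Δ (τ :: Γ) (φ' :: Ψ.map (Fml.shift 1)) t σ φ →
      UHOL Δ Γ Ψ (.lam t) (.arr τ σ) (funSpec τ φ' φ)
  | app {Δ Γ Ψ t u τ σ φ' φ} : Fml.WF Δ (σ :: τ :: Γ) φ →
      UHOL Δ Γ Ψ t (.arr τ σ) (funSpec τ φ' φ) → UHOL Δ Γ Ψ u τ φ' →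
      UHOL Δ Γ Ψ (.app t u) σ (φ.tsub (.var 0 ;; u.shift 1 ;; Tm.sh 1))
  | tt {Δ Γ Ψ φ} : Fml.WF Δ (.bool :: Γ) φ → HOL Δ Γ Ψ (φ.inst .tt) → UHOL Δ Γ Ψ .tt .bool φ
  | ff {Δ Γ Ψ φ} : Fml.WF Δ (.bool :: Γ) φ → HOL Δ Γ Ψ (φ.inst .ff) → UHOL Δ Γ Ψ .ff .bool φ
  | zero {Δ Γ Ψ φ} : Fml.WF Δ (.nat :: Γ) φ → HOL Δ Γ Ψ (φ.inst .zero) →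
      UHOL Δ Γ Ψ .zero .nat φ
  | nil {Δ Γ Ψ σ φ} : Fml.WF Δ (.list σ :: Γ) φ → HOL Δ Γ Ψ (φ.inst .nil) →
      UHOL Δ Γ Ψ .nil (.list σ) φ
  | succ {Δ Γ Ψ t φ' φ} : Fml.WF Δ (.nat :: Γ) φ → UHOL Δ Γ Ψ t .nat φ' →
      HOL Δ Γ Ψ (.all .nat (.imp φ' (φ.tsub (.succ (.var 0) ;; Tm.sh 1)))) →
      UHOL Δ Γ Ψ (.succ t) .nat φ
  | cons {Δ Γ Ψ h t σ φ' φ'' φ} : Fml.WF Δ (.list σ :: Γ) φ → UHOL Δ Γ Ψ h σ φ' →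
      UHOL Δ Γ Ψ t (.list σ) φ'' →
      HOL Δ Γ Ψ (.all σ (.all (.list σ) (.imp (φ'.tsub (.var 1 ;; Tm.sh 2))
        (.imp (φ''.tsub (.var 0 ;; Tm.sh 2)) (φ.tsub (.cons (.var 1) (.var 0) ;; Tm.sh 2)))))) →
      UHOL Δ Γ Ψ (.cons h t) (.list σ) φ
  | pair {Δ Γ Ψ t u σ τ φ' φ'' φ} : Fml.WF Δ (.prod σ τ :: Γ) φ → UHOL Δ Γ Ψ t σ φ' →
      UHOL Δ Γ Ψ u τ φ'' →
      HOL Δ Γ Ψ (.all σ (.all τ (.imp (φ'.tsub (.var 1 ;; Tm.sh 2))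
        (.imp (φ''.tsub (.var 0 ;; Tm.sh 2)) (φ.tsub (.pair (.var 1) (.var 0) ;; Tm.sh 2)))))) →
      UHOL Δ Γ Ψ (.pair t u) (.prod σ τ) φ
  | fst {Δ Γ Ψ t σ τ φ} : Fml.WF Δ (σ :: Γ) φ →
      UHOL Δ Γ Ψ t (.prod σ τ) (φ.tsub (.fst (.var 0) ;; Tm.sh 1)) → UHOL Δ Γ Ψ (.fst t) σ φ
  | snd {Δ Γ Ψ t σ τ φ} : Fml.WF Δ (τ :: Γ) φ →
      UHOL Δ Γ Ψ t (.prod σ τ) (φ.tsub (.snd (.var 0) ;; Tm.sh 1)) → UHOL Δ Γ Ψ (.snd t) τ φ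
  | sub {Δ Γ Ψ t σ φ' φ} : Fml.WF Δ (σ :: Γ) φ → UHOL Δ Γ Ψ t σ φ' →
      HOL Δ Γ Ψ (.imp (φ'.inst t) (φ.inst t)) → UHOL Δ Γ Ψ t σ φ
  | boolCase {Δ Γ Ψ t u v σ φ} : HasTy Γ t .bool → UHOL Δ Γ (.eq .bool t .tt :: Ψ) u σ φ →
      UHOL Δ Γ (.eq .bool t .ff :: Ψ) v σ φ → UHOL Δ Γ Ψ (.boolCase t u v) σ φ
  | natCase {Δ Γ Ψ t u v σ φ} : HasTy Γ t .nat → UHOL Δ Γ (.eq .nat t .zero :: Ψ) u σ φ →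
      UHOL Δ Γ Ψ v (.arr .nat σ) (.all .nat (.imp (.eq .nat (t.shift 2) (.succ (.var 0)))
        (φ.tsub (.app (.var 1) (.var 0) ;; Tm.sh 2)))) →
      UHOL Δ Γ Ψ (.natCase t u v) σ φ
  | listCase {Δ Γ Ψ l u v τ σ φ} : HasTy Γ l (.list τ) →
      UHOL Δ Γ (.eq (.list τ) l .nil :: Ψ) u σ φ →
      UHOL Δ Γ Ψ v (.arr τ (.arr (.list τ) σ)) (.all τ (.all (.list τ)
        (.imp (.eq (.list τ) (l.shift 3) (.cons (.var 1) (.var 0)))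
          (φ.tsub (.app (.app (.var 2) (.var 1)) (.var 0) ;; Tm.sh 3))))) →
      UHOL Δ Γ Ψ (.listCase l u v) σ φ
  | letrec {Δ Γ Ψ e I σ φ' φ} : CWF Δ Γ Ψ → HasTy Γ (.letrec e) (.arr I σ) →
      Fml.WF Δ (I :: Γ) φ' → Fml.WF Δ (σ :: I :: Γ) φ →
      UHOL Δ (.arr I σ :: I :: Γ)
        (.all I (.imp (.cst (.lt (sizeOf I (.var 0)) (sizeOf I (.var 2))))
            (.imp (φ'.tsub (.var 0 ;; Tm.sh 3))
              (φ.tsub (.app (.var 1) (.var 0) ;; .var 0 ;; Tm.sh 3))))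
          :: φ'.shift 1 :: Ψ.map (Fml.shift 2))
        (e.subst (.var 1 ;; .var 0 ;; Tm.sh 2)) σ (φ.tsub (.var 0 ;; Tm.sh 2)) →
      UHOL Δ Γ Ψ (.letrec e) (.arr I σ) (funSpec I φ' φ)

/-! ## Relational higher-order logic -/

/-- `φ[t₁/r₁][t₂/r₂]`; the variable `r₁` is the variable 1 and `r₂` the variable 0. -/
def Fml.inst2 (φ : Fml) (t₁ t₂ : Tm) : Fml := φ.tsub (t₂ ;; t₁ ;; Tm.var)

/-- `∀ x₁ : τ₁, ∀ x₂ : τ₂, φ' ⇒ φ[r₁ x₁ / r₁][r₂ x₂ / r₂]`, for `φ'` over `Γ, x₁, x₂` and `φ` over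
`Γ, x₁, x₂, r₁, r₂`. -/
def funSpec2 (τ₁ τ₂ : Ty) (φ' φ : Fml) : Fml :=
  .all τ₁ (.all τ₂ (.imp (φ'.tsub (.var 0 ;; .var 1 ;; Tm.sh 4))
    (φ.tsub (.app (.var 2) (.var 0) ;; .app (.var 3) (.var 1) ;; .var 0 ;; .var 1 ;; Tm.sh 4))))

/-- `∀ x₁ : τ₁, φ' ⇒ φ[r₁ x₁ / r₁]`, for `φ'` over `Γ, x₁` and `φ` over `Γ, x₁, r₁, r₂`. -/
def funSpecL (τ₁ : Ty) (φ' φ : Fml) : Fml :=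
  .all τ₁ (.imp (φ'.tsub (.var 0 ;; Tm.sh 3))
    (φ.tsub (.var 1 ;; .app (.var 2) (.var 0) ;; .var 0 ;; Tm.sh 3)))

/-- `∀ x₂ : τ₂, φ' ⇒ φ[r₂ x₂ / r₂]`, for `φ'` over `Γ, x₂` and `φ` over `Γ, x₂, r₁, r₂`. -/
def funSpecR (τ₂ : Ty) (φ' φ : Fml) : Fml :=
  .all τ₂ (.imp (φ'.tsub (.var 0 ;; Tm.sh 3))
    (φ.tsub (.app (.var 1) (.var 0) ;; .var 2 ;; .var 0 ;; Tm.sh 3)))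

/-- `(a₁, a₂) < (b₁, b₂)`: componentwise `≤`, with at least one strict inequality. -/
def prodLt (a₁ a₂ b₁ b₂ : HIx) : Fml :=
  .and (.cst (.le a₁ b₁)) (.and (.cst (.le a₂ b₂)) (.or (.cst (.lt a₁ b₁)) (.cst (.lt a₂ b₂))))

/-- `RHOL Δ Γ Ψ t₁ σ₁ t₂ σ₂ φ` is the judgment `Γ, Δ | Ψ ⊢ t₁ : σ₁ ∼ t₂ : σ₂ | φ`. In `φ`, the
variable `r₁` is the variable 1 and `r₂` the variable 0. -/
inductive RHOL : ICtx → Ctx → List Fml → Tm → Ty → Tm → Ty → Fml → Prop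
  -- two-sided rules
  | abs {Δ Γ Ψ t₁ t₂ τ₁ τ₂ σ₁ σ₂ φ' φ} : CWF Δ Γ Ψ →
      RHOL Δ (τ₂ :: τ₁ :: Γ) (φ' :: Ψ.map (Fml.shift 2))
        (t₁.subst (.var 1 ;; Tm.sh 2)) σ₁ (t₂.subst (.var 0 ;; Tm.sh 2)) σ₂ φ →
      RHOL Δ Γ Ψ (.lam t₁) (.arr τ₁ σ₁) (.lam t₂) (.arr τ₂ σ₂) (funSpec2 τ₁ τ₂ φ' φ)
  | app {Δ Γ Ψ t₁ t₂ u₁ u₂ τ₁ τ₂ σ₁ σ₂ φ' φ} : Fml.WF Δ (σ₂ :: σ₁ :: τ₂ :: τ₁ :: Γ) φ →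
      RHOL Δ Γ Ψ t₁ (.arr τ₁ σ₁) t₂ (.arr τ₂ σ₂) (funSpec2 τ₁ τ₂ φ' φ) →
      RHOL Δ Γ Ψ u₁ τ₁ u₂ τ₂ φ' →
      RHOL Δ Γ Ψ (.app t₁ u₁) σ₁ (.app t₂ u₂) σ₂
        (φ.tsub (.var 0 ;; .var 1 ;; u₂.shift 2 ;; u₁.shift 2 ;; Tm.sh 2))
  | zero {Δ Γ Ψ φ} : Fml.WF Δ (.nat :: .nat :: Γ) φ → HOL Δ Γ Ψ (φ.inst2 .zero .zero) →
      RHOL Δ Γ Ψ .zero .nat .zero .nat φ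
  | succ {Δ Γ Ψ t₁ t₂ φ' φ} : Fml.WF Δ (.nat :: .nat :: Γ) φ →
      RHOL Δ Γ Ψ t₁ .nat t₂ .nat φ' →
      HOL Δ Γ Ψ (.all .nat (.all .nat (.imp φ'
        (φ.tsub (.succ (.var 0) ;; .succ (.var 1) ;; Tm.sh 2))))) →
      RHOL Δ Γ Ψ (.succ t₁) .nat (.succ t₂) .nat φ
  | var {Δ Γ Ψ n₁ n₂ σ₁ σ₂ φ} : HasTy Γ (.var n₁) σ₁ → HasTy Γ (.var n₂) σ₂ →
      Fml.WF Δ (σ₂ :: σ₁ :: Γ) φ → HOL Δ Γ Ψ (φ.inst2 (.var n₁) (.var n₂)) →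
      RHOL Δ Γ Ψ (.var n₁) σ₁ (.var n₂) σ₂ φ
  | tt {Δ Γ Ψ φ} : Fml.WF Δ (.bool :: .bool :: Γ) φ → HOL Δ Γ Ψ (φ.inst2 .tt .tt) →
      RHOL Δ Γ Ψ .tt .bool .tt .bool φ
  | ff {Δ Γ Ψ φ} : Fml.WF Δ (.bool :: .bool :: Γ) φ → HOL Δ Γ Ψ (φ.inst2 .ff .ff) →
      RHOL Δ Γ Ψ .ff .bool .ff .bool φ
  | nil {Δ Γ Ψ σ₁ σ₂ φ} : Fml.WF Δ (.list σ₂ :: .list σ₁ :: Γ) φ →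
      HOL Δ Γ Ψ (φ.inst2 .nil .nil) → RHOL Δ Γ Ψ .nil (.list σ₁) .nil (.list σ₂) φ
  | cons {Δ Γ Ψ h₁ t₁ h₂ t₂ σ₁ σ₂ φ' φ'' φ} : Fml.WF Δ (.list σ₂ :: .list σ₁ :: Γ) φ →
      RHOL Δ Γ Ψ h₁ σ₁ h₂ σ₂ φ' → RHOL Δ Γ Ψ t₁ (.list σ₁) t₂ (.list σ₂) φ'' →
      HOL Δ Γ Ψ (.all σ₁ (.all σ₂ (.all (.list σ₁) (.all (.list σ₂)
        (.imp (φ'.tsub (.var 2 ;; .var 3 ;; Tm.sh 4))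
          (.imp (φ''.tsub (.var 0 ;; .var 1 ;; Tm.sh 4))
            (φ.tsub (.cons (.var 2) (.var 0) ;; .cons (.var 3) (.var 1) ;; Tm.sh 4)))))))) →
      RHOL Δ Γ Ψ (.cons h₁ t₁) (.list σ₁) (.cons h₂ t₂) (.list σ₂) φ
  | pair {Δ Γ Ψ t₁ u₁ t₂ u₂ σ₁ τ₁ σ₂ τ₂ φ' φ'' φ} :
      Fml.WF Δ (.prod σ₂ τ₂ :: .prod σ₁ τ₁ :: Γ) φ →
      RHOL Δ Γ Ψ t₁ σ₁ t₂ σ₂ φ' → RHOL Δ Γ Ψ u₁ τ₁ u₂ τ₂ φ'' →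
      HOL Δ Γ Ψ (.all σ₁ (.all σ₂ (.all τ₁ (.all τ₂
        (.imp (φ'.tsub (.var 2 ;; .var 3 ;; Tm.sh 4))
          (.imp (φ''.tsub (.var 0 ;; .var 1 ;; Tm.sh 4))
            (φ.tsub (.pair (.var 2) (.var 0) ;; .pair (.var 3) (.var 1) ;; Tm.sh 4)))))))) →
      RHOL Δ Γ Ψ (.pair t₁ u₁) (.prod σ₁ τ₁) (.pair t₂ u₂) (.prod σ₂ τ₂) φ
  | fst {Δ Γ Ψ t₁ t₂ σ₁ τ₁ σ₂ τ₂ φ} : Fml.WF Δ (σ₂ :: σ₁ :: Γ) φ →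
      RHOL Δ Γ Ψ t₁ (.prod σ₁ τ₁) t₂ (.prod σ₂ τ₂)
        (φ.tsub (.fst (.var 0) ;; .fst (.var 1) ;; Tm.sh 2)) →
      RHOL Δ Γ Ψ (.fst t₁) σ₁ (.fst t₂) σ₂ φ
  | snd {Δ Γ Ψ t₁ t₂ σ₁ τ₁ σ₂ τ₂ φ} : Fml.WF Δ (τ₂ :: τ₁ :: Γ) φ →
      RHOL Δ Γ Ψ t₁ (.prod σ₁ τ₁) t₂ (.prod σ₂ τ₂)
        (φ.tsub (.snd (.var 0) ;; .snd (.var 1) ;; Tm.sh 2)) →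
      RHOL Δ Γ Ψ (.snd t₁) τ₁ (.snd t₂) τ₂ φ
  -- structural rules
  | sub {Δ Γ Ψ t₁ t₂ σ₁ σ₂ φ' φ} : Fml.WF Δ (σ₂ :: σ₁ :: Γ) φ → RHOL Δ Γ Ψ t₁ σ₁ t₂ σ₂ φ' →
      HOL Δ Γ Ψ (.imp (φ'.inst2 t₁ t₂) (φ.inst2 t₁ t₂)) → RHOL Δ Γ Ψ t₁ σ₁ t₂ σ₂ φ
  | andI {Δ Γ Ψ t₁ t₂ σ₁ σ₂ φ φ'} : RHOL Δ Γ Ψ t₁ σ₁ t₂ σ₂ φ → RHOL Δ Γ Ψ t₁ σ₁ t₂ σ₂ φ' →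
      RHOL Δ Γ Ψ t₁ σ₁ t₂ σ₂ (.and φ φ')
  | impI {Δ Γ Ψ t₁ t₂ σ₁ σ₂ φ φ'} : Fml.WF Δ (σ₂ :: σ₁ :: Γ) φ' →
      RHOL Δ Γ (φ'.inst2 t₁ t₂ :: Ψ) t₁ σ₁ t₂ σ₂ φ → RHOL Δ Γ Ψ t₁ σ₁ t₂ σ₂ (.imp φ' φ)
  | uholL {Δ Γ Ψ t₁ t₂ σ₁ σ₂ φ} : Fml.WF Δ (σ₂ :: σ₁ :: Γ) φ → HasTy Γ t₂ σ₂ →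
      UHOL Δ Γ Ψ t₁ σ₁ (φ.tsub (t₂.shift 1 ;; .var 0 ;; Tm.sh 1)) → RHOL Δ Γ Ψ t₁ σ₁ t₂ σ₂ φ
  | uholR {Δ Γ Ψ t₁ t₂ σ₁ σ₂ φ} : Fml.WF Δ (σ₂ :: σ₁ :: Γ) φ → HasTy Γ t₁ σ₁ →
      UHOL Δ Γ Ψ t₂ σ₂ (φ.tsub (.var 0 ;; t₁.shift 1 ;; Tm.sh 1)) → RHOL Δ Γ Ψ t₁ σ₁ t₂ σ₂ φ
  -- one-sided rules, left
  | absL {Δ Γ Ψ t₁ t₂ τ₁ σ₁ σ₂ φ' φ} : CWF Δ Γ Ψ → HasTy Γ t₂ σ₂ →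
      RHOL Δ (τ₁ :: Γ) (φ' :: Ψ.map (Fml.shift 1)) t₁ σ₁ (t₂.shift 1) σ₂ φ →
      RHOL Δ Γ Ψ (.lam t₁) (.arr τ₁ σ₁) t₂ σ₂ (funSpecL τ₁ φ' φ)
  | appL {Δ Γ Ψ t₁ u₁ u₂ τ₁ σ₁ σ₂ φ' φ} : Fml.WF Δ (σ₂ :: σ₁ :: τ₁ :: Γ) φ →
      RHOL Δ Γ Ψ t₁ (.arr τ₁ σ₁) u₂ σ₂ (funSpecL τ₁ φ' φ) → UHOL Δ Γ Ψ u₁ τ₁ φ' →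
      RHOL Δ Γ Ψ (.app t₁ u₁) σ₁ u₂ σ₂ (φ.tsub (.var 0 ;; .var 1 ;; u₁.shift 2 ;; Tm.sh 2))
  | zeroL {Δ Γ Ψ t₂ σ₂ φ} : Fml.WF Δ (σ₂ :: .nat :: Γ) φ → HasTy Γ t₂ σ₂ →
      HOL Δ Γ Ψ (φ.inst2 .zero t₂) → RHOL Δ Γ Ψ .zero .nat t₂ σ₂ φ
  | succL {Δ Γ Ψ t₁ t₂ σ₂ φ' φ} : Fml.WF Δ (σ₂ :: .nat :: Γ) φ → RHOL Δ Γ Ψ t₁ .nat t₂ σ₂ φ' →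
      HOL Δ Γ Ψ (.all .nat (.all σ₂ (.imp φ' (φ.tsub (.var 0 ;; .succ (.var 1) ;; Tm.sh 2))))) →
      RHOL Δ Γ Ψ (.succ t₁) .nat t₂ σ₂ φ
  | ttL {Δ Γ Ψ t₂ σ₂ φ} : Fml.WF Δ (σ₂ :: .bool :: Γ) φ → HasTy Γ t₂ σ₂ →
      HOL Δ Γ Ψ (φ.inst2 .tt t₂) → RHOL Δ Γ Ψ .tt .bool t₂ σ₂ φ
  | ffL {Δ Γ Ψ t₂ σ₂ φ} : Fml.WF Δ (σ₂ :: .bool :: Γ) φ → HasTy Γ t₂ σ₂ →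
      HOL Δ Γ Ψ (φ.inst2 .ff t₂) → RHOL Δ Γ Ψ .ff .bool t₂ σ₂ φ
  | varL {Δ Γ Ψ n₁ t₂ σ₁ σ₂ φ} : CWF Δ Γ Ψ → HasTy Γ (.var n₁) σ₁ → HasTy Γ t₂ σ₂ →
      Fml.WF Δ (σ₁ :: Γ) φ → φ.inst (.var n₁) ∈ Ψ →
      RHOL Δ Γ Ψ (.var n₁) σ₁ t₂ σ₂ (φ.tsub (.var 1 ;; Tm.sh 2))
  | nilL {Δ Γ Ψ t₂ σ₁ σ₂ φ} : Fml.WF Δ (σ₂ :: .list σ₁ :: Γ) φ → HasTy Γ t₂ σ₂ →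
      HOL Δ Γ Ψ (φ.inst2 .nil t₂) → RHOL Δ Γ Ψ .nil (.list σ₁) t₂ σ₂ φ
  | consL {Δ Γ Ψ h₁ t₁ t₂ σ₁ σ₂ φ' φ'' φ} : Fml.WF Δ (σ₂ :: .list σ₁ :: Γ) φ →
      RHOL Δ Γ Ψ h₁ σ₁ t₂ σ₂ φ' → RHOL Δ Γ Ψ t₁ (.list σ₁) t₂ σ₂ φ'' →
      HOL Δ Γ Ψ (.all σ₁ (.all σ₂ (.all (.list σ₁)
        (.imp (φ'.tsub (.var 1 ;; .var 2 ;; Tm.sh 3))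
          (.imp (φ''.tsub (.var 1 ;; .var 0 ;; Tm.sh 3))
            (φ.tsub (.var 1 ;; .cons (.var 2) (.var 0) ;; Tm.sh 3))))))) →
      RHOL Δ Γ Ψ (.cons h₁ t₁) (.list σ₁) t₂ σ₂ φ
  | pairL {Δ Γ Ψ t₁ u₁ t₂ σ₁ τ₁ σ₂ φ' φ'' φ} : Fml.WF Δ (σ₂ :: .prod σ₁ τ₁ :: Γ) φ →
      RHOL Δ Γ Ψ t₁ σ₁ t₂ σ₂ φ' → RHOL Δ Γ Ψ u₁ τ₁ t₂ σ₂ φ'' →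
      HOL Δ Γ Ψ (.all σ₁ (.all σ₂ (.all τ₁
        (.imp (φ'.tsub (.var 1 ;; .var 2 ;; Tm.sh 3))
          (.imp (φ''.tsub (.var 1 ;; .var 0 ;; Tm.sh 3))
            (φ.tsub (.var 1 ;; .pair (.var 2) (.var 0) ;; Tm.sh 3))))))) →
      RHOL Δ Γ Ψ (.pair t₁ u₁) (.prod σ₁ τ₁) t₂ σ₂ φ
  | fstL {Δ Γ Ψ t₁ t₂ σ₁ τ₁ σ₂ φ} : Fml.WF Δ (σ₂ :: σ₁ :: Γ) φ →
      RHOL Δ Γ Ψ t₁ (.prod σ₁ τ₁) t₂ σ₂ (φ.tsub (.var 0 ;; .fst (.var 1) ;; Tm.sh 2)) →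
      RHOL Δ Γ Ψ (.fst t₁) σ₁ t₂ σ₂ φ
  | sndL {Δ Γ Ψ t₁ t₂ σ₁ τ₁ σ₂ φ} : Fml.WF Δ (σ₂ :: τ₁ :: Γ) φ →
      RHOL Δ Γ Ψ t₁ (.prod σ₁ τ₁) t₂ σ₂ (φ.tsub (.var 0 ;; .snd (.var 1) ;; Tm.sh 2)) →
      RHOL Δ Γ Ψ (.snd t₁) τ₁ t₂ σ₂ φ
  -- one-sided rules, right
  | absR {Δ Γ Ψ t₁ t₂ τ₂ σ₁ σ₂ φ' φ} : CWF Δ Γ Ψ → HasTy Γ t₁ σ₁ →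
      RHOL Δ (τ₂ :: Γ) (φ' :: Ψ.map (Fml.shift 1)) (t₁.shift 1) σ₁ t₂ σ₂ φ →
      RHOL Δ Γ Ψ t₁ σ₁ (.lam t₂) (.arr τ₂ σ₂) (funSpecR τ₂ φ' φ)
  | appR {Δ Γ Ψ t₂ u₁ u₂ τ₂ σ₁ σ₂ φ' φ} : Fml.WF Δ (σ₂ :: σ₁ :: τ₂ :: Γ) φ →
      RHOL Δ Γ Ψ u₁ σ₁ t₂ (.arr τ₂ σ₂) (funSpecR τ₂ φ' φ) → UHOL Δ Γ Ψ u₂ τ₂ φ' →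
      RHOL Δ Γ Ψ u₁ σ₁ (.app t₂ u₂) σ₂ (φ.tsub (.var 0 ;; .var 1 ;; u₂.shift 2 ;; Tm.sh 2))
  | zeroR {Δ Γ Ψ t₁ σ₁ φ} : Fml.WF Δ (.nat :: σ₁ :: Γ) φ → HasTy Γ t₁ σ₁ →
      HOL Δ Γ Ψ (φ.inst2 t₁ .zero) → RHOL Δ Γ Ψ t₁ σ₁ .zero .nat φ
  | succR {Δ Γ Ψ t₁ t₂ σ₁ φ' φ} : Fml.WF Δ (.nat :: σ₁ :: Γ) φ → RHOL Δ Γ Ψ t₁ σ₁ t₂ .nat φ' →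
      HOL Δ Γ Ψ (.all σ₁ (.all .nat (.imp φ' (φ.tsub (.succ (.var 0) ;; .var 1 ;; Tm.sh 2))))) →
      RHOL Δ Γ Ψ t₁ σ₁ (.succ t₂) .nat φ
  | ttR {Δ Γ Ψ t₁ σ₁ φ} : Fml.WF Δ (.bool :: σ₁ :: Γ) φ → HasTy Γ t₁ σ₁ →
      HOL Δ Γ Ψ (φ.inst2 t₁ .tt) → RHOL Δ Γ Ψ t₁ σ₁ .tt .bool φ
  | ffR {Δ Γ Ψ t₁ σ₁ φ} : Fml.WF Δ (.bool :: σ₁ :: Γ) φ → HasTy Γ t₁ σ₁ →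
      HOL Δ Γ Ψ (φ.inst2 t₁ .ff) → RHOL Δ Γ Ψ t₁ σ₁ .ff .bool φ
  | varR {Δ Γ Ψ t₁ n₂ σ₁ σ₂ φ} : CWF Δ Γ Ψ → HasTy Γ t₁ σ₁ → HasTy Γ (.var n₂) σ₂ →
      Fml.WF Δ (σ₂ :: Γ) φ → φ.inst (.var n₂) ∈ Ψ →
      RHOL Δ Γ Ψ t₁ σ₁ (.var n₂) σ₂ (φ.tsub (.var 0 ;; Tm.sh 2))
  | nilR {Δ Γ Ψ t₁ σ₁ σ₂ φ} : Fml.WF Δ (.list σ₂ :: σ₁ :: Γ) φ → HasTy Γ t₁ σ₁ →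
      HOL Δ Γ Ψ (φ.inst2 t₁ .nil) → RHOL Δ Γ Ψ t₁ σ₁ .nil (.list σ₂) φ
  | consR {Δ Γ Ψ t₁ h₂ t₂ σ₁ σ₂ φ' φ'' φ} : Fml.WF Δ (.list σ₂ :: σ₁ :: Γ) φ →
      RHOL Δ Γ Ψ t₁ σ₁ h₂ σ₂ φ' → RHOL Δ Γ Ψ t₁ σ₁ t₂ (.list σ₂) φ'' →
      HOL Δ Γ Ψ (.all σ₁ (.all σ₂ (.all (.list σ₂)
        (.imp (φ'.tsub (.var 1 ;; .var 2 ;; Tm.sh 3))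
          (.imp (φ''.tsub (.var 0 ;; .var 2 ;; Tm.sh 3))
            (φ.tsub (.cons (.var 1) (.var 0) ;; .var 2 ;; Tm.sh 3))))))) →
      RHOL Δ Γ Ψ t₁ σ₁ (.cons h₂ t₂) (.list σ₂) φ
  | pairR {Δ Γ Ψ t₁ t₂ u₂ σ₁ σ₂ τ₂ φ' φ'' φ} : Fml.WF Δ (.prod σ₂ τ₂ :: σ₁ :: Γ) φ →
      RHOL Δ Γ Ψ t₁ σ₁ t₂ σ₂ φ' → RHOL Δ Γ Ψ t₁ σ₁ u₂ τ₂ φ'' →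
      HOL Δ Γ Ψ (.all σ₁ (.all σ₂ (.all τ₂
        (.imp (φ'.tsub (.var 1 ;; .var 2 ;; Tm.sh 3))
          (.imp (φ''.tsub (.var 0 ;; .var 2 ;; Tm.sh 3))
            (φ.tsub (.pair (.var 1) (.var 0) ;; .var 2 ;; Tm.sh 3))))))) →
      RHOL Δ Γ Ψ t₁ σ₁ (.pair t₂ u₂) (.prod σ₂ τ₂) φ
  | fstR {Δ Γ Ψ t₁ t₂ σ₁ σ₂ τ₂ φ} : Fml.WF Δ (σ₂ :: σ₁ :: Γ) φ →
      RHOL Δ Γ Ψ t₁ σ₁ t₂ (.prod σ₂ τ₂) (φ.tsub (.fst (.var 0) ;; .var 1 ;; Tm.sh 2)) →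
      RHOL Δ Γ Ψ t₁ σ₁ (.fst t₂) σ₂ φ
  | sndR {Δ Γ Ψ t₁ t₂ σ₁ σ₂ τ₂ φ} : Fml.WF Δ (τ₂ :: σ₁ :: Γ) φ →
      RHOL Δ Γ Ψ t₁ σ₁ t₂ (.prod σ₂ τ₂) (φ.tsub (.snd (.var 0) ;; .var 1 ;; Tm.sh 2)) →
      RHOL Δ Γ Ψ t₁ σ₁ (.snd t₂) τ₂ φ
  -- synchronous case rules
  | boolCase {Δ Γ Ψ t₁ u₁ v₁ t₂ u₂ v₂ σ₁ σ₂ φ} :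
      RHOL Δ Γ Ψ t₁ .bool t₂ .bool
        (.or (.and (.eq .bool (.var 1) .tt) (.eq .bool (.var 0) .tt))
          (.and (.eq .bool (.var 1) .ff) (.eq .bool (.var 0) .ff))) →
      RHOL Δ Γ (.eq .bool t₂ .tt :: .eq .bool t₁ .tt :: Ψ) u₁ σ₁ u₂ σ₂ φ →
      RHOL Δ Γ (.eq .bool t₂ .ff :: .eq .bool t₁ .ff :: Ψ) v₁ σ₁ v₂ σ₂ φ →
      RHOL Δ Γ Ψ (.boolCase t₁ u₁ v₁) σ₁ (.boolCase t₂ u₂ v₂) σ₂ φ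
  | natCase {Δ Γ Ψ t₁ u₁ v₁ t₂ u₂ v₂ σ₁ σ₂ φ} :
      RHOL Δ Γ Ψ t₁ .nat t₂ .nat
        (.iff (.eq .nat (.var 1) .zero) (.eq .nat (.var 0) .zero)) →
      RHOL Δ Γ (.eq .nat t₂ .zero :: .eq .nat t₁ .zero :: Ψ) u₁ σ₁ u₂ σ₂ φ →
      RHOL Δ Γ Ψ v₁ (.arr .nat σ₁) v₂ (.arr .nat σ₂)
        (.all .nat (.all .nat (.imp (.eq .nat (t₁.shift 4) (.succ (.var 1)))
          (.imp (.eq .nat (t₂.shift 4) (.succ (.var 0)))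
            (φ.tsub (.app (.var 2) (.var 0) ;; .app (.var 3) (.var 1) ;; Tm.sh 4)))))) →
      RHOL Δ Γ Ψ (.natCase t₁ u₁ v₁) σ₁ (.natCase t₂ u₂ v₂) σ₂ φ
  | listCase {Δ Γ Ψ l₁ u₁ v₁ l₂ u₂ v₂ τ₁ τ₂ σ₁ σ₂ φ} :
      RHOL Δ Γ Ψ l₁ (.list τ₁) l₂ (.list τ₂)
        (.iff (.eq (.list τ₁) (.var 1) .nil) (.eq (.list τ₂) (.var 0) .nil)) →
      RHOL Δ Γ (.eq (.list τ₂) l₂ .nil :: .eq (.list τ₁) l₁ .nil :: Ψ) u₁ σ₁ u₂ σ₂ φ →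
      RHOL Δ Γ Ψ v₁ (.arr τ₁ (.arr (.list τ₁) σ₁)) v₂ (.arr τ₂ (.arr (.list τ₂) σ₂))
        (.all τ₁ (.all τ₂ (.all (.list τ₁) (.all (.list τ₂)
          (.imp (.eq (.list τ₁) (l₁.shift 6) (.cons (.var 3) (.var 1)))
            (.imp (.eq (.list τ₂) (l₂.shift 6) (.cons (.var 2) (.var 0)))
              (φ.tsub (.app (.app (.var 4) (.var 2)) (.var 0) ;;
                .app (.app (.var 5) (.var 3)) (.var 1) ;; Tm.sh 6)))))))) →
      RHOL Δ Γ Ψ (.listCase l₁ u₁ v₁) σ₁ (.listCase l₂ u₂ v₂) σ₂ φ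
  -- one-sided case rules
  | boolCaseL {Δ Γ Ψ t₁ u₁ v₁ t₂ σ₁ σ₂ φ} : HasTy Γ t₁ .bool →
      RHOL Δ Γ (.eq .bool t₁ .tt :: Ψ) u₁ σ₁ t₂ σ₂ φ →
      RHOL Δ Γ (.eq .bool t₁ .ff :: Ψ) v₁ σ₁ t₂ σ₂ φ →
      RHOL Δ Γ Ψ (.boolCase t₁ u₁ v₁) σ₁ t₂ σ₂ φ
  | boolCaseR {Δ Γ Ψ t₁ t₂ u₂ v₂ σ₁ σ₂ φ} : HasTy Γ t₂ .bool →
      RHOL Δ Γ (.eq .bool t₂ .tt :: Ψ) t₁ σ₁ u₂ σ₂ φ →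
      RHOL Δ Γ (.eq .bool t₂ .ff :: Ψ) t₁ σ₁ v₂ σ₂ φ →
      RHOL Δ Γ Ψ t₁ σ₁ (.boolCase t₂ u₂ v₂) σ₂ φ
  | natCaseL {Δ Γ Ψ t₁ u₁ v₁ t₂ σ₁ σ₂ φ} : HasTy Γ t₁ .nat →
      RHOL Δ Γ (.eq .nat t₁ .zero :: Ψ) u₁ σ₁ t₂ σ₂ φ →
      RHOL Δ Γ Ψ v₁ (.arr .nat σ₁) t₂ σ₂
        (.all .nat (.imp (.eq .nat (t₁.shift 3) (.succ (.var 0)))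
          (φ.tsub (.var 1 ;; .app (.var 2) (.var 0) ;; Tm.sh 3)))) →
      RHOL Δ Γ Ψ (.natCase t₁ u₁ v₁) σ₁ t₂ σ₂ φ
  | natCaseR {Δ Γ Ψ t₁ t₂ u₂ v₂ σ₁ σ₂ φ} : HasTy Γ t₂ .nat →
      RHOL Δ Γ (.eq .nat t₂ .zero :: Ψ) t₁ σ₁ u₂ σ₂ φ →
      RHOL Δ Γ Ψ t₁ σ₁ v₂ (.arr .nat σ₂)
        (.all .nat (.imp (.eq .nat (t₂.shift 3) (.succ (.var 0)))
          (φ.tsub (.app (.var 1) (.var 0) ;; .var 2 ;; Tm.sh 3)))) →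
      RHOL Δ Γ Ψ t₁ σ₁ (.natCase t₂ u₂ v₂) σ₂ φ
  | listCaseL {Δ Γ Ψ l₁ u₁ v₁ t₂ τ σ₁ σ₂ φ} : HasTy Γ l₁ (.list τ) →
      RHOL Δ Γ (.eq (.list τ) l₁ .nil :: Ψ) u₁ σ₁ t₂ σ₂ φ →
      RHOL Δ Γ Ψ v₁ (.arr τ (.arr (.list τ) σ₁)) t₂ σ₂
        (.all τ (.all (.list τ) (.imp (.eq (.list τ) (l₁.shift 4) (.cons (.var 1) (.var 0)))
          (φ.tsub (.var 2 ;; .app (.app (.var 3) (.var 1)) (.var 0) ;; Tm.sh 4))))) →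
      RHOL Δ Γ Ψ (.listCase l₁ u₁ v₁) σ₁ t₂ σ₂ φ
  | listCaseR {Δ Γ Ψ t₁ l₂ u₂ v₂ τ σ₁ σ₂ φ} : HasTy Γ l₂ (.list τ) →
      RHOL Δ Γ (.eq (.list τ) l₂ .nil :: Ψ) t₁ σ₁ u₂ σ₂ φ →
      RHOL Δ Γ Ψ t₁ σ₁ v₂ (.arr τ (.arr (.list τ) σ₂))
        (.all τ (.all (.list τ) (.imp (.eq (.list τ) (l₂.shift 4) (.cons (.var 1) (.var 0)))
          (φ.tsub (.app (.app (.var 2) (.var 1)) (.var 0) ;; .var 3 ;; Tm.sh 4))))) →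
      RHOL Δ Γ Ψ t₁ σ₁ (.listCase l₂ u₂ v₂) σ₂ φ
  -- recursion rules
  | letrec {Δ Γ Ψ e₁ e₂ I₁ I₂ σ₁ σ₂ φ' φ} : CWF Δ Γ Ψ →
      HasTy Γ (.letrec e₁) (.arr I₁ σ₁) → HasTy Γ (.letrec e₂) (.arr I₂ σ₂) →
      Fml.WF Δ (I₂ :: I₁ :: Γ) φ' → Fml.WF Δ (σ₂ :: σ₁ :: I₂ :: I₁ :: Γ) φ →
      RHOL Δ (.arr I₂ σ₂ :: .arr I₁ σ₁ :: I₂ :: I₁ :: Γ)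
        (.all I₁ (.all I₂ (.imp
            (prodLt (sizeOf I₁ (.var 1)) (sizeOf I₂ (.var 0))
              (sizeOf I₁ (.var 5)) (sizeOf I₂ (.var 4)))
            (.imp (φ'.tsub (.var 0 ;; .var 1 ;; Tm.sh 6))
              (φ.tsub (.app (.var 2) (.var 0) ;; .app (.var 3) (.var 1) ;; .var 0 ;; .var 1 ;;
                Tm.sh 6)))))
          :: φ'.shift 2 :: Ψ.map (Fml.shift 4))
        (e₁.subst (.var 3 ;; .var 1 ;; Tm.sh 4)) σ₁ (e₂.subst (.var 2 ;; .var 0 ;; Tm.sh 4)) σ₂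
        (φ.tsub (.var 0 ;; .var 1 ;; Tm.sh 4)) →
      RHOL Δ Γ Ψ (.letrec e₁) (.arr I₁ σ₁) (.letrec e₂) (.arr I₂ σ₂) (funSpec2 I₁ I₂ φ' φ)
  | letrecL {Δ Γ Ψ e₁ t₂ I₁ σ₁ σ₂ φ' φ} : CWF Δ Γ Ψ →
      HasTy Γ (.letrec e₁) (.arr I₁ σ₁) → HasTy Γ t₂ σ₂ →
      Fml.WF Δ (I₁ :: Γ) φ' → Fml.WF Δ (σ₂ :: σ₁ :: I₁ :: Γ) φ →
      RHOL Δ (.arr I₁ σ₁ :: I₁ :: Γ)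
        (.all I₁ (.imp (.cst (.lt (sizeOf I₁ (.var 0)) (sizeOf I₁ (.var 2))))
            (.imp (φ'.tsub (.var 0 ;; Tm.sh 3))
              (φ.tsub (t₂.shift 3 ;; .app (.var 1) (.var 0) ;; .var 0 ;; Tm.sh 3))))
          :: φ'.shift 1 :: Ψ.map (Fml.shift 2))
        (e₁.subst (.var 1 ;; .var 0 ;; Tm.sh 2)) σ₁ (t₂.shift 2) σ₂
        (φ.tsub (.var 0 ;; .var 1 ;; Tm.sh 3)) →
      RHOL Δ Γ Ψ (.letrec e₁) (.arr I₁ σ₁) t₂ σ₂ (funSpecL I₁ φ' φ)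
  | letrecR {Δ Γ Ψ t₁ e₂ I₂ σ₁ σ₂ φ' φ} : CWF Δ Γ Ψ →
      HasTy Γ t₁ σ₁ → HasTy Γ (.letrec e₂) (.arr I₂ σ₂) →
      Fml.WF Δ (I₂ :: Γ) φ' → Fml.WF Δ (σ₂ :: σ₁ :: I₂ :: Γ) φ →
      RHOL Δ (.arr I₂ σ₂ :: I₂ :: Γ)
        (.all I₂ (.imp (.cst (.lt (sizeOf I₂ (.var 0)) (sizeOf I₂ (.var 2))))
            (.imp (φ'.tsub (.var 0 ;; Tm.sh 3))
              (φ.tsub (.app (.var 1) (.var 0) ;; t₁.shift 3 ;; .var 0 ;; Tm.sh 3))))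
          :: φ'.shift 1 :: Ψ.map (Fml.shift 2))
        (t₁.shift 2) σ₁ (e₂.subst (.var 1 ;; .var 0 ;; Tm.sh 2)) σ₂
        (φ.tsub (.var 0 ;; .var 1 ;; Tm.sh 3)) →
      RHOL Δ Γ Ψ t₁ σ₁ (.letrec e₂) (.arr I₂ σ₂) (funSpecR I₂ φ' φ)

/-! ## RelCost -/

/-- The costs of the elimination forms. -/
structure CostModel where
  app : ℕ
  iapp : ℕ
  case : ℕ

/-- RelCost expressions with de Bruijn indices. `ilam t` is `Λ t`, `iapp t` is `t []`; in
`case t t₁ t₂` the branch `t₂` binds the head (index 1) and the tail (index 0). -/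
inductive Ex
  | var (n : ℕ)
  | num (n : ℕ)
  | lam (t : Ex)
  | app (t u : Ex)
  | ilam (t : Ex)
  | iapp (t : Ex)
  | nil
  | cons (t u : Ex)
  | case (t t₁ t₂ : Ex)

namespace Ex

def rename : Ex → (ℕ → ℕ) → Ex
  | var n, ξ => var (ξ n)
  | num n, _ => num n
  | lam t, ξ => lam (t.rename (upr ξ))
  | app t u, ξ => app (t.rename ξ) (u.rename ξ)
  | ilam t, ξ => ilam (t.rename ξ)
  | iapp t, ξ => iapp (t.rename ξ)
  | nil, _ => nil
  | cons t u, ξ => cons (t.rename ξ) (u.rename ξ)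
  | case t t₁ t₂, ξ => case (t.rename ξ) (t₁.rename ξ) (t₂.rename (upr (upr ξ)))

def up (σ : ℕ → Ex) : ℕ → Ex := var 0 ;; fun n => (σ n).rename (· + 1)

def subst : Ex → (ℕ → Ex) → Ex
  | var n, σ => σ n
  | num n, _ => num n
  | lam t, σ => lam (t.subst (up σ))
  | app t u, σ => app (t.subst σ) (u.subst σ)
  | ilam t, σ => ilam (t.subst σ)
  | iapp t, σ => iapp (t.subst σ)
  | nil, _ => nil
  | cons t u, σ => cons (t.subst σ) (u.subst σ)
  | case t t₁ t₂, σ => case (t.subst σ) (t₁.subst σ) (t₂.subst (up (up σ)))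

/-- `Eval κ t v c`: under eager, call-by-value evaluation, `t` evaluates to the value `v` with
cost `c`. -/
inductive Eval (κ : CostModel) : Ex → Ex → ℕ → Prop
  | num (n) : Eval κ (num n) (num n) 0
  | lam (t) : Eval κ (lam t) (lam t) 0
  | ilam (t) : Eval κ (ilam t) (ilam t) 0
  | nil : Eval κ nil nil 0
  | cons {t u v w c d} : Eval κ t v c → Eval κ u w d → Eval κ (cons t u) (cons v w) (c + d)
  | app {t u b w v c d e} : Eval κ t (lam b) c → Eval κ u w d → Eval κ (b.subst (w ;; var)) v e →
      Eval κ (app t u) v (c + d + e + κ.app)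
  | iapp {t b v c d} : Eval κ t (ilam b) c → Eval κ b v d → Eval κ (iapp t) v (c + d + κ.iapp)
  | case_nil {t t₁ t₂ v c d} : Eval κ t nil c → Eval κ t₁ v d →
      Eval κ (case t t₁ t₂) v (c + d + κ.case)
  | case_cons {t t₁ t₂ h l v c d} : Eval κ t (cons h l) c →
      Eval κ (t₂.subst (l ;; h ;; var)) v d → Eval κ (case t t₁ t₂) v (c + d + κ.case)

end Ex

/-- Unary types. -/
inductive UTy
  | nat
  | list (n : Idx) (A : UTy)
  | arr (A : UTy) (k l : Idx) (B : UTy)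
  | all (S : Srt) (k l : Idx) (A : UTy)

/-- Relational types: `nat` is `ℕ_r`, `u A` is `U A`, `list n α τ` is `list[n]^α τ`. -/
inductive RTy
  | nat
  | list (n α : Idx) (τ : RTy)
  | arr (τ : RTy) (l : Idx) (σ : RTy)
  | all (S : Srt) (l : Idx) (τ : RTy)
  | u (A : UTy)
  | box (τ : RTy)

namespace UTy

/-- Substitution of index terms. -/
def sub : UTy → (ℕ → Idx) → UTy
  | nat, _ => nat
  | list n A, θ => list (n.bind θ) (A.sub θ)
  | arr A k l B, θ => arr (A.sub θ) (k.bind θ) (l.bind θ) (B.sub θ)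
  | all S k l A, θ => all S (k.bind (iup θ)) (l.bind (iup θ)) (A.sub (iup θ))

def shift (k : ℕ) (A : UTy) : UTy := A.sub (fun i => Ix.leaf (i + k))

/-- `A{J/i}` for the index variable 0. -/
def inst (A : UTy) (J : Idx) : UTy := A.sub (J ;; Ix.leaf)

def WF : ICtx → UTy → Prop
  | _, nat => True
  | Δ, list n A => Idx.HasSort Δ n .nat ∧ WF Δ A
  | Δ, arr A k l B => WF Δ A ∧ Idx.HasSort Δ k .real ∧ Idx.HasSort Δ l .real ∧ WF Δ B
  | Δ, all S k l A =>
      Idx.HasSort (S :: Δ) k .real ∧ Idx.HasSort (S :: Δ) l .real ∧ WF (S :: Δ) A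

/-- Erasure to simple types. -/
def erase : UTy → Ty
  | nat => .nat
  | list _ A => .list A.erase
  | arr A _ _ B => .arr A.erase B.erase
  | all _ _ _ A => .arr .nat A.erase

end UTy

namespace RTy

def sub : RTy → (ℕ → Idx) → RTy
  | nat, _ => nat
  | list n α τ, θ => list (n.bind θ) (α.bind θ) (τ.sub θ)
  | arr τ l σ, θ => arr (τ.sub θ) (l.bind θ) (σ.sub θ)
  | all S l τ, θ => all S (l.bind (iup θ)) (τ.sub (iup θ))
  | u A, θ => u (A.sub θ)
  | box τ, θ => box (τ.sub θ)

def shift (k : ℕ) (τ : RTy) : RTy := τ.sub (fun i => Ix.leaf (i + k))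

def inst (τ : RTy) (J : Idx) : RTy := τ.sub (J ;; Ix.leaf)

def WF : ICtx → RTy → Prop
  | _, nat => True
  | Δ, list n α τ => Idx.HasSort Δ n .nat ∧ Idx.HasSort Δ α .nat ∧ WF Δ τ
  | Δ, arr τ l σ => WF Δ τ ∧ Idx.HasSort Δ l .real ∧ WF Δ σ
  | Δ, all S l τ => Idx.HasSort (S :: Δ) l .real ∧ WF (S :: Δ) τ
  | Δ, u A => A.WF Δ
  | Δ, box τ => WF Δ τ

/-- Erasure to simple types. -/
def erase : RTy → Ty
  | nat => .nat
  | list _ _ τ => .list τ.erase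
  | arr τ _ σ => .arr τ.erase σ.erase
  | all _ _ τ => .arr .nat τ.erase
  | u A => A.erase
  | box τ => τ.erase

/-- Erasure of relational types to unary types. -/
def bar : RTy → UTy
  | nat => .nat
  | list n _ τ => .list n τ.bar
  | arr τ _ σ => .arr τ.bar (.num 0) .inf σ.bar
  | all S _ τ => .all S (.num 0) .inf τ.bar
  | u A => A
  | box τ => τ.bar

end RTy

/-- `Δ; Φ ⊢ A ⊑ A'`: subtyping of unary types. -/
inductive USub : ICtx → List ICst → UTy → UTy → Prop
  | refl {Δ Φ A} : USub Δ Φ A A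
  | trans {Δ Φ A B C} : B.WF Δ → USub Δ Φ A B → USub Δ Φ B C → USub Δ Φ A C
  | list {Δ Φ n n' A A'} : Entails Δ Φ (.eq n n') → USub Δ Φ A A' →
      USub Δ Φ (.list n A) (.list n' A')
  | arr {Δ Φ A A' B B' k k' l l'} : USub Δ Φ A' A → USub Δ Φ B B' → Entails Δ Φ (.le k' k) →
      Entails Δ Φ (.le l l') → USub Δ Φ (.arr A k l B) (.arr A' k' l' B')
  | all {Δ Φ S A A' k k' l l'} : USub (S :: Δ) (Φ.map (ICst.shift 1)) A A' →
      Entails (S :: Δ) (Φ.map (ICst.shift 1)) (.le k' k) →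
      Entails (S :: Δ) (Φ.map (ICst.shift 1)) (.le l l') →
      USub Δ Φ (.all S k l A) (.all S k' l' A')

/-- `Δ; Φ ⊢ τ ⊑ τ'`: subtyping of relational types. -/
inductive RSub : ICtx → List ICst → RTy → RTy → Prop
  | refl {Δ Φ τ} : RSub Δ Φ τ τ
  | trans {Δ Φ τ₁ τ₂ τ₃} : τ₂.WF Δ → RSub Δ Φ τ₁ τ₂ → RSub Δ Φ τ₂ τ₃ → RSub Δ Φ τ₁ τ₃
  | list {Δ Φ n n' α α' τ τ'} : Entails Δ Φ (.eq n n') → Entails Δ Φ (.le α α') →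
      RSub Δ Φ τ τ' → RSub Δ Φ (.list n α τ) (.list n' α' τ')
  | listZero {Δ Φ n α τ} : Entails Δ Φ (.eq α (.num 0)) →
      RSub Δ Φ (.list n α τ) (.list n α (.box τ))
  | listBox {Δ Φ n α τ} : RSub Δ Φ (.list n α (.box τ)) (.box (.list n α τ))
  | arr {Δ Φ τ τ' σ σ' l l'} : RSub Δ Φ τ' τ → RSub Δ Φ σ σ' → Entails Δ Φ (.le l l') →
      RSub Δ Φ (.arr τ l σ) (.arr τ' l' σ')
  | arrBox {Δ Φ τ σ l} : RSub Δ Φ (.box (.arr τ l σ)) (.arr (.box τ) (.num 0) (.box σ))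
  | arrU {Δ Φ A B k l} : RSub Δ Φ (.u (.arr A k l B)) (.arr (.u A) (.sub l k) (.u B))
  | all {Δ Φ S τ τ' l l'} : RSub (S :: Δ) (Φ.map (ICst.shift 1)) τ τ' →
      Entails (S :: Δ) (Φ.map (ICst.shift 1)) (.le l l') →
      RSub Δ Φ (.all S l τ) (.all S l' τ')
  | allU {Δ Φ S A k l} : RSub Δ Φ (.u (.all S k l A)) (.all S (.sub l k) (.u A))
  | u {Δ Φ A A'} : USub Δ Φ A A' → RSub Δ Φ (.u A) (.u A')
  | weak {Δ Φ τ} : RSub Δ Φ τ (.u τ.bar)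
  | natBox {Δ Φ} : RSub Δ Φ .nat (.box .nat)
  | boxE {Δ Φ τ} : RSub Δ Φ (.box τ) τ
  | boxBox {Δ Φ τ} : RSub Δ Φ (.box τ) (.box (.box τ))
  | box {Δ Φ τ τ'} : RSub Δ Φ τ τ' → RSub Δ Φ (.box τ) (.box τ')

/-- `UTyping κ Δ Φ Ω k l t A` is the judgment `Δ; Φ; Ω ⊢ᵏₗ t : A`: the expression `t` has type `A`,
and its cost is at least `k` and at most `l`. -/
inductive UTyping (κ : CostModel) :
    ICtx → List ICst → List UTy → Idx → Idx → Ex → UTy → Prop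
  | var {Δ Φ Ω n A} : (Ω)[n]? = some A → UTyping κ Δ Φ Ω (.num 0) (.num 0) (.var n) A
  | num {Δ Φ Ω n} : UTyping κ Δ Φ Ω (.num 0) (.num 0) (.num n) .nat
  | lam {Δ Φ Ω A₁ A₂ k l t} : A₁.WF Δ → UTyping κ Δ Φ (A₁ :: Ω) k l t A₂ →
      UTyping κ Δ Φ Ω (.num 0) (.num 0) (.lam t) (.arr A₁ k l A₂)
  | app {Δ Φ Ω A₁ A₂ k l k₁ l₁ k₂ l₂ t₁ t₂} : UTyping κ Δ Φ Ω k₁ l₁ t₁ (.arr A₁ k l A₂) →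
      UTyping κ Δ Φ Ω k₂ l₂ t₂ A₁ →
      UTyping κ Δ Φ Ω (.add (.add (.add k₁ k₂) k) (.num κ.app))
        (.add (.add (.add l₁ l₂) l) (.num κ.app)) (.app t₁ t₂) A₂
  | nil {Δ Φ Ω A} : A.WF Δ → UTyping κ Δ Φ Ω (.num 0) (.num 0) .nil (.list (.num 0) A)
  | cons {Δ Φ Ω A n k₁ l₁ k₂ l₂ t₁ t₂} : UTyping κ Δ Φ Ω k₁ l₁ t₁ A →
      UTyping κ Δ Φ Ω k₂ l₂ t₂ (.list n A) →
      UTyping κ Δ Φ Ω (.add k₁ k₂) (.add l₁ l₂) (.cons t₁ t₂) (.list (.add n (.num 1)) A)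
  | case {Δ Φ Ω A A' n k l k' l' t t₁ t₂} : UTyping κ Δ Φ Ω k l t (.list n A) →
      UTyping κ Δ (.eq n (.num 0) :: Φ) Ω k' l' t₁ A' →
      UTyping κ (.nat :: Δ)
        (.eq (n.shift 1) (.add (.leaf 0) (.num 1)) :: Φ.map (ICst.shift 1))
        (.list (.leaf 0) (A.shift 1) :: A.shift 1 :: Ω.map (UTy.shift 1))
        (k'.shift 1) (l'.shift 1) t₂ (A'.shift 1) →
      UTyping κ Δ Φ Ω (.add (.add k k') (.num κ.case)) (.add (.add l l') (.num κ.case))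
        (.case t t₁ t₂) A'
  | ilam {Δ Φ Ω S A k l t} :
      UTyping κ (S :: Δ) (Φ.map (ICst.shift 1)) (Ω.map (UTy.shift 1)) k l t A →
      UTyping κ Δ Φ Ω (.num 0) (.num 0) (.ilam t) (.all S k l A)
  | iapp {Δ Φ Ω S A J k l k' l' t} : UTyping κ Δ Φ Ω k l t (.all S k' l' A) → Idx.HasSort Δ J S →
      UTyping κ Δ Φ Ω (.add (.add k (k'.bind (J ;; Ix.leaf))) (.num κ.iapp))
        (.add (.add l (l'.bind (J ;; Ix.leaf))) (.num κ.iapp)) (.iapp t) (A.inst J)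
  | sub {Δ Φ Ω A A' k l k' l' t} : UTyping κ Δ Φ Ω k l t A → A'.WF Δ → Idx.HasSort Δ k' .real →
      Idx.HasSort Δ l' .real → USub Δ Φ A A' → Entails Δ Φ (.le k' k) → Entails Δ Φ (.le l l') →
      UTyping κ Δ Φ Ω k' l' t A'

/-- `RTyping κ Δ Φ Γ l t₁ t₂ τ` is the judgment `Δ; Φ; Γ ⊢ t₁ ⊖ t₂ ≲ l : τ`: the expressions `t₁`,
`t₂` have the relational type `τ`, and the cost of `t₁` minus that of `t₂` is at most `l`. -/
inductive RTyping (κ : CostModel) :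
    ICtx → List ICst → List RTy → Idx → Ex → Ex → RTy → Prop
  | var {Δ Φ Γ n τ} : Γ[n]? = some τ → RTyping κ Δ Φ Γ (.num 0) (.var n) (.var n) τ
  | num {Δ Φ Γ n} : RTyping κ Δ Φ Γ (.num 0) (.num n) (.num n) .nat
  | nil {Δ Φ Γ α τ} : Idx.HasSort Δ α .nat → τ.WF Δ →
      RTyping κ Δ Φ Γ (.num 0) .nil .nil (.list (.num 0) α τ)
  | cons₁ {Δ Φ Γ n α τ l₁ l₂ t₁ t₁' t₂ t₂'} : RTyping κ Δ Φ Γ l₁ t₁ t₁' τ →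
      RTyping κ Δ Φ Γ l₂ t₂ t₂' (.list n α τ) →
      RTyping κ Δ Φ Γ (.add l₁ l₂) (.cons t₁ t₂) (.cons t₁' t₂')
        (.list (.add n (.num 1)) (.add α (.num 1)) τ)
  | cons₂ {Δ Φ Γ n α τ l₁ l₂ t₁ t₁' t₂ t₂'} : RTyping κ Δ Φ Γ l₁ t₁ t₁' (.box τ) →
      RTyping κ Δ Φ Γ l₂ t₂ t₂' (.list n α τ) →
      RTyping κ Δ Φ Γ (.add l₁ l₂) (.cons t₁ t₂) (.cons t₁' t₂') (.list (.add n (.num 1)) α τ)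
  | case {Δ Φ Γ n α τ τ' l l' t t' t₁ t₁' t₂ t₂'} : RTyping κ Δ Φ Γ l t t' (.list n α τ) →
      RTyping κ Δ (.eq n (.num 0) :: Φ) Γ l' t₁ t₁' τ' →
      -- the index variable `i` is 0
      RTyping κ (.nat :: Δ)
        (.eq (n.shift 1) (.add (.leaf 0) (.num 1)) :: Φ.map (ICst.shift 1))
        (.list (.leaf 0) (α.shift 1) (τ.shift 1) :: .box (τ.shift 1) :: Γ.map (RTy.shift 1))
        (l'.shift 1) t₂ t₂' (τ'.shift 1) →
      -- the index variable `i` is 0 and `β` is 1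
      RTyping κ (.nat :: .nat :: Δ)
        (.eq (α.shift 2) (.add (.leaf 1) (.num 1)) ::
          .eq (n.shift 2) (.add (.leaf 0) (.num 1)) :: Φ.map (ICst.shift 2))
        (.list (.leaf 0) (.leaf 1) (τ.shift 2) :: τ.shift 2 :: Γ.map (RTy.shift 2))
        (l'.shift 2) t₂ t₂' (τ'.shift 2) →
      RTyping κ Δ Φ Γ (.add l l') (.case t t₁ t₂) (.case t' t₁' t₂') τ'
  | lam {Δ Φ Γ τ₁ τ₂ l t₁ t₂} : τ₁.WF Δ → RTyping κ Δ Φ (τ₁ :: Γ) l t₁ t₂ τ₂ →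
      RTyping κ Δ Φ Γ (.num 0) (.lam t₁) (.lam t₂) (.arr τ₁ l τ₂)
  | app {Δ Φ Γ τ₁ τ₂ l l₁ l₂ t₁ t₁' t₂ t₂'} : RTyping κ Δ Φ Γ l₁ t₁ t₁' (.arr τ₁ l τ₂) →
      RTyping κ Δ Φ Γ l₂ t₂ t₂' τ₁ →
      RTyping κ Δ Φ Γ (.add (.add l₁ l₂) l) (.app t₁ t₂) (.app t₁' t₂') τ₂
  | ilam {Δ Φ Γ S τ l t t'} :
      RTyping κ (S :: Δ) (Φ.map (ICst.shift 1)) (Γ.map (RTy.shift 1)) l t t' τ →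
      RTyping κ Δ Φ Γ (.num 0) (.ilam t) (.ilam t') (.all S l τ)
  | iapp {Δ Φ Γ S τ J l l' t t'} : RTyping κ Δ Φ Γ l t t' (.all S l' τ) → Idx.HasSort Δ J S →
      RTyping κ Δ Φ Γ (.add l (l'.bind (J ;; Ix.leaf))) (.iapp t) (.iapp t') (τ.inst J)
  -- `ξ` embeds the variables of `Γ` in the larger context `Γ'`
  | nochange {Δ Φ Γ Γ' τ l t} (ξ : ℕ → ℕ) : Function.Injective ξ →
      (∀ (n : ℕ) (σ : RTy), Γ[n]? = some σ → Γ'[ξ n]? = some σ) →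
      RTyping κ Δ Φ Γ l t t τ → (∀ σ ∈ Γ, RSub Δ Φ σ (.box σ)) →
      RTyping κ Δ Φ Γ' (.num 0) (t.rename ξ) (t.rename ξ) (.box τ)
  | switch {Δ Φ Γ A k₁ l₁ k₂ l₂ t₁ t₂} : UTyping κ Δ Φ (Γ.map RTy.bar) k₁ l₁ t₁ A →
      UTyping κ Δ Φ (Γ.map RTy.bar) k₂ l₂ t₂ A → RTyping κ Δ Φ Γ (.sub l₁ k₂) t₁ t₂ (.u A)
  | sub {Δ Φ Γ τ τ' l l' t t'} : RTyping κ Δ Φ Γ l t t' τ → τ'.WF Δ → Idx.HasSort Δ l' .real →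
      RSub Δ Φ τ τ' → Entails Δ Φ (.le l l') → RTyping κ Δ Φ Γ l' t t' τ'

/-! ## Cost-instrumented translation -/

/-- The value translation of simple types. -/
def Ty.costV : Ty → Ty
  | .bool => .bool
  | .nat => .nat
  | .list A => .list A.costV
  | .prod A B => .prod A.costV B.costV
  | .arr A B => .arr A.costV (.prod B.costV .nat)

/-- The expression translation of simple types. -/
def Ty.costE (A : Ty) : Ty := .prod A.costV .nat

/-- The translation of expressions. -/
def Ex.cost (κ : CostModel) : Ex → Tm
  | var n => .pair (.var n) .zero
  | num n => .pair (Tm.numeral n) .zero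
  | lam t => .pair (.lam (t.cost κ)) .zero
  | ilam t => .pair (.lam ((t.cost κ).shift 1)) .zero
  | app t u =>
      Tm.letIn (t.cost κ) (Tm.letIn ((u.cost κ).shift 1)
        (Tm.letIn (.app (.fst (.var 1)) (.fst (.var 0)))
          (.pair (.fst (.var 0))
            (Tm.add (Tm.add (Tm.add (.snd (.var 2)) (.snd (.var 1))) (.snd (.var 0)))
              (Tm.numeral κ.app)))))
  | iapp t =>
      Tm.letIn (t.cost κ) (Tm.letIn (.app (.fst (.var 0)) .zero)
        (.pair (.fst (.var 0))
          (Tm.add (Tm.add (.snd (.var 1)) (.snd (.var 0))) (Tm.numeral κ.iapp))))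
  | nil => .pair .nil .zero
  | cons t u =>
      Tm.letIn (t.cost κ) (Tm.letIn ((u.cost κ).shift 1)
        (.pair (.cons (.fst (.var 1)) (.fst (.var 0)))
          (Tm.add (.snd (.var 1)) (.snd (.var 0)))))
  | case t t₁ t₂ =>
      Tm.letIn (t.cost κ) (.listCase (.fst (.var 0))
        (Tm.letIn ((t₁.cost κ).shift 1)
          (.pair (.fst (.var 0))
            (Tm.add (Tm.add (.snd (.var 1)) (.snd (.var 0))) (Tm.numeral κ.case))))
        (.lam (.lam (Tm.letIn ((t₂.cost κ).rename (upr (upr (· + 1))))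
          (.pair (.fst (.var 0))
            (Tm.add (Tm.add (.snd (.var 3)) (.snd (.var 0))) (Tm.numeral κ.case)))))))

/-- `k ≤ π₂ x ≤ l`. -/
def costBounds (k l : Idx) (x : Tm) : Fml :=
  .and (.cst (.le k.toH (HIx.tm (.snd x)))) (.cst (.le (HIx.tm (.snd x)) l.toH))

/-- The formula `⌊A⌋_v(x)` of a unary type. -/
def UTy.fmlV : UTy → Tm → Fml
  | nat, _ => .top
  | list n A, x => .listU A.erase.costV n.toH x (A.fmlV (.var 0))
  | arr A k l B, x => .all A.erase.costV (.imp (A.fmlV (.var 0))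
      (.and (B.fmlV (.fst (.app (x.shift 1) (.var 0)))) (costBounds k l (.app (x.shift 1) (.var 0)))))
  | all S k l A, x => .all .nat (.imp .top (.alli S
      (.and (A.fmlV (.fst (.app (x.shift 1) (.var 0)))) (costBounds k l (.app (x.shift 1) (.var 0))))))

/-- `π₂ x - π₂ y ≤ l`. -/
def costDiff (l : Idx) (x y : Tm) : Fml :=
  .cst (.le (.sub (HIx.tm (.snd x)) (HIx.tm (.snd y))) l.toH)

/-- The formula `⌊τ⌋_v(x, y)` of a relational type. -/
def RTy.fmlV : RTy → Tm → Tm → Fml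
  | nat, x, y => .eq .nat x y
  | u A, x, y => .and (A.fmlV x) (A.fmlV y)
  | box τ, x, y => .and (.eq τ.erase.costV x y) (τ.fmlV x y)
  | list n α τ, x, y => .listR τ.erase.costV n.toH x y α.toH (τ.fmlV (.var 1) (.var 0))
  | arr τ l σ, x, y =>
      .and ((UTy.arr τ.bar (.num 0) .inf σ.bar).fmlV x)
        (.and ((UTy.arr τ.bar (.num 0) .inf σ.bar).fmlV y)
          (.all τ.erase.costV (.all τ.erase.costV (.imp (τ.fmlV (.var 1) (.var 0))
            (.and
              (σ.fmlV (.fst (.app (x.shift 2) (.var 1))) (.fst (.app (y.shift 2) (.var 0))))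
              (costDiff l (.app (x.shift 2) (.var 1)) (.app (y.shift 2) (.var 0))))))))
  | all S l τ, x, y =>
      .and ((UTy.all S (.num 0) .inf τ.bar).fmlV x)
        (.and ((UTy.all S (.num 0) .inf τ.bar).fmlV y)
          (.all .nat (.all .nat (.imp .top (.alli S
            (.and
              (τ.fmlV (.fst (.app (x.shift 2) (.var 1))) (.fst (.app (y.shift 2) (.var 0))))
              (costDiff l (.app (x.shift 2) (.var 1)) (.app (y.shift 2) (.var 0)))))))))

/-- The formula `⌊τ⌋_e^l(x, y)` of a relational type. -/
def RTy.fmlE (τ : RTy) (l : Idx) (x y : Tm) : Fml :=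
  .and (τ.fmlV (.fst x) (.fst y)) (costDiff l x y)

/-- The simple context of a relational context: every variable `n` has two copies, the left one
being the variable `2n + 1` and the right one the variable `2n`. -/
def relCtx (Γ : List RTy) : Ctx := Γ.flatMap (fun τ => [τ.erase.costV, τ.erase.costV])

/-- The assertions of a relational context. -/
def relHyps (Γ : List RTy) : List Fml :=
  Γ.mapIdx (fun n τ => τ.fmlV (.var (2 * n + 1)) (.var (2 * n)))

/-- The copies of a term in which each variable is replaced by its left or right copy. -/
def Tm.copyL (t : Tm) : Tm := t.rename (fun n => 2 * n + 1)
def Tm.copyR (t : Tm) : Tm := t.rename (fun n => 2 * n)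

/-! ## The values of RelCost types -/

/-- Lists of length `n` whose elements satisfy `P`. -/
def ListU (P : Ex → Prop) : ℕ → Ex → Prop
  | 0, v => v = .nil
  | n + 1, v => ∃ w ws, v = .cons w ws ∧ P w ∧ ListU P n ws

/-- Pairs of lists of length `n` whose elements are related by `R` and differ in at most `a`
positions. -/
def ListR (R : Ex → Ex → Prop) : ℕ → ℕ → Ex → Ex → Prop
  | 0, _, v, v' => v = .nil ∧ v' = .nil
  | n + 1, a, v, v' => ∃ w ws z zs, v = .cons w ws ∧ v' = .cons z zs ∧ R w z ∧
      ((w = z ∧ ListR R n a ws zs) ∨ ∃ b, a = b + 1 ∧ ListR R n b ws zs)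

/-- The closed values of a unary type, for a valuation `δ` of the index variables. -/
def UTy.Val (κ : CostModel) : UTy → (ℕ → EReal) → Ex → Prop
  | nat, _, v => ∃ n, v = .num n
  | list n A, δ, v => ∃ m : ℕ, n.eval δ = (m : EReal) ∧ ListU (fun w => A.Val κ δ w) m v
  | arr A k l B, δ, v => ∃ t, v = .lam t ∧ ∀ w, A.Val κ δ w →
      ∃ r c, Ex.Eval κ (t.subst (w ;; .var)) r c ∧ B.Val κ δ r ∧
        k.eval δ ≤ (c : EReal) ∧ (c : EReal) ≤ l.eval δ
  | all S k l A, δ, v => ∃ t, v = .ilam t ∧ ∀ a, S.Mem a →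
      ∃ r c, Ex.Eval κ t r c ∧ A.Val κ (a ;; δ) r ∧
        k.eval (a ;; δ) ≤ (c : EReal) ∧ (c : EReal) ≤ l.eval (a ;; δ)

/-- The pairs of closed values of a relational type. -/
def RTy.Val (κ : CostModel) : RTy → (ℕ → EReal) → Ex → Ex → Prop
  | nat, _, v, v' => ∃ n, v = .num n ∧ v' = .num n
  | list n α τ, δ, v, v' => ∃ m a : ℕ, n.eval δ = (m : EReal) ∧ α.eval δ = (a : EReal) ∧
      ListR (fun w z => τ.Val κ δ w z) m a v v'
  | arr τ l σ, δ, v, v' =>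
      (UTy.arr τ.bar (.num 0) .inf σ.bar).Val κ δ v ∧
      (UTy.arr τ.bar (.num 0) .inf σ.bar).Val κ δ v' ∧
      ∃ t t', v = .lam t ∧ v' = .lam t' ∧ ∀ w w', τ.Val κ δ w w' →
        ∃ r c r' c', Ex.Eval κ (t.subst (w ;; .var)) r c ∧
          Ex.Eval κ (t'.subst (w' ;; .var)) r' c' ∧ σ.Val κ δ r r' ∧
          (c : EReal) - (c' : EReal) ≤ l.eval δ
  | all S l τ, δ, v, v' =>
      (UTy.all S (.num 0) .inf τ.bar).Val κ δ v ∧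
      (UTy.all S (.num 0) .inf τ.bar).Val κ δ v' ∧
      ∃ t t', v = .ilam t ∧ v' = .ilam t' ∧ ∀ a, S.Mem a →
        ∃ r c r' c', Ex.Eval κ t r c ∧ Ex.Eval κ t' r' c' ∧ τ.Val κ (a ;; δ) r r' ∧
          (c : EReal) - (c' : EReal) ≤ l.eval (a ;; δ)
  | u A, δ, v, v' => A.Val κ δ v ∧ A.Val κ δ v'
  | box τ, δ, v, v' => v = v' ∧ τ.Val κ δ v v'

end RelCost

open RelCost

namespace RelCost

/-! ## Substitution calculus -/

@[simp] theorem scons_zero {α : Type} (a : α) (f : ℕ → α) : (a ;; f) 0 = a := rfl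
@[simp] theorem scons_succ {α : Type} (a : α) (f : ℕ → α) (n : ℕ) : (a ;; f) (n + 1) = f n := rfl
@[simp] theorem scons_one {α : Type} (a : α) (f : ℕ → α) : (a ;; f) 1 = f 0 := rfl
@[simp] theorem scons_two {α : Type} (a : α) (f : ℕ → α) : (a ;; f) 2 = f 1 := rfl
@[simp] theorem scons_three {α : Type} (a : α) (f : ℕ → α) : (a ;; f) 3 = f 2 := rfl
@[simp] theorem scons_four {α : Type} (a : α) (f : ℕ → α) : (a ;; f) 4 = f 3 := rfl
@[simp] theorem scons_five {α : Type} (a : α) (f : ℕ → α) : (a ;; f) 5 = f 4 := rfl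

namespace Tm

theorem subst_congr (t : Tm) : ∀ {σ τ : ℕ → Tm}, (∀ n, σ n = τ n) → t.subst σ = t.subst τ := by
  intro σ τ h; rw [funext h]

theorem up_var_comp (ξ : ℕ → ℕ) : up (fun n => var (ξ n)) = fun n => var (upr ξ n) := by
  funext n; cases n <;> rfl

theorem rename_eq_subst (t : Tm) : ∀ ξ : ℕ → ℕ, t.rename ξ = t.subst (fun n => var (ξ n)) := by
  induction t <;> intro ξ <;> simp_all [rename, subst, up_var_comp]

theorem up_comp_upr (σ : ℕ → Tm) (ξ : ℕ → ℕ) :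
    (fun n => up σ (upr ξ n)) = up (fun n => σ (ξ n)) := by
  funext n; cases n <;> rfl

theorem rename_subst (t : Tm) : ∀ (ξ : ℕ → ℕ) (σ : ℕ → Tm),
    (t.rename ξ).subst σ = t.subst (fun n => σ (ξ n)) := by
  induction t <;> intro ξ σ <;> simp_all [rename, subst, up_comp_upr]

theorem rename_rename (t : Tm) (ξ ξ' : ℕ → ℕ) :
    (t.rename ξ).rename ξ' = t.rename (fun n => ξ' (ξ n)) := by
  rw [rename_eq_subst _ ξ', rename_subst, rename_eq_subst]

theorem up_rename (σ : ℕ → Tm) (ξ : ℕ → ℕ) :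
    (fun n => (up σ n).rename (upr ξ)) = up (fun n => (σ n).rename ξ) := by
  funext n
  cases n with
  | zero => rfl
  | succ n => simp only [up, scons_succ, shift, rename_rename]; rfl

theorem subst_rename (t : Tm) : ∀ (σ : ℕ → Tm) (ξ : ℕ → ℕ),
    (t.subst σ).rename ξ = t.subst (fun n => (σ n).rename ξ) := by
  induction t <;> intro σ ξ <;> simp_all [rename, subst, up_rename]

theorem up_subst (σ τ : ℕ → Tm) :
    (fun n => (up σ n).subst (up τ)) = up (fun n => (σ n).subst τ) := by
  funext n
  cases n with
  | zero => rfl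
  | succ n => simp only [up, scons_succ, shift, rename_subst, subst_rename]

@[simp] theorem subst_subst (t : Tm) : ∀ (σ τ : ℕ → Tm),
    (t.subst σ).subst τ = t.subst (fun n => (σ n).subst τ) := by
  induction t <;> intro σ τ <;> simp_all [subst, up_subst]

theorem up_var : up var = var := by funext n; cases n <;> rfl

@[simp] theorem subst_var (t : Tm) : t.subst var = t := by
  induction t <;> simp_all [subst, up_var]

@[simp] theorem subst_var' (t : Tm) : t.subst (fun n => var n) = t := subst_var t

theorem shift_eq (k : ℕ) (t : Tm) : t.shift k = t.subst (sh k) := rename_eq_subst _ _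

theorem up_eq (σ : ℕ → Tm) : up σ = (var 0 ;; fun n => (σ n).subst (sh 1)) := by
  funext n; cases n <;> simp [up, shift_eq]

@[simp] theorem sh_apply (k n : ℕ) : sh k n = var (n + k) := rfl

end Tm

namespace Ix

theorem bind_bind {L M N : Type} (f : L → Ix M) (g : M → Ix N) (I : Ix L) :
    (I.bind f).bind g = I.bind (fun x => (f x).bind g) := by
  induction I <;> simp_all [bind]

theorem bind_leaf {L : Type} (I : Ix L) : I.bind leaf = I := by
  induction I <;> simp_all [bind]

theorem eval_bind {L M : Type} (f : L → Ix M) (ρ : M → EReal) (I : Ix L) :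
    (I.bind f).eval ρ = I.eval (fun x => (f x).eval ρ) := by
  induction I <;> simp_all [bind, eval]

theorem AllLeaves.imp {L : Type} {p q : L → Prop} {I : Ix L} (h : ∀ x, p x → q x) :
    I.AllLeaves p → I.AllLeaves q := by
  induction I <;> simp_all [AllLeaves]

theorem IsNat.allLeaves {L : Type} {p : L → Prop} {I : Ix L} : I.IsNat p → I.AllLeaves p := by
  induction I <;> simp_all [IsNat, AllLeaves]

theorem AllLeaves.bind {L M : Type} {p : L → Prop} {q : M → Prop} {f : L → Ix M} {I : Ix L}
    (h : ∀ x, p x → (f x).AllLeaves q) : I.AllLeaves p → (I.bind f).AllLeaves q := by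
  induction I <;> simp_all [AllLeaves, Ix.bind]

theorem IsNat.bind {L M : Type} {p : L → Prop} {q : M → Prop} {f : L → Ix M} {I : Ix L}
    (h : ∀ x, p x → (f x).IsNat q) : I.IsNat p → (I.bind f).IsNat q := by
  induction I <;> simp_all [IsNat, Ix.bind]

end Ix

namespace Cst

theorem bind_bind {L M N : Type} (f : L → Ix M) (g : M → Ix N) (C : Cst L) :
    (C.bind f).bind g = C.bind (fun x => (f x).bind g) := by
  induction C <;> simp_all [bind, Ix.bind_bind]

theorem bind_leaf {L : Type} (C : Cst L) : C.bind Ix.leaf = C := by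
  induction C <;> simp_all [bind, Ix.bind_leaf]

theorem holds_bind {L M : Type} (f : L → Ix M) (ρ : M → EReal) (C : Cst L) :
    (C.bind f).Holds ρ ↔ C.Holds (fun x => (f x).eval ρ) := by
  induction C <;> simp_all [bind, Holds, Ix.eval_bind]

theorem AllLeaves.bind {L M : Type} {p : L → Prop} {q : M → Prop} {f : L → Ix M} {C : Cst L}
    (h : ∀ x, p x → (f x).AllLeaves q) : C.AllLeaves p → (C.bind f).AllLeaves q := by
  induction C with
  | not _ ih => exact ih
  | _ => exact fun H => ⟨H.1.bind h, H.2.bind h⟩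

end Cst

namespace HIx

theorem leafSub_sub (σ σ' : ℕ → Tm) (θ θ' : ℕ → HIx) (x : ℕ ⊕ Tm) :
    (leafSub σ θ x).bind (leafSub σ' θ') =
      leafSub (fun n => (σ n).subst σ') (fun i => (θ i).sub σ' θ') x := by
  cases x <;> simp [leafSub, sub, tm, Ix.bind]

@[simp] theorem sub_sub (I : HIx) (σ σ' : ℕ → Tm) (θ θ' : ℕ → HIx) :
    (I.sub σ θ).sub σ' θ' = I.sub (fun n => (σ n).subst σ') (fun i => (θ i).sub σ' θ') := by
  simp only [sub, Ix.bind_bind, leafSub_sub]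

theorem leafSub_id (x : ℕ ⊕ Tm) : leafSub Tm.var ivar x = Ix.leaf x := by
  cases x <;> simp [leafSub, ivar, tm]

@[simp] theorem sub_id (I : HIx) : I.sub Tm.var ivar = I := by
  rw [sub, funext leafSub_id, Ix.bind_leaf]

@[simp] theorem ivar_sub (i : ℕ) (σ : ℕ → Tm) (θ : ℕ → HIx) : (ivar i).sub σ θ = θ i := rfl
@[simp] theorem tm_sub (t : Tm) (σ : ℕ → Tm) (θ : ℕ → HIx) :
    (tm t).sub σ θ = tm (t.subst σ) := rfl
@[simp] theorem num_sub (n : ℕ) (σ : ℕ → Tm) (θ : ℕ → HIx) : sub (.num n) σ θ = .num n := rfl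
@[simp] theorem inf_sub (σ : ℕ → Tm) (θ : ℕ → HIx) : sub .inf σ θ = .inf := rfl
@[simp] theorem add_sub (I J : HIx) (σ : ℕ → Tm) (θ : ℕ → HIx) :
    sub (.add I J) σ θ = .add (I.sub σ θ) (J.sub σ θ) := rfl
@[simp] theorem sub_sub' (I J : HIx) (σ : ℕ → Tm) (θ : ℕ → HIx) :
    HIx.sub (Ix.sub I J) σ θ = Ix.sub (HIx.sub I σ θ) (HIx.sub J σ θ) := rfl
@[simp] theorem ish_apply (k i : ℕ) : ish k i = ivar (i + k) := rfl

end HIx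

/-- Action of substitutions on constraints. -/
def HCst.sub (C : HCst) (σ : ℕ → Tm) (θ : ℕ → HIx) : HCst := C.bind (HIx.leafSub σ θ)

namespace HCst

@[simp] theorem sub_sub (C : HCst) (σ σ' : ℕ → Tm) (θ θ' : ℕ → HIx) :
    (C.sub σ θ).sub σ' θ' = C.sub (fun n => (σ n).subst σ') (fun i => (θ i).sub σ' θ') := by
  simp only [sub, Cst.bind_bind, HIx.leafSub_sub]

@[simp] theorem sub_id (C : HCst) : C.sub Tm.var HIx.ivar = C := by
  rw [sub, funext HIx.leafSub_id, Cst.bind_leaf]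

@[simp] theorem eq_sub (I J : HIx) (σ : ℕ → Tm) (θ : ℕ → HIx) :
    sub (.eq I J) σ θ = .eq (I.sub σ θ) (J.sub σ θ) := rfl
@[simp] theorem le_sub (I J : HIx) (σ : ℕ → Tm) (θ : ℕ → HIx) :
    sub (.le I J) σ θ = .le (I.sub σ θ) (J.sub σ θ) := rfl
@[simp] theorem lt_sub (I J : HIx) (σ : ℕ → Tm) (θ : ℕ → HIx) :
    sub (.lt I J) σ θ = .lt (I.sub σ θ) (J.sub σ θ) := rfl
@[simp] theorem not_sub (C : HCst) (σ : ℕ → Tm) (θ : ℕ → HIx) :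
    sub (.not C) σ θ = .not (C.sub σ θ) := rfl

theorem bind_sub (C : ICst) (f : ℕ → HIx) (σ : ℕ → Tm) (θ : ℕ → HIx) :
    sub (C.bind f) σ θ = C.bind (fun i => (f i).sub σ θ) := by
  simp only [sub, Cst.bind_bind, HIx.sub]

end HCst

namespace Fml

/-- Lift an index substitution under `k` term binders. -/
def tlift (θ : ℕ → HIx) (k : ℕ) : ℕ → HIx := fun i => (θ i).sub (Tm.sh k) HIx.ivar

/-- Lift an index substitution under an index binder. -/
def ilift (θ : ℕ → HIx) : ℕ → HIx := HIx.ivar 0 ;; fun i => (θ i).sub Tm.var (HIx.ish 1)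


@[simp] theorem top_sub (σ θ) : top.sub σ θ = top := rfl
@[simp] theorem bot_sub (σ θ) : bot.sub σ θ = bot := rfl
@[simp] theorem and_sub (φ ψ σ θ) : (and φ ψ).sub σ θ = and (φ.sub σ θ) (ψ.sub σ θ) := rfl
@[simp] theorem or_sub (φ ψ σ θ) : (or φ ψ).sub σ θ = or (φ.sub σ θ) (ψ.sub σ θ) := rfl
@[simp] theorem imp_sub (φ ψ σ θ) : (imp φ ψ).sub σ θ = imp (φ.sub σ θ) (ψ.sub σ θ) := rfl
@[simp] theorem all_sub (τ φ σ θ) :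
    (all τ φ).sub σ θ = all τ (φ.sub (Tm.up σ) (tlift θ 1)) := rfl
@[simp] theorem ex_sub (τ φ σ θ) :
    (ex τ φ).sub σ θ = ex τ (φ.sub (Tm.up σ) (tlift θ 1)) := rfl
@[simp] theorem alli_sub (S φ σ θ) : (alli S φ).sub σ θ = alli S (φ.sub σ (ilift θ)) := rfl
@[simp] theorem exi_sub (S φ σ θ) : (exi S φ).sub σ θ = exi S (φ.sub σ (ilift θ)) := rfl
@[simp] theorem eq_sub (τ t u σ θ) :
    (Fml.eq τ t u).sub σ θ = Fml.eq τ (t.subst σ) (u.subst σ) := rfl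
@[simp] theorem cst_sub (C : HCst) (σ θ) : (cst C).sub σ θ = cst (HCst.sub C σ θ) := rfl
@[simp] theorem listU_sub (τ n l P σ θ) : (listU τ n l P).sub σ θ =
    listU τ (n.sub σ θ) (l.subst σ) (P.sub (Tm.up σ) (tlift θ 1)) := rfl
@[simp] theorem listR_sub (τ n l₁ l₂ a P σ θ) : (listR τ n l₁ l₂ a P).sub σ θ =
    listR τ (n.sub σ θ) (l₁.subst σ) (l₂.subst σ) (a.sub σ θ)
      (P.sub (Tm.up (Tm.up σ)) (tlift θ 2)) := rfl

theorem tlift_sub (σ : ℕ → Tm) (θ θ' : ℕ → HIx) :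
    (fun i => (tlift θ 1 i).sub (Tm.up σ) (tlift θ' 1)) = tlift (fun i => (θ i).sub σ θ') 1 := by
  funext i; simp [tlift, Tm.up_eq, Tm.subst]

theorem tlift_sub₂ (σ : ℕ → Tm) (θ θ' : ℕ → HIx) :
    (fun i => (tlift θ 2 i).sub (Tm.up (Tm.up σ)) (tlift θ' 2)) =
      tlift (fun i => (θ i).sub σ θ') 2 := by
  funext i; simp [tlift, Tm.up_eq, Tm.subst]; rfl

theorem ilift_sub (σ : ℕ → Tm) (θ θ' : ℕ → HIx) :
    (fun i => (ilift θ i).sub σ (ilift θ')) = ilift (fun i => (θ i).sub σ θ') := by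
  funext i; cases i <;> simp [ilift, Tm.subst]

@[simp] theorem sub_sub (φ : Fml) : ∀ (σ σ' : ℕ → Tm) (θ θ' : ℕ → HIx),
    (φ.sub σ θ).sub σ' θ' = φ.sub (fun n => (σ n).subst σ') (fun i => (θ i).sub σ' θ') := by
  induction φ <;> intro σ σ' θ θ' <;> simp_all [Tm.up_subst, tlift_sub, ilift_sub, tlift_sub₂]

theorem tlift_ivar (k : ℕ) : tlift HIx.ivar k = HIx.ivar := rfl
theorem ilift_ivar : ilift HIx.ivar = HIx.ivar := by funext i; cases i <;> rfl

@[simp] theorem sub_id (φ : Fml) : φ.sub Tm.var HIx.ivar = φ := by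
  induction φ <;> simp_all [Tm.up_var, tlift_ivar, ilift_ivar]

theorem sub_congr (φ : Fml) {σ σ' : ℕ → Tm} {θ θ' : ℕ → HIx} (h : ∀ n, σ n = σ' n)
    (h' : ∀ i, θ i = θ' i) : φ.sub σ θ = φ.sub σ' θ' := by
  rw [funext h, funext h']

theorem sub_eq_self (φ : Fml) {σ : ℕ → Tm} {θ : ℕ → HIx} (h : ∀ n, σ n = .var n)
    (h' : ∀ i, θ i = HIx.ivar i) : φ.sub σ θ = φ := by
  rw [sub_congr φ h h']; exact sub_id φ

end Fml

/-- Unfold every substitution operation to `Tm.subst`, `HIx.sub` and `Fml.sub`. -/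
theorem HIx.shift_eq (k j : ℕ) (I : HIx) : I.shift k j = I.sub (Tm.sh k) (HIx.ish j) := rfl

/-! ## Typing under substitution -/

namespace Tm

theorem Guarded.of_not_free (t : Tm) : ∀ {f x : ℕ} {sm : List ℕ} {ξ : ℕ → ℕ}, (∀ n, ξ n ≠ f) →
    Guarded f x sm (t.rename ξ) := by
  have hup : ∀ {f : ℕ} {ξ : ℕ → ℕ}, (∀ n, ξ n ≠ f) → ∀ n, upr ξ n ≠ f + 1 := by
    intro f ξ h n
    cases n with
    | zero => simp [upr]
    | succ n => simpa [upr] using h n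
  induction t with
  | var n => intro f x sm ξ h; exact .var (h n)
  | lam _ ih => intro f x sm ξ h; exact .lam (ih (hup h))
  | letrec _ ih => intro f x sm ξ h; exact .letrec (ih (hup (hup h)))
  | pair _ _ ih₁ ih₂ => intro f x sm ξ h; exact .pair (ih₁ h) (ih₂ h)
  | app _ _ ih₁ ih₂ => intro f x sm ξ h; exact .app (ih₁ h) (ih₂ h)
  | cons _ _ ih₁ ih₂ => intro f x sm ξ h; exact .cons (ih₁ h) (ih₂ h)
  | fst _ ih => intro f x sm ξ h; exact .fst (ih h)
  | snd _ ih => intro f x sm ξ h; exact .snd (ih h)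
  | succ _ ih => intro f x sm ξ h; exact .succ (ih h)
  | natCase _ _ _ ih₁ ih₂ ih₃ => intro f x sm ξ h; exact .natCase (ih₁ h) (ih₂ h) (ih₃ h)
  | boolCase _ _ _ ih₁ ih₂ ih₃ => intro f x sm ξ h; exact .boolCase (ih₁ h) (ih₂ h) (ih₃ h)
  | listCase _ _ _ ih₁ ih₂ ih₃ => intro f x sm ξ h; exact .listCase (ih₁ h) (ih₂ h) (ih₃ h)
  | tt => intro f x sm ξ h; exact .tt
  | ff => intro f x sm ξ h; exact .ff
  | zero => intro f x sm ξ h; exact .zero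
  | nil => intro f x sm ξ h; exact .nil

theorem Guarded.rename {f x : ℕ} {sm : List ℕ} {t : Tm} (h : Guarded f x sm t) :
    ∀ {f' x' : ℕ} {sm' : List ℕ} {ξ : ℕ → ℕ}, (∀ n, n ≠ f → ξ n ≠ f') → ξ f = f' → ξ x = x' →
      (∀ y ∈ sm, ξ y ∈ sm') → Guarded f' x' sm' (t.rename ξ) := by
  have hup : ∀ {f f' : ℕ} {ξ : ℕ → ℕ}, (∀ n, n ≠ f → ξ n ≠ f') →
      ∀ n, n ≠ f + 1 → upr ξ n ≠ f' + 1 := by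
    intro f f' ξ h n hn
    cases n with
    | zero => simp [upr]
    | succ n => simpa [upr] using h n (by omega)
  have hsm : ∀ {sm sm' : List ℕ} {ξ : ℕ → ℕ}, (∀ y ∈ sm, ξ y ∈ sm') →
      ∀ y ∈ sm.map (· + 1), upr ξ y ∈ sm'.map (· + 1) := by
    intro sm sm' ξ h y hy
    obtain ⟨z, hz, rfl⟩ := List.mem_map.1 hy
    exact List.mem_map.2 ⟨ξ z, h z hz, rfl⟩
  have h2 : ∀ sm : List ℕ, sm.map (· + 2) = (sm.map (· + 1)).map (· + 1) := by
    intro sm; simp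
  induction h with
  | call hy => intro f' x' sm' ξ h1 hf hx hs; subst hf; exact .call (hs _ hy)
  | lam _ ih =>
    intro f' x' sm' ξ h1 hf hx hs
    exact .lam (ih (hup h1) (congrArg (· + 1) hf) (congrArg (· + 1) hx) (hsm hs))
  | letrec _ ih =>
    intro f' x' sm' ξ h1 hf hx hs
    refine .letrec (ih (hup (hup h1)) (congrArg (· + 2) hf) (congrArg (· + 2) hx) ?_)
    rw [h2, h2]
    exact hsm (hsm hs)
  | natCaseVar hy _ _ ih₁ ih₂ =>
    intro f' x' sm' ξ h1 hf hx hs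
    refine .natCaseVar ?_ (ih₁ h1 hf hx hs)
      (ih₂ (hup h1) (congrArg (· + 1) hf) (congrArg (· + 1) hx) ?_)
    · rcases List.mem_cons.1 hy with rfl | hy
      · simp [hx]
      · exact List.mem_cons_of_mem _ (hs _ hy)
    · intro y hy
      rcases List.mem_cons.1 hy with rfl | hy
      · simp [upr]
      · exact List.mem_cons_of_mem _ (hsm hs _ hy)
  | listCaseVar hy _ _ ih₁ ih₂ =>
    intro f' x' sm' ξ h1 hf hx hs
    refine .listCaseVar ?_ (ih₁ h1 hf hx hs)
      (ih₂ (hup (hup h1)) (congrArg (· + 2) hf) (congrArg (· + 2) hx) ?_)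
    · rcases List.mem_cons.1 hy with rfl | hy
      · simp [hx]
      · exact List.mem_cons_of_mem _ (hs _ hy)
    · intro y hy
      rcases List.mem_cons.1 hy with rfl | hy
      · simp [upr]
      · rw [h2] at hy ⊢
        exact List.mem_cons_of_mem _ (hsm (hsm hs) _ hy)
  | pair _ _ ih₁ ih₂ => intro f' x' sm' ξ h1 hf hx hs; exact .pair (ih₁ h1 hf hx hs) (ih₂ h1 hf hx hs)
  | app _ _ ih₁ ih₂ => intro f' x' sm' ξ h1 hf hx hs; exact .app (ih₁ h1 hf hx hs) (ih₂ h1 hf hx hs)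
  | cons _ _ ih₁ ih₂ => intro f' x' sm' ξ h1 hf hx hs; exact .cons (ih₁ h1 hf hx hs) (ih₂ h1 hf hx hs)
  | fst _ ih => intro f' x' sm' ξ h1 hf hx hs; exact .fst (ih h1 hf hx hs)
  | snd _ ih => intro f' x' sm' ξ h1 hf hx hs; exact .snd (ih h1 hf hx hs)
  | succ _ ih => intro f' x' sm' ξ h1 hf hx hs; exact .succ (ih h1 hf hx hs)
  | natCase _ _ _ ih₁ ih₂ ih₃ =>
    intro f' x' sm' ξ h1 hf hx hs
    exact .natCase (ih₁ h1 hf hx hs) (ih₂ h1 hf hx hs) (ih₃ h1 hf hx hs)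
  | boolCase _ _ _ ih₁ ih₂ ih₃ =>
    intro f' x' sm' ξ h1 hf hx hs
    exact .boolCase (ih₁ h1 hf hx hs) (ih₂ h1 hf hx hs) (ih₃ h1 hf hx hs)
  | listCase _ _ _ ih₁ ih₂ ih₃ =>
    intro f' x' sm' ξ h1 hf hx hs
    exact .listCase (ih₁ h1 hf hx hs) (ih₂ h1 hf hx hs) (ih₃ h1 hf hx hs)
  | var hn => intro f' x' sm' ξ h1 hf hx hs; exact .var (h1 _ hn)
  | tt => intros; exact .tt
  | ff => intros; exact .ff
  | zero => intros; exact .zero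
  | nil => intros; exact .nil

/-- The substitution `σ` respects a guard. -/
def GuardMap (f x : ℕ) (sm : List ℕ) (σ : ℕ → Tm) (f' x' : ℕ) (sm' : List ℕ) : Prop :=
  σ f = var f' ∧ σ x = var x' ∧ (∀ y ∈ sm, ∃ y' ∈ sm', σ y = var y') ∧
    ∀ n, n ≠ f → Guarded f' x' sm' (σ n)

theorem GuardMap.up {f x : ℕ} {sm : List ℕ} {σ : ℕ → Tm} {f' x' : ℕ} {sm' : List ℕ}
    (h : GuardMap f x sm σ f' x' sm') :
    GuardMap (f + 1) (x + 1) (sm.map (· + 1)) (up σ) (f' + 1) (x' + 1) (sm'.map (· + 1)) := by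
  obtain ⟨hf, hx, hs, hn⟩ := h
  refine ⟨by simp [Tm.up, hf, shift, Tm.rename], by simp [Tm.up, hx, shift, Tm.rename], ?_, ?_⟩
  · intro y hy
    obtain ⟨z, hz, rfl⟩ := List.mem_map.1 hy
    obtain ⟨y', hy', e⟩ := hs z hz
    exact ⟨y' + 1, List.mem_map.2 ⟨y', hy', rfl⟩, by simp [Tm.up, e, shift, Tm.rename]⟩
  · intro n h
    cases n with
    | zero => exact .var (by omega)
    | succ n =>
      exact (hn n (by omega)).rename (fun n h => by simpa using h) rfl rfl
        (fun y hy => List.mem_map.2 ⟨y, hy, rfl⟩)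

theorem GuardMap.cons {f x : ℕ} {sm : List ℕ} {σ : ℕ → Tm} {f' x' : ℕ} {sm' : List ℕ}
    (h : GuardMap f x sm σ f' x' sm') {y y' : ℕ} (e : σ y = var y') :
    GuardMap f x (y :: sm) σ f' x' (y' :: sm') := by
  obtain ⟨hf, hx, hs, hn⟩ := h
  refine ⟨hf, hx, ?_, fun n h => ?_⟩
  · intro z hz
    rcases List.mem_cons.1 hz with rfl | hz
    · exact ⟨y', by simp, e⟩
    · obtain ⟨z', h1, h2⟩ := hs z hz
      exact ⟨z', List.mem_cons_of_mem _ h1, h2⟩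
  · have := (hn n h).rename (ξ := id) (f' := f') (x' := x') (sm' := y' :: sm') (by simp) rfl rfl
      (fun y hy => List.mem_cons_of_mem _ hy)
    rwa [rename_eq_subst, show (fun n => var (id n)) = var from rfl, subst_var] at this

theorem Guarded.subst {f x : ℕ} {sm : List ℕ} {t : Tm} (h : Guarded f x sm t) :
    ∀ {σ : ℕ → Tm} {f' x' : ℕ} {sm' : List ℕ}, GuardMap f x sm σ f' x' sm' →
      Guarded f' x' sm' (t.subst σ) := by
  have h2 : ∀ sm : List ℕ, sm.map (· + 2) = (sm.map (· + 1)).map (· + 1) := by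
    intro sm; simp
  induction h with
  | var hn => intro σ f' x' sm' H; exact H.2.2.2 _ hn
  | call hy =>
    intro σ f' x' sm' H
    obtain ⟨y', hy', e⟩ := H.2.2.1 _ hy
    simp only [Tm.subst, H.1, e]
    exact .call hy'
  | lam _ ih => intro σ f' x' sm' H; exact .lam (ih H.up)
  | letrec _ ih =>
    intro σ f' x' sm' H
    refine .letrec (ih ?_)
    rw [h2, h2]; exact H.up.up
  | @natCaseVar f x sm y u v hy _ _ ih₁ ih₂ =>
    intro σ f' x' sm' H
    obtain ⟨y', hy', e⟩ : ∃ y' ∈ x' :: sm', σ y = Tm.var y' := by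
      rcases List.mem_cons.1 hy with rfl | hy
      · exact ⟨x', by simp, H.2.1⟩
      · obtain ⟨y', h1, h2⟩ := H.2.2.1 _ hy
        exact ⟨y', List.mem_cons_of_mem _ h1, h2⟩
    simp only [Tm.subst, e]
    exact .natCaseVar hy' (ih₁ H) (ih₂ (H.up.cons rfl))
  | @listCaseVar f x sm y u v hy _ _ ih₁ ih₂ =>
    intro σ f' x' sm' H
    obtain ⟨y', hy', e⟩ : ∃ y' ∈ x' :: sm', σ y = Tm.var y' := by
      rcases List.mem_cons.1 hy with rfl | hy
      · exact ⟨x', by simp, H.2.1⟩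
      · obtain ⟨y', h1, h2⟩ := H.2.2.1 _ hy
        exact ⟨y', List.mem_cons_of_mem _ h1, h2⟩
    simp only [Tm.subst, e]
    refine .listCaseVar hy' (ih₁ H) (ih₂ ?_)
    rw [h2, h2]
    exact H.up.up.cons rfl
  | pair _ _ ih₁ ih₂ => intro σ f' x' sm' H; exact .pair (ih₁ H) (ih₂ H)
  | app _ _ ih₁ ih₂ => intro σ f' x' sm' H; exact .app (ih₁ H) (ih₂ H)
  | cons _ _ ih₁ ih₂ => intro σ f' x' sm' H; exact .cons (ih₁ H) (ih₂ H)
  | fst _ ih => intro σ f' x' sm' H; exact .fst (ih H)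
  | snd _ ih => intro σ f' x' sm' H; exact .snd (ih H)
  | succ _ ih => intro σ f' x' sm' H; exact .succ (ih H)
  | natCase _ _ _ ih₁ ih₂ ih₃ =>
    intro σ f' x' sm' H
    exact .natCase (ih₁ H) (ih₂ H) (ih₃ H)
  | boolCase _ _ _ ih₁ ih₂ ih₃ =>
    intro σ f' x' sm' H
    exact .boolCase (ih₁ H) (ih₂ H) (ih₃ H)
  | listCase _ _ _ ih₁ ih₂ ih₃ =>
    intro σ f' x' sm' H
    exact .listCase (ih₁ H) (ih₂ H) (ih₃ H)
  | tt => intros; exact .tt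
  | ff => intros; exact .ff
  | zero => intros; exact .zero
  | nil => intros; exact .nil

theorem Guarded.subst_up_up {t : Tm} (h : Guarded 1 0 [] t) (σ : ℕ → Tm) :
    Guarded 1 0 [] (t.subst (Tm.up (Tm.up σ))) := by
  refine h.subst ⟨rfl, rfl, by simp, fun n hn => ?_⟩
  match n with
  | 0 => exact .var (by omega)
  | 1 => exact absurd rfl hn
  | n + 2 =>
    simp only [Tm.up, scons_succ, shift, rename_rename]
    exact Guarded.of_not_free _ (fun n => by omega)

end Tm

/-- `σ` is a well-typed substitution from `Γ` to `Γ'`. -/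
def Tm.Maps (Γ : Ctx) (σ : ℕ → Tm) (Γ' : Ctx) : Prop :=
  ∀ (n : ℕ) (τ : Ty), Γ[n]? = some τ → HasTy Γ' (σ n) τ

theorem HasTy.rename {Γ : Ctx} {t : Tm} {τ : Ty} (h : HasTy Γ t τ) :
    ∀ {Γ' : Ctx} {ξ : ℕ → ℕ}, (∀ n τ, Γ[n]? = some τ → Γ'[ξ n]? = some τ) →
      HasTy Γ' (t.rename ξ) τ := by
  have hup : ∀ {Γ Γ' : Ctx} {ξ : ℕ → ℕ} {σ : Ty}, (∀ (n : ℕ) τ, Γ[n]? = some τ → Γ'[ξ n]? = some τ) →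
      ∀ (n : ℕ) τ, (σ :: Γ)[n]? = some τ → (σ :: Γ')[upr ξ n]? = some τ := by
    intro Γ Γ' ξ σ h n τ hn
    cases n with
    | zero => simpa [upr] using hn
    | succ n => simpa [upr] using h n τ (by simpa using hn)
  induction h with
  | var hn => intro Γ' ξ h; exact .var (h _ _ hn)
  | lam _ ih => intro Γ' ξ h; exact .lam (ih (hup h))
  | letrec hI _ hg ih =>
    intro Γ' ξ h
    refine .letrec hI (ih (hup (hup h))) ?_
    have := hg.subst_up_up (fun n => .var (ξ n))
    rwa [Tm.up_var_comp, Tm.up_var_comp, ← Tm.rename_eq_subst] at this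
  | fst _ ih => intro Γ' ξ h; exact .fst (ih h)
  | snd _ ih => intro Γ' ξ h; exact .snd (ih h)
  | app _ _ ih₁ ih₂ => intro Γ' ξ h; exact .app (ih₁ h) (ih₂ h)
  | listCase _ _ _ ih₁ ih₂ ih₃ => intro Γ' ξ h; exact .listCase (ih₁ h) (ih₂ h) (ih₃ h)
  | pair _ _ ih₁ ih₂ => intro Γ' ξ h; exact .pair (ih₁ h) (ih₂ h)
  | cons _ _ ih₁ ih₂ => intro Γ' ξ h; exact .cons (ih₁ h) (ih₂ h)
  | succ _ ih => intro Γ' ξ h; exact .succ (ih h)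
  | natCase _ _ _ ih₁ ih₂ ih₃ => intro Γ' ξ h; exact .natCase (ih₁ h) (ih₂ h) (ih₃ h)
  | boolCase _ _ _ ih₁ ih₂ ih₃ => intro Γ' ξ h; exact .boolCase (ih₁ h) (ih₂ h) (ih₃ h)
  | tt => intros; exact .tt
  | ff => intros; exact .ff
  | zero => intros; exact .zero
  | nil => intros; exact .nil

theorem HasTy.shift {Γ : Ctx} {t : Tm} {τ : Ty} (h : HasTy Γ t τ) (σ : Ty) :
    HasTy (σ :: Γ) (t.subst (Tm.sh 1)) τ := by
  rw [← Tm.shift_eq]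
  exact h.rename (fun n τ hn => by simpa using hn)

theorem Tm.Maps.up {Γ Γ' : Ctx} {σ : ℕ → Tm} (h : Tm.Maps Γ σ Γ') (τ : Ty) :
    Tm.Maps (τ :: Γ) (Tm.up σ) (τ :: Γ') := by
  intro n τ' hn
  rw [Tm.up_eq]
  cases n with
  | zero => exact .var hn
  | succ n => exact (h n τ' (by simpa using hn)).shift τ

theorem HasTy.subst {Γ : Ctx} {t : Tm} {τ : Ty} (h : HasTy Γ t τ) :
    ∀ {Γ' : Ctx} {σ : ℕ → Tm}, Tm.Maps Γ σ Γ' → HasTy Γ' (t.subst σ) τ := by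
  induction h with
  | var hn => intro Γ' ξ h; exact h _ _ hn
  | lam _ ih => intro Γ' ξ h; exact .lam (ih (h.up _))
  | letrec hI _ hg ih => intro Γ' ξ h; exact .letrec hI (ih ((h.up _).up _)) (hg.subst_up_up _)
  | fst _ ih => intro Γ' ξ h; exact .fst (ih h)
  | snd _ ih => intro Γ' ξ h; exact .snd (ih h)
  | app _ _ ih₁ ih₂ => intro Γ' ξ h; exact .app (ih₁ h) (ih₂ h)
  | listCase _ _ _ ih₁ ih₂ ih₃ => intro Γ' ξ h; exact .listCase (ih₁ h) (ih₂ h) (ih₃ h)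
  | pair _ _ ih₁ ih₂ => intro Γ' ξ h; exact .pair (ih₁ h) (ih₂ h)
  | cons _ _ ih₁ ih₂ => intro Γ' ξ h; exact .cons (ih₁ h) (ih₂ h)
  | succ _ ih => intro Γ' ξ h; exact .succ (ih h)
  | natCase _ _ _ ih₁ ih₂ ih₃ => intro Γ' ξ h; exact .natCase (ih₁ h) (ih₂ h) (ih₃ h)
  | boolCase _ _ _ ih₁ ih₂ ih₃ => intro Γ' ξ h; exact .boolCase (ih₁ h) (ih₂ h) (ih₃ h)
  | tt => intros; exact .tt
  | ff => intros; exact .ff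
  | zero => intros; exact .zero
  | nil => intros; exact .nil

theorem Tm.Maps.cons {Γ Γ' : Ctx} {σ : ℕ → Tm} (h : Tm.Maps Γ σ Γ') {t : Tm} {τ : Ty}
    (ht : HasTy Γ' t τ) : Tm.Maps (τ :: Γ) (t ;; σ) Γ' := by
  intro n τ' hn
  cases n with
  | zero => simp only [List.getElem?_cons_zero, Option.some.injEq] at hn; subst hn; exact ht
  | succ n => exact h n τ' (by simpa using hn)

theorem Tm.Maps.var (Γ : Ctx) : Tm.Maps Γ Tm.var Γ := fun _ _ h => .var h
theorem Tm.Maps.sh_one (Γ : Ctx) (a : Ty) : Tm.Maps Γ (Tm.sh 1) (a :: Γ) :=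
  fun _ _ h => .var (by simpa using h)
theorem Tm.Maps.sh_two (Γ : Ctx) (a b : Ty) : Tm.Maps Γ (Tm.sh 2) (a :: b :: Γ) :=
  fun _ _ h => .var (by simpa using h)
theorem Tm.Maps.sh_three (Γ : Ctx) (a b c : Ty) : Tm.Maps Γ (Tm.sh 3) (a :: b :: c :: Γ) :=
  fun _ _ h => .var (by simpa using h)
theorem Tm.Maps.sh_four (Γ : Ctx) (a b c d : Ty) : Tm.Maps Γ (Tm.sh 4) (a :: b :: c :: d :: Γ) :=
  fun _ _ h => .var (by simpa using h)
theorem Tm.Maps.sh_six (Γ : Ctx) (a b c d e f : Ty) :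
    Tm.Maps Γ (Tm.sh 6) (a :: b :: c :: d :: e :: f :: Γ) :=
  fun _ _ h => .var (by simpa using h)

theorem Tm.Maps.comp {Γ₁ Γ₂ Γ₃ : Ctx} {σ σ' : ℕ → Tm} (h : Tm.Maps Γ₁ σ Γ₂)
    (h' : Tm.Maps Γ₂ σ' Γ₃) : Tm.Maps Γ₁ (fun n => (σ n).subst σ') Γ₃ :=
  fun n τ hn => (h n τ hn).subst h'

/-- `θ` is a well-sorted substitution from `Δ` to `Δ', Γ'`. -/
def HIx.Maps (Δ : ICtx) (θ : ℕ → HIx) (Δ' : ICtx) (Γ' : Ctx) : Prop :=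
  ∀ (i : ℕ) (S : Srt), Δ[i]? = some S → HIx.HasSort Δ' Γ' (θ i) S

theorem HIx.HasSort.real {Δ : ICtx} {Γ : Ctx} {I : HIx} {S : Srt} (h : HIx.HasSort Δ Γ I S) :
    HIx.HasSort Δ Γ I .real := by
  cases S with
  | real => exact h
  | nat =>
    refine Ix.AllLeaves.imp ?_ (Ix.IsNat.allLeaves h)
    rintro (i | t) h
    · exact (List.getElem?_eq_some_iff.1 h).1
    · exact h

theorem HIx.Maps.leaf {Δ Δ' : ICtx} {Γ Γ' : Ctx} {σ : ℕ → Tm} {θ : ℕ → HIx}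
    (hσ : Tm.Maps Γ σ Γ') (hθ : HIx.Maps Δ θ Δ' Γ') (x : ℕ ⊕ Tm)
    (hx : Sum.elim (fun i => i < Δ.length) (fun t => HasTy Γ t .nat) x) :
    (HIx.leafSub σ θ x).AllLeaves
      (Sum.elim (fun i => i < Δ'.length) (fun t => HasTy Γ' t .nat)) := by
  cases x with
  | inl i => exact (hθ i _ (List.getElem?_eq_getElem hx)).real
  | inr t => exact HasTy.subst hx hσ

theorem HIx.HasSort.sub {Δ Δ' : ICtx} {Γ Γ' : Ctx} {I : HIx} {S : Srt} {σ : ℕ → Tm} {θ : ℕ → HIx}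
    (h : HIx.HasSort Δ Γ I S) (hσ : Tm.Maps Γ σ Γ') (hθ : HIx.Maps Δ θ Δ' Γ') :
    HIx.HasSort Δ' Γ' (I.sub σ θ) S := by
  cases S with
  | real => exact Ix.AllLeaves.bind (hθ.leaf hσ) h
  | nat =>
    refine Ix.IsNat.bind ?_ h
    rintro (i | t) h
    · exact hθ i _ h
    · exact HasTy.subst h hσ

theorem HIx.Maps.ivar (Δ : ICtx) (Γ : Ctx) : HIx.Maps Δ HIx.ivar Δ Γ := by
  intro i S h
  cases S with
  | real => exact (List.getElem?_eq_some_iff.1 h).1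
  | nat => exact h

theorem HIx.Maps.ish (Δ : ICtx) (Γ : Ctx) (S : Srt) : HIx.Maps Δ (HIx.ish 1) (S :: Δ) Γ := by
  intro i S h
  exact HIx.Maps.ivar _ _ (i + 1) S (by simpa using h)

theorem HIx.Maps.ish_two (Δ : ICtx) (Γ : Ctx) (S S' : Srt) :
    HIx.Maps Δ (HIx.ish 2) (S :: S' :: Δ) Γ := by
  intro i S h
  exact HIx.Maps.ivar _ _ (i + 2) S (by simpa using h)

theorem HIx.Maps.cons {Δ Δ' : ICtx} {Γ' : Ctx} {θ : ℕ → HIx} (h : HIx.Maps Δ θ Δ' Γ') {I : HIx}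
    {S : Srt} (hI : HIx.HasSort Δ' Γ' I S) : HIx.Maps (S :: Δ) (I ;; θ) Δ' Γ' := by
  intro i S' hi
  cases i with
  | zero => simp only [List.getElem?_cons_zero, Option.some.injEq] at hi; subst hi; exact hI
  | succ i => exact h i S' (by simpa using hi)

theorem HIx.Maps.nil {Δ' : ICtx} {Γ' : Ctx} {θ : ℕ → HIx} : HIx.Maps [] θ Δ' Γ' := by
  intro i S hi; simp at hi

theorem HIx.Maps.sub {Δ Δ' Δ'' : ICtx} {Γ Γ' : Ctx} {θ θ' : ℕ → HIx} {σ : ℕ → Tm}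
    (h : HIx.Maps Δ θ Δ' Γ) (hσ : Tm.Maps Γ σ Γ') (hθ : HIx.Maps Δ' θ' Δ'' Γ') :
    HIx.Maps Δ (fun i => (θ i).sub σ θ') Δ'' Γ' :=
  fun i S hi => (h i S hi).sub hσ hθ

theorem HIx.Maps.ilift {Δ Δ' : ICtx} {Γ' : Ctx} {θ : ℕ → HIx} (h : HIx.Maps Δ θ Δ' Γ') (S : Srt) :
    HIx.Maps (S :: Δ) (Fml.ilift θ) (S :: Δ') Γ' :=
  HIx.Maps.cons (h.sub (Tm.Maps.var _) (HIx.Maps.ish _ _ _)) (HIx.Maps.ivar _ _ 0 S rfl)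

theorem HIx.Maps.tlift {Δ Δ' : ICtx} {Γ' : Ctx} {θ : ℕ → HIx} (h : HIx.Maps Δ θ Δ' Γ') (τ : Ty) :
    HIx.Maps Δ (Fml.tlift θ 1) Δ' (τ :: Γ') :=
  h.sub (Tm.Maps.sh_one _ _) (HIx.Maps.ivar _ _)

theorem HIx.Maps.tlift₂ {Δ Δ' : ICtx} {Γ' : Ctx} {θ : ℕ → HIx} (h : HIx.Maps Δ θ Δ' Γ')
    (τ τ' : Ty) : HIx.Maps Δ (Fml.tlift θ 2) Δ' (τ :: τ' :: Γ') :=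
  h.sub (Tm.Maps.sh_two _ _ _) (HIx.Maps.ivar _ _)

theorem Fml.WF.sub {φ : Fml} : ∀ {Δ Δ' : ICtx} {Γ Γ' : Ctx} {σ : ℕ → Tm} {θ : ℕ → HIx},
    Fml.WF Δ Γ φ → Tm.Maps Γ σ Γ' → HIx.Maps Δ θ Δ' Γ' → Fml.WF Δ' Γ' (φ.sub σ θ) := by
  induction φ with
  | top => intros; trivial
  | bot => intros; trivial
  | and φ ψ ih₁ ih₂ => intro _ _ _ _ _ _ h hσ hθ; exact ⟨ih₁ h.1 hσ hθ, ih₂ h.2 hσ hθ⟩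
  | or φ ψ ih₁ ih₂ => intro _ _ _ _ _ _ h hσ hθ; exact ⟨ih₁ h.1 hσ hθ, ih₂ h.2 hσ hθ⟩
  | imp φ ψ ih₁ ih₂ => intro _ _ _ _ _ _ h hσ hθ; exact ⟨ih₁ h.1 hσ hθ, ih₂ h.2 hσ hθ⟩
  | all τ φ ih => intro _ _ _ _ _ _ h hσ hθ; exact ih h (hσ.up _) (hθ.tlift _)
  | ex τ φ ih => intro _ _ _ _ _ _ h hσ hθ; exact ih h (hσ.up _) (hθ.tlift _)
  | alli S φ ih => intro _ _ _ _ _ _ h hσ hθ; exact ih h hσ (hθ.ilift _)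
  | exi S φ ih => intro _ _ _ _ _ _ h hσ hθ; exact ih h hσ (hθ.ilift _)
  | eq τ t u => intro _ _ _ _ _ _ h hσ hθ; exact ⟨h.1.subst hσ, h.2.subst hσ⟩
  | cst C => intro _ _ _ _ _ _ h hσ hθ; exact Cst.AllLeaves.bind (hθ.leaf hσ) h
  | listU τ n l P ih =>
    intro _ _ _ _ _ _ h hσ hθ
    exact ⟨h.1.sub hσ hθ, h.2.1.subst hσ, ih h.2.2 (hσ.up _) (hθ.tlift _)⟩
  | listR τ n l₁ l₂ a P ih =>
    intro _ _ _ _ _ _ h hσ hθ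
    exact ⟨h.1.sub hσ hθ, h.2.1.subst hσ, h.2.2.1.subst hσ, h.2.2.2.1.sub hσ hθ,
      ih h.2.2.2.2 ((hσ.up _).up _) (hθ.tlift₂ _ _)⟩

theorem Fml.WF.shift {Δ : ICtx} {Γ : Ctx} {φ : Fml} (h : φ.WF Δ Γ) (τ : Ty) :
    (φ.shift 1).WF Δ (τ :: Γ) :=
  h.sub (Tm.Maps.sh_one _ _) (HIx.Maps.ivar _ _)

theorem Fml.WF.ishift {Δ : ICtx} {Γ : Ctx} {φ : Fml} (h : φ.WF Δ Γ) (S : Srt) :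
    (φ.ishift 1).WF (S :: Δ) Γ :=
  h.sub (Tm.Maps.var _) (HIx.Maps.ish _ _ _)

theorem Fml.WF.inst {Δ : ICtx} {Γ : Ctx} {φ : Fml} {τ : Ty} {t : Tm} (h : φ.WF Δ (τ :: Γ))
    (ht : HasTy Γ t τ) : (φ.inst t).WF Δ Γ :=
  h.sub ((Tm.Maps.var _).cons ht) (HIx.Maps.ivar _ _)

theorem Fml.WF.iinst {Δ : ICtx} {Γ : Ctx} {φ : Fml} {S : Srt} {I : HIx} (h : φ.WF (S :: Δ) Γ)
    (hI : HIx.HasSort Δ Γ I S) : (φ.iinst I).WF Δ Γ :=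
  h.sub (Tm.Maps.var _) ((HIx.Maps.ivar _ _).cons hI)

theorem CWF.shift {Δ : ICtx} {Γ : Ctx} {Ψ : List Fml} (h : CWF Δ Γ Ψ) (τ : Ty) :
    CWF Δ (τ :: Γ) (Ψ.map (Fml.shift 1)) := by
  intro ψ hψ
  obtain ⟨φ, hφ, rfl⟩ := List.mem_map.1 hψ
  exact (h φ hφ).shift τ

theorem CWF.ishift {Δ : ICtx} {Γ : Ctx} {Ψ : List Fml} (h : CWF Δ Γ Ψ) (S : Srt) :
    CWF (S :: Δ) Γ (Ψ.map (Fml.ishift 1)) := by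
  intro ψ hψ
  obtain ⟨φ, hφ, rfl⟩ := List.mem_map.1 hψ
  exact (h φ hφ).ishift S

theorem CWF.cons {Δ : ICtx} {Γ : Ctx} {Ψ : List Fml} {φ : Fml} (hφ : φ.WF Δ Γ) (h : CWF Δ Γ Ψ) :
    CWF Δ Γ (φ :: Ψ) := by
  intro ψ hψ
  rcases List.mem_cons.1 hψ with rfl | hψ
  exacts [hφ, h _ hψ]

/-! ## Conversion under substitution -/

theorem Tm.IsCon.subst {t : Tm} (h : t.IsCon) (σ : ℕ → Tm) : (t.subst σ).IsCon := by
  cases h <;> constructor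

theorem Tm.Conv.subst {t u : Tm} (h : Tm.Conv t u) :
    ∀ σ : ℕ → Tm, Tm.Conv (t.subst σ) (u.subst σ) := by
  induction h with
  | refl => intro σ; exact .refl _
  | symm _ ih => intro σ; exact (ih σ).symm
  | trans _ _ ih₁ ih₂ => intro σ; exact (ih₁ σ).trans (ih₂ σ)
  | beta t u =>
    intro σ
    have : (t.inst u).subst σ = (t.subst (Tm.up σ)).inst (u.subst σ) := by
      simp only [Tm.inst, Tm.subst_subst]
      refine Tm.subst_congr _ (fun n => ?_)
      cases n <;> simp [Tm.up_eq, Tm.subst]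
    rw [this]; exact .beta _ _
  | mu e c hc =>
    intro σ
    have : (e.subst (c ;; .letrec e ;; Tm.var)).subst σ =
        (e.subst (Tm.up (Tm.up σ))).subst (c.subst σ ;; (Tm.letrec e).subst σ ;; Tm.var) := by
      simp only [Tm.subst_subst]
      refine Tm.subst_congr _ (fun n => ?_)
      rcases n with _ | _ | n <;> simp [Tm.up_eq, Tm.subst]
    rw [this]; exact .mu _ _ (hc.subst σ)
  | fst_pair => intro σ; exact .fst_pair _ _
  | snd_pair => intro σ; exact .snd_pair _ _
  | natCase_zero => intro σ; exact .natCase_zero _ _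
  | natCase_succ => intro σ; exact .natCase_succ _ _ _
  | boolCase_tt => intro σ; exact .boolCase_tt _ _
  | boolCase_ff => intro σ; exact .boolCase_ff _ _
  | listCase_nil => intro σ; exact .listCase_nil _ _
  | listCase_cons => intro σ; exact .listCase_cons _ _ _ _
  | pair _ _ ih₁ ih₂ => intro σ; exact .pair (ih₁ σ) (ih₂ σ)
  | fst _ ih => intro σ; exact .fst (ih σ)
  | snd _ ih => intro σ; exact .snd (ih σ)
  | app _ _ ih₁ ih₂ => intro σ; exact .app (ih₁ σ) (ih₂ σ)
  | lam _ ih => intro σ; exact .lam (ih _)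
  | succ _ ih => intro σ; exact .succ (ih σ)
  | cons _ _ ih₁ ih₂ => intro σ; exact .cons (ih₁ σ) (ih₂ σ)
  | natCase _ _ _ ih₁ ih₂ ih₃ => intro σ; exact .natCase (ih₁ σ) (ih₂ σ) (ih₃ σ)
  | boolCase _ _ _ ih₁ ih₂ ih₃ => intro σ; exact .boolCase (ih₁ σ) (ih₂ σ) (ih₃ σ)
  | listCase _ _ _ ih₁ ih₂ ih₃ => intro σ; exact .listCase (ih₁ σ) (ih₂ σ) (ih₃ σ)
  | letrec _ ih => intro σ; exact .letrec (ih _)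

/-! ## Substitution and weakening in HOL -/

namespace Fml

theorem inst_sub (φ : Fml) (t : Tm) (σ : ℕ → Tm) (θ : ℕ → HIx) :
    (φ.inst t).sub σ θ = (φ.sub (Tm.up σ) (tlift θ 1)).inst (t.subst σ) := by
  simp only [inst, tsub, sub_sub]
  refine sub_congr _ (fun n => ?_) (fun i => ?_)
  · cases n <;> simp [Tm.up_eq, Tm.subst]
  · simp [tlift, Tm.subst]

theorem iinst_sub (φ : Fml) (I : HIx) (σ : ℕ → Tm) (θ : ℕ → HIx) :
    (φ.iinst I).sub σ θ = (φ.sub σ (ilift θ)).iinst (I.sub σ θ) := by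
  simp only [iinst, isub, sub_sub]
  refine sub_congr _ (fun n => ?_) (fun i => ?_)
  · simp [Tm.subst]
  · cases i <;> simp [ilift]

theorem shift_sub (φ : Fml) (σ : ℕ → Tm) (θ : ℕ → HIx) :
    (φ.shift 1).sub (Tm.up σ) (tlift θ 1) = (φ.sub σ θ).shift 1 := by
  simp only [shift, tsub, sub_sub]
  refine sub_congr _ (fun n => ?_) (fun i => ?_)
  · simp [Tm.subst, Tm.up_eq]
  · simp [tlift]

theorem ishift_sub (φ : Fml) (σ : ℕ → Tm) (θ : ℕ → HIx) :
    (φ.ishift 1).sub σ (ilift θ) = (φ.sub σ θ).ishift 1 := by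
  simp only [ishift, isub, sub_sub]
  refine sub_congr _ (fun n => ?_) (fun i => ?_)
  · simp [Tm.subst]
  · simp [ilift]

theorem shift_shift (φ : Fml) : (φ.shift 1).shift 1 = φ.shift 2 := by
  simp only [shift, tsub, sub_sub]
  exact sub_congr _ (fun n => by simp [Tm.subst]) (fun i => rfl)

theorem iff_sub (φ ψ : Fml) (σ : ℕ → Tm) (θ : ℕ → HIx) :
    (iff φ ψ).sub σ θ = iff (φ.sub σ θ) (ψ.sub σ θ) := rfl

end Fml

theorem listUSucc_sub (τ : Ty) (n : HIx) (l : Tm) (P : Fml) (σ : ℕ → Tm) (θ : ℕ → HIx) :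
    (listUSucc τ n l P).sub σ θ =
      listUSucc τ (n.sub σ θ) (l.subst σ) (P.sub (Tm.up σ) (Fml.tlift θ 1)) := by
  simp only [listUSucc, Fml.tsub, Fml.ex_sub, Fml.and_sub, Fml.eq_sub, Fml.listU_sub,
    HIx.shift_eq, Tm.shift_eq, Tm.subst]
  refine congrArg _ (congrArg _ (congrArg₂ _ (congrArg₂ _ ?_ rfl) (congrArg₂ _ ?_ ?_)))
  · simp only [Tm.subst_subst]
    exact Tm.subst_congr _ (fun n => by simp [Tm.up_eq, Tm.subst] <;> rfl)
  · simp only [Fml.sub_sub]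
    refine (Fml.sub_congr _ (fun n => ?_) (fun i => ?_))
    · cases n <;> simp [Tm.up_eq, Tm.subst]
    · simp [Fml.tlift, Tm.subst]
  · congr 1
    · simp only [HIx.sub_sub]
      congr 1 <;> funext k <;> simp [Tm.up_eq, Tm.subst, Fml.tlift] <;> rfl
    · simp only [Fml.sub_sub]
      refine (Fml.sub_congr _ (fun n => ?_) (fun i => ?_))
      · cases n <;> simp [Tm.up_eq, Tm.subst]
      · simp [Fml.tlift, Tm.subst]

theorem listRSucc_sub (τ : Ty) (n : HIx) (l₁ l₂ : Tm) (a : HIx) (P : Fml) (σ : ℕ → Tm)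
    (θ : ℕ → HIx) :
    (listRSucc τ n l₁ l₂ a P).sub σ θ =
      listRSucc τ (n.sub σ θ) (l₁.subst σ) (l₂.subst σ) (a.sub σ θ)
        (P.sub (Tm.up (Tm.up σ)) (Fml.tlift θ 2)) := by
  have e1 : ∀ t : Tm, (t.subst (Tm.sh 4)).subst (Tm.up (Tm.up (Tm.up (Tm.up σ)))) =
      (t.subst σ).subst (Tm.sh 4) := by
    intro t
    simp only [Tm.subst_subst]
    exact Tm.subst_congr _ (fun n => by simp [Tm.up_eq, Tm.subst] <;> rfl)
  have e2 : ∀ I : HIx, (I.shift 4 0).sub (Tm.up (Tm.up (Tm.up (Tm.up σ))))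
      (Fml.tlift (Fml.tlift (Fml.tlift (Fml.tlift θ 1) 1) 1) 1) = (I.sub σ θ).shift 4 0 := by
    intro I
    simp only [HIx.shift_eq, HIx.sub_sub]
    congr 1 <;> funext k <;> simp [Tm.up_eq, Tm.subst, Fml.tlift] <;> rfl
  have e3 : ∀ I : HIx, (I.shift 4 1).sub (Tm.up (Tm.up (Tm.up (Tm.up σ))))
      (Fml.ilift (Fml.tlift (Fml.tlift (Fml.tlift (Fml.tlift θ 1) 1) 1) 1)) =
        (I.sub σ θ).shift 4 1 := by
    intro I
    simp only [HIx.shift_eq, HIx.sub_sub]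
    congr 1 <;> funext k <;> simp [Tm.up_eq, Tm.subst, Fml.tlift, Fml.ilift] <;> rfl
  simp only [listRSucc, Fml.tsub, Fml.ex_sub, Fml.exi_sub, Fml.and_sub, Fml.or_sub, Fml.cst_sub,
    HCst.lt_sub, HCst.eq_sub, HIx.num_sub, HIx.add_sub, Fml.eq_sub, Fml.listR_sub,
    e1, e2, e3, Tm.shift_eq, Tm.subst]
  refine congrArg _ (congrArg _ (congrArg _ (congrArg _ (congrArg₂ _ rfl (congrArg₂ _ rfl
    (congrArg₂ _ ?_ (congrArg₂ _ (congrArg₂ _ rfl ?_)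
      (congrArg₂ _ rfl (congrArg _ (congrArg₂ _ rfl ?_))))))))))
  · simp only [Fml.sub_sub]
    refine (Fml.sub_congr _ (fun n => ?_) (fun i => ?_))
    · rcases n with _ | _ | n <;> simp [Tm.up_eq, Tm.subst]
    · simp [Fml.tlift, Tm.subst]
  · refine congrArg₂ _ rfl ?_
    simp only [Fml.sub_sub]
    refine (Fml.sub_congr _ (fun n => ?_) (fun i => ?_))
    · rcases n with _ | _ | n <;> simp [Tm.up_eq, Tm.subst]
    · simp [Fml.tlift, Tm.subst]
  · refine congrArg₂ _ rfl ?_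
    simp only [Fml.sub_sub]
    refine (Fml.sub_congr _ (fun n => ?_) (fun i => ?_))
    · rcases n with _ | _ | n <;> simp [Tm.up_eq, Tm.subst]
    · simp [Fml.tlift, Tm.subst, Fml.ilift]

/-- The assertions `Ψ` are mapped into `Ψ'` by a substitution. -/
def HypMap (Ψ : List Fml) (σ : ℕ → Tm) (θ : ℕ → HIx) (Ψ' : List Fml) : Prop :=
  ∀ ψ ∈ Ψ, ψ.sub σ θ ∈ Ψ'

namespace HypMap

theorem cons {Ψ Ψ' : List Fml} {σ : ℕ → Tm} {θ : ℕ → HIx} (h : HypMap Ψ σ θ Ψ') (φ : Fml) :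
    HypMap (φ :: Ψ) σ θ (φ.sub σ θ :: Ψ') := by
  intro ψ hψ
  rcases List.mem_cons.1 hψ with rfl | hψ
  · exact List.mem_cons_self
  · exact List.mem_cons_of_mem _ (h _ hψ)

theorem tlift {Ψ Ψ' : List Fml} {σ : ℕ → Tm} {θ : ℕ → HIx} (h : HypMap Ψ σ θ Ψ') :
    HypMap (Ψ.map (Fml.shift 1)) (Tm.up σ) (Fml.tlift θ 1) (Ψ'.map (Fml.shift 1)) := by
  intro ψ hψ
  obtain ⟨φ, hφ, rfl⟩ := List.mem_map.1 hψ
  exact List.mem_map.2 ⟨_, h φ hφ, (φ.shift_sub σ θ).symm⟩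

theorem ilift {Ψ Ψ' : List Fml} {σ : ℕ → Tm} {θ : ℕ → HIx} (h : HypMap Ψ σ θ Ψ') :
    HypMap (Ψ.map (Fml.ishift 1)) σ (Fml.ilift θ) (Ψ'.map (Fml.ishift 1)) := by
  intro ψ hψ
  obtain ⟨φ, hφ, rfl⟩ := List.mem_map.1 hψ
  exact List.mem_map.2 ⟨_, h φ hφ, (φ.ishift_sub σ θ).symm⟩

theorem tlift₂ {Ψ Ψ' : List Fml} {σ : ℕ → Tm} {θ : ℕ → HIx} (h : HypMap Ψ σ θ Ψ') :
    HypMap (Ψ.map (Fml.shift 2)) (Tm.up (Tm.up σ)) (Fml.tlift (Fml.tlift θ 1) 1)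
      (Ψ'.map (Fml.shift 2)) := by
  have e : ∀ Ψ : List Fml, Ψ.map (Fml.shift 2) = (Ψ.map (Fml.shift 1)).map (Fml.shift 1) := by
    intro Ψ; simp [Fml.shift_shift]
  rw [e, e]
  exact h.tlift.tlift

end HypMap

theorem CWF.shift_two {Δ : ICtx} {Γ : Ctx} {Ψ : List Fml} (h : CWF Δ Γ Ψ) (τ τ' : Ty) :
    CWF Δ (τ :: τ' :: Γ) (Ψ.map (Fml.shift 2)) := by
  have := (h.shift τ').shift τ
  simpa [Fml.shift_shift, Function.comp_def] using this

theorem CWF.head {Δ : ICtx} {Γ : Ctx} {Ψ : List Fml} {φ : Fml} (h : CWF Δ Γ (φ :: Ψ)) : φ.WF Δ Γ :=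
  h _ List.mem_cons_self

theorem CWF.tail {Δ : ICtx} {Γ : Ctx} {Ψ : List Fml} {φ : Fml} (h : CWF Δ Γ (φ :: Ψ)) :
    CWF Δ Γ Ψ := fun ψ hψ => h ψ (List.mem_cons_of_mem _ hψ)

theorem listUSucc_wf {Δ : ICtx} {Γ : Ctx} {τ : Ty} {n : HIx} {l : Tm} {P : Fml}
    (hn : n.HasSort Δ Γ .nat) (hl : HasTy Γ l (.list τ)) (hP : P.WF Δ (τ :: Γ)) :
    (listUSucc τ n l P).WF Δ Γ := by
  refine ⟨⟨?_, .cons (.var rfl) (.var rfl)⟩, ?_, ?_, .var rfl, ?_⟩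
  · rw [Tm.shift_eq]; exact hl.subst (Tm.Maps.sh_two _ _ _)
  · exact hP.sub ((Tm.Maps.sh_two _ _ _).cons (.var rfl)) (HIx.Maps.ivar _ _)
  · exact hn.sub (Tm.Maps.sh_two _ _ _) (HIx.Maps.ivar _ _)
  · exact hP.sub ((Tm.Maps.sh_three _ _ _ _).cons (.var rfl)) (HIx.Maps.ivar _ _)

theorem listRSucc_wf {Δ : ICtx} {Γ : Ctx} {τ : Ty} {n : HIx} {l₁ l₂ : Tm} {a : HIx} {P : Fml}
    (hn : n.HasSort Δ Γ .nat) (hl₁ : HasTy Γ l₁ (.list τ)) (hl₂ : HasTy Γ l₂ (.list τ))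
    (ha : a.HasSort Δ Γ .nat) (hP : P.WF Δ (τ :: τ :: Γ)) :
    (listRSucc τ n l₁ l₂ a P).WF Δ Γ := by
  refine ⟨⟨?_, .cons (.var rfl) (.var rfl)⟩, ⟨?_, .cons (.var rfl) (.var rfl)⟩, ?_,
    ⟨⟨.var rfl, .var rfl⟩, ?_, .var rfl, .var rfl, ?_, ?_⟩, ⟨trivial, ?_⟩,
    ⟨?_, by exact Nat.succ_pos _, trivial⟩, ?_, .var rfl, .var rfl, ?_, ?_⟩
  · rw [Tm.shift_eq]; exact hl₁.subst (Tm.Maps.sh_four _ _ _ _ _)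
  · rw [Tm.shift_eq]; exact hl₂.subst (Tm.Maps.sh_four _ _ _ _ _)
  · exact hP.sub (((Tm.Maps.sh_four _ _ _ _ _).cons (.var rfl)).cons (.var rfl))
      (HIx.Maps.ivar _ _)
  · exact hn.sub (Tm.Maps.sh_four _ _ _ _ _) (HIx.Maps.ivar _ _)
  · exact ha.sub (Tm.Maps.sh_four _ _ _ _ _) (HIx.Maps.ivar _ _)
  · exact hP.sub (((Tm.Maps.sh_six _ _ _ _ _ _ _).cons (.var rfl)).cons (.var rfl))
      (HIx.Maps.ivar _ _)
  · exact ha.real.sub (Tm.Maps.sh_four _ _ _ _ _) (HIx.Maps.ivar _ _)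
  · exact ha.real.sub (Tm.Maps.sh_four _ _ _ _ _) (HIx.Maps.ish _ _ _)
  · exact hn.sub (Tm.Maps.sh_four _ _ _ _ _) (HIx.Maps.ish _ _ _)
  · exact HIx.Maps.ivar _ _ 0 .nat rfl
  · exact hP.sub (((Tm.Maps.sh_six _ _ _ _ _ _ _).cons (.var rfl)).cons (.var rfl))
      (HIx.Maps.ish _ _ _)

/-- Derivable sequents are well formed. -/
theorem HOL.wf {Δ : ICtx} {Γ : Ctx} {Ψ : List Fml} {φ : Fml} (h : HOL Δ Γ Ψ φ) :
    CWF Δ Γ Ψ ∧ φ.WF Δ Γ := by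
  induction h with
  | ax h hφ => exact ⟨h, h _ hφ⟩
  | conv h h1 h2 _ => exact ⟨h, h1, h2⟩
  | subst hφ _ _ ih₁ ih₂ => exact ⟨ih₁.1, hφ.inst ih₂.2.2⟩
  | impI _ ih => exact ⟨ih.1.tail, ih.1.head, ih.2⟩
  | impE _ _ ih₁ ih₂ => exact ⟨ih₁.1, ih₁.2.2⟩
  | allI h _ ih => exact ⟨h, ih.2⟩
  | allE _ ht ih => exact ⟨ih.1, Fml.WF.inst ih.2 ht⟩
  | exI hφ _ _ ih => exact ⟨ih.1, hφ⟩
  | exE _ hχ _ ih _ => exact ⟨ih.1, hχ⟩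
  | topI h => exact ⟨h, trivial⟩
  | botE _ hφ ih => exact ⟨ih.1, hφ⟩
  | andI _ _ ih₁ ih₂ => exact ⟨ih₁.1, ih₁.2, ih₂.2⟩
  | andE₁ _ ih => exact ⟨ih.1, ih.2.1⟩
  | andE₂ _ ih => exact ⟨ih.1, ih.2.2⟩
  | orI₁ _ h ih => exact ⟨ih.1, ih.2, h⟩
  | orI₂ h _ ih => exact ⟨ih.1, h, ih.2⟩
  | orE _ _ _ ih₁ ih₂ _ => exact ⟨ih₁.1, ih₂.2⟩
  | alliI h _ ih => exact ⟨h, ih.2⟩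
  | alliE _ hI ih => exact ⟨ih.1, Fml.WF.iinst ih.2 hI⟩
  | exiI hφ _ _ ih => exact ⟨ih.1, hφ⟩
  | exiE _ hχ _ ih _ => exact ⟨ih.1, hχ⟩
  | list hφ _ _ ih _ => exact ⟨ih.1, hφ⟩
  | nat hφ _ _ ih _ => exact ⟨ih.1, hφ⟩
  | bool hφ _ _ ih _ => exact ⟨ih.1, hφ⟩
  | nilCons h ht => exact ⟨h, ⟨.nil, ht⟩, trivial⟩
  | cons₁ _ ih =>
    obtain ⟨h, h1, h2⟩ := ih
    cases h1; cases h2; exact ⟨h, by assumption, by assumption⟩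
  | cons₂ _ ih =>
    obtain ⟨h, h1, h2⟩ := ih
    cases h1; cases h2; exact ⟨h, by assumption, by assumption⟩
  | zeroSucc h ht => exact ⟨h, ⟨.zero, .succ ht⟩, trivial⟩
  | succInj _ ih =>
    obtain ⟨h, h1, h2⟩ := ih
    cases h1; cases h2; exact ⟨h, by assumption, by assumption⟩
  | ttff h => exact ⟨h, ⟨.tt, .ff⟩, trivial⟩
  | isubst hφ _ hJ _ _ ih _ => exact ⟨ih.1, hφ.iinst hJ⟩
  | inat hφ _ _ ih _ => exact ⟨ih.1, hφ⟩
  | arith Δ' Cs C θ h _ hC _ hθ _ _ =>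
    refine ⟨h, Cst.AllLeaves.bind ?_ hC⟩
    intro i hi
    exact (hθ i _ (List.getElem?_eq_getElem hi)).real
  | cstNot _ _ ih _ => exact ⟨ih.1, trivial⟩
  | tmZero h => exact ⟨h, HasTy.zero, trivial⟩
  | tmSucc h ht => exact ⟨h, HasTy.succ ht, ht, trivial⟩
  | tmEq _ ih => exact ih
  | listU_zero h hl hP => exact ⟨h, ⟨⟨trivial, hl, hP⟩, hl, .nil⟩, ⟨hl, .nil⟩, trivial, hl, hP⟩
  | listU_succ h hn hl hP =>
    exact ⟨h, ⟨⟨⟨hn, trivial⟩, hl, hP⟩, listUSucc_wf hn hl hP⟩, listUSucc_wf hn hl hP,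
      ⟨hn, trivial⟩, hl, hP⟩
  | listR_zero h hl₁ hl₂ ha hP =>
    exact ⟨h, ⟨⟨trivial, hl₁, hl₂, ha, hP⟩, ⟨hl₁, .nil⟩, hl₂, .nil⟩, ⟨⟨hl₁, .nil⟩, hl₂, .nil⟩,
      trivial, hl₁, hl₂, ha, hP⟩
  | listR_succ h hn hl₁ hl₂ ha hP =>
    exact ⟨h, ⟨⟨⟨hn, trivial⟩, hl₁, hl₂, ha, hP⟩, listRSucc_wf hn hl₁ hl₂ ha hP⟩,
      listRSucc_wf hn hl₁ hl₂ ha hP, ⟨hn, trivial⟩, hl₁, hl₂, ha, hP⟩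

/-- Derivability in HOL is stable under well-typed substitutions. -/
theorem HOL.sub {Δ : ICtx} {Γ : Ctx} {Ψ : List Fml} {φ : Fml} (h : HOL Δ Γ Ψ φ) :
    ∀ {Δ' : ICtx} {Γ' : Ctx} {Ψ' : List Fml} {σ : ℕ → Tm} {θ : ℕ → HIx}, Tm.Maps Γ σ Γ' →
      HIx.Maps Δ θ Δ' Γ' → CWF Δ' Γ' Ψ' → HypMap Ψ σ θ Ψ' → HOL Δ' Γ' Ψ' (φ.sub σ θ) := by
  induction h with
  | ax _ hφ => intro _ _ _ _ _ hσ hθ hΨ H; exact .ax hΨ (H _ hφ)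
  | conv _ h1 h2 h3 =>
    intro _ _ _ _ _ hσ hθ hΨ H; exact .conv hΨ (h1.subst hσ) (h2.subst hσ) (h3.subst _)
  | subst hφ _ _ ih₁ ih₂ =>
    intro _ _ _ _ _ hσ hθ hΨ H
    have h1 := ih₁ hσ hθ hΨ H
    rw [Fml.inst_sub] at h1 ⊢
    exact .subst (hφ.sub (hσ.up _) (hθ.tlift _)) h1 (ih₂ hσ hθ hΨ H)
  | impI h ih =>
    intro _ _ _ _ _ hσ hθ hΨ H
    exact .impI (ih hσ hθ (CWF.cons (h.wf.1.head.sub hσ hθ) hΨ) (H.cons _))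
  | impE _ _ ih₁ ih₂ => intro _ _ _ _ _ hσ hθ hΨ H; exact .impE (ih₁ hσ hθ hΨ H) (ih₂ hσ hθ hΨ H)
  | allI hC _ ih =>
    intro _ _ _ _ _ hσ hθ hΨ H
    exact .allI hΨ (ih (hσ.up _) (hθ.tlift _) (hΨ.shift _) H.tlift)
  | allE _ ht ih =>
    intro _ _ _ _ _ hσ hθ hΨ H
    rw [Fml.inst_sub]
    exact .allE (ih hσ hθ hΨ H) (ht.subst hσ)
  | exI hφ ht _ ih =>
    intro _ _ _ _ _ hσ hθ hΨ H
    have h1 := ih hσ hθ hΨ H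
    rw [Fml.inst_sub] at h1
    exact .exI (hφ.sub (hσ.up _) (hθ.tlift _)) (ht.subst hσ) h1
  | exE h1 hχ h2 ih₁ ih₂ =>
    intro _ _ _ _ _ hσ hθ hΨ H
    refine .exE (ih₁ hσ hθ hΨ H) (hχ.sub hσ hθ) ?_
    rw [← Fml.shift_sub]
    exact ih₂ (hσ.up _) (hθ.tlift _)
      (CWF.cons (h2.wf.1.head.sub (hσ.up _) (hθ.tlift _)) (hΨ.shift _)) (H.tlift.cons _)
  | topI => intro _ _ _ _ _ hσ hθ hΨ H; exact .topI hΨ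
  | botE _ hφ ih => intro _ _ _ _ _ hσ hθ hΨ H; exact .botE (ih hσ hθ hΨ H) (hφ.sub hσ hθ)
  | andI _ _ ih₁ ih₂ =>
    intro _ _ _ _ _ hσ hθ hΨ H; exact .andI (ih₁ hσ hθ hΨ H) (ih₂ hσ hθ hΨ H)
  | andE₁ _ ih => intro _ _ _ _ _ hσ hθ hΨ H; exact .andE₁ (ih hσ hθ hΨ H)
  | andE₂ _ ih => intro _ _ _ _ _ hσ hθ hΨ H; exact .andE₂ (ih hσ hθ hΨ H)
  | orI₁ _ h ih => intro _ _ _ _ _ hσ hθ hΨ H; exact .orI₁ (ih hσ hθ hΨ H) (h.sub hσ hθ)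
  | orI₂ h _ ih => intro _ _ _ _ _ hσ hθ hΨ H; exact .orI₂ (h.sub hσ hθ) (ih hσ hθ hΨ H)
  | orE _ h₂ h₃ ih₁ ih₂ ih₃ =>
    intro _ _ _ _ _ hσ hθ hΨ H
    exact .orE (ih₁ hσ hθ hΨ H) (ih₂ hσ hθ (CWF.cons (h₂.wf.1.head.sub hσ hθ) hΨ) (H.cons _))
      (ih₃ hσ hθ (CWF.cons (h₃.wf.1.head.sub hσ hθ) hΨ) (H.cons _))
  | alliI _ _ ih =>
    intro _ _ _ _ _ hσ hθ hΨ H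
    exact .alliI hΨ (ih hσ (hθ.ilift _) (hΨ.ishift _) H.ilift)
  | alliE _ hI ih =>
    intro _ _ _ _ _ hσ hθ hΨ H
    rw [Fml.iinst_sub]
    exact .alliE (ih hσ hθ hΨ H) (hI.sub hσ hθ)
  | exiI hφ hI _ ih =>
    intro _ _ _ _ _ hσ hθ hΨ H
    have h1 := ih hσ hθ hΨ H
    rw [Fml.iinst_sub] at h1
    exact .exiI (hφ.sub hσ (hθ.ilift _)) (hI.sub hσ hθ) h1
  | exiE _ hχ h2 ih₁ ih₂ =>
    intro _ _ _ _ _ hσ hθ hΨ H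
    refine .exiE (ih₁ hσ hθ hΨ H) (hχ.sub hσ hθ) ?_
    rw [← Fml.ishift_sub]
    exact ih₂ hσ (hθ.ilift _) (CWF.cons (h2.wf.1.head.sub hσ (hθ.ilift _)) (hΨ.ishift _))
      (H.ilift.cons _)
  | @list Δ Γ Ψ φ τ hφ _ h2 ih₁ ih₂ =>
    intro Δ' Γ' Ψ' σ θ hσ hθ hΨ H
    have h1 := ih₁ hσ hθ hΨ H
    rw [Fml.inst_sub] at h1
    refine .list (hφ.sub (hσ.up _) (hθ.tlift _)) h1 ?_
    have hw := h2.wf.1.head.sub ((hσ.up τ).up (.list τ)) ((hθ.tlift τ).tlift (.list τ))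
    have h3 := ih₂ ((hσ.up τ).up (.list τ)) ((hθ.tlift τ).tlift (.list τ))
      (CWF.cons hw (hΨ.shift_two _ _)) (H.tlift₂.cons _)
    have e1 : (φ.tsub (.var 0 ;; Tm.sh 2)).sub (Tm.up (Tm.up σ)) (Fml.tlift (Fml.tlift θ 1) 1) =
        (φ.sub (Tm.up σ) (Fml.tlift θ 1)).tsub (.var 0 ;; Tm.sh 2) := by
      simp only [Fml.tsub, Fml.sub_sub]
      refine (Fml.sub_congr _ (fun n => ?_) (fun i => ?_))
      · cases n <;> simp [Tm.up_eq, Tm.subst]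
      · simp [Fml.tlift, Tm.subst]
    have e2 : (φ.tsub (.cons (.var 1) (.var 0) ;; Tm.sh 2)).sub (Tm.up (Tm.up σ))
        (Fml.tlift (Fml.tlift θ 1) 1) =
        (φ.sub (Tm.up σ) (Fml.tlift θ 1)).tsub (.cons (.var 1) (.var 0) ;; Tm.sh 2) := by
      simp only [Fml.tsub, Fml.sub_sub]
      refine (Fml.sub_congr _ (fun n => ?_) (fun i => ?_))
      · cases n <;> simp [Tm.up_eq, Tm.subst]
      · simp [Fml.tlift, Tm.subst]
    rwa [e1, e2] at h3
  | @nat Δ Γ Ψ φ hφ _ h2 ih₁ ih₂ =>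
    intro Δ' Γ' Ψ' σ θ hσ hθ hΨ H
    have h1 := ih₁ hσ hθ hΨ H
    rw [Fml.inst_sub] at h1
    refine .nat (hφ.sub (hσ.up _) (hθ.tlift _)) h1 ?_
    have hw := h2.wf.1.head.sub (hσ.up .nat) (hθ.tlift .nat)
    have h3 := ih₂ (hσ.up .nat) (hθ.tlift .nat) (CWF.cons hw (hΨ.shift _)) (H.tlift.cons _)
    have e2 : (φ.tsub (.succ (.var 0) ;; Tm.sh 1)).sub (Tm.up σ) (Fml.tlift θ 1) =
        (φ.sub (Tm.up σ) (Fml.tlift θ 1)).tsub (.succ (.var 0) ;; Tm.sh 1) := by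
      simp only [Fml.tsub, Fml.sub_sub]
      refine (Fml.sub_congr _ (fun n => ?_) (fun i => ?_))
      · cases n <;> simp [Tm.up_eq, Tm.subst] <;> rfl
      · simp [Fml.tlift, Tm.subst] <;> rfl
    rwa [e2] at h3
  | bool hφ _ _ ih₁ ih₂ =>
    intro _ _ _ _ _ hσ hθ hΨ H
    have h1 := ih₁ hσ hθ hΨ H
    have h2 := ih₂ hσ hθ hΨ H
    rw [Fml.inst_sub] at h1 h2
    exact .bool (hφ.sub (hσ.up _) (hθ.tlift _)) h1 h2
  | nilCons _ ht => intro _ _ _ _ _ hσ hθ hΨ H; exact .nilCons hΨ (ht.subst hσ)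
  | cons₁ _ ih => intro _ _ _ _ _ hσ hθ hΨ H; exact .cons₁ (ih hσ hθ hΨ H)
  | cons₂ _ ih => intro _ _ _ _ _ hσ hθ hΨ H; exact .cons₂ (ih hσ hθ hΨ H)
  | zeroSucc _ ht => intro _ _ _ _ _ hσ hθ hΨ H; exact .zeroSucc hΨ (ht.subst hσ)
  | succInj _ ih => intro _ _ _ _ _ hσ hθ hΨ H; exact .succInj (ih hσ hθ hΨ H)
  | ttff => intro _ _ _ _ _ hσ hθ hΨ H; exact .ttff hΨ
  | isubst hφ hI hJ _ _ ih₁ ih₂ =>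
    intro _ _ _ _ _ hσ hθ hΨ H
    have h1 := ih₁ hσ hθ hΨ H
    rw [Fml.iinst_sub] at h1 ⊢
    exact .isubst (hφ.sub hσ (hθ.ilift _)) (hI.sub hσ hθ) (hJ.sub hσ hθ) h1 (ih₂ hσ hθ hΨ H)
  | @inat Δ Γ Ψ φ hφ _ h2 ih₁ ih₂ =>
    intro Δ' Γ' Ψ' σ θ hσ hθ hΨ H
    have h1 := ih₁ hσ hθ hΨ H
    rw [Fml.iinst_sub] at h1
    refine .inat (hφ.sub hσ (hθ.ilift _)) h1 ?_
    have hw := h2.wf.1.head.sub hσ (hθ.ilift .nat)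
    have h3 := ih₂ hσ (hθ.ilift .nat) (CWF.cons hw (hΨ.ishift _)) (H.ilift.cons _)
    have e2 : (φ.isub (.add (HIx.ivar 0) (.num 1) ;; HIx.ish 1)).sub σ (Fml.ilift θ) =
        (φ.sub σ (Fml.ilift θ)).isub (.add (HIx.ivar 0) (.num 1) ;; HIx.ish 1) := by
      simp only [Fml.isub, Fml.sub_sub]
      refine (Fml.sub_congr _ (fun n => ?_) (fun i => ?_))
      · simp [Tm.subst]
      · cases i <;> simp [Fml.ilift, Tm.subst] <;> rfl
    rwa [e2] at h3
  | arith Δ₀ Cs C θ₀ _ hCs hC hE hθ₀ _ ih =>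
    intro Δ' Γ' Ψ' σ θ hσ hθ hΨ H
    have h1 := HOL.arith (Ψ := Ψ') Δ₀ Cs C (fun i => (θ₀ i).sub σ θ) hΨ hCs hC hE
      (fun i S hi => (hθ₀ i S hi).sub hσ hθ) (fun D hD => by
        have := ih D hD hσ hθ hΨ H
        rwa [Fml.cst_sub, HCst.bind_sub] at this)
    rwa [Fml.cst_sub, HCst.bind_sub]
  | cstNot _ _ ih₁ ih₂ =>
    intro _ _ _ _ _ hσ hθ hΨ H; exact .cstNot (ih₁ hσ hθ hΨ H) (ih₂ hσ hθ hΨ H)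
  | tmZero => intro _ _ _ _ _ hσ hθ hΨ H; exact .tmZero hΨ
  | tmSucc _ ht => intro _ _ _ _ _ hσ hθ hΨ H; exact .tmSucc hΨ (ht.subst hσ)
  | tmEq _ ih => intro _ _ _ _ _ hσ hθ hΨ H; exact .tmEq (ih hσ hθ hΨ H)
  | listU_zero _ hl hP =>
    intro _ _ _ _ _ hσ hθ hΨ H
    exact .listU_zero hΨ (hl.subst hσ) (hP.sub (hσ.up _) (hθ.tlift _))
  | listU_succ _ hn hl hP =>
    intro _ _ _ _ _ hσ hθ hΨ H
    rw [Fml.iff_sub, listUSucc_sub]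
    exact .listU_succ hΨ (hn.sub hσ hθ) (hl.subst hσ) (hP.sub (hσ.up _) (hθ.tlift _))
  | listR_zero _ hl₁ hl₂ ha hP =>
    intro _ _ _ _ _ hσ hθ hΨ H
    exact .listR_zero hΨ (hl₁.subst hσ) (hl₂.subst hσ) (ha.sub hσ hθ)
      (hP.sub ((hσ.up _).up _) (hθ.tlift₂ _ _))
  | listR_succ _ hn hl₁ hl₂ ha hP =>
    intro _ _ _ _ _ hσ hθ hΨ H
    rw [Fml.iff_sub, listRSucc_sub]
    exact .listR_succ hΨ (hn.sub hσ hθ) (hl₁.subst hσ) (hl₂.subst hσ) (ha.sub hσ hθ)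
      (hP.sub ((hσ.up _).up _) (hθ.tlift₂ _ _))

/-! ## Derived rules of HOL -/

theorem HasTy.subst_congr {Γ : Ctx} {t : Tm} {τ : Ty} (h : HasTy Γ t τ) :
    ∀ {σ σ' : ℕ → Tm}, (∀ n, n < Γ.length → σ n = σ' n) → t.subst σ = t.subst σ' := by
  have hup : ∀ {Γ : Ctx} {τ : Ty} {σ σ' : ℕ → Tm}, (∀ n, n < Γ.length → σ n = σ' n) →
      ∀ n, n < (τ :: Γ).length → Tm.up σ n = Tm.up σ' n := by
    intro Γ τ σ σ' h n hn
    cases n with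
    | zero => rfl
    | succ n => simp only [Tm.up_eq, scons_succ]; rw [h n (by simpa using hn)]
  induction h with
  | var hn => intro σ σ' h; exact h _ (List.getElem?_eq_some_iff.1 hn).1
  | lam _ ih => intro σ σ' h; exact congrArg Tm.lam (ih (hup h))
  | letrec _ _ _ ih => intro σ σ' h; exact congrArg Tm.letrec (ih (hup (hup h)))
  | fst _ ih => intro σ σ' h; exact congrArg Tm.fst (ih h)
  | snd _ ih => intro σ σ' h; exact congrArg Tm.snd (ih h)
  | succ _ ih => intro σ σ' h; exact congrArg Tm.succ (ih h)
  | app _ _ ih₁ ih₂ => intro σ σ' h; exact congrArg₂ Tm.app (ih₁ h) (ih₂ h)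
  | cons _ _ ih₁ ih₂ => intro σ σ' h; exact congrArg₂ Tm.cons (ih₁ h) (ih₂ h)
  | pair _ _ ih₁ ih₂ => intro σ σ' h; exact congrArg₂ Tm.pair (ih₁ h) (ih₂ h)
  | natCase _ _ _ ih₁ ih₂ ih₃ => intro σ σ' h; simp only [Tm.subst, ih₁ h, ih₂ h, ih₃ h]
  | boolCase _ _ _ ih₁ ih₂ ih₃ => intro σ σ' h; simp only [Tm.subst, ih₁ h, ih₂ h, ih₃ h]
  | listCase _ _ _ ih₁ ih₂ ih₃ => intro σ σ' h; simp only [Tm.subst, ih₁ h, ih₂ h, ih₃ h]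
  | _ => intros; rfl

theorem CWF.top {Δ : ICtx} {Γ : Ctx} {Ψ : List Fml} (h : CWF Δ Γ Ψ) : CWF Δ Γ (.top :: Ψ) :=
  h.cons trivial

namespace HOL

variable {Δ : ICtx} {Γ : Ctx} {Ψ : List Fml}

theorem weaken {φ : Fml} (h : HOL Δ Γ Ψ φ) {Ψ' : List Fml} (hΨ : CWF Δ Γ Ψ') (hs : Ψ ⊆ Ψ') :
    HOL Δ Γ Ψ' φ := by
  have := h.sub (Tm.Maps.var _) (HIx.Maps.ivar _ _) hΨ (fun ψ hψ => by
    rw [Fml.sub_id]; exact hs hψ)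
  rwa [Fml.sub_id] at this

theorem weaken_cons {φ ψ : Fml} (h : HOL Δ Γ Ψ φ) (hψ : ψ.WF Δ Γ) : HOL Δ Γ (ψ :: Ψ) φ :=
  h.weaken (h.wf.1.cons hψ) (List.subset_cons_self _ _)

theorem cut {Ψ' : List Fml} (hΨ : CWF Δ Γ Ψ') : ∀ {Ψ : List Fml} {φ : Fml}, HOL Δ Γ Ψ φ →
    (∀ ψ ∈ Ψ, HOL Δ Γ Ψ' ψ) → HOL Δ Γ Ψ' φ := by
  intro Ψ
  induction Ψ with
  | nil => intro φ h _; exact h.weaken hΨ (List.nil_subset _)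
  | cons ψ Ψ ih =>
    intro φ h H
    exact .impE (ih h.impI fun χ hχ => H χ (List.mem_cons_of_mem _ hχ)) (H ψ List.mem_cons_self)

/-- The simultaneous substitution of terms, index terms and derivations in a derivation. -/
theorem sub_cut {φ : Fml} (h : HOL Δ Γ Ψ φ) {Δ' : ICtx} {Γ' : Ctx} {Ψ' : List Fml}
    {σ : ℕ → Tm} {θ : ℕ → HIx} (hσ : Tm.Maps Γ σ Γ') (hθ : HIx.Maps Δ θ Δ' Γ')
    (hΨ : CWF Δ' Γ' Ψ') (H : ∀ ψ ∈ Ψ, HOL Δ' Γ' Ψ' (ψ.sub σ θ)) : HOL Δ' Γ' Ψ' (φ.sub σ θ) := by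
  refine cut hΨ (h.sub hσ hθ (Ψ' := Ψ.map fun ψ => ψ.sub σ θ) ?_ ?_) ?_
  · intro χ hχ
    obtain ⟨ψ, hψ, rfl⟩ := List.mem_map.1 hχ
    exact (h.wf.1 ψ hψ).sub hσ hθ
  · intro ψ hψ
    exact List.mem_map.2 ⟨ψ, hψ, rfl⟩
  · intro χ hχ
    obtain ⟨ψ, hψ, rfl⟩ := List.mem_map.1 hχ
    exact H ψ hψ

theorem shift {φ : Fml} (h : HOL Δ Γ Ψ φ) (τ : Ty) :
    HOL Δ (τ :: Γ) (Ψ.map (Fml.shift 1)) (φ.shift 1) :=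
  h.sub (Tm.Maps.sh_one _ _) (HIx.Maps.ivar _ _) (h.wf.1.shift τ)
    fun ψ hψ => List.mem_map.2 ⟨ψ, hψ, rfl⟩

theorem ishift {φ : Fml} (h : HOL Δ Γ Ψ φ) (S : Srt) :
    HOL (S :: Δ) Γ (Ψ.map (Fml.ishift 1)) (φ.ishift 1) :=
  h.sub (Tm.Maps.var _) (HIx.Maps.ish _ _ _) (h.wf.1.ishift S)
    fun ψ hψ => List.mem_map.2 ⟨ψ, hψ, rfl⟩

theorem hyp_cons {φ : Fml} (hφ : φ.WF Δ Γ) (hΨ : CWF Δ Γ Ψ) : HOL Δ Γ (φ :: Ψ) φ :=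
  .ax (hΨ.cons hφ) List.mem_cons_self

theorem eq_refl {t : Tm} {τ : Ty} (hΨ : CWF Δ Γ Ψ) (ht : HasTy Γ t τ) : HOL Δ Γ Ψ (.eq τ t t) :=
  .conv hΨ ht ht (.refl t)

/-- Replacement of equals, with the two instances given up to equality of assertions. -/
theorem rew {φ φ₁ φ₂ : Fml} {τ : Ty} {t u : Tm} (h : HOL Δ Γ Ψ (.eq τ t u)) (φ₁' : HOL Δ Γ Ψ φ₁)
    (hφ : φ.WF Δ (τ :: Γ)) (e₁ : φ.inst t = φ₁) (e₂ : φ.inst u = φ₂) : HOL Δ Γ Ψ φ₂ := by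
  subst e₁ e₂; exact .subst hφ φ₁' h

theorem subst_shift_inst (t u : Tm) : (t.subst (Tm.sh 1)).subst (u ;; Tm.var) = t := by
  rw [Tm.subst_subst]; exact Tm.subst_var t

theorem eq_symm {τ : Ty} {t u : Tm} (h : HOL Δ Γ Ψ (.eq τ t u)) : HOL Δ Γ Ψ (.eq τ u t) := by
  refine h.rew (φ := .eq τ (.var 0) (t.subst (Tm.sh 1))) (eq_refl h.wf.1 h.wf.2.1)
    ⟨.var rfl, h.wf.2.1.shift _⟩ ?_ ?_ <;>
  simp only [Fml.inst, Fml.tsub, Fml.eq_sub, subst_shift_inst] <;> rfl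

theorem eq_trans {τ : Ty} {t u v : Tm} (h : HOL Δ Γ Ψ (.eq τ t u)) (h' : HOL Δ Γ Ψ (.eq τ u v)) :
    HOL Δ Γ Ψ (.eq τ t v) := by
  refine h'.rew (φ := .eq τ (t.subst (Tm.sh 1)) (.var 0)) h ⟨h.wf.2.1.shift _, .var rfl⟩ ?_ ?_ <;>
  simp only [Fml.inst, Fml.tsub, Fml.eq_sub, subst_shift_inst] <;> rfl

theorem eq_conv {τ : Ty} {t t' : Tm} (hΨ : CWF Δ Γ Ψ) (ht : HasTy Γ t τ) (ht' : HasTy Γ t' τ)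
    (h : Tm.Conv t t') : HOL Δ Γ Ψ (.eq τ t t') := .conv hΨ ht ht' h

/-- Congruence of equality. -/
theorem eq_congr {σ τ : Ty} {t u s : Tm} (h : HOL Δ Γ Ψ (.eq σ t u)) (hs : HasTy (σ :: Γ) s τ) :
    HOL Δ Γ Ψ (.eq τ (s.subst (t ;; Tm.var)) (s.subst (u ;; Tm.var))) := by
  have ht := hs.subst ((Tm.Maps.var Γ).cons h.wf.2.1)
  refine h.rew (φ := .eq τ ((s.subst (t ;; Tm.var)).subst (Tm.sh 1)) s) (eq_refl h.wf.1 ht)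
    ⟨ht.shift _, hs⟩ ?_ ?_ <;>
  simp only [Fml.inst, Fml.tsub, Fml.eq_sub, subst_shift_inst]

theorem eq_fst {σ τ : Ty} {t u : Tm} (h : HOL Δ Γ Ψ (.eq (.prod σ τ) t u)) :
    HOL Δ Γ Ψ (.eq σ (.fst t) (.fst u)) :=
  h.eq_congr (s := .fst (.var 0)) (.fst (.var rfl))

theorem eq_snd {σ τ : Ty} {t u : Tm} (h : HOL Δ Γ Ψ (.eq (.prod σ τ) t u)) :
    HOL Δ Γ Ψ (.eq τ (.snd t) (.snd u)) :=
  h.eq_congr (s := .snd (.var 0)) (.snd (.var rfl))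

theorem eq_app {σ τ : Ty} {t u v : Tm} (h : HOL Δ Γ Ψ (.eq (.arr σ τ) t u)) (hv : HasTy Γ v σ) :
    HOL Δ Γ Ψ (.eq τ (.app t v) (.app u v)) := by
  have := h.eq_congr (s := .app (.var 0) (v.subst (Tm.sh 1))) (.app (.var rfl) (hv.shift _))
  simpa only [Tm.subst, subst_shift_inst, scons_zero] using this

theorem eq_app_right {σ τ : Ty} {t u v : Tm} (h : HOL Δ Γ Ψ (.eq σ t u))
    (hv : HasTy Γ v (.arr σ τ)) : HOL Δ Γ Ψ (.eq τ (.app v t) (.app v u)) := by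
  have := h.eq_congr (s := .app (v.subst (Tm.sh 1)) (.var 0)) (.app (hv.shift _) (.var rfl))
  simpa only [Tm.subst, subst_shift_inst, scons_zero] using this

/-- Substituting provably equal terms for the variables of a term. -/
theorem eq_subst {Γ₀ : Ctx} {t : Tm} {τ : Ty} (ht : HasTy Γ₀ t τ) (hΨ : CWF Δ Γ Ψ)
    {σ σ' : ℕ → Tm} (h : ∀ n τ, Γ₀[n]? = some τ → HOL Δ Γ Ψ (.eq τ (σ n) (σ' n))) :
    HOL Δ Γ Ψ (.eq τ (t.subst σ) (t.subst σ')) := by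
  have key : ∀ k, HOL Δ Γ Ψ (.eq τ (t.subst σ)
      (t.subst fun n => if n < k then σ' n else σ n)) := by
    intro k
    induction k with
    | zero => simpa using eq_refl hΨ (ht.subst fun n τ hn => (h n τ hn).wf.2.1)
    | succ k ih =>
      by_cases hk : k < Γ₀.length
      · refine ih.eq_trans ?_
        have hm : Tm.Maps Γ₀ (fun n => if n = k then Tm.var 0 else
            (if n < k then σ' n else σ n).subst (Tm.sh 1)) (Γ₀[k] :: Γ) := by
          intro n τ hn
          by_cases e : n = k
          · subst e
            simp only [if_true]
            exact .var (by simpa [List.getElem?_eq_getElem hk] using hn)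
          · simp only [e, if_false]
            split
            · exact (h n τ hn).wf.2.2.shift _
            · exact (h n τ hn).wf.2.1.shift _
        have := (h k _ (List.getElem?_eq_getElem hk)).eq_congr (ht.subst hm)
        simp only [Tm.subst_subst] at this
        convert this using 2 <;>
        · refine Tm.subst_congr _ fun n => ?_
          by_cases e : n = k
          · subst e; simp [Tm.subst]
          · simp only [e, if_false, subst_shift_inst]
            try simp only [show n < k + 1 ↔ n < k by omega]
      · convert ih using 2
        refine ht.subst_congr fun n hn => ?_
        simp [show n < k by omega, show n < k + 1 by omega]
  refine (key Γ₀.length).eq_trans ?_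
  rw [ht.subst_congr (σ' := σ') fun n hn => by simp [hn]]
  exact eq_refl hΨ (ht.subst fun n τ hn => (h n τ hn).wf.2.2)

theorem andE {φ ψ : Fml} (h : HOL Δ Γ Ψ (.and φ ψ)) : HOL Δ Γ Ψ φ ∧ HOL Δ Γ Ψ ψ :=
  ⟨h.andE₁, h.andE₂⟩

end HOL

/-! ## From HOL to RHOL -/

theorem Tm.lenFun_hasTy (Γ : Ctx) (τ : Ty) : HasTy Γ Tm.lenFun (.arr (.list τ) .nat) :=
  .letrec (.inr ⟨τ, rfl⟩)
    (.listCase (.var rfl) .zero (.lam (.lam (.succ (.app (.var (τ := .arr (.list τ) .nat) rfl)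
      (.var rfl))))))
    (.listCaseVar (by simp) .zero (.succ (.call (by simp))))

theorem sizeOf_hasSort {Δ : ICtx} {Γ : Ctx} {I : Ty} {t : Tm} (hI : I.IsInd) (ht : HasTy Γ t I) :
    HIx.HasSort Δ Γ (sizeOf I t) .real := by
  rcases hI with rfl | ⟨τ, rfl⟩
  · exact ht
  · exact HasTy.app (Tm.lenFun_hasTy _ _) ht

/-- Every well-typed term satisfies the trivial refinement. -/
theorem UHOL.top {Γ : Ctx} {t : Tm} {τ : Ty} (h : HasTy Γ t τ) :
    ∀ {Δ : ICtx} {Γ' : Ctx} {Ψ : List Fml} {ξ : ℕ → ℕ}, (∀ n τ, Γ[n]? = some τ → Γ'[ξ n]? = some τ) →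
      CWF Δ Γ' Ψ → UHOL Δ Γ' Ψ (t.rename ξ) τ .top := by
  have hup : ∀ {Γ Γ' : Ctx} {ξ : ℕ → ℕ} {σ : Ty}, (∀ (n : ℕ) τ, Γ[n]? = some τ → Γ'[ξ n]? = some τ) →
      ∀ (n : ℕ) τ, (σ :: Γ)[n]? = some τ → (σ :: Γ')[upr ξ n]? = some τ := by
    intro Γ Γ' ξ σ h n τ hn
    cases n with
    | zero => simpa [upr] using hn
    | succ n => simpa [upr] using h n τ (by simpa using hn)
  have toTop : ∀ {Δ : ICtx} {Γ : Ctx} {Ψ : List Fml} {t : Tm} {τ : Ty} {φ : Fml}, CWF Δ Γ Ψ →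
      (φ.inst t).WF Δ Γ → UHOL Δ Γ Ψ t τ φ → UHOL Δ Γ Ψ t τ .top := by
    intro Δ Γ Ψ t τ φ hΨ hφ h
    exact .sub trivial h (.impI (.topI (hΨ.cons hφ)))
  have ofTop : ∀ {Δ : ICtx} {Γ : Ctx} {Ψ : List Fml} {t : Tm} {τ : Ty} {φ : Fml}, CWF Δ Γ Ψ →
      φ.WF Δ (τ :: Γ) → HOL Δ Γ (.top :: Ψ) (φ.inst t) → UHOL Δ Γ Ψ t τ .top →
      UHOL Δ Γ Ψ t τ φ := by
    intro Δ Γ Ψ t τ φ hΨ hφ hd h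
    exact .sub hφ h (.impI hd)
  have hspec : ∀ {Δ : ICtx} {Γ : Ctx} {Ψ : List Fml} (t : Tm) (σ : Ty), CWF Δ Γ Ψ →
      HOL Δ Γ Ψ ((funSpec σ .top .top).inst t) := by
    intro Δ Γ Ψ t σ hΨ
    exact .allI hΨ (.impI (.topI ((hΨ.shift σ).top)))
  have hcons : ∀ {Δ : ICtx} {Γ : Ctx} {Ψ : List Fml} (σ τ : Ty), CWF Δ Γ Ψ →
      HOL Δ Γ Ψ (.all σ (.all τ (.imp .top (.imp .top .top)))) := by
    intro Δ Γ Ψ σ τ hΨ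
    refine .allI hΨ (.allI (hΨ.shift _) (.impI (.impI (.topI ?_))))
    exact (((hΨ.shift σ).shift τ).top).top
  induction h with
  | var hn => intro Δ Γ' Ψ ξ h hΨ; exact .var (.var (h _ _ hn)) trivial (.topI hΨ)
  | pair _ _ ih₁ ih₂ =>
    intro Δ Γ' Ψ ξ h hΨ
    exact .pair trivial (ih₁ h hΨ) (ih₂ h hΨ) (hcons _ _ hΨ)
  | cons _ _ ih₁ ih₂ =>
    intro Δ Γ' Ψ ξ h hΨ
    exact .cons trivial (ih₁ h hΨ) (ih₂ h hΨ) (hcons _ _ hΨ)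
  | fst _ ih => intro Δ Γ' Ψ ξ h hΨ; exact .fst trivial (ih h hΨ)
  | snd _ ih => intro Δ Γ' Ψ ξ h hΨ; exact .snd trivial (ih h hΨ)
  | app _ _ ih₁ ih₂ =>
    intro Δ Γ' Ψ ξ h hΨ
    exact .app (φ := .top) (φ' := .top) trivial (ofTop hΨ ⟨trivial, trivial⟩
      (hspec _ _ (hΨ.top)) (ih₁ h hΨ)) (ih₂ h hΨ)
  | lam _ ih =>
    intro Δ Γ' Ψ ξ h hΨ
    exact toTop (φ := funSpec _ .top .top) hΨ ⟨trivial, trivial⟩ (.abs (φ := .top) (φ' := .top) hΨ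
      (ih (hup h) ((hΨ.shift _).top)))
  | tt => intro Δ Γ' Ψ ξ h hΨ; exact .tt trivial (.topI hΨ)
  | ff => intro Δ Γ' Ψ ξ h hΨ; exact .ff trivial (.topI hΨ)
  | zero => intro Δ Γ' Ψ ξ h hΨ; exact .zero trivial (.topI hΨ)
  | nil => intro Δ Γ' Ψ ξ h hΨ; exact .nil trivial (.topI hΨ)
  | succ _ ih =>
    intro Δ Γ' Ψ ξ h hΨ
    exact .succ trivial (ih h hΨ) (.allI hΨ (.impI (.topI ((hΨ.shift _).top))))
  | natCase ht _ _ _ ih₂ ih₃ =>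
    intro Δ Γ' Ψ ξ h hΨ
    have ht' := ht.rename h
    have hw : Fml.WF Δ (.nat :: Γ') (.eq .nat ((Tm.subst (Tm.rename _ ξ) (Tm.sh 1)))
      (.succ (.var 0))) := ⟨ht'.shift .nat, .succ (.var rfl)⟩
    refine .natCase ht' (ih₂ h (hΨ.cons ⟨ht', .zero⟩)) (ofTop hΨ ?_ ?_ (ih₃ h hΨ))
    · refine ⟨⟨?_, .succ (.var rfl)⟩, trivial⟩
      rw [Tm.shift_eq]; exact ht'.subst (Tm.Maps.sh_two _ _ _)
    · refine .allI (hΨ.top) (.impI (.topI (((hΨ.top).shift _).cons ?_)))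
      refine ⟨?_, .succ (.var rfl)⟩
      simp only [Tm.shift_eq, Tm.subst_subst]
      exact ht'.shift _
  | boolCase ht _ _ _ ih₂ ih₃ =>
    intro Δ Γ' Ψ ξ h hΨ
    have ht' := ht.rename h
    exact .boolCase ht' (ih₂ h (hΨ.cons ⟨ht', .tt⟩)) (ih₃ h (hΨ.cons ⟨ht', .ff⟩))
  | @listCase Γ t u v τ σ ht _ _ _ ih₂ ih₃ =>
    intro Δ Γ' Ψ ξ h hΨ
    have ht' := ht.rename h
    refine .listCase ht' (ih₂ h (hΨ.cons ⟨ht', .nil⟩)) (ofTop hΨ ?_ ?_ (ih₃ h hΨ))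
    · refine ⟨⟨?_, .cons (.var rfl) (.var rfl)⟩, trivial⟩
      rw [Tm.shift_eq]; exact ht'.subst (Tm.Maps.sh_three _ _ _ _)
    · refine .allI (hΨ.top) (.allI ((hΨ.top).shift _) (.impI (.topI
        ((((hΨ.top).shift _).shift _).cons ?_))))
      refine ⟨?_, .cons (.var rfl) (.var rfl)⟩
      simp only [Tm.shift_eq, Tm.subst_subst]
      exact ht'.subst (Tm.Maps.sh_two _ _ _)
  | @letrec Γ e I σ hI he hg ih =>
    intro Δ Γ' Ψ ξ h hΨ
    have hr := (HasTy.letrec hI he hg).rename h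
    refine toTop (φ := funSpec _ .top .top) hΨ ⟨trivial, trivial⟩ (.letrec (φ := .top) (φ' := .top) hΨ hr trivial trivial ?_)
    have e1 : (e.rename (upr (upr ξ))).subst (.var 1 ;; .var 0 ;; Tm.sh 2) =
        e.rename (1 ;; 0 ;; fun n => ξ n + 2) := by
      rw [Tm.rename_subst, Tm.rename_eq_subst]
      refine Tm.subst_congr _ fun n => ?_
      rcases n with _ | _ | n <;> simp [upr]
    rw [e1]
    refine ih ?_ ?_
    · intro n τ hn
      rcases n with _ | _ | n
      · simpa using hn
      · simpa using hn
      · simpa using h n τ (by simpa using hn)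
    · refine ((hΨ.shift_two _ _).top).cons ⟨⟨?_, ?_⟩, trivial, trivial⟩
      · exact sizeOf_hasSort hI (.var rfl)
      · exact sizeOf_hasSort hI (.var rfl)

/-- A relational refinement that is provable in HOL is derivable in RHOL. -/
theorem RHOL.of_hol {Δ : ICtx} {Γ : Ctx} {Ψ : List Fml} {t₁ t₂ : Tm} {σ₁ σ₂ : Ty} {φ : Fml}
    (h₁ : HasTy Γ t₁ σ₁) (h₂ : HasTy Γ t₂ σ₂) (hφ : φ.WF Δ (σ₂ :: σ₁ :: Γ))
    (h : HOL Δ Γ Ψ (φ.inst2 t₁ t₂)) : RHOL Δ Γ Ψ t₁ σ₁ t₂ σ₂ φ := by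
  have := UHOL.top h₁ (ξ := id) (fun _ _ h => h) h.wf.1
  rw [Tm.rename_eq_subst, show (fun n => Tm.var (id n)) = Tm.var from rfl, Tm.subst_var] at this
  exact .sub hφ (.uholL (φ := .top) trivial h₂ this) (.impI (h.weaken_cons trivial))

/-! ## Arithmetic in HOL -/

namespace Tm

theorem addFun_subst (σ : ℕ → Tm) : addFun.subst σ = addFun := rfl

theorem add_subst (t u : Tm) (σ : ℕ → Tm) : (add t u).subst σ = add (t.subst σ) (u.subst σ) := rfl

theorem add_rename (t u : Tm) (ξ : ℕ → ℕ) : (add t u).rename ξ = add (t.rename ξ) (u.rename ξ) :=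
  rfl

theorem numeral_subst (n : ℕ) (σ : ℕ → Tm) : (numeral n).subst σ = numeral n := by
  induction n with
  | zero => rfl
  | succ n ih => simp [numeral, Tm.subst, ih]

theorem numeral_rename (n : ℕ) (ξ : ℕ → ℕ) : (numeral n).rename ξ = numeral n := by
  rw [rename_eq_subst, numeral_subst]

theorem numeral_hasTy (Γ : Ctx) (n : ℕ) : HasTy Γ (numeral n) .nat := by
  induction n with
  | zero => exact .zero
  | succ n ih => exact .succ ih

theorem addFun_hasTy (Γ : Ctx) : HasTy Γ addFun (.arr .nat (.arr .nat .nat)) := by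
  refine .letrec (.inl rfl) (.lam (.natCase (.var rfl) (.var rfl) (.lam (.succ (.app (.app
    (.var (τ := .arr .nat (.arr .nat .nat)) rfl) (.var rfl)) (.var rfl)))))) ?_
  exact .lam (.natCaseVar (by simp) (.var (by decide)) (.succ (.app (.call (by simp))
    (.var (by decide)))))

theorem add_hasTy {Γ : Ctx} {t u : Tm} (ht : HasTy Γ t .nat) (hu : HasTy Γ u .nat) :
    HasTy Γ (add t u) .nat :=
  .app (.app (addFun_hasTy Γ) ht) hu

theorem add_zero_conv (u : Tm) : Conv (add zero u) u := by
  refine (Conv.app (.mu _ _ .zero) (.refl u)).trans ((Conv.beta _ _).trans ?_)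
  exact .natCase_zero _ _

theorem add_succ_conv (t u : Tm) : Conv (add (succ t) u) (succ (add t u)) := by
  refine (Conv.app (.mu _ _ (.succ t)) (.refl u)).trans ((Conv.beta _ _).trans ?_)
  refine (Conv.natCase_succ _ _ _).trans ((Conv.beta _ _).trans ?_)
  simp only [Tm.subst, Tm.inst, Tm.up_eq, scons_zero, scons_succ,
    Tm.subst_subst, sh_apply, add]
  have e : ∀ s : Tm, s = t → ∀ v : Tm, v = u →
    Conv (((addFun.app s).app v).succ) (((addFun.app t).app u).succ) := by
    rintro s rfl v rfl; exact .refl _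
  exact e _ (by rw [rename_subst]; exact subst_var t) _ (subst_var u)

end Tm

theorem HIx.Maps.cons_tm {Δ Δ' : ICtx} {Γ' : Ctx} {θ : ℕ → HIx} (h : HIx.Maps Δ θ Δ' Γ') {t : Tm}
    (ht : HasTy Γ' t .nat) : HIx.Maps (.nat :: Δ) (HIx.tm t ;; θ) Δ' Γ' :=
  h.cons (I := HIx.tm t) (S := .nat) ht

namespace HOL

variable {Δ : ICtx} {Γ : Ctx} {Ψ : List Fml}

theorem cst_refl {I : HIx} (hΨ : CWF Δ Γ Ψ) (hI : HIx.HasSort Δ Γ I .real) :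
    HOL Δ Γ Ψ (.cst (.eq I I)) :=
  .arith [.real] [] (.eq (.leaf 0) (.leaf 0)) (I ;; HIx.ivar) hΨ (by simp)
    (by simp [ICst.WF, Cst.AllLeaves, Ix.AllLeaves]) (fun _ _ _ => rfl)
    (HIx.Maps.nil.cons hI) (by simp)

theorem cst_eq_sorts {I J : HIx} (h : HOL Δ Γ Ψ (.cst (.eq I J))) :
    HIx.HasSort Δ Γ I .real ∧ HIx.HasSort Δ Γ J .real := h.wf.2

theorem cst_symm {I J : HIx} (h : HOL Δ Γ Ψ (.cst (.eq I J))) : HOL Δ Γ Ψ (.cst (.eq J I)) := by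
  refine .arith [.real, .real] [.eq (.leaf 0) (.leaf 1)] (.eq (.leaf 1) (.leaf 0))
    (I ;; J ;; HIx.ivar) h.wf.1 ?_ ?_ ?_ ((HIx.Maps.nil.cons h.cst_eq_sorts.2).cons
    h.cst_eq_sorts.1) ?_
  · simp [ICst.WF, Cst.AllLeaves, Ix.AllLeaves]
  · simp [ICst.WF, Cst.AllLeaves, Ix.AllLeaves]
  · intro δ _ hδ
    exact (hδ _ List.mem_cons_self : δ 0 = δ 1).symm
  · exact List.forall_mem_singleton.2 h

theorem cst_of_eq {t u : Tm} (h : HOL Δ Γ Ψ (.eq .nat t u)) :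
    HOL Δ Γ Ψ (.cst (.eq (HIx.tm t) (HIx.tm u))) := by
  refine h.rew (φ := .cst (.eq (HIx.tm (t.subst (Tm.sh 1))) (HIx.tm (.var 0))))
    (cst_refl (I := HIx.tm t) h.wf.1 h.wf.2.1) ⟨h.wf.2.1.shift _, .var rfl⟩ ?_ ?_ <;>
  · simp only [Fml.inst, Fml.tsub, Fml.cst_sub, HCst.eq_sub, HIx.tm_sub, subst_shift_inst]
    rfl

theorem cst_trans {I J K : HIx} (h : HOL Δ Γ Ψ (.cst (.eq I J)))
    (h' : HOL Δ Γ Ψ (.cst (.eq J K))) : HOL Δ Γ Ψ (.cst (.eq I K)) := by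
  refine .arith [.real, .real, .real] [.eq (.leaf 0) (.leaf 1), .eq (.leaf 1) (.leaf 2)]
    (.eq (.leaf 0) (.leaf 2)) (I ;; J ;; K ;; HIx.ivar) h.wf.1 ?_ ?_ ?_
    (((HIx.Maps.nil.cons h'.cst_eq_sorts.2).cons h.cst_eq_sorts.2).cons h.cst_eq_sorts.1) ?_
  · simp [ICst.WF, Cst.AllLeaves, Ix.AllLeaves]
  · simp [ICst.WF, Cst.AllLeaves, Ix.AllLeaves]
  · intro δ _ hδ
    have h1 : δ 0 = δ 1 := hδ (.eq (.leaf 0) (.leaf 1)) (by simp)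
    have h2 : δ 1 = δ 2 := hδ (.eq (.leaf 1) (.leaf 2)) (by simp)
    exact h1.trans h2
  · exact List.forall_mem_cons.2 ⟨h, List.forall_mem_cons.2 ⟨h', by simp⟩⟩

theorem tm_add {t u : Tm} (hΨ : CWF Δ Γ Ψ) (ht : HasTy Γ t .nat) (hu : HasTy Γ u .nat) :
    HOL Δ Γ Ψ (.cst (.eq (HIx.tm (Tm.add t u)) (.add (HIx.tm t) (HIx.tm u)))) := by
  have hu' := hu.shift .nat
  have hw : Fml.WF Δ (.nat :: Γ) (.cst (.eq (HIx.tm (Tm.add (.var 0) (u.subst (Tm.sh 1))))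
      (.add (HIx.tm (.var 0)) (HIx.tm (u.subst (Tm.sh 1)))))) :=
    ⟨Tm.add_hasTy (.var rfl) hu', HasTy.var rfl, hu'⟩
  have key := (HOL.nat (Ψ := Ψ) hw ?_ ?_).allE ht
  · simpa only [Fml.inst, Fml.tsub, Fml.cst_sub, HCst.eq_sub, HIx.tm_sub, HIx.add_sub,
      Tm.add_subst, Tm.subst, scons_zero, subst_shift_inst] using key
  · simp only [Fml.inst, Fml.tsub, Fml.cst_sub, HCst.eq_sub, HIx.tm_sub, HIx.add_sub,
      Tm.add_subst, subst_shift_inst]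
    refine (eq_conv hΨ (Tm.add_hasTy .zero hu) hu (Tm.add_zero_conv u)).cst_of_eq.cst_trans ?_
    refine .arith [.nat, .nat] [.eq (.leaf 0) (.num 0)]
      (.eq (.leaf 1) (.add (.leaf 0) (.leaf 1))) (HIx.tm .zero ;; HIx.tm u ;; HIx.ivar) hΨ
      ?_ ?_ ?_ ((HIx.Maps.nil.cons_tm hu).cons_tm .zero) ?_
    · simp [ICst.WF, Cst.AllLeaves, Ix.AllLeaves]
    · simp [ICst.WF, Cst.AllLeaves, Ix.AllLeaves]
    · intro δ _ hδ
      have h1 := hδ (.eq (.leaf 0) (.num 0)) (by simp)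
      simp only [Cst.Holds, Ix.eval] at h1 ⊢
      simp [h1]
    · exact List.forall_mem_singleton.2 (HOL.tmZero hΨ)
  · have hΨ' := (hΨ.shift .nat).cons hw
    simp only [Fml.tsub, Fml.cst_sub, HCst.eq_sub, HIx.tm_sub, HIx.add_sub, Tm.add_subst]
    have e : (u.subst (Tm.sh 1)).subst ((Tm.var 0).succ ;; Tm.sh 1) = u.subst (Tm.sh 1) := by
      rw [Tm.subst_subst]; rfl
    rw [e]
    refine (eq_conv hΨ' (Tm.add_hasTy (.succ (.var rfl)) hu') (.succ (Tm.add_hasTy (.var rfl) hu'))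
      (Tm.add_succ_conv _ _)).cst_of_eq.cst_trans ?_
    refine (HOL.tmSucc hΨ' (Tm.add_hasTy (.var rfl) hu')).cst_trans ?_
    refine .arith [.nat, .nat, .nat, .nat] [.eq (.leaf 0) (.add (.leaf 1) (.leaf 2)),
      .eq (.leaf 3) (.add (.leaf 1) (.num 1))]
      (.eq (.add (.leaf 0) (.num 1)) (.add (.leaf 3) (.leaf 2)))
      (HIx.tm (Tm.add (.var 0) (u.subst (Tm.sh 1))) ;; HIx.tm (.var 0) ;;
        HIx.tm (u.subst (Tm.sh 1)) ;; HIx.tm (.succ (.var 0)) ;; HIx.ivar) hΨ'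
      ?_ ?_ ?_ ((((HIx.Maps.nil.cons_tm (.succ (.var rfl))).cons_tm hu').cons_tm (.var rfl)).cons_tm
        (Tm.add_hasTy (.var rfl) hu')) ?_
    · simp [ICst.WF, Cst.AllLeaves, Ix.AllLeaves]
    · simp [ICst.WF, Cst.AllLeaves, Ix.AllLeaves]
    · intro δ _ hδ
      have h1 := hδ (.eq (.leaf 0) (.add (.leaf 1) (.leaf 2))) (by simp)
      have h2 := hδ (.eq (.leaf 3) (.add (.leaf 1) (.num 1))) (by simp)
      simp only [Cst.Holds, Ix.eval] at h1 h2 ⊢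
      rw [h1, h2]; exact add_right_comm _ _ _
    · exact List.forall_mem_cons.2 ⟨hyp_cons hw (hΨ.shift _),
        List.forall_mem_cons.2 ⟨HOL.tmSucc hΨ' (.var rfl), by simp⟩⟩

theorem tm_numeral (hΨ : CWF Δ Γ Ψ) (n : ℕ) :
    HOL Δ Γ Ψ (.cst (.eq (HIx.tm (Tm.numeral n)) (.num n))) := by
  induction n with
  | zero => exact .tmZero hΨ
  | succ n ih =>
    refine (HOL.tmSucc hΨ (Tm.numeral_hasTy _ n)).cst_trans ?_
    refine .arith [.nat] [.eq (.leaf 0) (.num n)] (.eq (.add (.leaf 0) (.num 1)) (.num (n + 1)))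
      (HIx.tm (Tm.numeral n) ;; HIx.ivar) hΨ ?_ ?_ ?_
      (HIx.Maps.nil.cons_tm (Tm.numeral_hasTy _ n)) ?_
    · simp [ICst.WF, Cst.AllLeaves, Ix.AllLeaves]
    · simp [ICst.WF, Cst.AllLeaves, Ix.AllLeaves]
    · intro δ _ hδ
      have h1 := hδ (.eq (.leaf 0) (.num n)) (by simp)
      simp only [Cst.Holds, Ix.eval] at h1 ⊢
      rw [h1]; push_cast; rfl
    · exact List.forall_mem_singleton.2 ih

/-- Inconsistent constraints. -/
theorem absurd_cst {Δ' : ICtx} {Cs : List ICst} {θ : ℕ → HIx} {φ : Fml} (hΨ : CWF Δ Γ Ψ)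
    (hCs : ∀ D ∈ Cs, D.WF Δ')
    (h : ∀ δ : ℕ → EReal, Δ'.Valid δ → ¬ ∀ D ∈ Cs, D.Holds δ) (hθ : HIx.Maps Δ' θ Δ Γ)
    (H : ∀ D ∈ Cs, HOL Δ Γ Ψ (.cst (D.bind θ))) (hφ : φ.WF Δ Γ) : HOL Δ Γ Ψ φ := by
  refine .botE (.cstNot (C := .eq (.num 0) (.num 0)) ?_ (cst_refl hΨ trivial)) hφ
  exact .arith Δ' Cs (.not (.eq (.num 0) (.num 0))) θ hΨ hCs ⟨trivial, trivial⟩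
    (fun δ hδ hD => absurd hD (h δ hδ)) hθ H

theorem nat_index_cases {n : HIx} {χ : Fml} (hΨ : CWF Δ Γ Ψ) (hn : n.HasSort Δ Γ .nat)
    (hχ : χ.WF Δ Γ) (h₀ : HOL Δ Γ (.cst (.eq n (.num 0)) :: Ψ) χ)
    (h₁ : HOL (.nat :: Δ) Γ (.cst (.eq (n.shift 0 1) (.add (HIx.ivar 0) (.num 1))) ::
      Ψ.map (Fml.ishift 1)) (χ.ishift 1)) : HOL Δ Γ Ψ χ := by
  have hw : Fml.WF (.nat :: Δ) Γ (.or (.cst (.eq (HIx.ivar 0) (.num 0)))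
      (.exi .nat (.cst (.eq (HIx.ivar 1) (.add (HIx.ivar 0) (.num 1)))))) := by
    refine ⟨⟨?_, trivial⟩, ?_, ?_, trivial⟩
    · exact Nat.succ_pos _
    · exact Nat.succ_lt_succ (Nat.succ_pos _)
    · exact Nat.succ_pos _
  have key := (HOL.inat (Ψ := Ψ) hw ?_ ?_).alliE hn
  · refine .orE key h₀ (.exiE (.ax (CWF.cons ?_ hΨ) List.mem_cons_self) hχ ?_)
    · exact key.wf.2.2
    · exact h₁.weaken (CWF.cons h₁.wf.1.head (CWF.cons (Fml.WF.ishift key.wf.2.2 .nat)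
        (hΨ.ishift _)))
        (List.cons_subset_cons _ (List.subset_cons_self _ _))
  · exact .orI₁ (cst_refl hΨ trivial) (hw.2.iinst (I := .num 0) trivial)
  · have hΨ' := (hΨ.ishift .nat).cons hw
    have hs : HIx.HasSort (.nat :: Δ) Γ (HIx.ivar 0) .nat := HIx.Maps.ivar _ _ 0 .nat rfl
    refine .orI₂ ⟨⟨hs.real, trivial⟩, trivial⟩ (.exiI (I := HIx.ivar 0) ?_ hs ?_)
    · refine ⟨⟨?_, trivial⟩, ?_, trivial⟩
      · exact Nat.succ_lt_succ (Nat.succ_pos _)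
      · exact Nat.succ_pos _
    · exact cst_refl (I := .add (HIx.ivar 0) (.num 1)) hΨ' ⟨hs.real, trivial⟩

/-- Replacement of equal index terms, with the instances given up to equality of assertions. -/
theorem irew {φ φ₁ φ₂ : Fml} {S : Srt} {I J : HIx} (h : HOL Δ Γ Ψ (.cst (.eq I J)))
    (φ₁' : HOL Δ Γ Ψ φ₁) (hφ : φ.WF (S :: Δ) Γ) (hI : I.HasSort Δ Γ S) (hJ : J.HasSort Δ Γ S)
    (e₁ : φ.iinst I = φ₁) (e₂ : φ.iinst J = φ₂) : HOL Δ Γ Ψ φ₂ := by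
  subst e₁ e₂; exact .isubst hφ hI hJ φ₁' h

end HOL

/-! ## The predicates on lists -/

namespace HOL

variable {Δ : ICtx} {Γ : Ctx} {Ψ : List Fml}

theorem all_imp_elim {τ : Ty} {φ ψ : Fml} {t : Tm} (h : HOL Δ Γ Ψ (.all τ (.imp φ ψ)))
    (ht : HasTy Γ t τ) (h' : HOL Δ Γ Ψ (φ.sub (t ;; Tm.var) HIx.ivar)) :
    HOL Δ Γ Ψ (ψ.sub (t ;; Tm.var) HIx.ivar) :=
  .impE (h.allE ht) h'

theorem ex2I {σ₁ σ₂ : Ty} {a b : Tm} {φ : Fml} (hφ : φ.WF Δ (σ₂ :: σ₁ :: Γ)) (ha : HasTy Γ a σ₁)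
    (hb : HasTy Γ b σ₂) (h : HOL Δ Γ Ψ (φ.sub (b ;; a ;; Tm.var) HIx.ivar)) :
    HOL Δ Γ Ψ (.ex σ₁ (.ex σ₂ φ)) := by
  have hw := hφ.sub (((Tm.Maps.var Γ).cons ha).up σ₂) (HIx.Maps.ivar _ _)
  refine .exI (φ := .ex σ₂ φ) hφ ha (.exI (t := b) hw hb ?_)
  simp only [Fml.inst, Fml.tsub, Fml.sub_sub]
  convert h using 2
  · funext n; rcases n with _ | _ | n <;> simp [Tm.up_eq, Tm.subst]
  · rfl

theorem ex4I {σ₁ σ₂ σ₃ σ₄ : Ty} {a b c d : Tm} {φ : Fml}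
    (hφ : φ.WF Δ (σ₄ :: σ₃ :: σ₂ :: σ₁ :: Γ)) (ha : HasTy Γ a σ₁) (hb : HasTy Γ b σ₂)
    (hc : HasTy Γ c σ₃) (hd : HasTy Γ d σ₄)
    (h : HOL Δ Γ Ψ (φ.sub (d ;; c ;; b ;; a ;; Tm.var) HIx.ivar)) :
    HOL Δ Γ Ψ (.ex σ₁ (.ex σ₂ (.ex σ₃ (.ex σ₄ φ)))) := by
  have hm := (((Tm.Maps.var Γ).cons ha).cons hb)
  refine ex2I (φ := .ex σ₃ (.ex σ₄ φ)) hφ ha hb (ex2I (a := c) (b := d)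
    (hφ.sub ((hm.up σ₃).up σ₄) (HIx.Maps.ivar _ _)) hc hd ?_)
  refine (congrArg (HOL Δ Γ Ψ) ?_).mpr h
  simp only [Fml.sub_sub]
  refine Fml.sub_congr _ (fun n => ?_) (fun i => rfl)
  rcases n with _ | _ | _ | _ | n <;> simp [Tm.up_eq, Tm.subst]

theorem listU_irew {τ : Ty} {n n' : HIx} {l : Tm} {P : Fml} (h : HOL Δ Γ Ψ (.cst (.eq n n')))
    (hn' : n'.HasSort Δ Γ .nat) (h' : HOL Δ Γ Ψ (.listU τ n l P)) : HOL Δ Γ Ψ (.listU τ n' l P) := by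
  obtain ⟨hn, hl, hP⟩ := h'.wf.2
  refine h.irew (S := .nat) (φ := .listU τ (HIx.ivar 0) l (P.sub Tm.var (HIx.ish 1))) h'
    ⟨HIx.Maps.ivar _ _ 0 .nat rfl, hl, hP.sub (Tm.Maps.var _) (HIx.Maps.ish _ _ _)⟩ hn hn' ?_ ?_ <;>
  · simp only [Fml.iinst, Fml.isub, Fml.listU_sub, Fml.sub_sub, Tm.subst_var]
    congr 1
    exact Fml.sub_eq_self _ (fun n => by cases n <;> simp [Tm.up_eq, Tm.subst])
      (fun i => by simp [Fml.tlift])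

theorem listU_nil {τ : Ty} {P : Fml} (hΨ : CWF Δ Γ Ψ) (hP : P.WF Δ (τ :: Γ)) :
    HOL Δ Γ Ψ (.listU τ (.num 0) .nil P) :=
  .impE (HOL.listU_zero hΨ .nil hP).andE₂ (eq_refl hΨ .nil)

theorem listU_cons {τ : Ty} {n : HIx} {w ws : Tm} {P : Fml} (hw : HasTy Γ w τ)
    (h : HOL Δ Γ Ψ (P.inst w)) (hl : HOL Δ Γ Ψ (.listU τ n ws P)) :
    HOL Δ Γ Ψ (.listU τ (.add n (.num 1)) (.cons w ws) P) := by
  obtain ⟨hn, hws, hP⟩ := hl.wf.2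
  have hs := listUSucc_wf hn (.cons hw hws) hP
  refine .impE (HOL.listU_succ h.wf.1 hn (.cons hw hws) hP).andE₂ (ex2I hs hw hws ?_)
  refine .andI ?_ (.andI ?_ ?_)
  · refine (congrArg (HOL Δ Γ Ψ) ?_).mpr (eq_refl h.wf.1 (.cons hw hws))
    simp only [Tm.shift_eq, Fml.eq_sub, Tm.subst_subst]
    congr 1
    exact Tm.subst_var _
  · refine (congrArg (HOL Δ Γ Ψ) ?_).mpr h
    simp only [Fml.inst, Fml.tsub, Fml.sub_sub]
    exact Fml.sub_congr _ (fun n => by cases n <;> simp [Tm.subst]) (fun i => rfl)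
  · refine (congrArg (HOL Δ Γ Ψ) ?_).mpr hl
    simp only [Fml.tsub, Fml.listU_sub, HIx.shift_eq, HIx.sub_sub, Fml.sub_sub]
    congr 1
    · exact HIx.sub_id n
    · exact Fml.sub_eq_self _ (fun n => by cases n <;> simp [Tm.up_eq, Tm.subst]) (fun i => rfl)

theorem listU_succ_elim {τ : Ty} {n : HIx} {l : Tm} {P χ : Fml} (hχ : χ.WF Δ Γ)
    (h : HOL Δ Γ Ψ (.listU τ (.add n (.num 1)) l P))
    (h' : ∀ Ψ', Ψ' = .listU τ (n.shift 2 0) (.var 0) (P.tsub (.var 0 ;; Tm.sh 3)) ::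
      P.tsub (.var 1 ;; Tm.sh 2) :: .eq (.list τ) (l.shift 2) (.cons (.var 1) (.var 0)) ::
      Ψ.map (Fml.shift 2) → CWF Δ (.list τ :: τ :: Γ) Ψ' →
      HOL Δ (.list τ :: τ :: Γ) Ψ' (χ.shift 2)) : HOL Δ Γ Ψ χ := by
  obtain ⟨⟨hn, -⟩, hl, hP⟩ := h.wf.2
  have hs := listUSucc_wf hn hl hP
  have hΨ := h.wf.1
  refine .exE (.impE (HOL.listU_succ hΨ hn hl hP).andE₁ h) hχ ?_
  have hs' : Fml.WF Δ (τ :: Γ) (.ex (.list τ) _) := hs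
  have hΨ₁ := (hΨ.shift τ).cons hs'
  refine .exE (.ax hΨ₁ List.mem_cons_self) (hχ.shift _) ?_
  rw [Fml.shift_shift]
  have fin : ∀ {Ψ'' : List Fml}, HOL Δ (.list τ :: τ :: Γ) Ψ'' (.and
      (.eq (.list τ) (l.shift 2) (.cons (.var 1) (.var 0))) (.and (P.tsub (.var 1 ;; Tm.sh 2))
        (.listU τ (n.shift 2 0) (.var 0) (P.tsub (.var 0 ;; Tm.sh 3))))) →
      (∀ φ ∈ Ψ, φ.shift 2 ∈ Ψ'') → HOL Δ (.list τ :: τ :: Γ) Ψ'' (χ.shift 2) := by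
    intro Ψ'' hh hm
    have H : ∀ ψ ∈ .listU τ (n.shift 2 0) (.var 0) (P.tsub (.var 0 ;; Tm.sh 3)) ::
        P.tsub (.var 1 ;; Tm.sh 2) :: .eq (.list τ) (l.shift 2) (.cons (.var 1) (.var 0)) ::
        Ψ.map (Fml.shift 2), HOL Δ (.list τ :: τ :: Γ) Ψ'' ψ := by
      refine List.forall_mem_cons.2 ⟨hh.andE₂.andE₂, List.forall_mem_cons.2 ⟨hh.andE₂.andE₁,
        List.forall_mem_cons.2 ⟨hh.andE₁, ?_⟩⟩⟩
      intro ψ hψ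
      obtain ⟨φ, hφ, rfl⟩ := List.mem_map.1 hψ
      exact .ax hh.wf.1 (hm φ hφ)
    exact (h' _ rfl fun ψ hψ => (H ψ hψ).wf.2).cut hh.wf.1 H
  refine fin (hyp_cons hs (hΨ₁.shift (.list τ))) fun φ hφ => List.mem_cons_of_mem _ ?_
  rw [← Fml.shift_shift]
  exact List.mem_map_of_mem (List.mem_cons_of_mem _ (List.mem_map_of_mem hφ))

theorem listU_cases {τ : Ty} {n : HIx} {l : Tm} {P χ : Fml} (hχ : χ.WF Δ Γ)
    (h : HOL Δ Γ Ψ (.listU τ n l P))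
    (h₀ : HOL Δ Γ (.eq (.list τ) l .nil :: .cst (.eq n (.num 0)) :: Ψ) χ)
    (h₁ : HOL (.nat :: Δ) (.list τ :: τ :: Γ)
      (.listU τ (HIx.ivar 0) (.var 0) (P.sub (.var 0 ;; Tm.sh 3) (HIx.ish 1)) ::
        P.sub (.var 1 ;; Tm.sh 2) (HIx.ish 1) ::
        .eq (.list τ) (l.shift 2) (.cons (.var 1) (.var 0)) ::
        .cst (.eq (n.shift 2 1) (.add (HIx.ivar 0) (.num 1))) ::
        Ψ.map (fun ψ => ψ.sub (Tm.sh 2) (HIx.ish 1))) (χ.sub (Tm.sh 2) (HIx.ish 1))) :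
    HOL Δ Γ Ψ χ := by
  obtain ⟨hn, hl, hP⟩ := h.wf.2
  have hΨ := h.wf.1
  refine nat_index_cases hΨ hn hχ ?_ ?_
  · have hc : Fml.WF Δ Γ (.cst (.eq n (.num 0))) := ⟨hn.real, trivial⟩
    have e := listU_irew (hyp_cons hc hΨ) (n' := .num 0) trivial (h.weaken_cons hc)
    exact .impE (.impI h₀) (.impE (HOL.listU_zero e.wf.1 hl hP).andE₁ e)
  · have hi : HIx.HasSort (.nat :: Δ) Γ (HIx.ivar 0) .nat := HIx.Maps.ivar _ _ 0 .nat rfl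
    have hn' : (n.shift 0 1).HasSort (.nat :: Δ) Γ .nat := hn.sub (Tm.Maps.var _) (HIx.Maps.ish _ _ _)
    have hc : Fml.WF (.nat :: Δ) Γ
        (.cst (.eq (n.shift 0 1) (.add (HIx.ivar 0) (.num 1)))) := ⟨hn'.real, hi.real, trivial⟩
    have hh := (h.ishift .nat).weaken_cons hc
    have e := listU_irew (hyp_cons hc (hΨ.ishift _)) (n' := .add (HIx.ivar 0) (.num 1))
      ⟨hi, trivial⟩ hh
    refine listU_succ_elim (hχ.ishift _) e fun Ψ' hΨ' _ => ?_
    subst hΨ'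
    have e1 : ∀ φ : Fml, (φ.ishift 1).shift 2 = φ.sub (Tm.sh 2) (HIx.ish 1) := by
      intro φ
      simp only [Fml.ishift, Fml.shift, Fml.isub, Fml.tsub, Fml.sub_sub]
      exact Fml.sub_congr _ (fun n => rfl) (fun i => rfl)
    rw [e1]
    convert h₁ using 1
    have e2 : ∀ ψ ∈ Ψ, ((Fml.shift 2 ∘ Fml.ishift 1) ψ) = ψ.sub (Tm.sh 2) (HIx.ish 1) :=
      fun ψ _ => e1 ψ
    simp only [List.map_cons, List.map_map, Fml.tsub, Fml.sub_sub, Tm.subst_var]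
    congr 1
    · congr 1
      exact Fml.sub_congr _ (fun n => by cases n <;> simp [Tm.up_eq, Tm.subst])
        (fun i => by simp; rfl)
    congr 1
    · exact Fml.sub_congr _ (fun n => by cases n <;> simp [Tm.up_eq, Tm.subst])
        (fun i => by simp; rfl)
    congr 1
    congr 1
    · simp only [Fml.shift, Fml.tsub, Fml.cst_sub, HCst.eq_sub, HIx.shift_eq, HIx.sub_sub]
      rfl
    · exact List.map_congr_left e2

theorem listU_ind {τ : Ty} {n : HIx} {l : Tm} {P χ : Fml} (hχ : χ.WF (.nat :: Δ) (.list τ :: Γ))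
    (h : HOL Δ Γ Ψ (.listU τ n l P))
    (h₀ : HOL Δ Γ Ψ (χ.sub (.nil ;; Tm.var) (.num 0 ;; HIx.ivar)))
    (h₁ : HOL (.nat :: Δ) (.list τ :: τ :: Γ)
      (χ.sub (.var 0 ;; Tm.sh 2) HIx.ivar :: P.sub (.var 1 ;; Tm.sh 2) (HIx.ish 1) ::
        Ψ.map (fun ψ => ψ.sub (Tm.sh 2) (HIx.ish 1)))
      (χ.sub (.cons (.var 1) (.var 0) ;; Tm.sh 2) (.add (HIx.ivar 0) (.num 1) ;; HIx.ish 1))) :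
    HOL Δ Γ Ψ (χ.sub (l ;; Tm.var) (n ;; HIx.ivar)) := by
  obtain ⟨hn, hl, hP⟩ := h.wf.2
  have hΨ := h.wf.1
  have hi : HIx.HasSort (.nat :: Δ) Γ (HIx.ivar 0) .nat := HIx.Maps.ivar _ _ 0 .nat rfl
  have hLw : Fml.WF (.nat :: Δ) (.list τ :: Γ)
      (.listU τ (HIx.ivar 0) (.var 0) (P.sub (Tm.up (Tm.sh 1)) (HIx.ish 1))) :=
    ⟨HIx.Maps.ivar _ _ 0 .nat rfl, .var rfl,
      hP.sub ((Tm.Maps.sh_one _ _).up _) (HIx.Maps.ish _ _ _)⟩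
  have hF : Fml.WF (.nat :: Δ) Γ (.all (.list τ) (.imp
      (.listU τ (HIx.ivar 0) (.var 0) (P.sub (Tm.up (Tm.sh 1)) (HIx.ish 1))) χ)) := ⟨hLw, hχ⟩
  have key : HOL Δ Γ Ψ (.alli .nat (.all (.list τ) (.imp
      (.listU τ (HIx.ivar 0) (.var 0) (P.sub (Tm.up (Tm.sh 1)) (HIx.ish 1))) χ))) := by
    refine HOL.inat hF ?_ ?_
    · have hL0 : Fml.WF Δ (.list τ :: Γ)
          (.listU τ (.num 0) (.var 0) (P.sub (Tm.up (Tm.sh 1)) HIx.ivar)) :=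
        ⟨trivial, .var rfl, hP.sub ((Tm.Maps.sh_one _ _).up _) (HIx.Maps.ivar _ _)⟩
      have hcn := hχ.sub (Tm.Maps.var _) ((HIx.Maps.ivar Δ (.list τ :: Γ)).cons
        (I := .num 0) (S := .nat) trivial)
      have e : HOL Δ Γ Ψ (.all (.list τ) (.imp
          (.listU τ (.num 0) (.var 0) (P.sub (Tm.up (Tm.sh 1)) HIx.ivar))
          (χ.sub Tm.var (.num 0 ;; HIx.ivar)))) := by
        refine .allI hΨ (.impI ?_)
        have e1 := (HOL.impE (HOL.listU_zero ((hΨ.shift (.list τ)).cons hL0) (.var rfl)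
          hL0.2.2).andE₁ (hyp_cons hL0 (hΨ.shift _))).eq_symm
        refine e1.rew (φ := χ.sub (.var 0 ;; Tm.sh 2) (.num 0 ;; HIx.ivar))
          ((h₀.shift (.list τ)).weaken_cons hL0) ?_ ?_ ?_
        · exact hχ.sub ((Tm.Maps.sh_two _ _ _).cons (.var rfl)) ((HIx.Maps.ivar _ _).cons
            (I := .num 0) (S := .nat) trivial)
        · simp only [Fml.inst, Fml.tsub, Fml.shift, Fml.sub_sub]
          exact Fml.sub_congr _ (fun n => by cases n <;> simp [Tm.subst])
            (fun i => by cases i <;> simp)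
        · simp only [Fml.inst, Fml.tsub, Fml.sub_sub]
          exact Fml.sub_congr _ (fun n => by cases n <;> simp [Tm.subst])
            (fun i => by cases i <;> simp)
      refine (congrArg (HOL Δ Γ Ψ) ?_).mpr e
      simp only [Fml.iinst, Fml.isub, Fml.all_sub, Fml.imp_sub, Fml.listU_sub, Fml.sub_sub]
      congr 2
      · congr 1
        exact Fml.sub_congr _ (fun n => by cases n <;> simp [Tm.up_eq, Tm.subst])
          (fun i => by simp [Fml.tlift])
      · exact Fml.sub_congr _ (fun n => by cases n <;> simp [Tm.up_eq, Tm.subst])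
          (fun i => by cases i <;> simp [Fml.tlift])
    · have hL1 : Fml.WF (.nat :: Δ) (.list τ :: Γ) (.listU τ (.add (HIx.ivar 0) (.num 1)) (.var 0)
          (P.sub (Tm.up (Tm.sh 1)) (HIx.ish 1))) := ⟨⟨hi, trivial⟩, hLw.2⟩
      have hm : HIx.Maps (.nat :: Δ) (.add (HIx.ivar 0) (.num 1) ;; HIx.ish 1) (.nat :: Δ)
          (.list τ :: Γ) := (HIx.Maps.ish _ _ _).cons (S := .nat) ⟨hi, trivial⟩
      have hΨ' := (hΨ.ishift .nat).cons hF
      have e : HOL (.nat :: Δ) Γ ((.all (.list τ) (.imp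
          (.listU τ (HIx.ivar 0) (.var 0) (P.sub (Tm.up (Tm.sh 1)) (HIx.ish 1))) χ)) ::
          Ψ.map (Fml.ishift 1)) (.all (.list τ) (.imp
          (.listU τ (.add (HIx.ivar 0) (.num 1)) (.var 0) (P.sub (Tm.up (Tm.sh 1)) (HIx.ish 1)))
          (χ.sub Tm.var (.add (HIx.ivar 0) (.num 1) ;; HIx.ish 1)))) := by
        refine .allI hΨ' (.impI (listU_succ_elim (hχ.sub (Tm.Maps.var _) hm)
          (hyp_cons hL1 (hΨ'.shift _)) ?_))
        intro Ψ' eΨ hw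
        have hL : HOL (.nat :: Δ) (.list τ :: τ :: .list τ :: Γ) Ψ' (.listU τ (HIx.ivar 0) (.var 0)
            (P.sub (.var 0 ;; Tm.sh 4) (HIx.ish 1))) := by
          refine .ax hw (eΨ ▸ List.mem_cons.2 (.inl ?_))
          simp only [Fml.tsub, Fml.sub_sub]
          congr 1
          exact Fml.sub_congr _ (fun n => by cases n <;> simp [Tm.up_eq, Tm.subst])
            (fun i => by simp)
        have hPw : HOL (.nat :: Δ) (.list τ :: τ :: .list τ :: Γ) Ψ'
            (P.sub (.var 1 ;; Tm.sh 3) (HIx.ish 1)) := by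
          refine .ax hw (eΨ ▸ List.mem_cons_of_mem _ (List.mem_cons.2 (.inl ?_)))
          simp only [Fml.tsub, Fml.sub_sub]
          exact Fml.sub_congr _ (fun n => by cases n <;> simp [Tm.up_eq, Tm.subst])
            (fun i => by simp)
        have hE : HOL (.nat :: Δ) (.list τ :: τ :: .list τ :: Γ) Ψ'
            (.eq (.list τ) (.var 2) (.cons (.var 1) (.var 0))) :=
          .ax hw (eΨ ▸ List.mem_cons_of_mem _ (List.mem_cons_of_mem _ List.mem_cons_self))
        have hΨ3 : ∀ φ ∈ Ψ, HOL (.nat :: Δ) (.list τ :: τ :: .list τ :: Γ) Ψ'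
            (φ.sub (Tm.sh 3) (HIx.ish 1)) := by
          refine fun φ hφ => .ax hw (eΨ ▸ ?_)
          refine List.mem_cons_of_mem _ (List.mem_cons_of_mem _ (List.mem_cons_of_mem _ ?_))
          simp only [List.map_cons, List.map_map]
          refine List.mem_cons_of_mem _ (List.mem_cons_of_mem _ (List.mem_map.2 ⟨φ, hφ, ?_⟩))
          simp only [Function.comp, Fml.shift, Fml.ishift, Fml.tsub, Fml.isub, Fml.sub_sub]
          exact Fml.sub_congr _ (fun n => rfl) (fun i => rfl)
        have hF3 : HOL (.nat :: Δ) (.list τ :: τ :: .list τ :: Γ) Ψ' (Fml.sub (.all (.list τ) (.imp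
            (.listU τ (HIx.ivar 0) (.var 0) (P.sub (Tm.up (Tm.sh 1)) (HIx.ish 1))) χ))
              (Tm.sh 3) HIx.ivar) := by
          refine .ax hw (eΨ ▸ ?_)
          refine List.mem_cons_of_mem _ (List.mem_cons_of_mem _ (List.mem_cons_of_mem _ ?_))
          simp only [List.map_cons]
          refine List.mem_cons_of_mem _ (List.mem_cons.2 (.inl ?_))
          simp only [Fml.shift, Fml.tsub, Fml.sub_sub]
          exact Fml.sub_congr _ (fun n => rfl) (fun i => rfl)
        have hIH : HOL (.nat :: Δ) (.list τ :: τ :: .list τ :: Γ) Ψ'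
            (χ.sub (.var 0 ;; Tm.sh 3) HIx.ivar) := by
          refine (congrArg (HOL _ _ Ψ') ?_).mpr (all_imp_elim (t := .var 0) hF3 (.var rfl)
            ((congrArg (HOL _ _ Ψ') ?_).mpr hL))
          · simp only [Fml.sub_sub]
            exact Fml.sub_congr _ (fun n => by cases n <;> simp [Tm.up_eq, Tm.subst])
              (fun i => rfl)
          · simp only [Fml.sub_sub, Fml.listU_sub]
            congr 1
            exact Fml.sub_congr _ (fun n => by cases n <;> simp [Tm.up_eq, Tm.subst])
              (fun i => rfl)
        have hm3 : Tm.Maps Γ (Tm.sh 3) (.list τ :: τ :: .list τ :: Γ) := Tm.Maps.sh_three _ _ _ _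
        have e1 := h₁.sub_cut (Ψ' := Ψ') (σ := .var 0 ;; .var 1 ;; Tm.sh 3) (θ := HIx.ivar)
          ((hm3.cons (t := .var 1) (.var rfl)).cons (t := .var 0) (.var rfl))
          (HIx.Maps.ivar _ _) hw ?_
        · refine hE.eq_symm.rew (φ := χ.sub (.var 0 ;; Tm.sh 4)
            (.add (HIx.ivar 0) (.num 1) ;; HIx.ish 1)) e1 ?_ ?_ ?_
          · exact hχ.sub ((hm3.comp (Tm.Maps.sh_one _ _)).cons (.var rfl))
              ((HIx.Maps.ish _ _ _).cons (S := .nat) ⟨HIx.Maps.ivar _ _ 0 .nat rfl, trivial⟩)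
          · simp only [Fml.inst, Fml.tsub, Fml.sub_sub]
            exact Fml.sub_congr _ (fun n => by cases n <;> simp [Tm.subst])
              (fun i => by cases i <;> simp)
          · simp only [Fml.inst, Fml.shift, Fml.tsub, Fml.sub_sub]
            exact Fml.sub_congr _ (fun n => by cases n <;> simp [Tm.subst])
              (fun i => by cases i <;> simp)
        · refine List.forall_mem_cons.2 ⟨?_, List.forall_mem_cons.2 ⟨?_, fun ψ hψ => ?_⟩⟩
          · refine (congrArg (HOL _ _ Ψ') ?_).mpr hIH
            simp only [Fml.sub_sub]
            exact Fml.sub_congr _ (fun n => by cases n <;> simp [Tm.subst]) (fun i => rfl)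
          · refine (congrArg (HOL _ _ Ψ') ?_).mpr hPw
            simp only [Fml.sub_sub]
            exact Fml.sub_congr _ (fun n => by cases n <;> simp [Tm.subst]) (fun i => rfl)
          · obtain ⟨φ, hφ, rfl⟩ := List.mem_map.1 hψ
            refine (congrArg (HOL _ _ Ψ') ?_).mpr (hΨ3 φ hφ)
            simp only [Fml.sub_sub]
            exact Fml.sub_congr _ (fun n => by simp [Tm.subst]) (fun i => rfl)
      refine (congrArg (HOL (.nat :: Δ) Γ _) ?_).mpr e
      simp only [Fml.isub, Fml.all_sub, Fml.imp_sub, Fml.listU_sub, Fml.sub_sub]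
      congr 2
      · congr 1
        exact Fml.sub_congr _ (fun n => by cases n <;> simp [Tm.up_eq, Tm.subst])
          (fun i => by simp [Fml.tlift])
      · exact Fml.sub_congr _ (fun n => by cases n <;> simp [Tm.up_eq, Tm.subst])
          (fun i => by cases i <;> simp [Fml.tlift])
  refine (congrArg (HOL Δ Γ Ψ) ?_).mpr (all_imp_elim (key.alliE hn) (t := l) hl ?_)
  · simp only [Fml.sub_sub]
    refine Fml.sub_congr _ (fun n => by cases n <;> simp [Tm.up_eq, Tm.subst]) (fun i => ?_)
    cases i with
    | zero =>
      simp only [scons_zero, HIx.shift_eq, HIx.sub_sub]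
      exact (HIx.sub_id n).symm
    | succ i => rfl
  · refine (congrArg (HOL Δ Γ Ψ) ?_).mpr h
    simp only [Fml.sub_sub, Fml.listU_sub]
    congr 1
    · simp only [HIx.ivar_sub, scons_zero, HIx.shift_eq, HIx.sub_sub]
      exact HIx.sub_id n
    · exact Fml.sub_eq_self _ (fun n => by cases n <;> simp [Tm.up_eq, Tm.subst])
        (fun i => by simp [Fml.tlift, HIx.shift_eq])

end HOL

namespace HOL

/-- `Ext Δ Γ Ψ σ θ Δ' Γ' Ψ'`: the substitutions `σ` and `θ` map the sequent context `Δ; Γ; Ψ` to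
`Δ'; Γ'; Ψ'`, in which the instances of `Ψ` are derivable. -/
structure Ext (Δ : ICtx) (Γ : Ctx) (Ψ : List Fml) (σ : ℕ → Tm) (θ : ℕ → HIx) (Δ' : ICtx) (Γ' : Ctx)
    (Ψ' : List Fml) : Prop where
  tm : Tm.Maps Γ σ Γ'
  ix : HIx.Maps Δ θ Δ' Γ'
  wf : CWF Δ' Γ' Ψ'
  hyps : ∀ ψ ∈ Ψ, HOL Δ' Γ' Ψ' (ψ.sub σ θ)

variable {Δ Δ' Δ'' : ICtx} {Γ Γ' Γ'' : Ctx} {Ψ Ψ' Ψ'' : List Fml} {σ σ' : ℕ → Tm} {θ θ' : ℕ → HIx}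

theorem Ext.hol (e : Ext Δ Γ Ψ σ θ Δ' Γ' Ψ') {φ : Fml} (h : HOL Δ Γ Ψ φ) :
    HOL Δ' Γ' Ψ' (φ.sub σ θ) :=
  h.sub_cut e.tm e.ix e.wf e.hyps

theorem Ext.hol_eq (e : Ext Δ Γ Ψ σ θ Δ' Γ' Ψ') {τ : Ty} {t u : Tm} (h : HOL Δ Γ Ψ (.eq τ t u)) :
    HOL Δ' Γ' Ψ' (.eq τ (t.subst σ) (u.subst σ)) := e.hol h

theorem Ext.hol_cst (e : Ext Δ Γ Ψ σ θ Δ' Γ' Ψ') {C : HCst} (h : HOL Δ Γ Ψ (.cst C)) :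
    HOL Δ' Γ' Ψ' (.cst (C.sub σ θ)) := e.hol h

theorem Ext.comp (e : Ext Δ Γ Ψ σ θ Δ' Γ' Ψ') (e' : Ext Δ' Γ' Ψ' σ' θ' Δ'' Γ'' Ψ'') :
    Ext Δ Γ Ψ (fun n => (σ n).subst σ') (fun i => (θ i).sub σ' θ') Δ'' Γ'' Ψ'' where
  tm := e.tm.comp e'.tm
  ix := e.ix.sub e'.tm e'.ix
  wf := e'.wf
  hyps ψ hψ := by simpa only [Fml.sub_sub] using e'.hol (e.hyps ψ hψ)

theorem Ext.weaken (hΨ : CWF Δ Γ Ψ') (h : ∀ ψ ∈ Ψ, ψ ∈ Ψ') :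
    Ext Δ Γ Ψ Tm.var HIx.ivar Δ Γ Ψ' where
  tm := Tm.Maps.var _
  ix := HIx.Maps.ivar _ _
  wf := hΨ
  hyps ψ hψ := by simpa only [Fml.sub_id] using HOL.ax hΨ (h ψ hψ)

theorem Ext.cons {φ : Fml} (hφ : φ.WF Δ Γ) (hΨ : CWF Δ Γ Ψ) :
    Ext Δ Γ Ψ Tm.var HIx.ivar Δ Γ (φ :: Ψ) :=
  .weaken (hΨ.cons hφ) fun _ h => List.mem_cons_of_mem _ h

theorem Ext.shift (hΨ : CWF Δ Γ Ψ) (τ : Ty) :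
    Ext Δ Γ Ψ (Tm.sh 1) HIx.ivar Δ (τ :: Γ) (Ψ.map (Fml.shift 1)) where
  tm := Tm.Maps.sh_one _ _
  ix := HIx.Maps.ivar _ _
  wf := hΨ.shift τ
  hyps ψ hψ := .ax (hΨ.shift τ) (List.mem_map_of_mem hψ)

theorem Ext.ishift (hΨ : CWF Δ Γ Ψ) (S : Srt) :
    Ext Δ Γ Ψ Tm.var (HIx.ish 1) (S :: Δ) Γ (Ψ.map (Fml.ishift 1)) where
  tm := Tm.Maps.var _
  ix := HIx.Maps.ish _ _ _
  wf := hΨ.ishift S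
  hyps ψ hψ := .ax (hΨ.ishift S) (List.mem_map_of_mem hψ)

theorem impI' {φ ψ : Fml} (hφ : φ.WF Δ Γ) (hΨ : CWF Δ Γ Ψ)
    (h : ∀ Ψ', Ext Δ Γ Ψ Tm.var HIx.ivar Δ Γ Ψ' → HOL Δ Γ Ψ' φ → HOL Δ Γ Ψ' ψ) :
    HOL Δ Γ Ψ (.imp φ ψ) :=
  .impI (h _ (.cons hφ hΨ) (hyp_cons hφ hΨ))

theorem allI' {τ : Ty} {φ : Fml} (hΨ : CWF Δ Γ Ψ)
    (h : ∀ Ψ', Ext Δ Γ Ψ (Tm.sh 1) HIx.ivar Δ (τ :: Γ) Ψ' → HOL Δ (τ :: Γ) Ψ' φ) :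
    HOL Δ Γ Ψ (.all τ φ) :=
  .allI hΨ (h _ (.shift hΨ τ))

theorem all_impI {τ : Ty} {φ ψ : Fml} (hφ : φ.WF Δ (τ :: Γ)) (hΨ : CWF Δ Γ Ψ)
    (h : ∀ Ψ', Ext Δ Γ Ψ (Tm.sh 1) HIx.ivar Δ (τ :: Γ) Ψ' → HOL Δ (τ :: Γ) Ψ' φ →
      HOL Δ (τ :: Γ) Ψ' ψ) :
    HOL Δ Γ Ψ (.all τ (.imp φ ψ)) :=
  allI' hΨ fun _ e => impI' hφ e.wf fun Ψ'' e' h' => h Ψ'' (by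
    simpa only [Tm.subst_var, HIx.sub_id] using e.comp e') h'

theorem alliI' {S : Srt} {φ : Fml} (hΨ : CWF Δ Γ Ψ)
    (h : ∀ Ψ', Ext Δ Γ Ψ Tm.var (HIx.ish 1) (S :: Δ) Γ Ψ' → HOL (S :: Δ) Γ Ψ' φ) :
    HOL Δ Γ Ψ (.alli S φ) :=
  .alliI hΨ (h _ (.ishift hΨ S))

theorem exE' {τ : Ty} {φ χ : Fml} (h : HOL Δ Γ Ψ (.ex τ φ)) (hχ : χ.WF Δ Γ)
    (h' : ∀ Ψ', Ext Δ Γ Ψ (Tm.sh 1) HIx.ivar Δ (τ :: Γ) Ψ' → HOL Δ (τ :: Γ) Ψ' φ →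
      HOL Δ (τ :: Γ) Ψ' (χ.sub (Tm.sh 1) HIx.ivar)) : HOL Δ Γ Ψ χ :=
  .exE h hχ (h' _ (by
    simpa only [Tm.subst_var, HIx.sub_id] using
      (Ext.shift h.wf.1 τ).comp (.cons h.wf.2 (h.wf.1.shift τ))) (hyp_cons h.wf.2 (h.wf.1.shift τ)))

theorem exiE' {S : Srt} {φ χ : Fml} (h : HOL Δ Γ Ψ (.exi S φ)) (hχ : χ.WF Δ Γ)
    (h' : ∀ Ψ', Ext Δ Γ Ψ Tm.var (HIx.ish 1) (S :: Δ) Γ Ψ' → HOL (S :: Δ) Γ Ψ' φ →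
      HOL (S :: Δ) Γ Ψ' (χ.sub Tm.var (HIx.ish 1))) : HOL Δ Γ Ψ χ :=
  .exiE h hχ (h' _ (by
    simpa only [Tm.subst_var, HIx.sub_id] using
      (Ext.ishift h.wf.1 S).comp (.cons h.wf.2 (h.wf.1.ishift S)))
    (hyp_cons h.wf.2 (h.wf.1.ishift S)))

theorem orE' {φ ψ χ : Fml} (h : HOL Δ Γ Ψ (.or φ ψ))
    (h₁ : ∀ Ψ', Ext Δ Γ Ψ Tm.var HIx.ivar Δ Γ Ψ' → HOL Δ Γ Ψ' φ → HOL Δ Γ Ψ' χ)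
    (h₂ : ∀ Ψ', Ext Δ Γ Ψ Tm.var HIx.ivar Δ Γ Ψ' → HOL Δ Γ Ψ' ψ → HOL Δ Γ Ψ' χ) : HOL Δ Γ Ψ χ :=
  .orE h (h₁ _ (.cons h.wf.2.1 h.wf.1) (hyp_cons h.wf.2.1 h.wf.1))
    (h₂ _ (.cons h.wf.2.2 h.wf.1) (hyp_cons h.wf.2.2 h.wf.1))

theorem ex4E {σ₁ σ₂ σ₃ σ₄ : Ty} {φ χ : Fml} (h : HOL Δ Γ Ψ (.ex σ₁ (.ex σ₂ (.ex σ₃ (.ex σ₄ φ)))))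
    (hχ : χ.WF Δ Γ)
    (h' : ∀ Ψ', Ext Δ Γ Ψ (Tm.sh 4) HIx.ivar Δ (σ₄ :: σ₃ :: σ₂ :: σ₁ :: Γ) Ψ' →
      HOL Δ (σ₄ :: σ₃ :: σ₂ :: σ₁ :: Γ) Ψ' φ →
      HOL Δ (σ₄ :: σ₃ :: σ₂ :: σ₁ :: Γ) Ψ' (χ.sub (Tm.sh 4) HIx.ivar)) : HOL Δ Γ Ψ χ := by
  have w := fun {Δ Γ χ} (h : Fml.WF Δ Γ χ) τ => h.sub (Tm.Maps.sh_one Γ τ) (HIx.Maps.ivar _ _)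
  refine exE' h hχ fun _ e₁ h₁ => exE' h₁ (w hχ _) fun _ e₂ h₂ =>
    exE' h₂ (w (w hχ _) _) fun _ e₃ h₃ => exE' h₃ (w (w (w hχ _) _) _) fun Ψ' e₄ h₄ => ?_
  simp only [Fml.sub_sub]
  exact h' Ψ' (((e₁.comp e₂).comp e₃).comp e₄) h₄

theorem listR_irew {τ : Ty} {n n' a a' : HIx} {l₁ l₂ : Tm} {P : Fml}
    (e₁ : HOL Δ Γ Ψ (.cst (.eq n n'))) (hn' : n'.HasSort Δ Γ .nat)
    (e₂ : HOL Δ Γ Ψ (.cst (.eq a a'))) (ha' : a'.HasSort Δ Γ .nat)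
    (h : HOL Δ Γ Ψ (.listR τ n l₁ l₂ a P)) : HOL Δ Γ Ψ (.listR τ n' l₁ l₂ a' P) := by
  obtain ⟨hn, hl₁, hl₂, ha, hP⟩ := h.wf.2
  have hi := HIx.Maps.ivar (.nat :: Δ) Γ 0 .nat rfl
  have hP' := hP.sub (Tm.Maps.var _) (HIx.Maps.ish Δ (τ :: τ :: Γ) .nat)
  have h₁ : HOL Δ Γ Ψ (.listR τ n' l₁ l₂ a P) := by
    refine e₁.irew (S := .nat) (φ := .listR τ (HIx.ivar 0) l₁ l₂ (a.sub Tm.var (HIx.ish 1))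
      (P.sub Tm.var (HIx.ish 1))) h
      ⟨hi, hl₁, hl₂, ha.sub (Tm.Maps.var _) (HIx.Maps.ish _ _ _), hP'⟩ hn hn' ?_ ?_ <;>
    · simp only [Fml.iinst, Fml.isub, Fml.listR_sub, Fml.sub_sub, Tm.subst_var, HIx.sub_sub]
      congr 1
      · exact HIx.sub_id a
      · exact Fml.sub_eq_self _ (fun n => by rcases n with _ | _ | n <;> simp [Tm.up_eq, Tm.subst])
          (fun i => by simp [Fml.tlift])
  refine e₂.irew (S := .nat) (φ := .listR τ (n'.sub Tm.var (HIx.ish 1)) l₁ l₂ (HIx.ivar 0)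
    (P.sub Tm.var (HIx.ish 1))) h₁
    ⟨hn'.sub (Tm.Maps.var _) (HIx.Maps.ish _ _ _), hl₁, hl₂, hi, hP'⟩ ha ha' ?_ ?_ <;>
  · simp only [Fml.iinst, Fml.isub, Fml.listR_sub, Fml.sub_sub, Tm.subst_var, HIx.sub_sub]
    congr 1
    · exact HIx.sub_id n'
    · exact Fml.sub_eq_self _ (fun n => by rcases n with _ | _ | n <;> simp [Tm.up_eq, Tm.subst])
        (fun i => by simp [Fml.tlift])

theorem listR_nil {τ : Ty} {a : HIx} {P : Fml} (hΨ : CWF Δ Γ Ψ) (ha : a.HasSort Δ Γ .nat)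
    (hP : P.WF Δ (τ :: τ :: Γ)) : HOL Δ Γ Ψ (.listR τ (.num 0) .nil .nil a P) :=
  .impE (HOL.listR_zero hΨ .nil .nil ha hP).andE₂ (.andI (eq_refl hΨ .nil) (eq_refl hΨ .nil))

theorem listR_cons {τ : Ty} {n a : HIx} {w z ws zs : Tm} {P : Fml} (hn : n.HasSort Δ Γ .nat)
    (ha : a.HasSort Δ Γ .nat) (hP : P.WF Δ (τ :: τ :: Γ)) (hw : HasTy Γ w τ) (hz : HasTy Γ z τ)
    (hws : HasTy Γ ws (.list τ)) (hzs : HasTy Γ zs (.list τ))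
    (h : HOL Δ Γ Ψ (P.sub (z ;; w ;; Tm.var) HIx.ivar))
    (h' : HOL Δ Γ Ψ (.or (.and (.eq τ w z) (.listR τ n ws zs a P))
      (.and (.cst (.lt (.num 0) a)) (.exi .nat (.and
        (.cst (.eq (a.sub Tm.var (HIx.ish 1)) (.add (HIx.ivar 0) (.num 1))))
        (.listR τ (n.sub Tm.var (HIx.ish 1)) ws zs (HIx.ivar 0) (P.sub Tm.var (HIx.ish 1)))))))) :
    HOL Δ Γ Ψ (.listR τ (.add n (.num 1)) (.cons w ws) (.cons z zs) a P) := by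
  have hs := listRSucc_wf hn (.cons hw hws) (.cons hz hzs) ha hP
  refine .impE (HOL.listR_succ h.wf.1 hn (.cons hw hws) (.cons hz hzs) ha hP).andE₂
    (ex4I hs hw hz hws hzs (.andI ?_ (.andI ?_ (.andI ?_ ?_))))
  · refine (congrArg (HOL Δ Γ Ψ) ?_).mpr (eq_refl h.wf.1 (.cons hw hws))
    simp only [Tm.shift_eq, Fml.eq_sub, Tm.subst_subst]
    congr 1
    exact Tm.subst_var _
  · refine (congrArg (HOL Δ Γ Ψ) ?_).mpr (eq_refl h.wf.1 (.cons hz hzs))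
    simp only [Tm.shift_eq, Fml.eq_sub, Tm.subst_subst]
    congr 1
    exact Tm.subst_var _
  · refine (congrArg (HOL Δ Γ Ψ) ?_).mpr h
    simp only [Fml.tsub, Fml.sub_sub]
    exact Fml.sub_congr _ (fun n => by rcases n with _ | _ | n <;> simp [Tm.subst]) (fun i => rfl)
  · refine (congrArg (HOL Δ Γ Ψ) ?_).mpr h'
    simp only [Fml.or_sub, Fml.and_sub, Fml.eq_sub, Fml.listR_sub, Fml.cst_sub, Fml.exi_sub,
      HCst.lt_sub, HCst.eq_sub, HIx.shift_eq, HIx.sub_sub, Fml.tsub, Fml.sub_sub]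
    congr 1
    · congr 1
      congr 1
      · exact HIx.sub_id n
      · exact HIx.sub_id a
      · exact Fml.sub_eq_self _ (fun n => by rcases n with _ | _ | n <;> simp [Tm.up_eq, Tm.subst])
          (fun i => rfl)
    · congr 1
      · congr 2
        exact HIx.sub_id a
      congr 1
      congr 1
      congr 1
      exact Fml.sub_congr _ (fun n => by rcases n with _ | _ | n <;> simp [Tm.up_eq, Tm.subst])
          (fun i => rfl)

theorem listR_cons_eq {τ : Ty} {n a : HIx} {w z ws zs : Tm} {P : Fml}
    (h : HOL Δ Γ Ψ (P.sub (z ;; w ;; Tm.var) HIx.ivar)) (e : HOL Δ Γ Ψ (.eq τ w z))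
    (h' : HOL Δ Γ Ψ (.listR τ n ws zs a P)) :
    HOL Δ Γ Ψ (.listR τ (.add n (.num 1)) (.cons w ws) (.cons z zs) a P) := by
  obtain ⟨hn, hl₁, hl₂, ha, hP⟩ := h'.wf.2
  have hi := HIx.Maps.ivar (.nat :: Δ) Γ 0 .nat rfl
  refine listR_cons hn ha hP e.wf.2.1 e.wf.2.2 hl₁ hl₂ h (.orI₁ (.andI e h') ?_)
  exact ⟨⟨trivial, ha.real⟩, ⟨(ha.sub (Tm.Maps.var _) (HIx.Maps.ish _ _ _)).real, hi.real, trivial⟩,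
    hn.sub (Tm.Maps.var _) (HIx.Maps.ish _ _ _), hl₁, hl₂, hi,
    hP.sub (Tm.Maps.var _) (HIx.Maps.ish _ _ _)⟩

theorem listR_cons_add {τ : Ty} {n b : HIx} {w z ws zs : Tm} {P : Fml}
    (h : HOL Δ Γ Ψ (P.sub (z ;; w ;; Tm.var) HIx.ivar)) (hw : HasTy Γ w τ) (hz : HasTy Γ z τ)
    (h' : HOL Δ Γ Ψ (.listR τ n ws zs b P)) :
    HOL Δ Γ Ψ (.listR τ (.add n (.num 1)) (.cons w ws) (.cons z zs) (.add b (.num 1)) P) := by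
  obtain ⟨hn, hl₁, hl₂, hb, hP⟩ := h'.wf.2
  have hΨ := h.wf.1
  have hi := HIx.Maps.ivar (.nat :: Δ) Γ 0 .nat rfl
  have ha : HIx.HasSort Δ Γ (.add b (.num 1)) .nat := ⟨hb, trivial⟩
  refine listR_cons hn ha hP hw hz hl₁ hl₂ h (.orI₂ ⟨⟨hw, hz⟩, hn, hl₁, hl₂, ha, hP⟩
    (.andI ?_ (.exiI (I := b) ?_ hb (.andI ?_ ?_))))
  · refine .arith [.nat] [] (.lt (.num 0) (.add (.leaf 0) (.num 1))) (b ;; HIx.ivar) hΨ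
      (by simp) (by simp [ICst.WF, Cst.AllLeaves, Ix.AllLeaves]) ?_ (HIx.Maps.nil.cons hb) (by simp)
    intro δ hδ _
    obtain ⟨m, hm⟩ := hδ 0 .nat rfl
    simp only [Cst.Holds, Ix.eval, hm]
    exact_mod_cast Nat.succ_pos m
  · exact ⟨⟨(ha.sub (Tm.Maps.var _) (HIx.Maps.ish _ _ _)).real, hi.real, trivial⟩,
      hn.sub (Tm.Maps.var _) (HIx.Maps.ish _ _ _), hl₁, hl₂, hi,
      hP.sub (Tm.Maps.var _) (HIx.Maps.ish _ _ _)⟩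
  · refine (congrArg (HOL Δ Γ Ψ) ?_).mpr (cst_refl hΨ ha.real)
    simp only [Fml.cst_sub, HCst.eq_sub, HIx.sub_sub]
    congr 2
    exact HIx.sub_id _
  · refine (congrArg (HOL Δ Γ Ψ) ?_).mpr h'
    simp only [Fml.listR_sub, HIx.sub_sub, Fml.sub_sub, Tm.subst_var]
    congr 1
    · exact HIx.sub_id _
    · exact Fml.sub_eq_self _ (fun n => by rcases n with _ | _ | n <;> simp [Tm.up_eq, Tm.subst])
          (fun i => by simp [Fml.tlift])

end HOL

theorem HasTy.consArgs {Γ : Ctx} {w ws : Tm} {τ : Ty} (h : HasTy Γ (.cons w ws) (.list τ)) :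
    HasTy Γ w τ ∧ HasTy Γ ws (.list τ) := by
  cases h with | cons h h' => exact ⟨h, h'⟩

namespace HOL

variable {Δ : ICtx} {Γ : Ctx} {Ψ : List Fml}

theorem listR_succ_elim {τ : Ty} {n a : HIx} {l₁ l₂ : Tm} {P χ : Fml} (hχ : χ.WF Δ Γ)
    (h : HOL Δ Γ Ψ (.listR τ (.add n (.num 1)) l₁ l₂ a P))
    (h₁ : ∀ {Γ' Ψ' σ w z ws zs}, Ext Δ Γ Ψ σ HIx.ivar Δ Γ' Ψ' →
      HOL Δ Γ' Ψ' (.eq (.list τ) (l₁.subst σ) (.cons w ws)) →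
      HOL Δ Γ' Ψ' (.eq (.list τ) (l₂.subst σ) (.cons z zs)) →
      HOL Δ Γ' Ψ' (P.sub (z ;; w ;; σ) HIx.ivar) → HOL Δ Γ' Ψ' (.eq τ w z) →
      HOL Δ Γ' Ψ' (.listR τ (n.sub σ HIx.ivar) ws zs (a.sub σ HIx.ivar)
        (P.sub (Tm.up (Tm.up σ)) HIx.ivar)) → HOL Δ Γ' Ψ' (χ.sub σ HIx.ivar))
    (h₂ : ∀ {Γ' Ψ' σ w z ws zs}, Ext Δ Γ Ψ σ (HIx.ish 1) (.nat :: Δ) Γ' Ψ' →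
      HOL (.nat :: Δ) Γ' Ψ' (.eq (.list τ) (l₁.subst σ) (.cons w ws)) →
      HOL (.nat :: Δ) Γ' Ψ' (.eq (.list τ) (l₂.subst σ) (.cons z zs)) →
      HOL (.nat :: Δ) Γ' Ψ' (P.sub (z ;; w ;; σ) (HIx.ish 1)) →
      HOL (.nat :: Δ) Γ' Ψ' (.cst (.eq (a.sub σ (HIx.ish 1)) (.add (HIx.ivar 0) (.num 1)))) →
      HOL (.nat :: Δ) Γ' Ψ' (.listR τ (n.sub σ (HIx.ish 1)) ws zs (HIx.ivar 0)
        (P.sub (Tm.up (Tm.up σ)) (HIx.ish 1))) → HOL (.nat :: Δ) Γ' Ψ' (χ.sub σ (HIx.ish 1))) :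
    HOL Δ Γ Ψ χ := by
  obtain ⟨⟨hn, -⟩, hl₁, hl₂, ha, hP⟩ := h.wf.2
  refine ex4E (.impE (HOL.listR_succ h.wf.1 hn hl₁ hl₂ ha hP).andE₁ h) hχ fun Ψ₁ e hh => ?_
  have hχ' : (χ.sub (Tm.sh 4) HIx.ivar).WF Δ (.list τ :: .list τ :: τ :: τ :: Γ) :=
    hχ.sub (Tm.Maps.sh_four _ _ _ _ _) (HIx.Maps.ivar _ _)
  have hE₁ := hh.andE₁
  have hE₂ := hh.andE₂.andE₁
  have hPw := hh.andE₂.andE₂.andE₁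
  have hor := hh.andE₂.andE₂.andE₂
  rw [Tm.shift_eq] at hE₁ hE₂
  refine orE' hor (fun Ψ₂ e₂ hh => ?_) (fun Ψ₂ e₂ hh => exiE' hh.andE₂ hχ' fun Ψ₃ e₃ hh => ?_)
  · refine h₁ (w := .var 3) (z := .var 2) (ws := .var 1) (zs := .var 0) ?_ ?_ ?_ ?_ hh.andE₁ ?_
    · simpa only [Tm.subst_var, HIx.sub_id] using e.comp e₂
    · simpa only [Tm.subst_var] using e₂.hol_eq hE₁
    · simpa only [Tm.subst_var] using e₂.hol_eq hE₂
    · simpa only [Fml.sub_id, Fml.tsub] using e₂.hol hPw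
    · refine (congrArg (HOL _ _ _) ?_).mpr hh.andE₂
      congr 1
      exact Fml.sub_congr _ (fun n => by rcases n with _ | _ | n <;> simp [Tm.up_eq, Tm.subst])
        (fun i => rfl)
  · rw [Fml.sub_sub]
    have e' := (e.comp e₂).comp e₃
    refine h₂ (w := .var 3) (z := .var 2) (ws := .var 1) (zs := .var 0) (σ := Tm.sh 4) ?_ ?_ ?_ ?_
      hh.andE₁ ?_
    · exact e'
    · have := e₃.hol_eq (e₂.hol_eq hE₁)
      simpa only [Tm.subst_var] using this
    · have := e₃.hol_eq (e₂.hol_eq hE₂)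
      simpa only [Tm.subst_var] using this
    · refine (congrArg (HOL _ _ _) ?_).mpr (e₃.hol (e₂.hol hPw))
      simp only [Fml.tsub, Fml.sub_sub]
      exact Fml.sub_congr _ (fun n => by rcases n with _ | _ | n <;> simp [Tm.subst])
        (fun i => rfl)
    · refine (congrArg (HOL _ _ _) ?_).mpr hh.andE₂
      congr 1
      exact Fml.sub_congr _ (fun n => by rcases n with _ | _ | n <;> simp [Tm.up_eq, Tm.subst])
        (fun i => rfl)

/-- Case analysis on related lists. -/
theorem listR_cases {τ : Ty} {n a : HIx} {l₁ l₂ : Tm} {P χ : Fml} (hχ : χ.WF Δ Γ)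
    (h : HOL Δ Γ Ψ (.listR τ n l₁ l₂ a P))
    (h₀ : ∀ {Ψ'}, Ext Δ Γ Ψ Tm.var HIx.ivar Δ Γ Ψ' → HOL Δ Γ Ψ' (.eq (.list τ) l₁ .nil) →
      HOL Δ Γ Ψ' (.eq (.list τ) l₂ .nil) → HOL Δ Γ Ψ' (.cst (.eq n (.num 0))) → HOL Δ Γ Ψ' χ)
    (h₁ : ∀ {Δ' Γ' Ψ' σ θ i w z ws zs}, Ext Δ Γ Ψ σ θ Δ' Γ' Ψ' →
      HOL Δ' Γ' Ψ' (.eq (.list τ) (l₁.subst σ) (.cons w ws)) →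
      HOL Δ' Γ' Ψ' (.eq (.list τ) (l₂.subst σ) (.cons z zs)) →
      HOL Δ' Γ' Ψ' (P.sub (z ;; w ;; σ) θ) → HOL Δ' Γ' Ψ' (.eq τ w z) →
      HOL Δ' Γ' Ψ' (.cst (.eq (n.sub σ θ) (.add i (.num 1)))) →
      HOL Δ' Γ' Ψ' (.listR τ i ws zs (a.sub σ θ) (P.sub (Tm.up (Tm.up σ)) (Fml.tlift θ 2))) →
      HOL Δ' Γ' Ψ' (χ.sub σ θ))
    (h₂ : ∀ {Δ' Γ' Ψ' σ θ i b w z ws zs}, Ext Δ Γ Ψ σ θ Δ' Γ' Ψ' →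
      HOL Δ' Γ' Ψ' (.eq (.list τ) (l₁.subst σ) (.cons w ws)) →
      HOL Δ' Γ' Ψ' (.eq (.list τ) (l₂.subst σ) (.cons z zs)) →
      HOL Δ' Γ' Ψ' (P.sub (z ;; w ;; σ) θ) →
      HOL Δ' Γ' Ψ' (.cst (.eq (n.sub σ θ) (.add i (.num 1)))) →
      HOL Δ' Γ' Ψ' (.cst (.eq (a.sub σ θ) (.add b (.num 1)))) →
      HOL Δ' Γ' Ψ' (.listR τ i ws zs b (P.sub (Tm.up (Tm.up σ)) (Fml.tlift θ 2))) →
      HOL Δ' Γ' Ψ' (χ.sub σ θ)) :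
    HOL Δ Γ Ψ χ := by
  obtain ⟨hn, hl₁, hl₂, ha, hP⟩ := h.wf.2
  have hΨ := h.wf.1
  refine nat_index_cases hΨ hn hχ ?_ ?_
  · have hc : Fml.WF Δ Γ (.cst (.eq n (.num 0))) := ⟨hn.real, trivial⟩
    have hc' := hyp_cons hc hΨ
    have e := HOL.impE (HOL.listR_zero hc'.wf.1 hl₁ hl₂ ha hP).andE₁
      (listR_irew hc' trivial (cst_refl hc'.wf.1 ha.real) ha (h.weaken_cons hc))
    exact h₀ (.cons hc hΨ) e.andE₁ e.andE₂ hc'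
  · have hi : HIx.HasSort (.nat :: Δ) Γ (HIx.ivar 0) .nat := HIx.Maps.ivar _ _ 0 .nat rfl
    have hn' : (n.shift 0 1).HasSort (.nat :: Δ) Γ .nat := hn.sub (Tm.Maps.var _) (HIx.Maps.ish _ _ _)
    have ha' : (a.shift 0 1).HasSort (.nat :: Δ) Γ .nat := ha.sub (Tm.Maps.var _) (HIx.Maps.ish _ _ _)
    have hc : Fml.WF (.nat :: Δ) Γ
        (.cst (.eq (n.shift 0 1) (.add (HIx.ivar 0) (.num 1)))) := ⟨hn'.real, hi.real, trivial⟩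
    have hc' := hyp_cons hc (hΨ.ishift _)
    have e₀ : Ext Δ Γ Ψ Tm.var (HIx.ish 1) (.nat :: Δ) Γ
        (.cst (.eq (n.shift 0 1) (.add (HIx.ivar 0) (.num 1))) :: Ψ.map (Fml.ishift 1)) := by
      simpa only [Tm.subst_var, HIx.sub_id] using (Ext.ishift hΨ .nat).comp (.cons hc (hΨ.ishift _))
    have e := listR_irew hc' (n' := .add (HIx.ivar 0) (.num 1)) ⟨hi, trivial⟩
      (cst_refl hc'.wf.1 ha'.real) ha' (e₀.hol h)
    refine listR_succ_elim (hχ.ishift _) e ?_ ?_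
    · intro Γ' Ψ' σ w z ws zs e₁ E₁ E₂ hPw E hl
      have hcc := e₁.hol_cst hc'
      simp only [Fml.ishift, Fml.isub, Fml.sub_sub, Tm.subst_subst, HCst.eq_sub, HIx.sub_sub,
        HIx.shift_eq] at hcc E₁ E₂ hPw hl ⊢
      refine h₁ (w := w) (z := z) (ws := ws) (zs := zs) (i := HIx.ivar 0) (e₀.comp e₁)
        ?_ ?_ ?_ E hcc ?_
      · simpa only [Tm.subst_subst, Tm.subst] using E₁
      · simpa only [Tm.subst_subst, Tm.subst] using E₂
      · refine (congrArg (HOL _ _ _) ?_).mpr hPw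
        exact Fml.sub_congr _ (fun n => by rcases n with _ | _ | n <;> simp [Tm.up_eq, Tm.subst])
          (fun i => rfl)
      · refine (congrArg (HOL _ _ _) ?_).mpr hl
        congr 1
        exact Fml.sub_congr _ (fun n => by rcases n with _ | _ | n <;> simp [Tm.up_eq, Tm.subst])
          (fun i => rfl)
    · intro Γ' Ψ' σ w z ws zs e₁ E₁ E₂ hPw E hl
      have hcc := e₁.hol_cst hc'
      simp only [Fml.ishift, Fml.isub, Fml.sub_sub, Tm.subst_subst, HCst.eq_sub, HIx.sub_sub,
        HIx.shift_eq] at hcc E₁ E₂ hPw hl E ⊢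
      refine h₂ (w := w) (z := z) (ws := ws) (zs := zs) (i := HIx.ivar 1) (b := HIx.ivar 0)
        (e₀.comp e₁) ?_ ?_ ?_ hcc E ?_
      · simpa only [Tm.subst_subst, Tm.subst] using E₁
      · simpa only [Tm.subst_subst, Tm.subst] using E₂
      · refine (congrArg (HOL _ _ _) ?_).mpr hPw
        exact Fml.sub_congr _ (fun n => by rcases n with _ | _ | n <;> simp [Tm.up_eq, Tm.subst])
          (fun i => rfl)
      · refine (congrArg (HOL _ _ _) ?_).mpr hl
        congr 1
        exact Fml.sub_congr _ (fun n => by rcases n with _ | _ | n <;> simp [Tm.up_eq, Tm.subst])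
          (fun i => rfl)

/-- Replacement of equal terms for the variables 0 and 1 of an assertion. -/
theorem sub_rew₂ {Δ₀ : ICtx} {Γ₀ : Ctx} {σ : ℕ → Tm} {θ : ℕ → HIx} {χ : Fml} {τ₁ τ₂ : Ty}
    {u₁ v₁ u₂ v₂ : Tm} (hχ : χ.WF Δ₀ (τ₂ :: τ₁ :: Γ₀)) (hσ : Tm.Maps Γ₀ σ Γ)
    (hθ : HIx.Maps Δ₀ θ Δ Γ) (e₁ : HOL Δ Γ Ψ (.eq τ₁ u₁ v₁)) (e₂ : HOL Δ Γ Ψ (.eq τ₂ u₂ v₂))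
    (h : HOL Δ Γ Ψ (χ.sub (u₂ ;; u₁ ;; σ) θ)) : HOL Δ Γ Ψ (χ.sub (v₂ ;; v₁ ;; σ) θ) := by
  have b₀ := e₁.rew (φ := χ.sub (u₂.subst (Tm.sh 1) ;; .var 0 ;; fun n => (σ n).subst (Tm.sh 1))
    (Fml.tlift θ 1)) h (hχ.sub (((hσ.comp (Tm.Maps.sh_one _ _)).cons (.var rfl)).cons
      (e₂.wf.2.1.subst (Tm.Maps.sh_one _ _))) (hθ.tlift _))
    (φ₂ := χ.sub (u₂ ;; v₁ ;; σ) θ) ?_ ?_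
  · refine e₂.rew (φ := χ.sub (.var 0 ;; v₁.subst (Tm.sh 1) ;; fun n => (σ n).subst (Tm.sh 1))
      (Fml.tlift θ 1)) b₀ (hχ.sub (((hσ.comp (Tm.Maps.sh_one _ _)).cons
        (e₁.wf.2.2.subst (Tm.Maps.sh_one _ _))).cons (.var rfl)) (hθ.tlift _)) ?_ ?_ <;>
    · simp only [Fml.inst, Fml.tsub, Fml.sub_sub]
      refine Fml.sub_congr _ (fun n => ?_) (fun i => by simp [Fml.tlift, Tm.subst])
      rcases n with _ | _ | n <;> simp [Tm.subst]
  all_goals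
    simp only [Fml.inst, Fml.tsub, Fml.sub_sub]
    refine Fml.sub_congr _ (fun n => ?_) (fun i => by simp [Fml.tlift, Tm.subst])
    rcases n with _ | _ | n <;> simp [Tm.subst]

/-- Replacement of equal index terms for the index variable 0 of an assertion. -/
theorem sub_irew {Δ₀ : ICtx} {Γ₀ : Ctx} {σ : ℕ → Tm} {θ : ℕ → HIx} {χ : Fml} {S : Srt}
    {I J : HIx} (hχ : χ.WF (S :: Δ₀) Γ₀) (hσ : Tm.Maps Γ₀ σ Γ)
    (hθ : HIx.Maps Δ₀ θ Δ Γ) (hI : HIx.HasSort Δ Γ I S) (hJ : HIx.HasSort Δ Γ J S)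
    (e : HOL Δ Γ Ψ (.cst (.eq I J)))
    (h : HOL Δ Γ Ψ (χ.sub σ (I ;; θ))) : HOL Δ Γ Ψ (χ.sub σ (J ;; θ)) := by
  refine e.irew (φ := χ.sub σ (HIx.ivar 0 ;; fun i => (θ i).sub Tm.var (HIx.ish 1))) h
    (hχ.sub hσ (hθ.ilift S)) hI hJ ?_ ?_ <;>
  · simp only [Fml.iinst, Fml.isub, Fml.sub_sub]
    refine Fml.sub_congr _ (fun n => by simp) (fun i => ?_)
    rcases i with _ | i <;> simp [Tm.subst]

/-- Induction on related lists. In `χ` the left list is the variable 1 and the right one the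
variable 0; the length is the index variable 1 and the number of differences 0. -/
theorem listR_ind {τ : Ty} {n a : HIx} {l₁ l₂ : Tm} {P χ : Fml}
    (hχ : χ.WF (.nat :: .nat :: Δ) (.list τ :: .list τ :: Γ))
    (h : HOL Δ Γ Ψ (.listR τ n l₁ l₂ a P))
    (h₀ : ∀ {Δ' Γ' Ψ' σ θ a'}, Ext Δ Γ Ψ σ θ Δ' Γ' Ψ' → HIx.HasSort Δ' Γ' a' .nat →
      HOL Δ' Γ' Ψ' (χ.sub (.nil ;; .nil ;; σ) (a' ;; .num 0 ;; θ)))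
    (h₁ : ∀ {Δ' Γ' Ψ' σ θ n' a' w z ws zs}, Ext Δ Γ Ψ σ θ Δ' Γ' Ψ' →
      HOL Δ' Γ' Ψ' (P.sub (z ;; w ;; σ) θ) → HOL Δ' Γ' Ψ' (.eq τ w z) →
      HOL Δ' Γ' Ψ' (.listR τ n' ws zs a' (P.sub (Tm.up (Tm.up σ)) (Fml.tlift θ 2))) →
      HOL Δ' Γ' Ψ' (χ.sub (zs ;; ws ;; σ) (a' ;; n' ;; θ)) →
      HOL Δ' Γ' Ψ' (χ.sub (.cons z zs ;; .cons w ws ;; σ) (a' ;; .add n' (.num 1) ;; θ)))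
    (h₂ : ∀ {Δ' Γ' Ψ' σ θ n' b w z ws zs}, Ext Δ Γ Ψ σ θ Δ' Γ' Ψ' → HasTy Γ' w τ → HasTy Γ' z τ →
      HOL Δ' Γ' Ψ' (P.sub (z ;; w ;; σ) θ) →
      HOL Δ' Γ' Ψ' (.listR τ n' ws zs b (P.sub (Tm.up (Tm.up σ)) (Fml.tlift θ 2))) →
      HOL Δ' Γ' Ψ' (χ.sub (zs ;; ws ;; σ) (b ;; n' ;; θ)) →
      HOL Δ' Γ' Ψ' (χ.sub (.cons z zs ;; .cons w ws ;; σ)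
        (.add b (.num 1) ;; .add n' (.num 1) ;; θ))) :
    HOL Δ Γ Ψ (χ.sub (l₂ ;; l₁ ;; Tm.var) (a ;; n ;; HIx.ivar)) := by
  obtain ⟨hn, hl₁, hl₂, ha, hP⟩ := h.wf.2
  have hΨ := h.wf.1
  have hLw : Fml.WF (.nat :: .nat :: Δ) (.list τ :: .list τ :: Γ) (.listR τ (HIx.ivar 1) (.var 1)
      (.var 0) (HIx.ivar 0) (P.sub (Tm.up (Tm.up (Tm.sh 2))) (HIx.ish 2))) :=
    ⟨HIx.Maps.ivar _ _ 1 .nat rfl, .var rfl, .var rfl, HIx.Maps.ivar _ _ 0 .nat rfl,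
      hP.sub (((Tm.Maps.sh_two _ _ _).up _).up _) (HIx.Maps.ish_two _ _ _ _)⟩
  obtain ⟨F, eF⟩ : ∃ F : Fml, F = .alli .nat (.all (.list τ) (.all (.list τ) (.imp
    (.listR τ (HIx.ivar 1) (.var 1) (.var 0) (HIx.ivar 0)
      (P.sub (Tm.up (Tm.up (Tm.sh 2))) (HIx.ish 2))) χ))) := ⟨_, rfl⟩
  have hF : F.WF (.nat :: Δ) Γ := by rw [eF]; exact ⟨hLw, hχ⟩
  have hi0 : ∀ {Δ : ICtx} {Γ : Ctx}, HIx.HasSort (.nat :: Δ) Γ (HIx.ivar 0) .nat :=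
    HIx.Maps.ivar _ _ 0 .nat rfl
  have elim : ∀ {Δ' Γ' Ψ' σ θ n' a' k₁ k₂}, HOL Δ' Γ' Ψ' (F.sub σ (n' ;; θ)) →
      HOL Δ' Γ' Ψ' (.listR τ n' k₁ k₂ a' (P.sub (Tm.up (Tm.up σ)) (Fml.tlift θ 2))) →
      HOL Δ' Γ' Ψ' (χ.sub (k₂ ;; k₁ ;; σ) (a' ;; n' ;; θ)) := by
    intro Δ' Γ' Ψ' σ θ n' a' k₁ k₂ hf hl
    obtain ⟨-, hk₁, hk₂, ha', -⟩ := hl.wf.2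
    rw [eF] at hf
    have hh := ((hf.alliE ha').allE (t := k₁) hk₁).allE (t := k₂) hk₂
    refine (congrArg (HOL _ _ _) ?_).mpr (HOL.impE hh ((congrArg (HOL _ _ _) ?_).mpr hl))
    · simp only [Fml.sub_sub]
      refine Fml.sub_congr _ (fun n => ?_) (fun i => ?_)
      · rcases n with _ | _ | n <;> simp [Tm.up_eq, Tm.subst]
      · rcases i with _ | _ | i <;> simp [HIx.shift_eq, Tm.up_eq, Tm.subst]
    · simp only [Fml.sub_sub, Fml.listR_sub]
      congr 1
      · simp [HIx.shift_eq, Tm.subst, Tm.up_eq]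
      · simp [Tm.up_eq, Tm.subst]
      · simp [HIx.shift_eq, Tm.subst, Tm.up_eq]
      · refine Fml.sub_congr _ (fun n => ?_) (fun i => ?_)
        · rcases n with _ | _ | n <;> simp [Tm.up_eq, Tm.subst]
        · simp [HIx.shift_eq, Fml.tlift, Tm.subst, Tm.up_eq] <;> rfl
  have intro' : ∀ {Δ' Γ' Ψ' σ θ n'}, Ext Δ Γ Ψ σ θ Δ' Γ' Ψ' → HIx.HasSort Δ' Γ' n' .nat →
      (∀ {Δ'' Γ'' Ψ'' σ' θ' a' k₁ k₂}, Ext Δ' Γ' Ψ' σ' θ' Δ'' Γ'' Ψ'' →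
        HOL Δ'' Γ'' Ψ'' (.listR τ (n'.sub σ' θ') k₁ k₂ a'
          (P.sub (Tm.up (Tm.up fun n => (σ n).subst σ'))
            (Fml.tlift (fun i => (θ i).sub σ' θ') 2))) →
        HOL Δ'' Γ'' Ψ'' (χ.sub (k₂ ;; k₁ ;; fun n => (σ n).subst σ')
          (a' ;; n'.sub σ' θ' ;; fun i => (θ i).sub σ' θ'))) →
      HOL Δ' Γ' Ψ' (F.sub σ (n' ;; θ)) := by
    intro Δ' Γ' Ψ' σ θ n' e hn' H
    have hFw := hF.sub e.tm (e.ix.cons hn')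
    rw [eF] at hFw ⊢
    refine alliI' e.wf fun Ψ₁ e₁ => allI' e₁.wf fun Ψ₂ e₂ => all_impI hFw.1 e₂.wf
      fun Ψ₃ e₃ hl => ?_
    have e' : Ext Δ' Γ' Ψ' (Tm.sh 2) (HIx.ish 1) (.nat :: Δ') (.list τ :: .list τ :: Γ') Ψ₃ :=
      (e₁.comp e₂).comp e₃
    refine (congrArg (HOL _ _ _) ?_).mpr (H e' (k₁ := .var 1) (k₂ := .var 0) (a' := HIx.ivar 0)
      ((congrArg (HOL _ _ _) ?_).mpr hl))
    · refine Fml.sub_congr _ (fun n => ?_) (fun i => ?_)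
      · rcases n with _ | _ | n <;> simp [Tm.up_eq, Tm.subst] <;> rfl
      · rcases i with _ | _ | i <;> simp [HIx.shift_eq, Tm.subst] <;> rfl
    · simp only [Fml.sub_sub, Fml.listR_sub]
      congr 1
      · simp [HIx.shift_eq, Tm.subst, Tm.up_eq] <;> rfl
      · refine Fml.sub_congr _ (fun n => ?_) (fun i => ?_)
        · rcases n with _ | _ | n <;> simp [Tm.up_eq, Tm.subst]
        · simp [HIx.shift_eq, Fml.tlift, Tm.subst, Tm.up_eq]
  have key : HOL Δ Γ Ψ (.alli .nat F) := by
    refine HOL.inat hF (intro' (.weaken hΨ fun _ h => h) trivial ?_) ?_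
    · intro Δ' Γ' Ψ' σ θ a' k₁ k₂ e hl
      obtain ⟨-, hk₁, hk₂, ha', hP'⟩ := hl.wf.2
      have hE := HOL.impE (HOL.listR_zero e.wf hk₁ hk₂ ha' hP').andE₁ hl
      exact sub_rew₂ hχ e.tm ((e.ix.cons (S := .nat) (I := .num 0) trivial).cons ha')
        hE.andE₁.eq_symm hE.andE₂.eq_symm (h₀ e ha')
    · have e₀ : Ext Δ Γ Ψ Tm.var (HIx.ish 1) (.nat :: Δ) Γ (F :: Ψ.map (Fml.ishift 1)) := by
        simpa only [Tm.subst_var, HIx.sub_id] using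
          (Ext.ishift hΨ .nat).comp (.cons hF (hΨ.ishift _))
      refine intro' e₀ ⟨hi0, trivial⟩ ?_
      intro Δ' Γ' Ψ' σ θ a' k₁ k₂ e hl
      obtain ⟨-, hk₁, hk₂, ha', hP'⟩ := hl.wf.2
      have hFe := e.hol (hyp_cons hF (hΨ.ishift .nat))
      have hθ0 : HIx.HasSort Δ' Γ' (θ 0) .nat := e.ix 0 .nat rfl
      have hθ : HIx.Maps Δ (fun i => θ (i + 1)) Δ' Γ' := fun i S h => e.ix (i + 1) S h
      have hχe : (χ.sub (k₂ ;; k₁ ;; σ) (a' ;; .add (θ 0) (.num 1) ;; fun i => θ (i + 1))).WF Δ' Γ' :=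
        hχ.sub ((e.tm.cons hk₁).cons hk₂)
          ((hθ.cons (S := .nat) (I := .add (θ 0) (.num 1)) ⟨hθ0, trivial⟩).cons ha')
      have e₁ : Ext Δ Γ Ψ σ (fun i => θ (i + 1)) Δ' Γ' Ψ' := e₀.comp e
      refine listR_succ_elim (n := θ 0) hχe hl ?_ ?_
      · intro Γ₁ Ψ₁ σ₁ w z ws zs e₂ E₁ E₂ hPw E hl'
        have e₃ := e₁.comp e₂
        have hPw' : HOL Δ' Γ₁ Ψ₁ (P.sub (z ;; w ;; fun n => (σ n).subst σ₁)
            fun i => (θ (i + 1)).sub σ₁ HIx.ivar) := by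
          refine (congrArg (HOL _ _ _) ?_).mpr hPw
          simp only [Fml.sub_sub]
          refine Fml.sub_congr _ (fun n => ?_) (fun i => ?_)
          · rcases n with _ | _ | n <;> simp [Tm.subst, Tm.up_eq]
          · simp [Fml.tlift, Tm.subst]
        have hl'' : HOL Δ' Γ₁ Ψ₁ (.listR τ ((θ 0).sub σ₁ HIx.ivar) ws zs (a'.sub σ₁ HIx.ivar)
            (P.sub (Tm.up (Tm.up fun n => (σ n).subst σ₁))
              (Fml.tlift (fun i => (θ (i + 1)).sub σ₁ HIx.ivar) 2))) := by
          refine (congrArg (HOL _ _ _) ?_).mpr hl'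
          simp only [Fml.sub_sub]
          congr 1
          refine Fml.sub_congr _ (fun n => ?_) (fun i => ?_)
          · rcases n with _ | _ | n <;> simp [Tm.subst, Tm.up_eq]
          · simp [Fml.tlift, Tm.subst, Tm.up_eq] <;> rfl
        have hFs : HOL Δ' Γ₁ Ψ₁ (F.sub (fun n => (σ n).subst σ₁) ((θ 0).sub σ₁ HIx.ivar ;;
            fun i => (θ (i + 1)).sub σ₁ HIx.ivar)) := by
          refine (congrArg (HOL _ _ _) ?_).mpr (e₂.hol hFe)
          simp only [Fml.sub_sub]
          exact Fml.sub_congr _ (fun n => rfl) (fun i => by cases i <;> rfl)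
        have := sub_rew₂ hχ e₃.tm ((e₃.ix.cons (S := .nat)
          (I := .add ((θ 0).sub σ₁ HIx.ivar) (.num 1)) ⟨hl''.wf.2.1, trivial⟩).cons
          hl''.wf.2.2.2.2.1) E₁.eq_symm E₂.eq_symm (h₁ e₃ hPw' E hl'' (elim hFs hl''))
        refine (congrArg (HOL _ _ _) ?_).mpr this
        simp only [Fml.sub_sub]
        refine Fml.sub_congr _ (fun n => ?_) (fun i => ?_)
        · rcases n with _ | _ | n <;> rfl
        · rcases i with _ | _ | i <;> rfl
      · intro Γ₁ Ψ₁ σ₁ w z ws zs e₂ E₁ E₂ hPw E hl'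
        have e₃ := e₁.comp e₂
        have hPw' : HOL (.nat :: Δ') Γ₁ Ψ₁ (P.sub (z ;; w ;; fun n => (σ n).subst σ₁)
            fun i => (θ (i + 1)).sub σ₁ (HIx.ish 1)) := by
          refine (congrArg (HOL _ _ _) ?_).mpr hPw
          simp only [Fml.sub_sub]
          refine Fml.sub_congr _ (fun n => ?_) (fun i => ?_)
          · rcases n with _ | _ | n <;> simp [Tm.subst, Tm.up_eq]
          · simp [Fml.tlift, Tm.subst] <;> rfl
        have hl'' : HOL (.nat :: Δ') Γ₁ Ψ₁ (.listR τ ((θ 0).sub σ₁ (HIx.ish 1)) ws zs (HIx.ivar 0)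
            (P.sub (Tm.up (Tm.up fun n => (σ n).subst σ₁))
              (Fml.tlift (fun i => (θ (i + 1)).sub σ₁ (HIx.ish 1)) 2))) := by
          refine (congrArg (HOL _ _ _) ?_).mpr hl'
          simp only [Fml.sub_sub]
          congr 1
          refine Fml.sub_congr _ (fun n => ?_) (fun i => ?_)
          · rcases n with _ | _ | n <;> simp [Tm.subst, Tm.up_eq]
          · simp [Fml.tlift, Tm.subst, Tm.up_eq] <;> rfl
        have hFs : HOL (.nat :: Δ') Γ₁ Ψ₁ (F.sub (fun n => (σ n).subst σ₁)
            ((θ 0).sub σ₁ (HIx.ish 1) ;; fun i => (θ (i + 1)).sub σ₁ (HIx.ish 1))) := by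
          refine (congrArg (HOL _ _ _) ?_).mpr (e₂.hol hFe)
          simp only [Fml.sub_sub]
          exact Fml.sub_congr _ (fun n => rfl) (fun i => by cases i <;> rfl)
        have hn' : HIx.HasSort (.nat :: Δ') Γ₁ (.add ((θ 0).sub σ₁ (HIx.ish 1)) (.num 1)) .nat :=
          ⟨hl''.wf.2.1, trivial⟩
        have hb : HIx.HasSort (.nat :: Δ') Γ₁ (.add (HIx.ivar 0) (.num 1)) .nat := ⟨hi0, trivial⟩
        have r := sub_rew₂ hχ e₃.tm ((e₃.ix.cons hn').cons hb) E₁.eq_symm E₂.eq_symm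
          (h₂ e₃ (HasTy.consArgs E₁.wf.2.2).1 (HasTy.consArgs E₂.wf.2.2).1 hPw' hl'' (elim hFs hl''))
        have := sub_irew hχ ((e₃.tm.cons E₁.wf.2.1).cons E₂.wf.2.1) (e₃.ix.cons hn')
          hb (ha'.sub e₂.tm e₂.ix) E.cst_symm r
        refine (congrArg (HOL _ _ _) ?_).mpr this
        simp only [Fml.sub_sub]
        refine Fml.sub_congr _ (fun n => ?_) (fun i => ?_)
        · rcases n with _ | _ | n <;> rfl
        · rcases i with _ | _ | i <;> rfl
  refine (congrArg (HOL _ _ _) ?_).mpr (elim ((congrArg (HOL _ _ _) ?_).mpr (key.alliE hn))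
    (θ := HIx.ivar) (σ := Tm.var) (n' := n) (a' := a) (k₁ := l₁) (k₂ := l₂) ?_)
  · rfl
  · rfl
  · simpa only [Tm.up_var, Fml.tlift_ivar, Fml.sub_id] using h

end HOL

namespace HOL

variable {Δ : ICtx} {Γ : Ctx} {Ψ : List Fml}

/-- Case analysis on lists. -/
theorem listU_cases' {τ : Ty} {n : HIx} {l : Tm} {P χ : Fml} (hχ : χ.WF Δ Γ)
    (h : HOL Δ Γ Ψ (.listU τ n l P))
    (h₀ : ∀ {Ψ'}, Ext Δ Γ Ψ Tm.var HIx.ivar Δ Γ Ψ' → HOL Δ Γ Ψ' (.eq (.list τ) l .nil) →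
      HOL Δ Γ Ψ' (.cst (.eq n (.num 0))) → HOL Δ Γ Ψ' χ)
    (h₁ : ∀ {Δ' Γ' Ψ' σ θ i w ws}, Ext Δ Γ Ψ σ θ Δ' Γ' Ψ' →
      HOL Δ' Γ' Ψ' (.eq (.list τ) (l.subst σ) (.cons w ws)) →
      HOL Δ' Γ' Ψ' (P.sub (w ;; σ) θ) →
      HOL Δ' Γ' Ψ' (.cst (.eq (n.sub σ θ) (.add i (.num 1)))) →
      HOL Δ' Γ' Ψ' (.listU τ i ws (P.sub (Tm.up σ) (Fml.tlift θ 1))) →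
      HOL Δ' Γ' Ψ' (χ.sub σ θ)) :
    HOL Δ Γ Ψ χ := by
  obtain ⟨hn, hl, hP⟩ := h.wf.2
  have hΨ := h.wf.1
  have m := Tm.Maps.sh_two Γ (.list τ) τ
  have mi := HIx.Maps.ish Δ (.list τ :: τ :: Γ) .nat
  have hi : HIx.HasSort (.nat :: Δ) (.list τ :: τ :: Γ) (HIx.ivar 0) .nat :=
    HIx.Maps.ivar _ _ 0 .nat rfl
  have hw₀ : CWF Δ Γ (.eq (.list τ) l .nil :: .cst (.eq n (.num 0)) :: Ψ) :=
    CWF.cons ⟨hl, .nil⟩ (CWF.cons ⟨hn.real, trivial⟩ hΨ)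
  have hΨ' : CWF (.nat :: Δ) (.list τ :: τ :: Γ) (Ψ.map fun ψ => ψ.sub (Tm.sh 2) (HIx.ish 1)) := by
    intro ψ hψ
    obtain ⟨φ, hφ, rfl⟩ := List.mem_map.1 hψ
    exact (hΨ φ hφ).sub m mi
  have hl' : HasTy (.list τ :: τ :: Γ) (l.shift 2) (.list τ) := by
    rw [Tm.shift_eq]; exact hl.subst m
  have hL : Fml.WF (.nat :: Δ) (.list τ :: τ :: Γ)
      (.listU τ (HIx.ivar 0) (.var 0) (P.sub (.var 0 ;; Tm.sh 3) (HIx.ish 1))) :=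
    ⟨hi, .var rfl, hP.sub ((m.comp (Tm.Maps.sh_one _ _)).cons (.var rfl)) (HIx.Maps.ish _ _ _)⟩
  have hw := CWF.cons hL (CWF.cons (hP.sub (m.cons (t := .var 1) (.var rfl)) mi)
    (CWF.cons (φ := .eq (.list τ) (l.shift 2) (.cons (.var 1) (.var 0)))
      ⟨hl', .cons (.var rfl) (.var rfl)⟩
      (CWF.cons (φ := .cst (.eq (n.shift 2 1) (.add (HIx.ivar 0) (.num 1))))
        ⟨(hn.sub m mi).real, hi.real, trivial⟩ hΨ')))
  refine listU_cases hχ h (h₀ (.weaken hw₀ fun _ h => ?_) (.ax hw₀ List.mem_cons_self)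
    (.ax hw₀ (List.mem_cons_of_mem _ List.mem_cons_self)))
    (h₁ (i := HIx.ivar 0) (w := .var 1) (ws := .var 0)
      ⟨m, mi, hw, fun ψ hψ => .ax hw ?_⟩ (.ax hw ?_) (.ax hw ?_) (.ax hw ?_) (.ax hw ?_))
  · exact List.mem_cons_of_mem _ (List.mem_cons_of_mem _ h)
  · simp only [List.mem_cons, List.mem_map]; exact .inr (.inr (.inr (.inr ⟨ψ, hψ, rfl⟩)))
  · simp [Tm.shift_eq]
  · simp
  · simp [HIx.shift_eq]
  · refine List.mem_cons.2 (.inl ?_)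
    congr 1

/-- Induction on lists. In `χ` the list is the variable 0; the length is the index variable 0. -/
theorem listU_ind' {τ : Ty} {n : HIx} {l : Tm} {P χ : Fml} (hχ : χ.WF (.nat :: Δ) (.list τ :: Γ))
    (h : HOL Δ Γ Ψ (.listU τ n l P))
    (h₀ : HOL Δ Γ Ψ (χ.sub (.nil ;; Tm.var) (.num 0 ;; HIx.ivar)))
    (h₁ : ∀ {Δ' Γ' Ψ' σ θ n' w ws}, Ext Δ Γ Ψ σ θ Δ' Γ' Ψ' → HasTy Γ' w τ →
      HOL Δ' Γ' Ψ' (P.sub (w ;; σ) θ) → HOL Δ' Γ' Ψ' (χ.sub (ws ;; σ) (n' ;; θ)) →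
      HOL Δ' Γ' Ψ' (χ.sub (.cons w ws ;; σ) (.add n' (.num 1) ;; θ))) :
    HOL Δ Γ Ψ (χ.sub (l ;; Tm.var) (n ;; HIx.ivar)) := by
  obtain ⟨hn, hl, hP⟩ := h.wf.2
  have hΨ := h.wf.1
  have m := Tm.Maps.sh_two Γ (.list τ) τ
  have mi := HIx.Maps.ish Δ (.list τ :: τ :: Γ) .nat
  have hw := CWF.cons (hχ.sub (m.cons (t := .var 0) (.var rfl)) (HIx.Maps.ivar _ _)) (CWF.cons
    (hP.sub (m.cons (t := .var 1) (.var rfl)) mi) (Ψ := Ψ.map fun ψ => ψ.sub (Tm.sh 2) (HIx.ish 1)) (by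
      intro ψ hψ
      obtain ⟨φ, hφ, rfl⟩ := List.mem_map.1 hψ
      exact (hΨ φ hφ).sub m mi))
  refine listU_ind hχ h h₀ (h₁ (n' := HIx.ivar 0) (w := .var 1) (ws := .var 0)
    ⟨m, mi, hw, fun ψ hψ => .ax hw ?_⟩ (.var rfl) (.ax hw ?_) (.ax hw (List.mem_cons.2 (.inl ?_))))
  · simp only [List.mem_cons, List.mem_map]; exact .inr (.inr ⟨ψ, hψ, rfl⟩)
  · simp
  · exact Fml.sub_congr _ (fun n => rfl) (fun i => by cases i <;> rfl)

end HOL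

/-! ## The assertions of types -/

namespace Fml

theorem tlift_tlift (θ : ℕ → HIx) : tlift (tlift θ 1) 1 = tlift θ 2 := by
  funext i; simp [tlift, Tm.subst]; rfl

/-- `K ≤ π₂ x ≤ L`. -/
def bnds (K L : HIx) (x : Tm) : Fml :=
  .and (.cst (.le K (HIx.tm (.snd x)))) (.cst (.le (HIx.tm (.snd x)) L))

/-- `π₂ x - π₂ y ≤ L`. -/
def dif (L : HIx) (x y : Tm) : Fml := .cst (.le (.sub (HIx.tm (.snd x)) (HIx.tm (.snd y))) L)

theorem bnds_sub (K L : HIx) (x : Tm) (σ θ) :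
    (bnds K L x).sub σ θ = bnds (K.sub σ θ) (L.sub σ θ) (x.subst σ) := rfl

theorem dif_sub (L : HIx) (x y : Tm) (σ θ) :
    (dif L x y).sub σ θ = dif (L.sub σ θ) (x.subst σ) (y.subst σ) := rfl

end Fml

theorem Idx.bind_sub (I : Idx) (θ : ℕ → HIx) (σ : ℕ → Tm) (θ' : ℕ → HIx) :
    HIx.sub (I.bind θ) σ θ' = I.bind (fun i => (θ i).sub σ θ') := Ix.bind_bind _ _ _

open Fml in
/-- The assertion of a unary type, under an index substitution. -/
def UTy.fml : UTy → (ℕ → HIx) → Tm → Fml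
  | nat, _, _ => .top
  | list n A, θ, x => .listU A.erase.costV (n.bind θ) x (A.fml (tlift θ 1) (.var 0))
  | arr A k l B, θ, x => .all A.erase.costV (.imp (A.fml (tlift θ 1) (.var 0))
      (.and (B.fml (tlift θ 1) (.fst (.app (x.subst (Tm.sh 1)) (.var 0))))
        (bnds (k.bind (tlift θ 1)) (l.bind (tlift θ 1)) (.app (x.subst (Tm.sh 1)) (.var 0)))))
  | all S k l A, θ, x => .all .nat (.imp .top (.alli S
      (.and (A.fml (ilift (tlift θ 1)) (.fst (.app (x.subst (Tm.sh 1)) (.var 0))))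
        (bnds (k.bind (ilift (tlift θ 1))) (l.bind (ilift (tlift θ 1)))
          (.app (x.subst (Tm.sh 1)) (.var 0))))))

open Fml in
/-- The assertion of a relational type, under an index substitution. -/
def RTy.fml : RTy → (ℕ → HIx) → Tm → Tm → Fml
  | nat, _, x, y => .eq .nat x y
  | u A, θ, x, y => .and (A.fml θ x) (A.fml θ y)
  | box τ, θ, x, y => .and (.eq τ.erase.costV x y) (τ.fml θ x y)
  | list n α τ, θ, x, y =>
      .listR τ.erase.costV (n.bind θ) x y (α.bind θ) (τ.fml (tlift θ 2) (.var 1) (.var 0))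
  | arr τ l σ, θ, x, y =>
      .and ((UTy.arr τ.bar (.num 0) .inf σ.bar).fml θ x)
        (.and ((UTy.arr τ.bar (.num 0) .inf σ.bar).fml θ y)
          (.all τ.erase.costV (.all τ.erase.costV (.imp (τ.fml (tlift θ 2) (.var 1) (.var 0))
            (.and
              (σ.fml (tlift θ 2) (.fst (.app (x.subst (Tm.sh 2)) (.var 1)))
                (.fst (.app (y.subst (Tm.sh 2)) (.var 0))))
              (dif (l.bind (tlift θ 2)) (.app (x.subst (Tm.sh 2)) (.var 1))
                (.app (y.subst (Tm.sh 2)) (.var 0))))))))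
  | all S l τ, θ, x, y =>
      .and ((UTy.all S (.num 0) .inf τ.bar).fml θ x)
        (.and ((UTy.all S (.num 0) .inf τ.bar).fml θ y)
          (.all .nat (.all .nat (.imp .top (.alli S
            (.and
              (τ.fml (ilift (tlift θ 2)) (.fst (.app (x.subst (Tm.sh 2)) (.var 1)))
                (.fst (.app (y.subst (Tm.sh 2)) (.var 0))))
              (dif (l.bind (ilift (tlift θ 2))) (.app (x.subst (Tm.sh 2)) (.var 1))
                (.app (y.subst (Tm.sh 2)) (.var 0)))))))))

theorem Idx.toH_eq (I : Idx) : I.toH = I.bind HIx.ivar := rfl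

theorem Idx.HasSort.bind {Δ Δ' : ICtx} {Γ : Ctx} {θ : ℕ → HIx} {I : Idx} {S : Srt}
    (h : Idx.HasSort Δ I S) (hθ : HIx.Maps Δ θ Δ' Γ) : HIx.HasSort Δ' Γ (Ix.bind θ I) S := by
  cases S with
  | real => exact Ix.AllLeaves.bind (fun i hi => (hθ i _ (List.getElem?_eq_getElem hi)).real) h
  | nat =>
    refine Ix.IsNat.bind (p := fun i => Δ[i]? = some Srt.nat) ?_ h
    exact fun i hi => hθ i .nat hi

theorem Idx.HasSort.real {Δ : ICtx} {I : Idx} {S : Srt} (h : Idx.HasSort Δ I S) :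
    Idx.HasSort Δ I .real := by
  cases S with
  | real => exact h
  | nat => exact Ix.AllLeaves.imp (fun i hi => (List.getElem?_eq_some_iff.1 hi).1) (Ix.IsNat.allLeaves h)

theorem iup_bind (φ : ℕ → Idx) (θ : ℕ → HIx) :
    (fun i => (iup φ i).bind (Fml.ilift θ)) = Fml.ilift (fun i => (φ i).bind θ) := by
  funext i
  cases i with
  | zero => rfl
  | succ i => simp only [iup, Fml.ilift, scons_succ, Idx.shift, Ix.map, Ix.bind_bind, HIx.sub]; rfl

theorem bind_tlift (φ : ℕ → Idx) (θ : ℕ → HIx) (k : ℕ) :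
    (fun i => (φ i).bind (Fml.tlift θ k)) = Fml.tlift (fun i => (φ i).bind θ) k := by
  funext i; exact (Idx.bind_sub _ _ _ _).symm

theorem Tm.subst_sh_up (x : Tm) (σ : ℕ → Tm) :
    (x.subst (sh 1)).subst (up σ) = (x.subst σ).subst (sh 1) := by
  simp [Tm.up_eq, Tm.subst]

theorem Tm.subst_sh_up₂ (x : Tm) (σ : ℕ → Tm) :
    (x.subst (sh 2)).subst (up (up σ)) = (x.subst σ).subst (sh 2) := by
  simp [Tm.up_eq, Tm.subst]; rfl

namespace UTy

theorem fmlV_eq (A : UTy) : ∀ x, A.fmlV x = A.fml HIx.ivar x := by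
  induction A <;> intro x <;>
    simp_all [fmlV, fml, Fml.tlift_ivar, Fml.ilift_ivar, Tm.shift_eq, costBounds, Fml.bnds, Idx.toH_eq]

theorem fml_sub (A : UTy) : ∀ (θ : ℕ → HIx) (x : Tm) (σ : ℕ → Tm) (θ' : ℕ → HIx),
    (A.fml θ x).sub σ θ' = A.fml (fun i => (θ i).sub σ θ') (x.subst σ) := by
  induction A <;> intro θ x σ θ' <;>
    simp_all [fml, Fml.bnds_sub, Idx.bind_sub, Fml.tlift_sub, Fml.ilift_sub, Tm.subst,
      Tm.subst_sh_up] <;> simp [Tm.up_eq]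

theorem erase_sub (A : UTy) : ∀ φ : ℕ → Idx, (A.sub φ).erase = A.erase := by
  induction A <;> intro φ <;> simp_all [sub, erase]

theorem sub_fml (A : UTy) : ∀ (φ : ℕ → Idx) (θ : ℕ → HIx) (x : Tm),
    (A.sub φ).fml θ x = A.fml (fun i => (φ i).bind θ) x := by
  induction A <;> intro φ θ x <;>
    simp_all [fml, sub, erase_sub, Ix.bind_bind, bind_tlift, iup_bind]

theorem fml_wf {A : UTy} : ∀ {Δ Δ' : ICtx} {Γ : Ctx} {θ : ℕ → HIx} {x : Tm}, A.WF Δ →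
    HIx.Maps Δ θ Δ' Γ → HasTy Γ x A.erase.costV → (A.fml θ x).WF Δ' Γ := by
  induction A with
  | nat => intros; trivial
  | list n A ih =>
    intro Δ Δ' Γ θ x h hθ hx
    exact ⟨h.1.bind hθ, hx, ih h.2 (hθ.tlift _) (.var rfl)⟩
  | arr A k l B ih₁ ih₂ =>
    intro Δ Δ' Γ θ x h hθ hx
    have hm := hθ.tlift A.erase.costV
    have hx' := HasTy.app (hx.shift A.erase.costV) (u := .var 0) (.var rfl)
    exact ⟨ih₁ h.1 hm (.var rfl), ih₂ h.2.2.2 hm (.fst hx'), ⟨h.2.1.bind hm, HasTy.snd hx'⟩,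
      HasTy.snd hx', h.2.2.1.bind hm⟩
  | all S k l A ih =>
    intro Δ Δ' Γ θ x h hθ hx
    have hm := (hθ.tlift .nat).ilift S
    have hx' := HasTy.app (hx.shift .nat) (u := .var 0) (.var rfl)
    exact ⟨trivial, ih h.2.2 hm (.fst hx'), ⟨h.1.bind hm, HasTy.snd hx'⟩,
      HasTy.snd hx', h.2.1.bind hm⟩

end UTy

namespace RTy

theorem bar_erase (τ : RTy) : τ.bar.erase = τ.erase := by
  induction τ <;> simp_all [bar, erase, UTy.erase]

theorem bar_wf (τ : RTy) : ∀ {Δ : ICtx}, τ.WF Δ → τ.bar.WF Δ := by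
  induction τ with
  | nat => intros; trivial
  | u A => intro Δ h; exact h
  | box τ ih => intro Δ h; exact ih h
  | list n α τ ih => intro Δ h; exact ⟨h.1, ih h.2.2⟩
  | arr τ l σ ih₁ ih₂ => intro Δ h; exact ⟨ih₁ h.1, trivial, trivial, ih₂ h.2.2⟩
  | all S l τ ih => intro Δ h; exact ⟨trivial, trivial, ih h.2⟩

theorem bar_sub (τ : RTy) : ∀ φ : ℕ → Idx, (τ.sub φ).bar = τ.bar.sub φ := by
  induction τ <;> intro φ <;> simp_all [bar, sub, UTy.sub, Ix.bind]

theorem erase_sub (τ : RTy) : ∀ φ : ℕ → Idx, (τ.sub φ).erase = τ.erase := by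
  intro φ; rw [← bar_erase, bar_sub, UTy.erase_sub, bar_erase]

theorem fmlV_eq (τ : RTy) : ∀ x y, τ.fmlV x y = τ.fml HIx.ivar x y := by
  induction τ <;> intro x y <;>
    simp_all [fmlV, fml, Fml.tlift_ivar, Fml.ilift_ivar, Tm.shift_eq, costDiff, Fml.dif,
      UTy.fmlV_eq, Idx.toH_eq]

theorem fml_sub (τ : RTy) : ∀ (θ : ℕ → HIx) (x y : Tm) (σ : ℕ → Tm) (θ' : ℕ → HIx),
    (τ.fml θ x y).sub σ θ' = τ.fml (fun i => (θ i).sub σ θ') (x.subst σ) (y.subst σ) := by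
  induction τ <;> intro θ x y σ θ' <;>
    simp_all [fml, Fml.dif_sub, Idx.bind_sub, Fml.tlift_sub₂, Fml.tlift_tlift, Fml.ilift_sub,
      Tm.subst, UTy.fml_sub] <;> simp [Tm.up_eq, Tm.subst] <;> exact ⟨rfl, rfl⟩

theorem sub_fml (τ : RTy) : ∀ (φ : ℕ → Idx) (θ : ℕ → HIx) (x y : Tm),
    (τ.sub φ).fml θ x y = τ.fml (fun i => (φ i).bind θ) x y := by
  induction τ with
  | all S l τ ih =>
    intro φ θ x y
    have h := UTy.sub_fml (.all S (.num 0) .inf τ.bar) φ θ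
    simp only [UTy.sub, Ix.bind] at h
    simp only [fml, sub, bar_sub, h, ih, Ix.bind_bind, bind_tlift, iup_bind]
  | arr τ l σ ih₁ ih₂ =>
    intro φ θ x y
    have h := UTy.sub_fml (.arr τ.bar (.num 0) .inf σ.bar) φ θ
    simp only [UTy.sub, Ix.bind] at h
    simp only [fml, sub, bar_sub, erase_sub, h, ih₁, ih₂, Ix.bind_bind, bind_tlift]
  | _ =>
    intro φ θ x y
    simp_all [fml, sub, erase_sub, UTy.sub_fml, Ix.bind_bind, bind_tlift]

theorem fml_wf {τ : RTy} : ∀ {Δ Δ' : ICtx} {Γ : Ctx} {θ : ℕ → HIx} {x y : Tm}, τ.WF Δ →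
    HIx.Maps Δ θ Δ' Γ → HasTy Γ x τ.erase.costV → HasTy Γ y τ.erase.costV →
    (τ.fml θ x y).WF Δ' Γ := by
  induction τ with
  | nat => intro Δ Δ' Γ θ x y _ _ hx hy; exact ⟨hx, hy⟩
  | u A => intro Δ Δ' Γ θ x y h hθ hx hy; exact ⟨UTy.fml_wf h hθ hx, UTy.fml_wf h hθ hy⟩
  | box τ ih => intro Δ Δ' Γ θ x y h hθ hx hy; exact ⟨⟨hx, hy⟩, ih h hθ hx hy⟩
  | list n α τ ih =>
    intro Δ Δ' Γ θ x y h hθ hx hy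
    exact ⟨h.1.bind hθ, hx, hy, h.2.1.bind hθ, ih h.2.2 (hθ.tlift₂ _ _) (.var rfl) (.var rfl)⟩
  | arr τ l σ ih₁ ih₂ =>
    intro Δ Δ' Γ θ x y h hθ hx hy
    have hb : (UTy.arr τ.bar (.num 0) .inf σ.bar).WF Δ := (RTy.arr τ l σ).bar_wf h
    have he := (RTy.arr τ l σ).bar_erase
    have hm := hθ.tlift₂ τ.erase.costV τ.erase.costV
    have hx' := HasTy.app (hx.subst (Tm.Maps.sh_two _ τ.erase.costV τ.erase.costV)) (u := .var 1)
      (.var rfl)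
    have hy' := HasTy.app (hy.subst (Tm.Maps.sh_two _ τ.erase.costV τ.erase.costV)) (u := .var 0)
      (.var rfl)
    exact ⟨UTy.fml_wf hb hθ (he ▸ hx), UTy.fml_wf hb hθ (he ▸ hy), ih₁ h.1 hm (.var rfl) (.var rfl),
      ih₂ h.2.2 hm (.fst hx') (.fst hy'), ⟨HasTy.snd hx', HasTy.snd hy'⟩, h.2.1.bind hm⟩
  | all S l τ ih =>
    intro Δ Δ' Γ θ x y h hθ hx hy
    have hb : (UTy.all S (.num 0) .inf τ.bar).WF Δ := (RTy.all S l τ).bar_wf h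
    have he := (RTy.all S l τ).bar_erase
    have hm := (hθ.tlift₂ .nat .nat).ilift S
    have hx' := HasTy.app (hx.subst (Tm.Maps.sh_two _ .nat .nat)) (u := .var 1) (.var rfl)
    have hy' := HasTy.app (hy.subst (Tm.Maps.sh_two _ .nat .nat)) (u := .var 0) (.var rfl)
    exact ⟨UTy.fml_wf hb hθ (he ▸ hx), UTy.fml_wf hb hθ (he ▸ hy), trivial,
      ih h.2 hm (.fst hx') (.fst hy'), ⟨HasTy.snd hx', HasTy.snd hy'⟩, h.1.bind hm⟩

end RTy

/-! ## Derivability of the assertions of types -/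

theorem Fml.tlift_comp (θ θ' : ℕ → HIx) (σ : ℕ → Tm) (w : Tm) :
    (fun i => (tlift θ 1 i).sub (w ;; σ) θ') = fun i => (θ i).sub σ θ' := by
  funext i; simp only [tlift, HIx.sub_sub]; rfl

theorem Fml.tlift_comp₂ (θ θ' : ℕ → HIx) (σ : ℕ → Tm) (w z : Tm) :
    (fun i => (tlift θ 2 i).sub (z ;; w ;; σ) θ') = fun i => (θ i).sub σ θ' := by
  funext i; simp only [tlift, HIx.sub_sub]; rfl

theorem Fml.ilift_comp (θ θ' : ℕ → HIx) (σ : ℕ → Tm) (I : HIx) :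
    (fun i => (ilift θ i).sub σ (I ;; θ')) = (I ;; fun i => (θ i).sub σ θ') := by
  funext i
  cases i with
  | zero => rfl
  | succ i => simp only [ilift, scons_succ, HIx.sub_sub]; rfl

theorem Fml.inst_tlift₂ (θ : ℕ → HIx) (w z : Tm) :
    (fun i => ((tlift θ 2 i).sub (Tm.up (w ;; Tm.var)) (tlift HIx.ivar 1)).sub (z ;; Tm.var)
      HIx.ivar) = θ := by
  funext i
  simp only [tlift, HIx.sub_sub]
  refine Eq.trans ?_ (HIx.sub_id (θ i))
  congr 1

theorem Fml.inst_sh₂ (x w z : Tm) :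
    ((x.subst (Tm.sh 2)).subst (Tm.up (w ;; Tm.var))).subst (z ;; Tm.var) = x := by
  simp only [Tm.subst_subst]
  exact Tm.subst_var x

theorem HIx.comp_id (θ : ℕ → HIx) : (fun i => (θ i).sub Tm.var HIx.ivar) = θ := by
  funext i; exact HIx.sub_id _

theorem ICst.shift_bind (C : ICst) (I : HIx) (θ : ℕ → HIx) :
    (C.shift 1).bind (I ;; θ) = C.bind θ := by
  simp only [ICst.shift, Cst.map, Cst.bind_bind]; rfl

theorem ICst.WF.shift {Δ : ICtx} {C : ICst} (h : C.WF Δ) (S : Srt) : (C.shift 1).WF (S :: Δ) :=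
  Cst.AllLeaves.bind (fun _ hi => Nat.succ_lt_succ hi) h

/-- `Model Δ Φ θ Δ' Γ Ψ`: the index substitution `θ` satisfies the constraints `Φ` in the sequent
context `Δ'; Γ; Ψ`. -/
structure Model (Δ : ICtx) (Φ : List ICst) (θ : ℕ → HIx) (Δ' : ICtx) (Γ : Ctx) (Ψ : List Fml) :
    Prop where
  ix : HIx.Maps Δ θ Δ' Γ
  wf : CWF Δ' Γ Ψ
  cwf : ∀ D ∈ Φ, D.WF Δ
  hyps : ∀ D ∈ Φ, HOL Δ' Γ Ψ (.cst (D.bind θ))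

namespace Model

variable {Δ Δ' Δ'' : ICtx} {Φ : List ICst} {Γ Γ' : Ctx} {Ψ Ψ' : List Fml} {θ θ' : ℕ → HIx}
  {σ : ℕ → Tm}

theorem ext (m : Model Δ Φ θ Δ' Γ Ψ) (e : HOL.Ext Δ' Γ Ψ σ θ' Δ'' Γ' Ψ') :
    Model Δ Φ (fun i => (θ i).sub σ θ') Δ'' Γ' Ψ' where
  ix := m.ix.sub e.tm e.ix
  wf := e.wf
  cwf := m.cwf
  hyps D hD := by
    have := e.hol_cst (m.hyps D hD)
    rwa [HCst.sub, Cst.bind_bind] at this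

theorem cons (m : Model Δ Φ θ Δ' Γ Ψ) {S : Srt} {I : HIx} (hI : HIx.HasSort Δ' Γ I S) :
    Model (S :: Δ) (Φ.map (ICst.shift 1)) (I ;; θ) Δ' Γ Ψ where
  ix := m.ix.cons hI
  wf := m.wf
  cwf D hD := by
    obtain ⟨C, hC, rfl⟩ := List.mem_map.1 hD
    exact (m.cwf C hC).shift S
  hyps D hD := by
    obtain ⟨C, hC, rfl⟩ := List.mem_map.1 hD
    rw [ICst.shift_bind]; exact m.hyps C hC

theorem hyp (m : Model Δ Φ θ Δ' Γ Ψ) {C : ICst} (hC : C.WF Δ) (h : HOL Δ' Γ Ψ (.cst (C.bind θ))) :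
    Model Δ (C :: Φ) θ Δ' Γ Ψ where
  ix := m.ix
  wf := m.wf
  cwf := List.forall_mem_cons.2 ⟨hC, m.cwf⟩
  hyps := List.forall_mem_cons.2 ⟨h, m.hyps⟩

theorem entails (m : Model Δ Φ θ Δ' Γ Ψ) {C : ICst} (h : Entails Δ Φ C) (hC : C.WF Δ) :
    HOL Δ' Γ Ψ (.cst (C.bind θ)) :=
  .arith Δ Φ C θ m.wf m.cwf hC h m.ix m.hyps

end Model

section

variable {Δ Δ' Δ'' : ICtx} {Φ : List ICst} {Γ Γ' : Ctx} {Ψ Ψ' : List Fml} {θ θ' : ℕ → HIx}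
  {σ : ℕ → Tm}

/-- The term `x` provably satisfies the assertion of the unary type `A`. -/
def UTy.Sat (A : UTy) (θ : ℕ → HIx) (Δ : ICtx) (Γ : Ctx) (Ψ : List Fml) (x : Tm) : Prop :=
  HasTy Γ x A.erase.costV ∧ HOL Δ Γ Ψ (A.fml θ x)

/-- The term `x` provably computes a value of type `A` with cost between `k` and `l`. -/
def UTy.SatE (A : UTy) (k l : Idx) (θ : ℕ → HIx) (Δ : ICtx) (Γ : Ctx) (Ψ : List Fml) (x : Tm) :
    Prop :=
  HasTy Γ x A.erase.costE ∧ HOL Δ Γ Ψ (A.fml θ (.fst x)) ∧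
    HOL Δ Γ Ψ (.cst (.le (k.bind θ) (HIx.tm (.snd x)))) ∧
    HOL Δ Γ Ψ (.cst (.le (HIx.tm (.snd x)) (l.bind θ)))

/-- The terms `x` and `y` provably satisfy the assertion of the relational type `τ`. -/
def RTy.Sat (τ : RTy) (θ : ℕ → HIx) (Δ : ICtx) (Γ : Ctx) (Ψ : List Fml) (x y : Tm) : Prop :=
  HasTy Γ x τ.erase.costV ∧ HasTy Γ y τ.erase.costV ∧ HOL Δ Γ Ψ (τ.fml θ x y)

/-- The terms `x` and `y` provably compute values related by `τ`, and the difference of the costs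
is at most `l`. -/
def RTy.SatE (τ : RTy) (l : Idx) (θ : ℕ → HIx) (Δ : ICtx) (Γ : Ctx) (Ψ : List Fml) (x y : Tm) :
    Prop :=
  HasTy Γ x τ.erase.costE ∧ HasTy Γ y τ.erase.costE ∧ HOL Δ Γ Ψ (τ.fml θ (.fst x) (.fst y)) ∧
    HOL Δ Γ Ψ (Fml.dif (l.bind θ) x y)

theorem UTy.Sat.ext {A : UTy} {x : Tm} (h : A.Sat θ Δ Γ Ψ x) (e : HOL.Ext Δ Γ Ψ σ θ' Δ' Γ' Ψ') :
    A.Sat (fun i => (θ i).sub σ θ') Δ' Γ' Ψ' (x.subst σ) :=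
  ⟨h.1.subst e.tm, by rw [← UTy.fml_sub]; exact e.hol h.2⟩

theorem RTy.Sat.ext {τ : RTy} {x y : Tm} (h : τ.Sat θ Δ Γ Ψ x y)
    (e : HOL.Ext Δ Γ Ψ σ θ' Δ' Γ' Ψ') :
    τ.Sat (fun i => (θ i).sub σ θ') Δ' Γ' Ψ' (x.subst σ) (y.subst σ) :=
  ⟨h.1.subst e.tm, h.2.1.subst e.tm, by rw [← RTy.fml_sub]; exact e.hol h.2.2⟩

theorem UTy.Sat.rew {A : UTy} {x y : Tm} (h : A.Sat θ Δ' Γ Ψ x) (hA : A.WF Δ)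
    (hθ : HIx.Maps Δ θ Δ' Γ) (e : HOL Δ' Γ Ψ (.eq A.erase.costV x y)) : A.Sat θ Δ' Γ Ψ y := by
  refine ⟨e.wf.2.2, e.rew (φ := A.fml (Fml.tlift θ 1) (.var 0)) h.2
    (A.fml_wf hA (hθ.tlift _) (.var rfl)) ?_ ?_⟩ <;>
  simp only [Fml.inst, Fml.tsub, UTy.fml_sub, Fml.tlift_comp, HIx.comp_id] <;> rfl

theorem RTy.Sat.rew {τ : RTy} {x y x' y' : Tm} (h : τ.Sat θ Δ' Γ Ψ x y) (hτ : τ.WF Δ)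
    (hθ : HIx.Maps Δ θ Δ' Γ) (e : HOL Δ' Γ Ψ (.eq τ.erase.costV x x'))
    (e' : HOL Δ' Γ Ψ (.eq τ.erase.costV y y')) : τ.Sat θ Δ' Γ Ψ x' y' := by
  refine ⟨e.wf.2.2, e'.wf.2.2, ?_⟩
  have h₁ : HOL Δ' Γ Ψ (τ.fml θ x' y) := by
    refine e.rew (φ := τ.fml (Fml.tlift θ 1) (.var 0) (y.subst (Tm.sh 1))) h.2.2
      (τ.fml_wf hτ (hθ.tlift _) (.var rfl) (h.2.1.shift _)) ?_ ?_ <;>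
    simp only [Fml.inst, Fml.tsub, RTy.fml_sub, Fml.tlift_comp, HIx.comp_id,
      HOL.subst_shift_inst] <;> rfl
  refine e'.rew (φ := τ.fml (Fml.tlift θ 1) (x'.subst (Tm.sh 1)) (.var 0)) h₁
    (τ.fml_wf hτ (hθ.tlift _) (e.wf.2.2.shift _) (.var rfl)) ?_ ?_ <;>
  simp only [Fml.inst, Fml.tsub, RTy.fml_sub, Fml.tlift_comp, HIx.comp_id,
    HOL.subst_shift_inst] <;> rfl

namespace HOL

theorem le_sorts {I J : HIx} (h : HOL Δ Γ Ψ (.cst (.le I J))) :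
    HIx.HasSort Δ Γ I .real ∧ HIx.HasSort Δ Γ J .real := h.wf.2

/-- Monotonicity of upper bounds on the difference of costs, up to equality. -/
theorem le_congr {I J I' J' : HIx} (h : HOL Δ Γ Ψ (.cst (.le I J)))
    (e : HOL Δ Γ Ψ (.cst (.eq I I'))) (e' : HOL Δ Γ Ψ (.cst (.eq J J'))) :
    HOL Δ Γ Ψ (.cst (.le I' J')) := by
  refine .arith [.real, .real, .real, .real]
    [.le (.leaf 0) (.leaf 1), .eq (.leaf 0) (.leaf 2), .eq (.leaf 1) (.leaf 3)]
    (.le (.leaf 2) (.leaf 3)) (I ;; J ;; I' ;; J' ;; HIx.ivar) h.wf.1 ?_ ?_ ?_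
    ((((HIx.Maps.nil.cons e'.cst_eq_sorts.2).cons e.cst_eq_sorts.2).cons
      h.le_sorts.2).cons h.le_sorts.1) ?_
  · simp [ICst.WF, Cst.AllLeaves, Ix.AllLeaves]
  · simp [ICst.WF, Cst.AllLeaves, Ix.AllLeaves]
  · intro δ _ hδ
    simpa [Cst.Holds, Ix.eval] using
      (show δ 2 ≤ δ 3 by
        have h1 : δ 0 ≤ δ 1 := hδ (.le (.leaf 0) (.leaf 1)) (by simp)
        have h2 : δ 0 = δ 2 := hδ (.eq (.leaf 0) (.leaf 2)) (by simp)
        have h3 : δ 1 = δ 3 := hδ (.eq (.leaf 1) (.leaf 3)) (by simp)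
        rw [← h2, ← h3]; exact h1)
  · exact List.forall_mem_cons.2 ⟨h, List.forall_mem_cons.2 ⟨e, List.forall_mem_cons.2 ⟨e', by simp⟩⟩⟩

theorem le_trans {I J K : HIx} (h : HOL Δ Γ Ψ (.cst (.le I J)))
    (h' : HOL Δ Γ Ψ (.cst (.le J K))) : HOL Δ Γ Ψ (.cst (.le I K)) := by
  refine .arith [.real, .real, .real] [.le (.leaf 0) (.leaf 1), .le (.leaf 1) (.leaf 2)]
    (.le (.leaf 0) (.leaf 2)) (I ;; J ;; K ;; HIx.ivar) h.wf.1 ?_ ?_ ?_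
    (((HIx.Maps.nil.cons h'.le_sorts.2).cons h.le_sorts.2).cons h.le_sorts.1) ?_
  · simp [ICst.WF, Cst.AllLeaves, Ix.AllLeaves]
  · simp [ICst.WF, Cst.AllLeaves, Ix.AllLeaves]
  · intro δ _ hδ
    have h1 : δ 0 ≤ δ 1 := hδ (.le (.leaf 0) (.leaf 1)) (by simp)
    have h2 : δ 1 ≤ δ 2 := hδ (.le (.leaf 1) (.leaf 2)) (by simp)
    exact h1.trans h2
  · exact List.forall_mem_cons.2 ⟨h, List.forall_mem_cons.2 ⟨h', by simp⟩⟩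

end HOL

theorem UTy.SatE.val {A : UTy} {k l : Idx} {x : Tm} (h : A.SatE k l θ Δ Γ Ψ x) :
    A.Sat θ Δ Γ Ψ (.fst x) := ⟨.fst h.1, h.2.1⟩

theorem RTy.SatE.val {τ : RTy} {l : Idx} {x y : Tm} (h : τ.SatE l θ Δ Γ Ψ x y) :
    τ.Sat θ Δ Γ Ψ (.fst x) (.fst y) := ⟨.fst h.1, .fst h.2.1, h.2.2.1⟩

theorem UTy.SatE.rew {A : UTy} {k l : Idx} {x y : Tm} (h : A.SatE k l θ Δ' Γ Ψ x) (hA : A.WF Δ)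
    (hθ : HIx.Maps Δ θ Δ' Γ) (e : HOL Δ' Γ Ψ (.eq A.erase.costE x y)) : A.SatE k l θ Δ' Γ Ψ y :=
  have e' := HOL.cst_of_eq (HOL.eq_snd e)
  ⟨e.wf.2.2, (h.val.rew hA hθ e.eq_fst).2, h.2.2.1.le_congr (HOL.cst_refl e.wf.1 h.2.2.1.le_sorts.1) e',
    h.2.2.2.le_congr e' (HOL.cst_refl e.wf.1 h.2.2.2.le_sorts.2)⟩

theorem HOL.cst_sub_congr {I J I' J' : HIx} (h : HOL Δ Γ Ψ (.cst (.eq I I')))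
    (h' : HOL Δ Γ Ψ (.cst (.eq J J'))) : HOL Δ Γ Ψ (.cst (.eq (.sub I J) (.sub I' J'))) := by
  refine .arith [.real, .real, .real, .real] [.eq (.leaf 0) (.leaf 1), .eq (.leaf 2) (.leaf 3)]
    (.eq (.sub (.leaf 0) (.leaf 2)) (.sub (.leaf 1) (.leaf 3)))
    (I ;; I' ;; J ;; J' ;; HIx.ivar) h.wf.1 ?_ ?_ ?_
    ((((HIx.Maps.nil.cons h'.cst_eq_sorts.2).cons h'.cst_eq_sorts.1).cons
      h.cst_eq_sorts.2).cons h.cst_eq_sorts.1) ?_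
  · simp [ICst.WF, Cst.AllLeaves, Ix.AllLeaves]
  · simp [ICst.WF, Cst.AllLeaves, Ix.AllLeaves]
  · intro δ _ hδ
    have h1 : δ 0 = δ 1 := hδ (.eq (.leaf 0) (.leaf 1)) (by simp)
    have h2 : δ 2 = δ 3 := hδ (.eq (.leaf 2) (.leaf 3)) (by simp)
    simp [Cst.Holds, Ix.eval, h1, h2]
  · exact List.forall_mem_cons.2 ⟨h, List.forall_mem_cons.2 ⟨h', by simp⟩⟩

theorem RTy.SatE.rew {τ : RTy} {l : Idx} {x y x' y' : Tm} (h : τ.SatE l θ Δ' Γ Ψ x y)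
    (hτ : τ.WF Δ) (hθ : HIx.Maps Δ θ Δ' Γ) (e : HOL Δ' Γ Ψ (.eq τ.erase.costE x x'))
    (e' : HOL Δ' Γ Ψ (.eq τ.erase.costE y y')) : τ.SatE l θ Δ' Γ Ψ x' y' :=
  ⟨e.wf.2.2, e'.wf.2.2, (h.val.rew hτ hθ e.eq_fst e'.eq_fst).2.2,
    h.2.2.2.le_congr ((HOL.cst_of_eq (HOL.eq_snd e)).cst_sub_congr (HOL.cst_of_eq (HOL.eq_snd e')))
      (HOL.cst_refl e.wf.1 h.2.2.2.le_sorts.2)⟩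

theorem UTy.arrI {A B : UTy} {k l : Idx} {x : Tm} (hθ : HIx.Maps Δ θ Δ' Γ) (hΨ : CWF Δ' Γ Ψ)
    (hA : A.WF Δ) (hx : HasTy Γ x (UTy.arr A k l B).erase.costV)
    (h : ∀ {Δ'' Γ' Ψ' σ θ' w}, HOL.Ext Δ' Γ Ψ σ θ' Δ'' Γ' Ψ' →
      A.Sat (fun i => (θ i).sub σ θ') Δ'' Γ' Ψ' w →
      B.SatE k l (fun i => (θ i).sub σ θ') Δ'' Γ' Ψ' (.app (x.subst σ) w)) :
    (UTy.arr A k l B).Sat θ Δ' Γ Ψ x := by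
  refine ⟨hx, HOL.all_impI (A.fml_wf hA (hθ.tlift _) (.var rfl)) hΨ fun Ψ' e hA' => ?_⟩
  obtain ⟨_, h₁, h₂, h₃⟩ := h e ⟨.var rfl, hA'⟩
  exact .andI h₁ (.andI h₂ h₃)

theorem UTy.Sat.app {A B : UTy} {k l : Idx} {x w : Tm} (h : (UTy.arr A k l B).Sat θ Δ Γ Ψ x)
    (hw : A.Sat θ Δ Γ Ψ w) : B.SatE k l θ Δ Γ Ψ (.app x w) := by
  have h' := HOL.all_imp_elim h.2 hw.1 (by
    rw [UTy.fml_sub, Fml.tlift_comp, HIx.comp_id]; exact hw.2)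
  simp only [Fml.and_sub, UTy.fml_sub, Fml.bnds_sub, Idx.bind_sub, Fml.tlift_comp, HIx.comp_id,
    Tm.subst, HOL.subst_shift_inst] at h'
  exact ⟨.app h.1 hw.1, h'.andE₁, h'.andE₂.andE₁, h'.andE₂.andE₂⟩

theorem UTy.allI {A : UTy} {S : Srt} {k l : Idx} {x : Tm} (hΨ : CWF Δ' Γ Ψ)
    (hx : HasTy Γ x (UTy.all S k l A).erase.costV)
    (h : ∀ {Δ'' Γ' Ψ' σ θ' w I}, HOL.Ext Δ' Γ Ψ σ θ' Δ'' Γ' Ψ' → HasTy Γ' w .nat →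
      HIx.HasSort Δ'' Γ' I S →
      A.SatE k l (I ;; fun i => (θ i).sub σ θ') Δ'' Γ' Ψ' (.app (x.subst σ) w)) :
    (UTy.all S k l A).Sat θ Δ' Γ Ψ x := by
  refine ⟨hx, HOL.all_impI trivial hΨ fun Ψ' e _ => HOL.alliI' e.wf fun Ψ'' e' => ?_⟩
  obtain ⟨_, h₁, h₂, h₃⟩ := h (e.comp e') (w := .var 0) (.var rfl) (HIx.Maps.ivar _ _ 0 S rfl)
  have hθ : (HIx.ivar 0 ;; fun i => (θ i).sub (fun n => (Tm.sh 1 n).subst Tm.var)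
      (fun i => (HIx.ivar i).sub Tm.var (HIx.ish 1))) = Fml.ilift (Fml.tlift θ 1) := by
    funext i
    cases i with
    | zero => rfl
    | succ i => simp only [Fml.ilift, Fml.tlift, scons_succ, HIx.sub_sub]
  rw [hθ] at h₁ h₂ h₃
  exact .andI h₁ (.andI h₂ h₃)

theorem UTy.Sat.iapp {A : UTy} {S : Srt} {k l : Idx} {x w : Tm} {I : HIx}
    (h : (UTy.all S k l A).Sat θ Δ Γ Ψ x) (hw : HasTy Γ w .nat) (hI : HIx.HasSort Δ Γ I S) :
    A.SatE k l (I ;; θ) Δ Γ Ψ (.app x w) := by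
  have h₁ := HOL.all_imp_elim h.2 hw (.topI h.2.wf.1)
  simp only [Fml.alli_sub, Fml.and_sub, UTy.fml_sub, Fml.bnds_sub, Idx.bind_sub, Fml.ilift_sub,
    Fml.tlift_comp, HIx.comp_id, Tm.subst, HOL.subst_shift_inst, scons_zero] at h₁
  have h₂ := h₁.alliE hI
  simp only [Fml.iinst, Fml.isub, Fml.and_sub, UTy.fml_sub, Fml.bnds_sub, Idx.bind_sub,
    Fml.ilift_comp, HIx.comp_id, Tm.subst_var] at h₂
  exact ⟨.app h.1 hw, h₂.andE₁, h₂.andE₂.andE₁, h₂.andE₂.andE₂⟩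

theorem RTy.arrI {τ τ' : RTy} {l : Idx} {x y : Tm} (hθ : HIx.Maps Δ θ Δ' Γ) (hΨ : CWF Δ' Γ Ψ)
    (hτ : τ.WF Δ) (hx : (UTy.arr τ.bar (.num 0) .inf τ'.bar).Sat θ Δ' Γ Ψ x)
    (hy : (UTy.arr τ.bar (.num 0) .inf τ'.bar).Sat θ Δ' Γ Ψ y)
    (h : ∀ {Δ'' Γ' Ψ' σ θ' w z}, HOL.Ext Δ' Γ Ψ σ θ' Δ'' Γ' Ψ' →
      τ.Sat (fun i => (θ i).sub σ θ') Δ'' Γ' Ψ' w z →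
      τ'.SatE l (fun i => (θ i).sub σ θ') Δ'' Γ' Ψ' (.app (x.subst σ) w) (.app (y.subst σ) z)) :
    (RTy.arr τ l τ').Sat θ Δ' Γ Ψ x y := by
  have hb := (RTy.arr τ l τ').bar_erase
  refine ⟨hb ▸ hx.1, hb ▸ hy.1, .andI hx.2 (.andI hy.2 (HOL.allI' hΨ fun Ψ₁ e₁ =>
    HOL.all_impI (τ.fml_wf hτ (hθ.tlift₂ _ _) (.var rfl) (.var rfl)) e₁.wf fun Ψ₂ e₂ hA => ?_))⟩
  obtain ⟨_, _, h₁, h₂⟩ := h (e₁.comp e₂) ⟨.var rfl, .var rfl, hA⟩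
  exact .andI h₁ h₂

theorem RTy.Sat.arr_bar {τ τ' : RTy} {l : Idx} {x y : Tm} (h : (RTy.arr τ l τ').Sat θ Δ Γ Ψ x y) :
    (UTy.arr τ.bar (.num 0) .inf τ'.bar).Sat θ Δ Γ Ψ x ∧
      (UTy.arr τ.bar (.num 0) .inf τ'.bar).Sat θ Δ Γ Ψ y :=
  have hb := (RTy.arr τ l τ').bar_erase
  ⟨⟨hb.symm ▸ h.1, h.2.2.andE₁⟩, hb.symm ▸ h.2.1, h.2.2.andE₂.andE₁⟩

theorem RTy.Sat.app {τ τ' : RTy} {l : Idx} {x y w z : Tm} (h : (RTy.arr τ l τ').Sat θ Δ Γ Ψ x y)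
    (hw : τ.Sat θ Δ Γ Ψ w z) : τ'.SatE l θ Δ Γ Ψ (.app x w) (.app y z) := by
  have h₁ := h.2.2.andE₂.andE₂.allE hw.1
  simp only [Fml.inst, Fml.tsub, Fml.all_sub, Fml.imp_sub, Fml.and_sub,
    RTy.fml_sub, Fml.dif_sub, Idx.bind_sub] at h₁
  have h₂ := h₁.allE hw.2.1
  simp only [Fml.inst, Fml.tsub, Fml.imp_sub, Fml.and_sub, RTy.fml_sub, Fml.dif_sub,
    Idx.bind_sub, Fml.inst_tlift₂, Fml.inst_sh₂, Tm.subst] at h₂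
  simp only [Tm.up_eq, scons_zero, scons_succ, Tm.subst, HOL.subst_shift_inst] at h₂
  exact ⟨.app h.1 hw.1, .app h.2.1 hw.2.1, (h₂.impE hw.2.2).andE₁, (h₂.impE hw.2.2).andE₂⟩

theorem RTy.allI {τ : RTy} {S : Srt} {l : Idx} {x y : Tm} (hΨ : CWF Δ' Γ Ψ)
    (hx : (UTy.all S (.num 0) .inf τ.bar).Sat θ Δ' Γ Ψ x)
    (hy : (UTy.all S (.num 0) .inf τ.bar).Sat θ Δ' Γ Ψ y)
    (h : ∀ {Δ'' Γ' Ψ' σ θ' w z I}, HOL.Ext Δ' Γ Ψ σ θ' Δ'' Γ' Ψ' → HasTy Γ' w .nat →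
      HasTy Γ' z .nat → HIx.HasSort Δ'' Γ' I S →
      τ.SatE l (I ;; fun i => (θ i).sub σ θ') Δ'' Γ' Ψ' (.app (x.subst σ) w) (.app (y.subst σ) z)) :
    (RTy.all S l τ).Sat θ Δ' Γ Ψ x y := by
  have hb := (RTy.all S l τ).bar_erase
  refine ⟨hb ▸ hx.1, hb ▸ hy.1, .andI hx.2 (.andI hy.2 (HOL.allI' hΨ fun Ψ₁ e₁ =>
    HOL.all_impI trivial e₁.wf fun Ψ₂ e₂ _ => HOL.alliI' e₂.wf fun Ψ₃ e₃ => ?_))⟩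
  obtain ⟨_, _, h₁, h₂⟩ := h ((e₁.comp e₂).comp e₃) (w := .var 1) (z := .var 0) (.var rfl) (.var rfl)
    (HIx.Maps.ivar _ _ 0 S rfl)
  have hθ : (HIx.ivar 0 ;; fun i => (θ i).sub
      (fun n => ((Tm.sh 1 n).subst (Tm.sh 1)).subst Tm.var)
      (fun i => ((HIx.ivar i).sub (Tm.sh 1) HIx.ivar).sub Tm.var (HIx.ish 1))) =
      Fml.ilift (Fml.tlift θ 2) := by
    funext i
    cases i with
    | zero => rfl
    | succ i => simp only [Fml.ilift, Fml.tlift, scons_succ, HIx.sub_sub]; rfl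
  rw [hθ] at h₁ h₂
  exact .andI h₁ h₂

theorem RTy.Sat.all_bar {τ : RTy} {S : Srt} {l : Idx} {x y : Tm}
    (h : (RTy.all S l τ).Sat θ Δ Γ Ψ x y) :
    (UTy.all S (.num 0) .inf τ.bar).Sat θ Δ Γ Ψ x ∧ (UTy.all S (.num 0) .inf τ.bar).Sat θ Δ Γ Ψ y :=
  have hb := (RTy.all S l τ).bar_erase
  ⟨⟨hb.symm ▸ h.1, h.2.2.andE₁⟩, hb.symm ▸ h.2.1, h.2.2.andE₂.andE₁⟩

theorem RTy.Sat.iapp {τ : RTy} {S : Srt} {l : Idx} {x y w z : Tm} {I : HIx}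
    (h : (RTy.all S l τ).Sat θ Δ Γ Ψ x y) (hw : HasTy Γ w .nat) (hz : HasTy Γ z .nat)
    (hI : HIx.HasSort Δ Γ I S) : τ.SatE l (I ;; θ) Δ Γ Ψ (.app x w) (.app y z) := by
  have h₁ := h.2.2.andE₂.andE₂.allE hw
  simp only [Fml.inst, Fml.tsub, Fml.all_sub, Fml.imp_sub, Fml.and_sub, Fml.alli_sub,
    RTy.fml_sub, Fml.dif_sub, Idx.bind_sub, Fml.ilift_sub] at h₁
  have h₂ := h₁.allE hz
  simp only [Fml.inst, Fml.tsub, Fml.imp_sub, Fml.and_sub, Fml.alli_sub, RTy.fml_sub,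
    Fml.dif_sub, Idx.bind_sub, Fml.ilift_sub, Fml.inst_tlift₂, Fml.inst_sh₂, Tm.subst] at h₂
  simp only [Tm.up_eq, scons_zero, scons_succ, Tm.subst, HOL.subst_shift_inst] at h₂
  have h₃ := (h₂.impE (.topI h.2.2.wf.1)).alliE hI
  simp only [Fml.iinst, Fml.isub, Fml.and_sub, RTy.fml_sub, Fml.dif_sub, Idx.bind_sub,
    Fml.ilift_comp, HIx.comp_id, Tm.subst_var] at h₃
  exact ⟨.app h.1 hw, .app h.2.1 hz, h₃.andE₁, h₃.andE₂⟩

end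

/-! ## Monotonicity of the predicates on lists -/

namespace Fml

theorem up_inst (P : Fml) (σ σ' : ℕ → Tm) (θ θ' : ℕ → HIx) (w : Tm) :
    (P.sub (Tm.up fun n => (σ n).subst σ') (tlift (fun i => (θ i).sub σ' θ') 1)).sub
      (w.subst σ' ;; Tm.var) HIx.ivar = (P.sub (w ;; σ) θ).sub σ' θ' := by
  simp only [sub_sub]
  refine sub_congr _ (fun n => ?_) (fun i => ?_)
  · rcases n with _ | n <;> simp [Tm.up_eq, Tm.subst]
  · simp only [tlift, HIx.sub_sub]
    rw [← HIx.sub_id (HIx.sub (θ i) σ' θ'), HIx.sub_sub]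
    simp only [Tm.subst_subst]
    rfl

theorem up_inst₂ (P : Fml) (σ σ' : ℕ → Tm) (θ θ' : ℕ → HIx) (w z : Tm) :
    (P.sub (Tm.up (Tm.up fun n => (σ n).subst σ')) (tlift (fun i => (θ i).sub σ' θ') 2)).sub
      (z.subst σ' ;; w.subst σ' ;; Tm.var) HIx.ivar = (P.sub (z ;; w ;; σ) θ).sub σ' θ' := by
  simp only [sub_sub]
  refine sub_congr _ (fun n => ?_) (fun i => ?_)
  · rcases n with _ | _ | n <;> simp [Tm.up_eq, Tm.subst]
  · simp only [tlift, HIx.sub_sub]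
    rw [← HIx.sub_id (HIx.sub (θ i) σ' θ'), HIx.sub_sub]
    simp only [Tm.subst_subst]
    rfl

end Fml

namespace HOL

variable {Δ : ICtx} {Γ : Ctx} {Ψ : List Fml}

theorem eq_cons {τ : Ty} {t t' u u' : Tm} (h : HOL Δ Γ Ψ (.eq τ t t'))
    (h' : HOL Δ Γ Ψ (.eq (.list τ) u u')) : HOL Δ Γ Ψ (.eq (.list τ) (.cons t u) (.cons t' u')) := by
  have h₁ := h.eq_congr (s := .cons (.var 0) (u.subst (Tm.sh 1))) (.cons (.var rfl) (h'.wf.2.1.shift _))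
  have h₂ := h'.eq_congr (s := .cons (t'.subst (Tm.sh 1)) (.var 0))
    (.cons (h.wf.2.2.shift _) (.var rfl))
  simp only [Tm.subst, subst_shift_inst, scons_zero] at h₁ h₂
  exact h₁.eq_trans h₂

theorem listU_mono {τ : Ty} {n : HIx} {l : Tm} {P P' : Fml} (h : HOL Δ Γ Ψ (.listU τ n l P))
    (hP' : P'.WF Δ (τ :: Γ))
    (H : ∀ {Δ' Γ' Ψ' σ θ w}, Ext Δ Γ Ψ σ θ Δ' Γ' Ψ' → HasTy Γ' w τ → HOL Δ' Γ' Ψ' (P.sub (w ;; σ) θ) →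
      HOL Δ' Γ' Ψ' (P'.sub (w ;; σ) θ)) : HOL Δ Γ Ψ (.listU τ n l P') := by
  have hχ : Fml.WF (.nat :: Δ) (.list τ :: Γ)
      (.listU τ (HIx.ivar 0) (.var 0) (P'.sub (Tm.up (Tm.sh 1)) (HIx.ish 1))) :=
    ⟨HIx.Maps.ivar _ _ 0 .nat rfl, .var rfl,
      hP'.sub ((Tm.Maps.sh_one _ _).up _) (HIx.Maps.ish _ _ _)⟩
  have e : ∀ {k m σ θ}, Fml.sub
      (.listU τ (HIx.ivar 0) (.var 0) (P'.sub (Tm.up (Tm.sh 1)) (HIx.ish 1))) (k ;; σ) (m ;; θ) =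
      .listU τ m k (P'.sub (Tm.up σ) (Fml.tlift θ 1)) := by
    intro k m σ θ
    simp only [Fml.listU_sub, Fml.sub_sub]
    congr 1
    refine Fml.sub_congr _ (fun n => ?_) (fun i => rfl)
    rcases n with _ | n <;> simp [Tm.up_eq, Tm.subst]
  have := listU_ind' hχ h ?_ ?_
  · rwa [e, Tm.up_var, Fml.tlift_ivar, Fml.sub_id] at this
  · rw [e, Tm.up_var, Fml.tlift_ivar, Fml.sub_id]; exact listU_nil h.wf.1 hP'
  · intro Δ' Γ' Ψ' σ θ n' w ws e' hw hPw ih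
    rw [e] at ih ⊢
    refine listU_cons hw ((congrArg (HOL _ _ _) ?_).mpr (H e' hw hPw)) ih
    have := Fml.up_inst P' σ Tm.var θ HIx.ivar w
    simp only [Tm.subst_var, HIx.sub_id, Fml.sub_id] at this
    exact this

theorem listR_unary {τ : Ty} {n a : HIx} {l₁ l₂ : Tm} {P P₁ P₂ : Fml}
    (h : HOL Δ Γ Ψ (.listR τ n l₁ l₂ a P)) (hP₁ : P₁.WF Δ (τ :: Γ)) (hP₂ : P₂.WF Δ (τ :: Γ))
    (H : ∀ {Δ' Γ' Ψ' σ θ w z}, Ext Δ Γ Ψ σ θ Δ' Γ' Ψ' → HasTy Γ' w τ → HasTy Γ' z τ →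
      HOL Δ' Γ' Ψ' (P.sub (z ;; w ;; σ) θ) →
      HOL Δ' Γ' Ψ' (P₁.sub (w ;; σ) θ) ∧ HOL Δ' Γ' Ψ' (P₂.sub (z ;; σ) θ)) :
    HOL Δ Γ Ψ (.listU τ n l₁ P₁) ∧ HOL Δ Γ Ψ (.listU τ n l₂ P₂) := by
  obtain ⟨χ, eχ⟩ : ∃ χ : Fml, χ =
    .and (.listU τ (HIx.ivar 1) (.var 1) (P₁.sub (Tm.up (Tm.sh 2)) (HIx.ish 2)))
      (.listU τ (HIx.ivar 1) (.var 0) (P₂.sub (Tm.up (Tm.sh 2)) (HIx.ish 2))) := ⟨_, rfl⟩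
  have hχ : Fml.WF (.nat :: .nat :: Δ) (.list τ :: .list τ :: Γ) χ := by
    rw [eχ]
    exact ⟨⟨HIx.Maps.ivar _ _ 1 .nat rfl, .var rfl,
      hP₁.sub ((Tm.Maps.sh_two _ _ _).up _) (HIx.Maps.ish_two _ _ _ _)⟩,
      HIx.Maps.ivar _ _ 1 .nat rfl, .var rfl,
      hP₂.sub ((Tm.Maps.sh_two _ _ _).up _) (HIx.Maps.ish_two _ _ _ _)⟩
  have e : ∀ {k₁ k₂ b m σ θ}, χ.sub (k₂ ;; k₁ ;; σ) (b ;; m ;; θ) =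
      .and (.listU τ m k₁ (P₁.sub (Tm.up σ) (Fml.tlift θ 1)))
        (.listU τ m k₂ (P₂.sub (Tm.up σ) (Fml.tlift θ 1))) := by
    intro k₁ k₂ b m σ θ
    subst eχ
    simp only [Fml.and_sub, Fml.listU_sub, Fml.sub_sub]
    congr 1 <;> congr 1 <;>
    · refine Fml.sub_congr _ (fun n => ?_) (fun i => rfl)
      rcases n with _ | n <;> simp [Tm.up_eq, Tm.subst]
  have eP : ∀ (P : Fml) w σ θ, (P.sub (Tm.up σ) (Fml.tlift θ 1)).inst w = P.sub (w ;; σ) θ := by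
    intro P w σ θ
    have := Fml.up_inst P σ Tm.var θ HIx.ivar w
    simp only [Tm.subst_var, HIx.sub_id, Fml.sub_id] at this
    exact this
  have := listR_ind hχ h ?_ ?_ ?_
  · rw [e, Tm.up_var, Fml.tlift_ivar, Fml.sub_id, Fml.sub_id] at this
    exact this.andE
  · intro Δ' Γ' Ψ' σ θ a' e' ha'
    rw [e]
    exact .andI (listU_nil e'.wf (hP₁.sub (e'.tm.up _) (e'.ix.tlift _)))
      (listU_nil e'.wf (hP₂.sub (e'.tm.up _) (e'.ix.tlift _)))
  · intro Δ' Γ' Ψ' σ θ n' a' w z ws zs e' hP E _ ih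
    rw [e] at ih ⊢
    obtain ⟨h₁, h₂⟩ := H e' E.wf.2.1 E.wf.2.2 hP
    exact .andI (listU_cons E.wf.2.1 (by rwa [eP]) ih.andE₁)
      (listU_cons E.wf.2.2 (by rwa [eP]) ih.andE₂)
  · intro Δ' Γ' Ψ' σ θ n' b w z ws zs e' hw hz hP _ ih
    rw [e] at ih ⊢
    obtain ⟨h₁, h₂⟩ := H e' hw hz hP
    exact .andI (listU_cons hw (by rwa [eP]) ih.andE₁) (listU_cons hz (by rwa [eP]) ih.andE₂)

/-- Related lists are equal if related elements are. -/
theorem listR_eq {τ : Ty} {n a : HIx} {l₁ l₂ : Tm} {P : Fml}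
    (h : HOL Δ Γ Ψ (.listR τ n l₁ l₂ a P))
    (H : ∀ {Δ' Γ' Ψ' σ θ w z}, Ext Δ Γ Ψ σ θ Δ' Γ' Ψ' → HOL Δ' Γ' Ψ' (P.sub (z ;; w ;; σ) θ) →
      HOL Δ' Γ' Ψ' (.eq τ w z)) : HOL Δ Γ Ψ (.eq (.list τ) l₁ l₂) := by
  have hχ : Fml.WF (.nat :: .nat :: Δ) (.list τ :: .list τ :: Γ) (.eq (.list τ) (.var 1) (.var 0)) :=
    ⟨.var rfl, .var rfl⟩
  refine listR_ind hχ h ?_ ?_ ?_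
  · intro Δ' Γ' Ψ' σ θ a' e' _
    exact eq_refl e'.wf .nil
  · intro Δ' Γ' Ψ' σ θ n' a' w z ws zs e' hP E _ ih
    exact E.eq_cons ih
  · intro Δ' Γ' Ψ' σ θ n' b w z ws zs e' _ _ hP _ ih
    exact (H e' hP).eq_cons ih

theorem listR_zero_mono {τ : Ty} {n a : HIx} {l₁ l₂ : Tm} {P P' : Fml}
    (h : HOL Δ Γ Ψ (.listR τ n l₁ l₂ a P)) (hP' : P'.WF Δ (τ :: τ :: Γ))
    (h₀ : HOL Δ Γ Ψ (.cst (.eq a (.num 0))))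
    (H : ∀ {Δ' Γ' Ψ' σ θ w z}, Ext Δ Γ Ψ σ θ Δ' Γ' Ψ' → HOL Δ' Γ' Ψ' (.eq τ w z) →
      HOL Δ' Γ' Ψ' (P.sub (z ;; w ;; σ) θ) → HOL Δ' Γ' Ψ' (P'.sub (z ;; w ;; σ) θ)) :
    HOL Δ Γ Ψ (.listR τ n l₁ l₂ a P') := by
  obtain ⟨χ, eχ⟩ : ∃ χ : Fml, χ = .imp (.cst (.eq (HIx.ivar 0) (.num 0)))
    (.listR τ (HIx.ivar 1) (.var 1) (.var 0) (HIx.ivar 0)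
      (P'.sub (Tm.up (Tm.up (Tm.sh 2))) (HIx.ish 2))) := ⟨_, rfl⟩
  have hi : HIx.HasSort (.nat :: .nat :: Δ) (.list τ :: .list τ :: Γ) (HIx.ivar 0) .nat :=
    HIx.Maps.ivar _ _ 0 .nat rfl
  have hχ : Fml.WF (.nat :: .nat :: Δ) (.list τ :: .list τ :: Γ) χ := by
    rw [eχ]
    exact ⟨⟨hi.real, trivial⟩, HIx.Maps.ivar _ _ 1 .nat rfl, .var rfl, .var rfl, hi,
      hP'.sub (((Tm.Maps.sh_two _ _ _).up _).up _) (HIx.Maps.ish_two _ _ _ _)⟩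
  have e : ∀ {k₁ k₂ b m σ θ}, χ.sub (k₂ ;; k₁ ;; σ) (b ;; m ;; θ) =
      .imp (.cst (.eq b (.num 0)))
        (.listR τ m k₁ k₂ b (P'.sub (Tm.up (Tm.up σ)) (Fml.tlift θ 2))) := by
    intro k₁ k₂ b m σ θ
    subst eχ
    simp only [Fml.imp_sub, Fml.listR_sub, Fml.sub_sub]
    congr 1
    congr 1
    refine Fml.sub_congr _ (fun n => ?_) (fun i => rfl)
    rcases n with _ | _ | n <;> simp [Tm.up_eq, Tm.subst]
  have eP : ∀ w z σ θ, (P'.sub (Tm.up (Tm.up σ)) (Fml.tlift θ 2)).sub (z ;; w ;; Tm.var) HIx.ivar =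
      P'.sub (z ;; w ;; σ) θ := by
    intro w z σ θ
    have := Fml.up_inst₂ P' σ Tm.var θ HIx.ivar w z
    simpa only [Tm.subst_var, HIx.sub_id, Fml.sub_id] using this
  have := listR_ind hχ h ?_ ?_ ?_
  · rw [e, Tm.up_var, Tm.up_var, Fml.tlift_ivar, Fml.sub_id] at this
    exact this.impE h₀
  · intro Δ' Γ' Ψ' σ θ a' e' ha'
    rw [e]
    have hz : Fml.WF Δ' Γ' (.cst (.eq a' (.num 0))) := ⟨ha'.real, trivial⟩
    exact .impI (listR_nil (e'.wf.cons hz) ha' (hP'.sub ((e'.tm.up _).up _) (e'.ix.tlift₂ _ _)))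
  · intro Δ' Γ' Ψ' σ θ n' a' w z ws zs e' hP E _ ih
    rw [e] at ih ⊢
    refine impI' ih.wf.2.1 e'.wf fun Ψ₁ e₁ h₁ => ?_
    have hw : ∀ {φ}, HOL Δ' Γ' Ψ' φ → HOL Δ' Γ' Ψ₁ φ := fun h => by simpa using e₁.hol h
    exact listR_cons_eq (hw (by rw [eP]; exact H e' E hP)) (hw E) ((hw ih).impE h₁)
  · intro Δ' Γ' Ψ' σ θ n' b w z ws zs e' hw hz hP hl ih
    rw [e] at ih ⊢
    obtain ⟨⟨hb, -⟩, hn', hws, hzs, hb', hP''⟩ := ih.wf.2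
    have hs : HIx.HasSort Δ' Γ' (.add b (.num 1)) .nat := ⟨hb', trivial⟩
    refine impI' ⟨hs.real, trivial⟩ e'.wf fun Ψ₁ e₁ h₁ => ?_
    refine absurd_cst (Δ' := [.nat]) (Cs := [.eq (.add (.leaf 0) (.num 1)) (.num 0)])
      (θ := b ;; HIx.ivar) e₁.wf ?_ ?_ (HIx.Maps.nil.cons hb') (List.forall_mem_singleton.2 h₁)
      ⟨⟨hn', trivial⟩, .cons hw hws, .cons hz hzs, hs, hP''⟩
    · simp [ICst.WF, Cst.AllLeaves, Ix.AllLeaves]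
    · intro δ hδ hD
      obtain ⟨m, hm⟩ := hδ 0 .nat rfl
      have h2 : δ 0 + ((1 : ℕ) : EReal) = ((0 : ℕ) : EReal) := by
        simpa [Cst.Holds, Ix.eval] using hD (.eq (.add (.leaf 0) (.num 1)) (.num 0)) (by simp)
      rw [hm] at h2
      exact absurd (by exact_mod_cast h2) (Nat.succ_ne_zero m)

theorem listR_mono {τ : Ty} {n a a' : HIx} {l₁ l₂ : Tm} {P P' : Fml}
    (h : HOL Δ Γ Ψ (.listR τ n l₁ l₂ a P)) (hP' : P'.WF Δ (τ :: τ :: Γ))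
    (ha' : HIx.HasSort Δ Γ a' .nat) (hle : HOL Δ Γ Ψ (.cst (.le a a')))
    (H : ∀ {Δ' Γ' Ψ' σ θ w z}, Ext Δ Γ Ψ σ θ Δ' Γ' Ψ' → HasTy Γ' w τ → HasTy Γ' z τ →
      HOL Δ' Γ' Ψ' (P.sub (z ;; w ;; σ) θ) → HOL Δ' Γ' Ψ' (P'.sub (z ;; w ;; σ) θ)) :
    HOL Δ Γ Ψ (.listR τ n l₁ l₂ a' P') := by
  obtain ⟨χ, eχ⟩ : ∃ χ : Fml, χ = .alli .nat (.imp (.cst (.le (HIx.ivar 1) (HIx.ivar 0)))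
    (.listR τ (HIx.ivar 2) (.var 1) (.var 0) (HIx.ivar 0)
      (P'.sub (Tm.up (Tm.up (Tm.sh 2))) (HIx.ish 3)))) := ⟨_, rfl⟩
  have hi : ∀ {Δ : ICtx} {Γ : Ctx}, HIx.HasSort (.nat :: Δ) Γ (HIx.ivar 0) .nat :=
    HIx.Maps.ivar _ _ 0 .nat rfl
  have hi₁ : ∀ {Δ : ICtx} {Γ : Ctx} {S}, HIx.HasSort (S :: .nat :: Δ) Γ (HIx.ivar 1) .nat :=
    HIx.Maps.ivar _ _ 1 .nat rfl
  have hχ : Fml.WF (.nat :: .nat :: Δ) (.list τ :: .list τ :: Γ) χ := by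
    rw [eχ]
    exact ⟨⟨hi₁.real, hi.real⟩, HIx.Maps.ivar _ _ 2 .nat rfl, .var rfl, .var rfl, hi,
      hP'.sub (((Tm.Maps.sh_two _ _ _).up _).up _)
        (fun i S h => HIx.Maps.ivar _ _ (i + 3) S (by simpa using h))⟩
  have elim : ∀ {Δ' Γ' Ψ' k₁ k₂ b b' m σ θ}, HOL Δ' Γ' Ψ' (χ.sub (k₂ ;; k₁ ;; σ) (b ;; m ;; θ)) →
      HIx.HasSort Δ' Γ' b' .nat → HOL Δ' Γ' Ψ' (.cst (.le b b')) →
      HOL Δ' Γ' Ψ' (.listR τ m k₁ k₂ b' (P'.sub (Tm.up (Tm.up σ)) (Fml.tlift θ 2))) := by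
    intro Δ' Γ' Ψ' k₁ k₂ b b' m σ θ h hb' hle
    rw [eχ] at h
    refine (congrArg (HOL _ _ _) ?_).mp (HOL.impE (h.alliE hb') ((congrArg (HOL _ _ _) ?_).mp hle))
    · simp only [Fml.sub_sub, Fml.listR_sub]
      congr 1
      · simp [HIx.shift_eq]
      · exact Tm.subst_var _
      · exact Tm.subst_var _
      · refine Fml.sub_congr _ (fun n => ?_) (fun i => ?_)
        · rcases n with _ | _ | n <;> simp [Tm.up_eq, Tm.subst]
        · simp [Fml.tlift, HIx.shift_eq, Tm.subst, Tm.up_var]; rfl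
    · simp only [Fml.cst_sub, HCst.le_sub, HIx.ivar_sub, HIx.shift_eq, scons_zero, scons_succ, HIx.sub_sub]
      congr 2
      exact (HIx.sub_id b).symm
  have intro' : ∀ {Δ' Γ' Ψ' k₁ k₂ b m σ θ}, Ext Δ Γ Ψ σ θ Δ' Γ' Ψ' → HasTy Γ' k₁ (.list τ) →
      HasTy Γ' k₂ (.list τ) → HIx.HasSort Δ' Γ' b .nat → HIx.HasSort Δ' Γ' m .nat →
      (∀ {Δ'' Ψ'' θ' b'}, Ext Δ' Γ' Ψ' Tm.var θ' Δ'' Γ' Ψ'' → HIx.HasSort Δ'' Γ' b' .nat →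
        HOL Δ'' Γ' Ψ'' (.cst (.le (b.sub Tm.var θ') b')) →
        HOL Δ'' Γ' Ψ'' (.listR τ (m.sub Tm.var θ') k₁ k₂ b'
          (P'.sub (Tm.up (Tm.up σ)) (Fml.tlift (fun i => (θ i).sub Tm.var θ') 2)))) →
      HOL Δ' Γ' Ψ' (χ.sub (k₂ ;; k₁ ;; σ) (b ;; m ;; θ)) := by
    intro Δ' Γ' Ψ' k₁ k₂ b m σ θ e hk₁ hk₂ hb hm H
    have hw := hχ.sub ((e.tm.cons hk₁).cons hk₂) ((e.ix.cons hm).cons hb)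
    rw [eχ] at hw ⊢
    refine alliI' e.wf fun Ψ₁ e₁ => impI' hw.1 e₁.wf fun Ψ₂ e₂ hl => ?_
    refine (congrArg (HOL _ _ _) ?_).mpr (H (e₁.comp e₂) (b' := HIx.ivar 0) hi
      ((congrArg (HOL _ _ _) ?_).mpr hl))
    · simp only [Fml.sub_sub, Fml.listR_sub]
      congr 1
      refine Fml.sub_congr _ (fun n => ?_) (fun i => ?_)
      · rcases n with _ | _ | n <;> simp [Tm.up_eq, Tm.subst]
      · simp [Fml.tlift, HIx.shift_eq, Tm.subst]
    · simp [HIx.shift_eq, Fml.ilift]; rfl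
  have eP : ∀ w z σ θ, (P'.sub (Tm.up (Tm.up σ)) (Fml.tlift θ 2)).sub (z ;; w ;; Tm.var) HIx.ivar =
      P'.sub (z ;; w ;; σ) θ := by
    intro w z σ θ
    have := Fml.up_inst₂ P' σ Tm.var θ HIx.ivar w z
    simpa only [Tm.subst_var, HIx.sub_id, Fml.sub_id] using this
  have := elim (listR_ind hχ h ?_ ?_ ?_) ha' hle
  · rwa [Tm.up_var, Tm.up_var, Fml.tlift_ivar, Fml.sub_id] at this
  · intro Δ' Γ' Ψ' σ θ b e' hb
    refine intro' e' .nil .nil hb trivial fun {_ _ _ b'} e₁ hb' _ => ?_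
    exact listR_nil e₁.wf hb' (hP'.sub ((e'.tm.up _).up _) ((e'.ix.sub e₁.tm e₁.ix).tlift₂ _ _))
  · intro Δ' Γ' Ψ' σ θ n' b w z ws zs e' hP E hl ih
    obtain ⟨hn', hws, hzs, hb, -⟩ := hl.wf.2
    refine intro' e' (.cons E.wf.2.1 hws) (.cons E.wf.2.2 hzs) hb ⟨hn', trivial⟩
      fun {_ _ θ' b'} e₁ hb' hle' => ?_
    have hH := e₁.hol (H e' E.wf.2.1 E.wf.2.2 hP)
    rw [← Fml.up_inst₂] at hH
    have hE := e₁.hol_eq E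
    have hih := e₁.hol ih
    simp only [Tm.subst_var] at hH hE
    refine listR_cons_eq hH hE (elim (b := b.sub Tm.var θ') (σ := σ) ?_ hb' hle')
    refine (congrArg (HOL _ _ _) ?_).mp hih
    simp only [Fml.sub_sub]
    refine Fml.sub_congr _ (fun n => ?_) (fun i => ?_)
    · rcases n with _ | _ | n <;> simp
    · rcases i with _ | _ | i <;> rfl
  · intro Δ' Γ' Ψ' σ θ n' b w z ws zs e' hw hz hP hl ih
    obtain ⟨hn', hws, hzs, hb, -⟩ := hl.wf.2
    refine intro' e' (.cons hw hws) (.cons hz hzs) ⟨hb, trivial⟩ ⟨hn', trivial⟩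
      fun {Δ₁ Ψ₁ θ' b'} e₁ hb' hle' => ?_
    have hP'' := (hP'.sub ((e'.tm.up τ).up τ) ((e'.ix.sub e₁.tm e₁.ix).tlift₂ τ τ))
    have hn₁ : HIx.HasSort Δ₁ Γ' (HIx.sub (Ix.add n' (.num 1)) Tm.var θ') .nat :=
      ⟨hn'.sub e₁.tm e₁.ix, trivial⟩
    have hb₁ : HIx.HasSort Δ₁ Γ' (b.sub Tm.var θ') .nat := hb.sub e₁.tm e₁.ix
    have hw0 : Fml.WF Δ₁ Γ' (.cst (.eq b' (.num 0))) := ⟨hb'.real, trivial⟩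
    refine nat_index_cases e₁.wf hb' ⟨hn₁, .cons hw hws, .cons hz hzs, hb', hP''⟩ ?_ ?_
    · refine absurd_cst (Δ' := [.nat, .nat])
        (Cs := [.eq (.leaf 0) (.num 0), .le (.add (.leaf 1) (.num 1)) (.leaf 0)])
        (θ := b' ;; b.sub Tm.var θ' ;; HIx.ivar) (e₁.wf.cons hw0) ?_ ?_
        ((HIx.Maps.nil.cons hb₁).cons hb')
        (List.forall_mem_cons.2 ⟨hyp_cons hw0 e₁.wf, List.forall_mem_singleton.2
          (hle'.weaken_cons hw0)⟩) ⟨hn₁, .cons hw hws, .cons hz hzs, hb', hP''⟩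
      · simp [ICst.WF, Cst.AllLeaves, Ix.AllLeaves]
      · intro δ hδ hD
        obtain ⟨m, hm⟩ := hδ 1 .nat rfl
        have h1 : δ 0 = ((0 : ℕ) : EReal) := hD (.eq (.leaf 0) (.num 0)) (by simp)
        have h2 : δ 1 + ((1 : ℕ) : EReal) ≤ δ 0 :=
          hD (.le (.add (.leaf 1) (.num 1)) (.leaf 0)) (by simp)
        rw [hm, h1] at h2
        exact absurd (show m + 1 ≤ 0 by exact_mod_cast h2) (Nat.not_succ_le_zero m)
    · have hw1 : Fml.WF (.nat :: Δ₁) Γ' (.cst (.eq (b'.shift 0 1) (.add (HIx.ivar 0) (.num 1)))) :=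
        ⟨(hb'.sub (Tm.Maps.var _) (HIx.Maps.ish _ _ _)).real, hi.real, trivial⟩
      have e₂ : Ext Δ₁ Γ' Ψ₁ Tm.var (HIx.ish 1) (.nat :: Δ₁) Γ'
          (.cst (.eq (b'.shift 0 1) (.add (HIx.ivar 0) (.num 1))) :: Ψ₁.map (Fml.ishift 1)) := by
        simpa only [Tm.subst_var, HIx.sub_id] using
          (Ext.ishift e₁.wf .nat).comp (.cons hw1 (e₁.wf.ishift _))
      have hc := hyp_cons hw1 (e₁.wf.ishift .nat)
      have hle₂ := e₂.hol_cst hle'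
      have e₃ := e₁.comp e₂
      simp only [Tm.subst_var] at e₃
      have hH := e₃.hol (H e' hw hz hP)
      rw [← Fml.up_inst₂] at hH
      simp only [Tm.subst_var] at hH
      have hb₂ := hb₁.sub e₂.tm e₂.ix
      have hle₃ : HOL (.nat :: Δ₁) Γ' (.cst (.eq (b'.shift 0 1) (.add (HIx.ivar 0) (.num 1))) ::
          Ψ₁.map (Fml.ishift 1)) (.cst (.le ((b.sub Tm.var θ').sub Tm.var (HIx.ish 1)) (HIx.ivar 0))) := by
        refine .arith [.nat, .nat, .nat]
          [.le (.add (.leaf 1) (.num 1)) (.leaf 0), .eq (.leaf 0) (.add (.leaf 2) (.num 1))]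
          (.le (.leaf 1) (.leaf 2))
          (b'.sub Tm.var (HIx.ish 1) ;; (b.sub Tm.var θ').sub Tm.var (HIx.ish 1) ;; HIx.ivar 0 ;; HIx.ivar)
          e₂.wf ?_ ?_ ?_
          (((HIx.Maps.nil.cons hi).cons hb₂).cons (hb'.sub e₂.tm e₂.ix)) ?_
        · simp [ICst.WF, Cst.AllLeaves, Ix.AllLeaves]
        · simp [ICst.WF, Cst.AllLeaves, Ix.AllLeaves]
        · intro δ hδ hD
          obtain ⟨m, hm⟩ := hδ 1 .nat rfl
          obtain ⟨m', hm'⟩ := hδ 2 .nat rfl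
          have h1 : δ 0 = δ 2 + ((1 : ℕ) : EReal) :=
            hD (.eq (.leaf 0) (.add (.leaf 2) (.num 1))) (by simp)
          have h2 : δ 1 + ((1 : ℕ) : EReal) ≤ δ 0 :=
            hD (.le (.add (.leaf 1) (.num 1)) (.leaf 0)) (by simp)
          rw [hm, h1, hm'] at h2
          have h3 : m + 1 ≤ m' + 1 := by exact_mod_cast h2
          show δ 1 ≤ δ 2
          rw [hm, hm']
          exact_mod_cast Nat.le_of_succ_le_succ h3
        · exact List.forall_mem_cons.2 ⟨hle₂, List.forall_mem_singleton.2 hc⟩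
      have hl' := elim (b := (b.sub Tm.var θ').sub Tm.var (HIx.ish 1)) (k₁ := ws) (k₂ := zs) (σ := σ)
        (m := (n'.sub Tm.var θ').sub Tm.var (HIx.ish 1))
        (θ := fun i => (θ i).sub Tm.var fun i => (θ' i).sub Tm.var (HIx.ish 1))
        ((congrArg (HOL _ _ _) ?_).mp (e₃.hol ih)) hi hle₃
      · have hcc := listR_cons_add hH hw hz hl'
        have := listR_irew (cst_refl e₂.wf hcc.wf.2.1.real) hcc.wf.2.1 hc.cst_symm
          (hb'.sub e₂.tm e₂.ix) hcc
        refine (congrArg (HOL _ _ _) ?_).mp this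
        simp only [Fml.ishift, Fml.isub, Fml.listR_sub, Fml.sub_sub, Tm.subst_var]
        congr 1
        refine Fml.sub_congr _ (fun n => ?_) (fun i => ?_)
        · rcases n with _ | _ | n <;> simp [Tm.up_eq, Tm.subst]
        · simp [Fml.tlift, Tm.subst, Tm.up_var]
      · simp only [Fml.sub_sub]
        refine Fml.sub_congr _ (fun n => ?_) (fun i => ?_)
        · rcases n with _ | _ | n <;> simp
        · rcases i with _ | _ | i <;> simp

end HOL

/-! ## Subtyping -/

/-- Subtyping of unary types in which a lower bound on costs may be replaced by 0. -/
inductive USubN : ICtx → List ICst → UTy → UTy → Prop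
  | refl {Δ Φ A} : USubN Δ Φ A A
  | trans {Δ Φ A B C} : B.WF Δ → USubN Δ Φ A B → USubN Δ Φ B C → USubN Δ Φ A C
  | list {Δ Φ n n' A A'} : Entails Δ Φ (.eq n n') → USubN Δ Φ A A' →
      USubN Δ Φ (.list n A) (.list n' A')
  | arr {Δ Φ A A' B B' k k' l l'} : USubN Δ Φ A' A → USubN Δ Φ B B' →
      Entails Δ Φ (.le k' (.max k (.num 0))) → Entails Δ Φ (.le l l') →
      USubN Δ Φ (.arr A k l B) (.arr A' k' l' B')
  | all {Δ Φ S A A' k k' l l'} : USubN (S :: Δ) (Φ.map (ICst.shift 1)) A A' →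
      Entails (S :: Δ) (Φ.map (ICst.shift 1)) (.le k' (.max k (.num 0))) →
      Entails (S :: Δ) (Φ.map (ICst.shift 1)) (.le l l') →
      USubN Δ Φ (.all S k l A) (.all S k' l' A')

theorem Entails.max_zero {Δ : ICtx} {Φ : List ICst} {k k' : Idx} (h : Entails Δ Φ (.le k' k)) :
    Entails Δ Φ (.le k' (.max k (.num 0))) :=
  fun δ hδ hΦ => le_max_of_le_left (h δ hδ hΦ)

theorem Entails.zero_le_max (Δ : ICtx) (Φ : List ICst) (k : Idx) :
    Entails Δ Φ (.le (.num 0) (.max k (.num 0))) :=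
  fun _ _ _ => le_max_right _ _

theorem Entails.le_inf (Δ : ICtx) (Φ : List ICst) (l : Idx) : Entails Δ Φ (.le l .inf) :=
  fun _ _ _ => le_top

theorem USub.toN {Δ : ICtx} {Φ : List ICst} {A A' : UTy} (h : USub Δ Φ A A') : USubN Δ Φ A A' := by
  induction h with
  | refl => exact .refl
  | trans hB _ _ ih₁ ih₂ => exact .trans hB ih₁ ih₂
  | list hn _ ih => exact .list hn ih
  | arr _ _ hk hl ih₁ ih₂ => exact .arr ih₁ ih₂ hk.max_zero hl
  | all _ hk hl ih => exact .all ih hk.max_zero hl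

theorem RSub.bar {Δ : ICtx} {Φ : List ICst} {τ τ' : RTy} (h : RSub Δ Φ τ τ') :
    USubN Δ Φ τ.bar τ'.bar := by
  induction h with
  | trans hτ _ _ ih₁ ih₂ => exact .trans (RTy.bar_wf _ hτ) ih₁ ih₂
  | list hn _ _ ih => exact .list hn ih
  | arr _ _ _ ih₁ ih₂ => exact .arr ih₁ ih₂ (.zero_le_max _ _ _) (.le_inf _ _ _)
  | arrU => exact .arr .refl .refl (.zero_le_max _ _ _) (.le_inf _ _ _)
  | all _ _ ih => exact .all ih (.zero_le_max _ _ _) (.le_inf _ _ _)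
  | allU => exact .all .refl (.zero_le_max _ _ _) (.le_inf _ _ _)
  | u h => exact h.toN
  | box _ ih => exact ih
  | _ => exact .refl

theorem USubN.erase_eq {Δ : ICtx} {Φ : List ICst} {A A' : UTy} (h : USubN Δ Φ A A') :
    A.erase = A'.erase := by
  induction h <;> simp_all [UTy.erase]

theorem RSub.erase_eq {Δ : ICtx} {Φ : List ICst} {τ τ' : RTy} (h : RSub Δ Φ τ τ') :
    τ.erase = τ'.erase := by
  rw [← τ.bar_erase, ← τ'.bar_erase, h.bar.erase_eq]

section

variable {Δ Δ' : ICtx} {Φ : List ICst} {Γ : Ctx} {Ψ : List Fml} {θ : ℕ → HIx}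

theorem UTy.SatE.mono {A A' : UTy} {k l k' l' : Idx} {x : Tm} (h : A.SatE k l θ Δ' Γ Ψ x)
    (m : Model Δ Φ θ Δ' Γ Ψ) (h' : A'.Sat θ Δ' Γ Ψ (.fst x)) (he : A.erase = A'.erase)
    (hk : Entails Δ Φ (.le k' (.max k (.num 0)))) (hl : Entails Δ Φ (.le l l'))
    (sk : Idx.HasSort Δ k .real) (sk' : Idx.HasSort Δ k' .real) (sl : Idx.HasSort Δ l .real)
    (sl' : Idx.HasSort Δ l' .real) : A'.SatE k' l' θ Δ' Γ Ψ x := by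
  refine ⟨he ▸ h.1, h'.2, ?_, ?_⟩
  · have hk₁ := m.entails hk ⟨sk', sk, trivial⟩
    refine .arith [.nat, .real, .real] [.le (.leaf 1) (.max (.leaf 2) (.num 0)), .le (.leaf 2) (.leaf 0)]
      (.le (.leaf 1) (.leaf 0)) (HIx.tm (.snd x) ;; k'.bind θ ;; k.bind θ ;; HIx.ivar) m.wf ?_ ?_ ?_
      (((HIx.Maps.nil.cons h.2.2.1.le_sorts.1).cons hk₁.le_sorts.1).cons_tm (.snd h.1)) ?_
    · simp [ICst.WF, Cst.AllLeaves, Ix.AllLeaves]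
    · simp [ICst.WF, Cst.AllLeaves, Ix.AllLeaves]
    · intro δ hδ hD
      obtain ⟨c, hc⟩ := hδ 0 .nat rfl
      have h1 : δ 1 ≤ max (δ 2) ((0 : ℕ) : EReal) :=
        hD (.le (.leaf 1) (.max (.leaf 2) (.num 0))) (by simp)
      have h2 : δ 2 ≤ δ 0 := hD (.le (.leaf 2) (.leaf 0)) (by simp)
      exact h1.trans (max_le h2 (show ((0 : ℕ) : EReal) ≤ δ 0 by rw [hc]; exact_mod_cast Nat.zero_le c))
    · exact List.forall_mem_cons.2 ⟨hk₁, List.forall_mem_singleton.2 h.2.2.1⟩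
  · exact h.2.2.2.le_trans (m.entails hl ⟨sl, sl'⟩)

theorem USubN.sat {A A' : UTy} (h : USubN Δ Φ A A') : A.WF Δ → A'.WF Δ →
    ∀ {θ : ℕ → HIx} {Δ' : ICtx} {Γ : Ctx} {Ψ : List Fml} {x : Tm}, Model Δ Φ θ Δ' Γ Ψ →
      A.Sat θ Δ' Γ Ψ x → A'.Sat θ Δ' Γ Ψ x := by
  induction h with
  | refl => intro _ _ θ Δ' Γ Ψ x _ h; exact h
  | trans hB _ _ ih₁ ih₂ => intro hA hC θ Δ' Γ Ψ x m h; exact ih₂ hB hC m (ih₁ hA hB m h)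
  | @list Δ Φ n n' A A' hn hs ih =>
    intro hA hA' θ Δ' Γ Ψ x m h
    have he := hs.erase_eq
    refine ⟨(by rw [UTy.erase, ← he]; exact h.1), ?_⟩
    rw [UTy.fml, ← he]
    refine HOL.listU_mono (HOL.listU_irew (m.entails hn ⟨hA.1.real, hA'.1.real⟩) (hA'.1.bind m.ix) h.2)
      (UTy.fml_wf hA'.2 (m.ix.tlift _) (by rw [← he]; exact .var rfl)) ?_
    intro Δ'' Γ' Ψ' σ θ' w e hw hP
    rw [UTy.fml_sub, Fml.tlift_comp] at hP ⊢
    exact (ih hA.2 hA'.2 (m.ext e) ⟨hw, hP⟩).2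
  | @arr Δ Φ A A' B B' k k' l l' hs₁ hs₂ hk hl ih₁ ih₂ =>
    intro hA hA' θ Δ' Γ Ψ x m h
    refine UTy.arrI m.ix m.wf hA'.1 ?_ ?_
    · rw [UTy.erase, hs₁.erase_eq, ← hs₂.erase_eq]; exact h.1
    · intro Δ'' Γ' Ψ' σ θ' w e hw
      have h' := (h.ext e).app (ih₁ hA'.1 hA.1 (m.ext e) hw)
      exact h'.mono (m.ext e) (ih₂ hA.2.2.2 hA'.2.2.2 (m.ext e) h'.val) hs₂.erase_eq hk hl hA.2.1
        hA'.2.1 hA.2.2.1 hA'.2.2.1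
  | @all Δ Φ S A A' k k' l l' hs hk hl ih =>
    intro hA hA' θ Δ' Γ Ψ x m h
    refine UTy.allI m.wf ?_ ?_
    · rw [UTy.erase, ← hs.erase_eq]; exact h.1
    · intro Δ'' Γ' Ψ' σ θ' w I e hw hI
      have h' := (h.ext e).iapp hw hI
      have m' := (m.ext e).cons hI
      exact h'.mono m' (ih hA.2.2 hA'.2.2 m' h'.val) hs.erase_eq hk hl hA.1 hA'.1 hA.2.1 hA'.2.1

theorem RTy.Sat.bar {τ : RTy} : ∀ {Δ Δ' : ICtx} {Γ : Ctx} {Ψ : List Fml} {θ : ℕ → HIx} {x y : Tm},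
    τ.WF Δ → HIx.Maps Δ θ Δ' Γ → τ.Sat θ Δ' Γ Ψ x y →
    τ.bar.Sat θ Δ' Γ Ψ x ∧ τ.bar.Sat θ Δ' Γ Ψ y := by
  induction τ with
  | nat =>
    intro Δ Δ' Γ Ψ θ x y _ _ h
    exact ⟨⟨h.1, .topI h.2.2.wf.1⟩, h.2.1, .topI h.2.2.wf.1⟩
  | u A => intro Δ Δ' Γ Ψ θ x y _ _ h; exact ⟨⟨h.1, h.2.2.andE₁⟩, h.2.1, h.2.2.andE₂⟩
  | box τ ih => intro Δ Δ' Γ Ψ θ x y hτ hθ h; exact ih hτ hθ ⟨h.1, h.2.1, h.2.2.andE₂⟩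
  | arr τ l σ _ _ => intro Δ Δ' Γ Ψ θ x y hτ hθ h; exact h.arr_bar
  | all S l τ _ => intro Δ Δ' Γ Ψ θ x y hτ hθ h; exact h.all_bar
  | list n α τ ih =>
    intro Δ Δ' Γ Ψ θ x y hτ hθ h
    have hb := τ.bar_erase
    have hw : (τ.bar.fml (Fml.tlift θ 1) (.var 0)).WF Δ' (τ.erase.costV :: Γ) :=
      UTy.fml_wf (τ.bar_wf hτ.2.2) (hθ.tlift _) (by rw [hb]; exact .var rfl)
    have := HOL.listR_unary h.2.2 hw hw ?_
    · refine ⟨⟨?_, ?_⟩, ?_, ?_⟩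
      · rw [RTy.bar, UTy.erase, hb]; exact h.1
      · rw [RTy.bar, UTy.fml, hb]; exact this.1
      · rw [RTy.bar, UTy.erase, hb]; exact h.2.1
      · rw [RTy.bar, UTy.fml, hb]; exact this.2
    · intro Δ'' Γ' Ψ' σ θ' w z e hw hz hP
      rw [RTy.fml_sub, Fml.tlift_comp₂] at hP
      simp only [UTy.fml_sub, Fml.tlift_comp]
      have := ih hτ.2.2 (hθ.sub e.tm e.ix) ⟨hw, hz, hP⟩
      exact ⟨this.1.2, this.2.2⟩

theorem HOL.dif_zero {x y : Tm} (h : HOL Δ Γ Ψ (.eq .nat (.snd x) (.snd y))) :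
    HOL Δ Γ Ψ (Fml.dif (.num 0) x y) := by
  refine .arith [.nat, .nat] [.eq (.leaf 0) (.leaf 1)] (.le (.sub (.leaf 0) (.leaf 1)) (.num 0))
    (HIx.tm (.snd x) ;; HIx.tm (.snd y) ;; HIx.ivar) h.wf.1 ?_ ?_ ?_
    ((HIx.Maps.nil.cons_tm h.wf.2.2).cons_tm h.wf.2.1) (List.forall_mem_singleton.2 (cst_of_eq h))
  · simp [ICst.WF, Cst.AllLeaves, Ix.AllLeaves]
  · simp [ICst.WF, Cst.AllLeaves, Ix.AllLeaves]
  · intro δ hδ hD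
    obtain ⟨c, hc⟩ := hδ 0 .nat rfl
    have h1 : δ 0 = δ 1 := hD (.eq (.leaf 0) (.leaf 1)) (by simp)
    show δ 0 - δ 1 ≤ ((0 : ℕ) : EReal)
    rw [← h1, hc, EReal.sub_self (EReal.natCast_ne_top c) (EReal.natCast_ne_bot c)]
    simp

theorem HOL.dif_bounds {x y : Tm} {k l : HIx}
    (h : HOL Δ Γ Ψ (.cst (.le (HIx.tm (.snd x)) l)))
    (h' : HOL Δ Γ Ψ (.cst (.le k (HIx.tm (.snd y))))) : HOL Δ Γ Ψ (Fml.dif (Ix.sub l k) x y) := by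
  refine .arith [.nat, .nat, .real, .real] [.le (.leaf 0) (.leaf 2), .le (.leaf 3) (.leaf 1)]
    (.le (.sub (.leaf 0) (.leaf 1)) (.sub (.leaf 2) (.leaf 3)))
    (HIx.tm (.snd x) ;; HIx.tm (.snd y) ;; l ;; k ;; HIx.ivar) h.wf.1 ?_ ?_ ?_
    ((((HIx.Maps.nil.cons h'.le_sorts.1).cons h.le_sorts.2).cons_tm h'.wf.2.2).cons_tm h.wf.2.1)
    (List.forall_mem_cons.2 ⟨h, List.forall_mem_singleton.2 h'⟩)
  · simp [ICst.WF, Cst.AllLeaves, Ix.AllLeaves]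
  · simp [ICst.WF, Cst.AllLeaves, Ix.AllLeaves]
  · intro δ hδ hD
    have h1 : δ 0 ≤ δ 2 := hD (.le (.leaf 0) (.leaf 2)) (by simp)
    have h2 : δ 3 ≤ δ 1 := hD (.le (.leaf 3) (.leaf 1)) (by simp)
    exact EReal.sub_le_sub h1 h2

theorem UTy.SatE.switch {A : UTy} {k₁ l₁ k₂ l₂ : Idx} {x y : Tm} (h : A.SatE k₁ l₁ θ Δ Γ Ψ x)
    (h' : A.SatE k₂ l₂ θ Δ Γ Ψ y) : (RTy.u A).SatE (.sub l₁ k₂) θ Δ Γ Ψ x y :=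
  ⟨h.1, h'.1, .andI h.2.1 h'.2.1, HOL.dif_bounds h.2.2.2 h'.2.2.1⟩

theorem RTy.SatE.mono {τ τ' : RTy} {l l' : Idx} {x y : Tm} (h : τ.SatE l θ Δ' Γ Ψ x y)
    (m : Model Δ Φ θ Δ' Γ Ψ) (h' : τ'.Sat θ Δ' Γ Ψ (.fst x) (.fst y)) (he : τ.erase = τ'.erase)
    (hl : Entails Δ Φ (.le l l')) (sl : Idx.HasSort Δ l .real)
    (sl' : Idx.HasSort Δ l' .real) : τ'.SatE l' θ Δ' Γ Ψ x y :=
  ⟨he ▸ h.1, he ▸ h.2.1, h'.2.2, h.2.2.2.le_trans (m.entails hl ⟨sl, sl'⟩)⟩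

theorem RTy.SatE.box {τ : RTy} {l : Idx} {x y : Tm} (h : τ.SatE l θ Δ Γ Ψ x y)
    (e : HOL Δ Γ Ψ (.eq τ.erase.costE x y)) : (RTy.box τ).SatE (.num 0) θ Δ Γ Ψ x y :=
  ⟨h.1, h.2.1, .andI e.eq_fst h.2.2.1, HOL.dif_zero e.eq_snd⟩

theorem RSub.sat {τ τ' : RTy} (h : RSub Δ Φ τ τ') : τ.WF Δ → τ'.WF Δ →
    ∀ {θ : ℕ → HIx} {Δ' : ICtx} {Γ : Ctx} {Ψ : List Fml} {x y : Tm}, Model Δ Φ θ Δ' Γ Ψ →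
      τ.Sat θ Δ' Γ Ψ x y → τ'.Sat θ Δ' Γ Ψ x y := by
  induction h with
  | refl => intro _ _ θ Δ' Γ Ψ x y _ h; exact h
  | trans hB _ _ ih₁ ih₂ => intro hA hC θ Δ' Γ Ψ x y m h; exact ih₂ hB hC m (ih₁ hA hB m h)
  | @list Δ Φ n n' α α' τ τ' hn hα hs ih =>
    intro hA hA' θ Δ' Γ Ψ x y m h
    have he := hs.erase_eq
    refine ⟨(by rw [RTy.erase, ← he]; exact h.1), (by rw [RTy.erase, ← he]; exact h.2.1), ?_⟩
    rw [RTy.fml, ← he]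
    have hn' := m.entails hn ⟨hA.1.real, hA'.1.real⟩
    have ha' := m.entails hα ⟨hA.2.1.real, hA'.2.1.real⟩
    refine HOL.listR_mono (HOL.listR_irew hn' (hA'.1.bind m.ix)
        (HOL.cst_refl m.wf (hA.2.1.bind m.ix).real) (hA.2.1.bind m.ix) h.2.2)
      (RTy.fml_wf hA'.2.2 (m.ix.tlift₂ _ _) (by rw [← he]; exact .var rfl)
        (by rw [← he]; exact .var rfl)) (hA'.2.1.bind m.ix) ha' ?_
    intro Δ'' Γ' Ψ' σ θ' w z e hw hz hP
    rw [RTy.fml_sub, Fml.tlift_comp₂] at hP ⊢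
    exact (ih hA.2.2 hA'.2.2 (m.ext e) ⟨hw, hz, hP⟩).2.2
  | @listZero Δ Φ n α τ hα =>
    intro hA hA' θ Δ' Γ Ψ x y m h
    refine ⟨h.1, h.2.1, HOL.listR_zero_mono h.2.2
      (RTy.fml_wf hA'.2.2 (m.ix.tlift₂ _ _) (.var rfl) (.var rfl))
      (m.entails hα ⟨hA.2.1.real, trivial⟩) ?_⟩
    intro Δ'' Γ' Ψ' σ θ' w z e hE hP
    exact .andI hE hP
  | @listBox Δ Φ n α τ =>
    intro hA hA' θ Δ' Γ Ψ x y m h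
    refine ⟨h.1, h.2.1, .andI (HOL.listR_eq h.2.2 ?_) (HOL.listR_mono h.2.2
      (RTy.fml_wf hA'.2.2 (m.ix.tlift₂ _ _) (.var rfl) (.var rfl)) (hA.2.1.bind m.ix)
      (m.entails (C := .le α α) (fun _ _ _ => le_refl _) ⟨hA.2.1.real, hA.2.1.real⟩) ?_)⟩
    · intro Δ'' Γ' Ψ' σ θ' w z e hP
      exact hP.andE₁
    · intro Δ'' Γ' Ψ' σ θ' w z e _ _ hP
      exact hP.andE₂
  | @arr Δ Φ τ τ' σ σ' l l' hs₁ hs₂ hl ih₁ ih₂ =>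
    intro hA hA' θ Δ' Γ Ψ x y m h
    have hb : USubN Δ Φ (RTy.arr τ l σ).bar (RTy.arr τ' l' σ').bar := (RSub.arr hs₁ hs₂ hl).bar
    have hs := fun {x} => hb.sat (RTy.bar_wf _ hA) (RTy.bar_wf _ hA') (x := x) m
    refine RTy.arrI m.ix m.wf hA'.1 (hs h.arr_bar.1) (hs h.arr_bar.2) ?_
    intro Δ'' Γ' Ψ' σ θ' w z e hw
    have h' := (h.ext e).app (ih₁ hA'.1 hA.1 (m.ext e) hw)
    exact h'.mono (m.ext e) (ih₂ hA.2.2 hA'.2.2 (m.ext e) h'.val) hs₂.erase_eq hl hA.2.1 hA'.2.1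
  | @arrBox Δ Φ τ σ l =>
    intro hA hA' θ Δ' Γ Ψ x y m h
    have hx : (RTy.arr τ l σ).Sat θ Δ' Γ Ψ x y := ⟨h.1, h.2.1, h.2.2.andE₂⟩
    refine RTy.arrI m.ix m.wf hA'.1 hx.arr_bar.1 hx.arr_bar.2 ?_
    intro Δ'' Γ' Ψ' σ θ' w z e hw
    have h' := (hx.ext e).app ⟨hw.1, hw.2.1, hw.2.2.andE₂⟩
    refine h'.box ?_
    exact (HOL.eq_app (e.hol_eq h.2.2.andE₁) hw.1).eq_trans
      (HOL.eq_app_right hw.2.2.andE₁ (hx.ext e).2.1)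
  | @arrU Δ Φ A B k l =>
    intro hA hA' θ Δ' Γ Ψ x y m h
    have hs := fun {x} => (RSub.arrU (Δ := Δ) (Φ := Φ) (A := A) (B := B) (k := k) (l := l)).bar.sat
      (RTy.bar_wf _ hA) (RTy.bar_wf _ hA') (x := x) m
    have hx : (UTy.arr A k l B).Sat θ Δ' Γ Ψ x := ⟨h.1, h.2.2.andE₁⟩
    have hy : (UTy.arr A k l B).Sat θ Δ' Γ Ψ y := ⟨h.2.1, h.2.2.andE₂⟩
    refine RTy.arrI m.ix m.wf hA'.1 (hs hx) (hs hy) ?_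
    intro Δ'' Γ' Ψ' σ θ' w z e hw
    exact ((hx.ext e).app ⟨hw.1, hw.2.2.andE₁⟩).switch ((hy.ext e).app ⟨hw.2.1, hw.2.2.andE₂⟩)
  | @all Δ Φ S τ τ' l l' hs hl ih =>
    intro hA hA' θ Δ' Γ Ψ x y m h
    have hb : USubN Δ Φ (RTy.all S l τ).bar (RTy.all S l' τ').bar := (RSub.all hs hl).bar
    have hs' := fun {x} => hb.sat (RTy.bar_wf _ hA) (RTy.bar_wf _ hA') (x := x) m
    refine RTy.allI m.wf (hs' h.all_bar.1) (hs' h.all_bar.2) ?_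
    intro Δ'' Γ' Ψ' σ θ' w z I e hw hz hI
    have h' := (h.ext e).iapp hw hz hI
    have m' := (m.ext e).cons hI
    exact h'.mono m' (ih hA.2 hA'.2 m' h'.val) hs.erase_eq hl hA.1 hA'.1
  | @allU Δ Φ S A k l =>
    intro hA hA' θ Δ' Γ Ψ x y m h
    have hs := fun {x} => (RSub.allU (Δ := Δ) (Φ := Φ) (S := S) (A := A) (k := k) (l := l)).bar.sat
      (RTy.bar_wf _ hA) (RTy.bar_wf _ hA') (x := x) m
    have hx : (UTy.all S k l A).Sat θ Δ' Γ Ψ x := ⟨h.1, h.2.2.andE₁⟩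
    have hy : (UTy.all S k l A).Sat θ Δ' Γ Ψ y := ⟨h.2.1, h.2.2.andE₂⟩
    refine RTy.allI m.wf (hs hx) (hs hy) ?_
    intro Δ'' Γ' Ψ' σ θ' w z I e hw hz hI
    exact ((hx.ext e).iapp hw hI).switch ((hy.ext e).iapp hz hI)
  | @u Δ Φ A A' hs =>
    intro hA hA' θ Δ' Γ Ψ x y m h
    have h₁ := hs.toN.sat hA hA' m ⟨h.1, h.2.2.andE₁⟩
    have h₂ := hs.toN.sat hA hA' m ⟨h.2.1, h.2.2.andE₂⟩
    exact ⟨h₁.1, h₂.1, .andI h₁.2 h₂.2⟩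
  | weak =>
    intro hA hA' θ Δ' Γ Ψ x y m h
    have := h.bar hA m.ix
    exact ⟨this.1.1, this.2.1, .andI this.1.2 this.2.2⟩
  | natBox => intro _ _ θ Δ' Γ Ψ x y m h; exact ⟨h.1, h.2.1, .andI h.2.2 h.2.2⟩
  | boxE => intro _ _ θ Δ' Γ Ψ x y m h; exact ⟨h.1, h.2.1, h.2.2.andE₂⟩
  | boxBox => intro _ _ θ Δ' Γ Ψ x y m h; exact ⟨h.1, h.2.1, .andI h.2.2.andE₁ h.2.2⟩
  | @box Δ Φ τ τ' hs ih =>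
    intro hA hA' θ Δ' Γ Ψ x y m h
    have h' := ih hA hA' m ⟨h.1, h.2.1, h.2.2.andE₂⟩
    refine ⟨h'.1, h'.2.1, .andI ?_ h'.2.2⟩
    rw [← hs.erase_eq]; exact h.2.2.andE₁

end

/-! ## Well-formedness of types in derivations -/

theorem Idx.HasSort.subst {Δ Δ' : ICtx} {I : Idx} {S : Srt} {φ : ℕ → Idx}
    (h : Idx.HasSort Δ I S) (hφ : ∀ i S, Δ[i]? = some S → Idx.HasSort Δ' (φ i) S) :
    Idx.HasSort Δ' (I.bind φ) S := by
  cases S with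
  | real =>
    exact Ix.AllLeaves.bind (fun i hi => (hφ i _ (List.getElem?_eq_getElem hi)).real) h
  | nat =>
    refine Ix.IsNat.bind (p := fun i => Δ[i]? = some Srt.nat) ?_ h
    exact fun i hi => hφ i .nat hi

theorem Idx.hasSort_leaf {Δ : ICtx} {i : ℕ} {S : Srt} (h : Δ[i]? = some S) :
    Idx.HasSort Δ (.leaf i) S := by
  cases S with
  | real => exact (List.getElem?_eq_some_iff.1 h).1
  | nat => exact h

theorem iup_hasSort {Δ Δ' : ICtx} {φ : ℕ → Idx} (S : Srt)
    (hφ : ∀ i S, Δ[i]? = some S → Idx.HasSort Δ' (φ i) S) :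
    ∀ i S', (S :: Δ)[i]? = some S' → Idx.HasSort (S :: Δ') (iup φ i) S' := by
  intro i S' h
  cases i with
  | zero => exact Idx.hasSort_leaf h
  | succ i => exact (hφ i S' h).subst fun j S h => Idx.hasSort_leaf (by simpa using h)

theorem inst_hasSort {Δ : ICtx} {J : Idx} {S : Srt} (hJ : Idx.HasSort Δ J S) :
    ∀ i S', (S :: Δ)[i]? = some S' → Idx.HasSort Δ ((J ;; Ix.leaf) i) S' := by
  intro i S' h
  cases i with
  | zero => simp at h; exact h ▸ hJ
  | succ i => exact Idx.hasSort_leaf (by simpa using h)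

theorem leaf_hasSort (Δ : ICtx) (S : Srt) :
    ∀ i S', Δ[i]? = some S' → Idx.HasSort (S :: Δ) (.leaf (i + 1)) S' :=
  fun _ _ h => Idx.hasSort_leaf (by simpa using h)

theorem leaf_hasSort₂ (Δ : ICtx) (S S₂ : Srt) :
    ∀ i S', Δ[i]? = some S' → Idx.HasSort (S :: S₂ :: Δ) (.leaf (i + 2)) S' :=
  fun _ _ h => Idx.hasSort_leaf (by simpa using h)

theorem UTy.WF.subst {A : UTy} : ∀ {Δ Δ' : ICtx} {φ : ℕ → Idx}, A.WF Δ →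
    (∀ i S, Δ[i]? = some S → Idx.HasSort Δ' (φ i) S) → (A.sub φ).WF Δ' := by
  induction A with
  | nat => intros; trivial
  | list n A ih => intro Δ Δ' φ h hφ; exact ⟨h.1.subst hφ, ih h.2 hφ⟩
  | arr A k l B ih₁ ih₂ =>
    intro Δ Δ' φ h hφ
    exact ⟨ih₁ h.1 hφ, h.2.1.subst hφ, h.2.2.1.subst hφ, ih₂ h.2.2.2 hφ⟩
  | all S k l A ih =>
    intro Δ Δ' φ h hφ
    have := iup_hasSort S hφ
    exact ⟨h.1.subst this, h.2.1.subst this, ih h.2.2 this⟩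

theorem RTy.WF.subst {τ : RTy} : ∀ {Δ Δ' : ICtx} {φ : ℕ → Idx}, τ.WF Δ →
    (∀ i S, Δ[i]? = some S → Idx.HasSort Δ' (φ i) S) → (τ.sub φ).WF Δ' := by
  induction τ with
  | nat => intros; trivial
  | list n α τ ih => intro Δ Δ' φ h hφ; exact ⟨h.1.subst hφ, h.2.1.subst hφ, ih h.2.2 hφ⟩
  | arr τ l σ ih₁ ih₂ => intro Δ Δ' φ h hφ; exact ⟨ih₁ h.1 hφ, h.2.1.subst hφ, ih₂ h.2.2 hφ⟩
  | all S l τ ih =>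
    intro Δ Δ' φ h hφ
    have := iup_hasSort S hφ
    exact ⟨h.1.subst this, ih h.2 this⟩
  | u A => intro Δ Δ' φ h hφ; exact UTy.WF.subst (A := A) h hφ
  | box τ ih => intro Δ Δ' φ h hφ; exact ih h hφ

theorem UTy.wf_map_shift {Δ : ICtx} {Ω : List UTy} (S : Srt) (h : ∀ A ∈ Ω, A.WF Δ) :
    ∀ A ∈ Ω.map (UTy.shift 1), A.WF (S :: Δ) := by
  intro A hA
  obtain ⟨B, hB, rfl⟩ := List.mem_map.1 hA
  exact (h B hB).subst (leaf_hasSort Δ S)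

theorem RTy.wf_map_shift {Δ : ICtx} {Γ : List RTy} (S : Srt) (h : ∀ τ ∈ Γ, τ.WF Δ) :
    ∀ τ ∈ Γ.map (RTy.shift 1), τ.WF (S :: Δ) := by
  intro A hA
  obtain ⟨B, hB, rfl⟩ := List.mem_map.1 hA
  exact (h B hB).subst (leaf_hasSort Δ S)

/-! ## Unary typing with nonnegative costs -/

/-- Unary typing in which lower bounds on costs may be replaced by 0, closed under renaming. -/
inductive UTypingN (κ : CostModel) :
    ICtx → List ICst → List UTy → Idx → Idx → Ex → UTy → Prop
  | var {Δ Φ Ω n A} : (Ω)[n]? = some A → UTypingN κ Δ Φ Ω (.num 0) (.num 0) (.var n) A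
  | num {Δ Φ Ω n} : UTypingN κ Δ Φ Ω (.num 0) (.num 0) (.num n) .nat
  | lam {Δ Φ Ω A₁ A₂ k l t} : A₁.WF Δ → UTypingN κ Δ Φ (A₁ :: Ω) k l t A₂ →
      UTypingN κ Δ Φ Ω (.num 0) (.num 0) (.lam t) (.arr A₁ k l A₂)
  | app {Δ Φ Ω A₁ A₂ k l k₁ l₁ k₂ l₂ t₁ t₂} : UTypingN κ Δ Φ Ω k₁ l₁ t₁ (.arr A₁ k l A₂) →
      UTypingN κ Δ Φ Ω k₂ l₂ t₂ A₁ →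
      UTypingN κ Δ Φ Ω (.add (.add (.add k₁ k₂) k) (.num κ.app))
        (.add (.add (.add l₁ l₂) l) (.num κ.app)) (.app t₁ t₂) A₂
  | nil {Δ Φ Ω A} : A.WF Δ → UTypingN κ Δ Φ Ω (.num 0) (.num 0) .nil (.list (.num 0) A)
  | cons {Δ Φ Ω A n k₁ l₁ k₂ l₂ t₁ t₂} : UTypingN κ Δ Φ Ω k₁ l₁ t₁ A →
      UTypingN κ Δ Φ Ω k₂ l₂ t₂ (.list n A) →
      UTypingN κ Δ Φ Ω (.add k₁ k₂) (.add l₁ l₂) (.cons t₁ t₂) (.list (.add n (.num 1)) A)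
  | case {Δ Φ Ω A A' n k l k' l' t t₁ t₂} : UTypingN κ Δ Φ Ω k l t (.list n A) →
      UTypingN κ Δ (.eq n (.num 0) :: Φ) Ω k' l' t₁ A' →
      UTypingN κ (.nat :: Δ)
        (.eq (n.shift 1) (.add (.leaf 0) (.num 1)) :: Φ.map (ICst.shift 1))
        (.list (.leaf 0) (A.shift 1) :: A.shift 1 :: Ω.map (UTy.shift 1))
        (k'.shift 1) (l'.shift 1) t₂ (A'.shift 1) →
      UTypingN κ Δ Φ Ω (.add (.add k k') (.num κ.case)) (.add (.add l l') (.num κ.case))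
        (.case t t₁ t₂) A'
  | ilam {Δ Φ Ω S A k l t} :
      UTypingN κ (S :: Δ) (Φ.map (ICst.shift 1)) (Ω.map (UTy.shift 1)) k l t A →
      UTypingN κ Δ Φ Ω (.num 0) (.num 0) (.ilam t) (.all S k l A)
  | iapp {Δ Φ Ω S A J k l k' l' t} : UTypingN κ Δ Φ Ω k l t (.all S k' l' A) → Idx.HasSort Δ J S →
      UTypingN κ Δ Φ Ω (.add (.add k (k'.bind (J ;; Ix.leaf))) (.num κ.iapp))
        (.add (.add l (l'.bind (J ;; Ix.leaf))) (.num κ.iapp)) (.iapp t) (A.inst J)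
  | sub {Δ Φ Ω A A' k l t} : UTypingN κ Δ Φ Ω k l t A → A'.WF Δ → USubN Δ Φ A A' →
      UTypingN κ Δ Φ Ω k l t A'
  | bounds {Δ Φ Ω A k l k' l' t} : UTypingN κ Δ Φ Ω k l t A → Idx.HasSort Δ k' .real →
      Idx.HasSort Δ l' .real → Entails Δ Φ (.le k' (.max k (.num 0))) → Entails Δ Φ (.le l l') →
      UTypingN κ Δ Φ Ω k' l' t A
  | rename {Δ Φ Ω Ω' A k l t} (ξ : ℕ → ℕ) :
      (∀ (n : ℕ) (B : UTy), (Ω)[n]? = some B → (Ω')[ξ n]? = some B) →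
      UTypingN κ Δ Φ Ω k l t A → UTypingN κ Δ Φ Ω' k l (t.rename ξ) A

variable {κ : CostModel}

theorem UTyping.toN {Δ Φ Ω k l t A} (h : UTyping κ Δ Φ Ω k l t A) : UTypingN κ Δ Φ Ω k l t A := by
  induction h with
  | var h => exact .var h
  | num => exact .num
  | lam h _ ih => exact .lam h ih
  | app _ _ ih₁ ih₂ => exact .app ih₁ ih₂
  | nil h => exact .nil h
  | cons _ _ ih₁ ih₂ => exact .cons ih₁ ih₂
  | case _ _ _ ih₁ ih₂ ih₃ => exact .case ih₁ ih₂ ih₃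
  | ilam _ ih => exact .ilam ih
  | iapp _ hJ ih => exact .iapp ih hJ
  | sub _ hA hk hl hs ek el ih => exact .bounds (.sub ih hA hs.toN) hk hl ek.max_zero el

theorem UTypingN.free {Δ Φ Ω k l t A} (h : UTypingN κ Δ Φ Ω k l t A) :
    UTypingN κ Δ Φ Ω (.num 0) .inf t A :=
  .bounds h trivial trivial (.zero_le_max _ _ _) (.le_inf _ _ _)

theorem RTy.map_shift_bar (Γ : List RTy) :
    (Γ.map (RTy.shift 1)).map RTy.bar = (Γ.map RTy.bar).map (UTy.shift 1) := by
  simp only [List.map_map]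
  exact List.map_congr_left fun τ _ => τ.bar_sub _

/-- Related expressions have the erased unary type. -/
theorem RTyping.unary {Δ Φ Γ l t₁ t₂ τ} (h : RTyping κ Δ Φ Γ l t₁ t₂ τ) :
    UTypingN κ Δ Φ (Γ.map RTy.bar) (.num 0) .inf t₁ τ.bar ∧
      UTypingN κ Δ Φ (Γ.map RTy.bar) (.num 0) .inf t₂ τ.bar := by
  induction h with
  | @var Δ Φ Γ n τ h =>
    have : UTypingN κ Δ Φ (Γ.map RTy.bar) (.num 0) (.num 0) (.var n) τ.bar :=
      .var (by rw [List.getElem?_map, h]; rfl)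
    exact ⟨this.free, this.free⟩
  | num => exact ⟨UTypingN.num.free, UTypingN.num.free⟩
  | nil _ h => exact ⟨(UTypingN.nil (RTy.bar_wf _ h)).free, (UTypingN.nil (RTy.bar_wf _ h)).free⟩
  | cons₁ _ _ ih₁ ih₂ => exact ⟨(UTypingN.cons ih₁.1 ih₂.1).free, (UTypingN.cons ih₁.2 ih₂.2).free⟩
  | cons₂ _ _ ih₁ ih₂ => exact ⟨(UTypingN.cons ih₁.1 ih₂.1).free, (UTypingN.cons ih₁.2 ih₂.2).free⟩
  | case _ _ _ _ ih₁ ih₂ ih₃ _ =>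
    simp only [List.map_cons, RTy.map_shift_bar, RTy.bar, RTy.shift, RTy.bar_sub] at ih₃
    exact ⟨(UTypingN.case ih₁.1 ih₂.1 ih₃.1).free, (UTypingN.case ih₁.2 ih₂.2 ih₃.2).free⟩
  | lam h _ ih =>
    exact ⟨(UTypingN.lam (RTy.bar_wf _ h) ih.1).free, (UTypingN.lam (RTy.bar_wf _ h) ih.2).free⟩
  | app _ _ ih₁ ih₂ => exact ⟨(UTypingN.app ih₁.1 ih₂.1).free, (UTypingN.app ih₁.2 ih₂.2).free⟩
  | ilam _ ih =>
    rw [RTy.map_shift_bar] at ih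
    exact ⟨(UTypingN.ilam ih.1).free, (UTypingN.ilam ih.2).free⟩
  | iapp _ hJ ih =>
    rw [RTy.inst, RTy.bar_sub]
    exact ⟨(UTypingN.iapp ih.1 hJ).free, (UTypingN.iapp ih.2 hJ).free⟩
  | @nochange Δ Φ Γ Γ' τ l t ξ _ hξ _ _ ih =>
    have : ∀ (n : ℕ) (B : UTy), (Γ.map RTy.bar)[n]? = some B →
        (Γ'.map RTy.bar)[ξ n]? = some B := by
      intro n B hB
      rw [List.getElem?_map, Option.map_eq_some_iff] at hB ⊢
      obtain ⟨σ, hσ, rfl⟩ := hB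
      exact ⟨σ, hξ n σ hσ, rfl⟩
    exact ⟨.rename ξ this ih.1, .rename ξ this ih.2⟩
  | switch h₁ h₂ => exact ⟨h₁.toN.free, h₂.toN.free⟩
  | sub _ hτ _ hs _ ih =>
    exact ⟨.sub ih.1 (RTy.bar_wf _ hτ) hs.bar, .sub ih.2 (RTy.bar_wf _ hτ) hs.bar⟩

theorem UTypingN.regular {Δ Φ Ω k l t A} (h : UTypingN κ Δ Φ Ω k l t A) : (∀ B ∈ Ω, B.WF Δ) →
    A.WF Δ ∧ Idx.HasSort Δ k .real ∧ Idx.HasSort Δ l .real := by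
  induction h with
  | var h => intro hΩ; exact ⟨hΩ _ (List.mem_of_getElem? h), trivial, trivial⟩
  | num => intro hΩ; exact ⟨trivial, trivial, trivial⟩
  | lam h _ ih =>
    intro hΩ
    have := ih (List.forall_mem_cons.2 ⟨h, hΩ⟩)
    exact ⟨⟨h, this.2.1, this.2.2, this.1⟩, trivial, trivial⟩
  | app _ _ ih₁ ih₂ =>
    intro hΩ
    have h₁ := ih₁ hΩ
    have h₂ := ih₂ hΩ
    exact ⟨h₁.1.2.2.2, ⟨⟨⟨h₁.2.1, h₂.2.1⟩, h₁.1.2.1⟩, trivial⟩, ⟨⟨h₁.2.2, h₂.2.2⟩, h₁.1.2.2.1⟩, trivial⟩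
  | nil h => intro hΩ; exact ⟨⟨trivial, h⟩, trivial, trivial⟩
  | cons _ _ ih₁ ih₂ =>
    intro hΩ
    have h₁ := ih₁ hΩ
    have h₂ := ih₂ hΩ
    exact ⟨⟨⟨h₂.1.1, trivial⟩, h₁.1⟩, ⟨h₁.2.1, h₂.2.1⟩, h₁.2.2, h₂.2.2⟩
  | case _ _ _ ih₁ ih₂ _ =>
    intro hΩ
    have h₁ := ih₁ hΩ
    have h₂ := ih₂ hΩ
    exact ⟨h₂.1, ⟨⟨h₁.2.1, h₂.2.1⟩, trivial⟩, ⟨h₁.2.2, h₂.2.2⟩, trivial⟩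
  | ilam _ ih =>
    intro hΩ
    have := ih (UTy.wf_map_shift _ hΩ)
    exact ⟨⟨this.2.1, this.2.2, this.1⟩, trivial, trivial⟩
  | iapp _ hJ ih =>
    intro hΩ
    have h₁ := ih hΩ
    have h₂ := inst_hasSort hJ
    exact ⟨h₁.1.2.2.subst h₂, ⟨⟨h₁.2.1, h₁.1.1.subst h₂⟩, trivial⟩, ⟨h₁.2.2, h₁.1.2.1.subst h₂⟩, trivial⟩
  | sub _ hA _ ih => intro hΩ; exact ⟨hA, (ih hΩ).2⟩
  | bounds _ hk hl _ _ ih => intro hΩ; exact ⟨(ih hΩ).1, hk, hl⟩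
  | rename ξ hξ _ ih =>
    intro hΩ
    refine ih fun B hB => ?_
    obtain ⟨n, hn⟩ := List.mem_iff_getElem?.1 hB
    exact hΩ B (List.mem_of_getElem? (hξ n B hn))

theorem RTy.wf_map_bar {Δ : ICtx} {Γ : List RTy} (h : ∀ τ ∈ Γ, τ.WF Δ) :
    ∀ A ∈ Γ.map RTy.bar, A.WF Δ := by
  intro A hA
  obtain ⟨τ, hτ, rfl⟩ := List.mem_map.1 hA
  exact τ.bar_wf (h τ hτ)

theorem RTyping.regular {Δ Φ Γ l t₁ t₂ τ} (h : RTyping κ Δ Φ Γ l t₁ t₂ τ) : (∀ σ ∈ Γ, σ.WF Δ) →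
    τ.WF Δ ∧ Idx.HasSort Δ l .real := by
  induction h with
  | var h => intro hΓ; exact ⟨hΓ _ (List.mem_of_getElem? h), trivial⟩
  | num => intro hΓ; exact ⟨trivial, trivial⟩
  | nil hα h => intro hΓ; exact ⟨⟨trivial, hα, h⟩, trivial⟩
  | cons₁ _ _ ih₁ ih₂ =>
    intro hΓ
    have h₁ := ih₁ hΓ
    have h₂ := ih₂ hΓ
    exact ⟨⟨⟨h₂.1.1, trivial⟩, ⟨h₂.1.2.1, trivial⟩, h₁.1⟩, h₁.2, h₂.2⟩
  | cons₂ _ _ ih₁ ih₂ =>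
    intro hΓ
    have h₁ := ih₁ hΓ
    have h₂ := ih₂ hΓ
    exact ⟨⟨⟨h₂.1.1, trivial⟩, h₂.1.2.1, h₁.1⟩, h₁.2, h₂.2⟩
  | case _ _ _ _ ih₁ ih₂ _ _ =>
    intro hΓ
    have h₂ := ih₂ hΓ
    exact ⟨h₂.1, (ih₁ hΓ).2, h₂.2⟩
  | lam h _ ih =>
    intro hΓ
    have := ih (List.forall_mem_cons.2 ⟨h, hΓ⟩)
    exact ⟨⟨h, this.2, this.1⟩, trivial⟩
  | app _ _ ih₁ ih₂ =>
    intro hΓ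
    have h₁ := ih₁ hΓ
    have h₂ := ih₂ hΓ
    exact ⟨h₁.1.2.2, ⟨h₁.2, h₂.2⟩, h₁.1.2.1⟩
  | ilam _ ih =>
    intro hΓ
    have := ih (RTy.wf_map_shift _ hΓ)
    exact ⟨⟨this.2, this.1⟩, trivial⟩
  | iapp _ hJ ih =>
    intro hΓ
    have h₁ := ih hΓ
    have h₂ := inst_hasSort hJ
    exact ⟨h₁.1.2.subst h₂, h₁.2, h₁.1.1.subst h₂⟩
  | nochange ξ _ hξ _ _ ih =>
    intro hΓ
    refine ⟨(ih fun σ hσ => ?_).1, trivial⟩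
    obtain ⟨n, hn⟩ := List.mem_iff_getElem?.1 hσ
    exact hΓ σ (List.mem_of_getElem? (hξ n σ hn))
  | switch h₁ h₂ =>
    intro hΓ
    have h₁ := h₁.toN.regular (RTy.wf_map_bar hΓ)
    have h₂ := h₂.toN.regular (RTy.wf_map_bar hΓ)
    exact ⟨h₁.1, h₁.2.2, h₂.2.1⟩
  | sub _ hτ hl _ _ _ => intro hΓ; exact ⟨hτ, hl⟩

/-! ## Typing of the translation -/

theorem HasTy.letIn {Γ : Ctx} {t u : Tm} {σ τ : Ty} (ht : HasTy Γ t σ) (hu : HasTy (σ :: Γ) u τ) :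
    HasTy Γ (Tm.letIn t u) τ := .app (.lam hu) ht

/-- The context of simple types of a unary context. -/
def valCtx (Ω : List UTy) : Ctx := Ω.map fun A => A.erase.costV

theorem valCtx_shift (Ω : List UTy) : valCtx (Ω.map (UTy.shift 1)) = valCtx Ω := by
  simp only [valCtx, List.map_map]
  exact List.map_congr_left fun A _ => congrArg Ty.costV (A.erase_sub _)

theorem valCtx_cons (A : UTy) (Ω : List UTy) : valCtx (A :: Ω) = A.erase.costV :: valCtx Ω := rfl

theorem UTy.erase_shift (A : UTy) : (A.shift 1).erase = A.erase := A.erase_sub _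

theorem HasTy.weaken {Γ : Ctx} {t : Tm} {τ : Ty} (h : HasTy Γ t τ) (σ : Ty) :
    HasTy (σ :: Γ) (t.shift 1) τ := by
  rw [Tm.shift_eq]; exact h.shift σ

theorem Ex.cost_rename (t : Ex) : ∀ ξ : ℕ → ℕ, (t.rename ξ).cost κ = (t.cost κ).rename ξ := by
  induction t with
  | var n => intro ξ; rfl
  | num n => intro ξ; simp only [Ex.rename, Ex.cost, Tm.rename, Tm.numeral_rename]
  | lam t ih => intro ξ; simp only [Ex.rename, Ex.cost, Tm.rename, ih]
  | ilam t ih =>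
    intro ξ
    simp only [Ex.rename, Ex.cost, Tm.rename, ih, Tm.shift, Tm.rename_rename]
    rfl
  | nil => intro ξ; rfl
  | app t u ih₁ ih₂ =>
    intro ξ
    simp only [Ex.rename, Ex.cost, Tm.letIn, Tm.rename, ih₁, ih₂, Tm.shift, Tm.rename_rename,
      Tm.add_rename, Tm.numeral_rename]
    rfl
  | iapp t ih =>
    intro ξ
    simp only [Ex.rename, Ex.cost, Tm.letIn, Tm.rename, ih, Tm.add_rename, Tm.numeral_rename]
    rfl
  | cons t u ih₁ ih₂ =>
    intro ξ
    simp only [Ex.rename, Ex.cost, Tm.letIn, Tm.rename, ih₁, ih₂, Tm.shift, Tm.rename_rename,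
      Tm.add_rename]
    rfl
  | case t t₁ t₂ ih₁ ih₂ ih₃ =>
    intro ξ
    have : (fun n => upr (upr (· + 1)) (upr (upr ξ) n)) =
        fun n => upr (upr (upr ξ)) (upr (upr (· + 1)) n) := by
      funext n
      rcases n with _ | _ | n <;> rfl
    simp only [Ex.rename, Ex.cost, Tm.letIn, Tm.rename, ih₁, ih₂, ih₃, Tm.shift, Tm.rename_rename,
      Tm.add_rename, Tm.numeral_rename, this]
    rfl

theorem UTypingN.cost_hasTy {Δ Φ Ω k l t A} (h : UTypingN κ Δ Φ Ω k l t A) :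
    HasTy (valCtx Ω) (t.cost κ) A.erase.costE := by
  induction h with
  | var h => exact .pair (.var (by rw [valCtx, List.getElem?_map, h]; rfl)) .zero
  | num => exact .pair (Tm.numeral_hasTy _ _) .zero
  | lam h _ ih => exact .pair (.lam ih) .zero
  | app _ _ ih₁ ih₂ =>
    exact .letIn ih₁ (.letIn (ih₂.weaken _) (.letIn (.app (.fst (.var rfl)) (.fst (.var rfl)))
      (.pair (.fst (.var rfl)) (Tm.add_hasTy (Tm.add_hasTy (Tm.add_hasTy (.snd (.var rfl))
        (.snd (.var rfl))) (.snd (.var rfl))) (Tm.numeral_hasTy _ _)))))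
  | nil h => exact .pair .nil .zero
  | cons _ _ ih₁ ih₂ =>
    exact .letIn ih₁ (.letIn (ih₂.weaken _) (.pair (.cons (.fst (.var rfl)) (.fst (.var rfl)))
      (Tm.add_hasTy (.snd (.var rfl)) (.snd (.var rfl)))))
  | case _ _ _ ih₁ ih₂ ih₃ =>
    refine .letIn ih₁ (.listCase (.fst (.var rfl)) (.letIn (ih₂.weaken _) (.pair (.fst (.var rfl))
      (Tm.add_hasTy (Tm.add_hasTy (.snd (.var rfl)) (.snd (.var rfl))) (Tm.numeral_hasTy _ _))))
      (.lam (.lam (.letIn ?_ (.pair (.fst (.var rfl)) (Tm.add_hasTy (Tm.add_hasTy (.snd (.var rfl))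
        (.snd (.var rfl))) (Tm.numeral_hasTy _ _)))))))
    simp only [valCtx_cons, valCtx_shift, UTy.erase, UTy.erase_shift, Ty.costV] at ih₃
    refine ih₃.rename fun n τ hn => ?_
    rcases n with _ | _ | n
    · exact hn
    · exact hn
    · exact hn
  | ilam _ ih =>
    rw [valCtx_shift] at ih
    exact .pair (.lam (ih.weaken _)) .zero
  | iapp _ hJ ih =>
    rw [UTy.inst, UTy.erase_sub]
    exact .letIn ih (.letIn (.app (.fst (.var rfl)) .zero) (.pair (.fst (.var rfl))
      (Tm.add_hasTy (Tm.add_hasTy (.snd (.var rfl)) (.snd (.var rfl))) (Tm.numeral_hasTy _ _))))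
  | sub _ _ hs ih => rw [← hs.erase_eq]; exact ih
  | bounds _ _ _ _ _ ih => exact ih
  | rename ξ hξ _ ih =>
    rw [Ex.cost_rename]
    refine ih.rename fun n τ hn => ?_
    rw [valCtx, List.getElem?_map, Option.map_eq_some_iff] at hn ⊢
    obtain ⟨B, hB, rfl⟩ := hn
    exact ⟨B, hξ n B hB, rfl⟩

/-! ## Conversion of the translation -/

namespace Tm

theorem subst_up_inst (u : Tm) (σ : ℕ → Tm) (w : Tm) :
    (u.subst (up σ)).subst (w ;; var) = u.subst (w ;; σ) := by
  rw [subst_subst]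
  refine subst_congr u fun n => ?_
  cases n with
  | zero => rfl
  | succ n =>
    rw [up_eq, scons_succ, subst_subst]
    exact subst_var _

theorem subst_shift_cons (t w : Tm) (σ : ℕ → Tm) : (t.shift 1).subst (w ;; σ) = t.subst σ := by
  rw [shift_eq, subst_subst]; rfl

theorem Conv.letIn_subst (t u : Tm) (σ : ℕ → Tm) :
    Conv ((letIn t u).subst σ) (u.subst (t.subst σ ;; σ)) := by
  rw [← subst_up_inst]; exact .beta (u.subst (up σ)) (t.subst σ)

theorem Conv.lam_subst (u w : Tm) (σ : ℕ → Tm) :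
    Conv (.app (Tm.subst (.lam u) σ) w) (u.subst (w ;; σ)) := by
  rw [← subst_up_inst]; exact .beta (u.subst (up σ)) w

end Tm

variable {κ : CostModel}

open Tm in
theorem Ex.cost_app_conv (t u : Ex) (σ : ℕ → Tm) :
    Conv (((app t u).cost κ).subst σ)
      (pair (fst (.app (fst ((t.cost κ).subst σ)) (fst ((u.cost κ).subst σ))))
        (add (add (add (snd ((t.cost κ).subst σ)) (snd ((u.cost κ).subst σ)))
          (snd (.app (fst ((t.cost κ).subst σ)) (fst ((u.cost κ).subst σ)))))
          (numeral κ.app))) := by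
  refine (Conv.letIn_subst _ _ _).trans ((Conv.letIn_subst _ _ _).trans
    ((Conv.letIn_subst _ _ _).trans ?_))
  simp only [Tm.subst, add_subst, numeral_subst, scons_zero, subst_shift_cons, scons_succ]
  exact .refl _

open Tm in
theorem Ex.cost_iapp_conv (t : Ex) (σ : ℕ → Tm) :
    Conv (((iapp t).cost κ).subst σ)
      (pair (fst (.app (fst ((t.cost κ).subst σ)) zero))
        (add (add (snd ((t.cost κ).subst σ)) (snd (.app (fst ((t.cost κ).subst σ)) zero)))
          (numeral κ.iapp))) := by
  refine (Conv.letIn_subst _ _ _).trans ((Conv.letIn_subst _ _ _).trans ?_)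
  simp only [Tm.subst, add_subst, numeral_subst, scons_zero, scons_succ]
  exact .refl _

open Tm in
theorem Ex.cost_cons_conv (t u : Ex) (σ : ℕ → Tm) :
    Conv (((Ex.cons t u).cost κ).subst σ)
      (pair (.cons (fst ((t.cost κ).subst σ)) (fst ((u.cost κ).subst σ)))
        (add (snd ((t.cost κ).subst σ)) (snd ((u.cost κ).subst σ)))) := by
  refine (Conv.letIn_subst _ _ _).trans ((Conv.letIn_subst _ _ _).trans ?_)
  simp only [Tm.subst, add_subst, scons_zero, subst_shift_cons, scons_succ]
  exact .refl _

/-- The branches of the translation of a case analysis, as functions of the translated scrutinee. -/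
def Ex.caseNil (κ : CostModel) (t₁ : Ex) : Tm :=
  Tm.letIn ((t₁.cost κ).shift 1) (.pair (.fst (.var 0))
    (Tm.add (Tm.add (.snd (.var 1)) (.snd (.var 0))) (Tm.numeral κ.case)))

def Ex.caseCons (κ : CostModel) (t₂ : Ex) : Tm :=
  .lam (.lam (Tm.letIn ((t₂.cost κ).rename (upr (upr (· + 1)))) (.pair (.fst (.var 0))
    (Tm.add (Tm.add (.snd (.var 3)) (.snd (.var 0))) (Tm.numeral κ.case)))))

open Tm in
theorem Ex.cost_case_conv (t t₁ t₂ : Ex) (σ : ℕ → Tm) :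
    Conv (((Ex.case t t₁ t₂).cost κ).subst σ)
      (listCase (fst ((t.cost κ).subst σ)) ((caseNil κ t₁).subst ((t.cost κ).subst σ ;; σ))
        ((caseCons κ t₂).subst ((t.cost κ).subst σ ;; σ))) := Conv.letIn_subst _ _ _

open Tm in
theorem Ex.caseNil_conv (t₁ : Ex) (σ : ℕ → Tm) (T : Tm) :
    Conv ((caseNil κ t₁).subst (T ;; σ)) (pair (fst ((t₁.cost κ).subst σ))
        (add (add (snd T) (snd ((t₁.cost κ).subst σ))) (numeral κ.case))) := by
  refine (Conv.letIn_subst _ _ _).trans ?_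
  simp only [Tm.subst, add_subst, numeral_subst, scons_zero, scons_succ, subst_shift_cons]
  exact .refl _

open Tm in
theorem Ex.caseCons_conv (t₂ : Ex) (σ : ℕ → Tm) (T w ws : Tm) :
    Conv (.app (.app ((caseCons κ t₂).subst (T ;; σ)) w) ws)
      (pair (fst ((t₂.cost κ).subst (ws ;; w ;; σ)))
        (add (add (snd T) (snd ((t₂.cost κ).subst (ws ;; w ;; σ)))) (numeral κ.case))) := by
  refine (Conv.app (Conv.lam_subst _ _ _) (.refl _)).trans ((Conv.lam_subst _ _ _).trans
    ((Conv.letIn_subst _ _ _).trans ?_))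
  have e : ((t₂.cost κ).rename (upr (upr (· + 1)))).subst (ws ;; w ;; T ;; σ) =
      (t₂.cost κ).subst (ws ;; w ;; σ) := by
    rw [rename_subst]
    refine subst_congr _ fun n => ?_
    rcases n with _ | _ | n <;> rfl
  simp only [Tm.subst, add_subst, numeral_subst, scons_zero, scons_succ, e]
  exact .refl _

variable {Δ Δ' Δ'' : ICtx} {Φ : List ICst} {Γ Γ' : Ctx} {Ψ Ψ' : List Fml} {θ θ' : ℕ → HIx}
  {σ : ℕ → Tm}

theorem HOL.case_nil {τ ρ : Ty} {l u v : Tm} (h : HOL Δ Γ Ψ (.eq (.list τ) l .nil))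
    (hu : HasTy Γ u ρ) (hv : HasTy Γ v (.arr τ (.arr (.list τ) ρ))) :
    HOL Δ Γ Ψ (.eq ρ (.listCase l u v) u) := by
  have := h.eq_congr (s := .listCase (.var 0) (u.subst (Tm.sh 1)) (v.subst (Tm.sh 1)))
    (.listCase (.var rfl) (hu.shift _) (hv.shift _))
  simp only [Tm.subst, subst_shift_inst, scons_zero] at this
  exact this.eq_trans (.eq_conv h.wf.1 (.listCase .nil hu hv) hu (.listCase_nil _ _))

theorem HOL.case_cons {τ ρ : Ty} {l w ws u v : Tm}
    (h : HOL Δ Γ Ψ (.eq (.list τ) l (.cons w ws))) (hw : HasTy Γ w τ) (hws : HasTy Γ ws (.list τ))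
    (hu : HasTy Γ u ρ) (hv : HasTy Γ v (.arr τ (.arr (.list τ) ρ))) :
    HOL Δ Γ Ψ (.eq ρ (.listCase l u v) (.app (.app v w) ws)) := by
  have := h.eq_congr (s := .listCase (.var 0) (u.subst (Tm.sh 1)) (v.subst (Tm.sh 1)))
    (.listCase (.var rfl) (hu.shift _) (hv.shift _))
  simp only [Tm.subst, subst_shift_inst, scons_zero] at this
  exact this.eq_trans (.eq_conv h.wf.1 (.listCase (.cons hw hws) hu hv) (.app (.app hv hw) hws)
    (.listCase_cons _ _ _ _))

/-! ## Sums of costs -/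

namespace HOL

theorem le_add_congr {I J I' J' : HIx} (h : HOL Δ Γ Ψ (.cst (.le I J)))
    (h' : HOL Δ Γ Ψ (.cst (.le I' J'))) :
    HOL Δ Γ Ψ (.cst (.le (.add I I') (.add J J'))) :=
  .arith [.real, .real, .real, .real] [.le (.leaf 0) (.leaf 1), .le (.leaf 2) (.leaf 3)]
    (.le (.add (.leaf 0) (.leaf 2)) (.add (.leaf 1) (.leaf 3)))
    (I ;; J ;; I' ;; J' ;; HIx.ivar) h.wf.1 (by simp [ICst.WF, Cst.AllLeaves, Ix.AllLeaves])
    (by simp [ICst.WF, Cst.AllLeaves, Ix.AllLeaves])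
    (fun δ _ hD => add_le_add (hD _ (by simp) : Cst.Holds δ (.le (.leaf 0) (.leaf 1)))
      (hD _ (by simp) : Cst.Holds δ (.le (.leaf 2) (.leaf 3))))
    ((((HIx.Maps.nil.cons h'.le_sorts.2).cons h'.le_sorts.1).cons h.le_sorts.2).cons h.le_sorts.1)
    (List.forall_mem_cons.2 ⟨h, List.forall_mem_singleton.2 h'⟩)

theorem le_refl {I : HIx} (hΨ : CWF Δ Γ Ψ) (hI : HIx.HasSort Δ Γ I .real) :
    HOL Δ Γ Ψ (.cst (.le I I)) :=
  .arith [.real] [] (.le (.leaf 0) (.leaf 0)) (I ;; HIx.ivar) hΨ (by simp)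
    (by simp [ICst.WF, Cst.AllLeaves, Ix.AllLeaves]) (fun _ _ _ => _root_.le_refl _)
    (HIx.Maps.nil.cons hI) (by simp)

theorem le_of_cst_eq {I J : HIx} (h : HOL Δ Γ Ψ (.cst (.eq I J))) : HOL Δ Γ Ψ (.cst (.le I J)) :=
  (le_refl h.wf.1 h.cst_eq_sorts.1).le_congr (.cst_refl h.wf.1 h.cst_eq_sorts.1) h

theorem le_tm_add {I J : HIx} {t u : Tm} (ht : HasTy Γ t .nat) (hu : HasTy Γ u .nat)
    (h : HOL Δ Γ Ψ (.cst (.le I (HIx.tm t)))) (h' : HOL Δ Γ Ψ (.cst (.le J (HIx.tm u)))) :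
    HOL Δ Γ Ψ (.cst (.le (.add I J) (HIx.tm (Tm.add t u)))) :=
  (h.le_add_congr h').le_trans (tm_add h.wf.1 ht hu).cst_symm.le_of_cst_eq

theorem tm_add_le {I J : HIx} {t u : Tm} (ht : HasTy Γ t .nat) (hu : HasTy Γ u .nat)
    (h : HOL Δ Γ Ψ (.cst (.le (HIx.tm t) I))) (h' : HOL Δ Γ Ψ (.cst (.le (HIx.tm u) J))) :
    HOL Δ Γ Ψ (.cst (.le (HIx.tm (Tm.add t u)) (.add I J))) :=
  (tm_add h.wf.1 ht hu).le_of_cst_eq.le_trans (h.le_add_congr h')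

theorem sub_add_le {I J : HIx} {c c' d d' : Tm} (hc : HasTy Γ c .nat) (hc' : HasTy Γ c' .nat)
    (hd : HasTy Γ d .nat) (hd' : HasTy Γ d' .nat)
    (h : HOL Δ Γ Ψ (.cst (.le (.sub (HIx.tm c) (HIx.tm d)) I)))
    (h' : HOL Δ Γ Ψ (.cst (.le (.sub (HIx.tm c') (HIx.tm d')) J))) :
    HOL Δ Γ Ψ (.cst (.le (.sub (HIx.tm (Tm.add c c')) (HIx.tm (Tm.add d d'))) (.add I J))) := by
  have hΨ := h.wf.1
  have e : HOL Δ Γ Ψ (.cst (.eq (.add (.sub (HIx.tm c) (HIx.tm d)) (.sub (HIx.tm c') (HIx.tm d')))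
      (.sub (.add (HIx.tm c) (HIx.tm c')) (.add (HIx.tm d) (HIx.tm d'))))) := by
    refine .arith [.nat, .nat, .nat, .nat] []
      (.eq (.add (.sub (.leaf 0) (.leaf 1)) (.sub (.leaf 2) (.leaf 3)))
        (.sub (.add (.leaf 0) (.leaf 2)) (.add (.leaf 1) (.leaf 3))))
      (HIx.tm c ;; HIx.tm d ;; HIx.tm c' ;; HIx.tm d' ;; HIx.ivar) hΨ (by simp)
      (by simp [ICst.WF, Cst.AllLeaves, Ix.AllLeaves]) (fun δ hδ _ => ?_)
      ((((HIx.Maps.nil.cons_tm hd').cons_tm hc').cons_tm hd).cons_tm hc) (by simp)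
    obtain ⟨a, ha⟩ := hδ 0 .nat rfl
    obtain ⟨b, hb⟩ := hδ 1 .nat rfl
    obtain ⟨a', ha'⟩ := hδ 2 .nat rfl
    obtain ⟨b', hb'⟩ := hδ 3 .nat rfl
    simp only [Cst.Holds, Ix.eval, ha, hb, ha', hb']
    simp only [← EReal.coe_natCast, ← EReal.coe_add, ← EReal.coe_sub]
    congr 1; ring
  refine (h.le_add_congr h').le_congr (e.cst_trans ?_) (.cst_refl hΨ (h.le_add_congr h').le_sorts.2)
  exact (tm_add hΨ hc hc').cst_symm.cst_sub_congr (tm_add hΨ hd hd').cst_symm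

theorem sub_add_numeral_le {I : HIx} {c d : Tm} (hc : HasTy Γ c .nat) (hd : HasTy Γ d .nat)
    (h : HOL Δ Γ Ψ (.cst (.le (.sub (HIx.tm c) (HIx.tm d)) I))) (n : ℕ) :
    HOL Δ Γ Ψ (.cst (.le (.sub (HIx.tm (Tm.add c (Tm.numeral n)))
      (HIx.tm (Tm.add d (Tm.numeral n)))) I)) := by
  have hΨ := h.wf.1
  have e : HOL Δ Γ Ψ (.cst (.le (.sub (HIx.tm (Tm.numeral n)) (HIx.tm (Tm.numeral n))) (.num 0))) := by
    refine .arith [.nat] [] (.le (.sub (.leaf 0) (.leaf 0)) (.num 0))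
      (HIx.tm (Tm.numeral n) ;; HIx.ivar) hΨ (by simp)
      (by simp [ICst.WF, Cst.AllLeaves, Ix.AllLeaves]) (fun δ hδ _ => ?_)
      (HIx.Maps.nil.cons_tm (Tm.numeral_hasTy _ _)) (by simp)
    obtain ⟨a, ha⟩ := hδ 0 .nat rfl
    simp only [Cst.Holds, Ix.eval, ha]
    simp only [← EReal.coe_natCast, ← EReal.coe_sub, sub_self]; simp
  refine (sub_add_le hc (Tm.numeral_hasTy _ _) hd (Tm.numeral_hasTy _ _) h e).le_trans ?_
  exact .arith [.real] [] (.le (.add (.leaf 0) (.num 0)) (.leaf 0)) (I ;; HIx.ivar) hΨ (by simp)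
    (by simp [ICst.WF, Cst.AllLeaves, Ix.AllLeaves])
    (fun δ _ _ => by simp [Cst.Holds, Ix.eval]) (HIx.Maps.nil.cons h.le_sorts.2) (by simp)

theorem le_numeral (hΨ : CWF Δ Γ Ψ) (n : ℕ) :
    HOL Δ Γ Ψ (.cst (.le (.num n) (HIx.tm (Tm.numeral n)))) ∧
      HOL Δ Γ Ψ (.cst (.le (HIx.tm (Tm.numeral n)) (.num n))) :=
  ⟨(tm_numeral hΨ n).cst_symm.le_of_cst_eq, (tm_numeral hΨ n).le_of_cst_eq⟩

theorem fst_pair_eq {ρ ρ' : Ty} {v c : Tm} (hΨ : CWF Δ Γ Ψ) (hv : HasTy Γ v ρ)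
    (hc : HasTy Γ c ρ') : HOL Δ Γ Ψ (.eq ρ v (.fst (.pair v c))) :=
  .eq_conv hΨ hv (.fst (.pair hv hc)) (.symm (.fst_pair _ _))

theorem snd_pair_eq {ρ ρ' : Ty} {v c : Tm} (hΨ : CWF Δ Γ Ψ) (hv : HasTy Γ v ρ)
    (hc : HasTy Γ c ρ') : HOL Δ Γ Ψ (.eq ρ' c (.snd (.pair v c))) :=
  .eq_conv hΨ hc (.snd (.pair hv hc)) (.symm (.snd_pair _ _))

end HOL

theorem UTy.Sat.pair {A : UTy} {k l : Idx} {v c : Tm} (h : A.Sat θ Δ' Γ Ψ v) (hA : A.WF Δ)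
    (hθ : HIx.Maps Δ θ Δ' Γ) (hc : HasTy Γ c .nat)
    (hk : HOL Δ' Γ Ψ (.cst (.le (k.bind θ) (HIx.tm c))))
    (hl : HOL Δ' Γ Ψ (.cst (.le (HIx.tm c) (l.bind θ)))) :
    A.SatE k l θ Δ' Γ Ψ (.pair v c) := by
  have hΨ := h.2.wf.1
  have e := (HOL.snd_pair_eq hΨ h.1 hc).cst_of_eq
  exact ⟨.pair h.1 hc, (h.rew hA hθ (HOL.fst_pair_eq hΨ h.1 hc)).2,
    hk.le_trans e.le_of_cst_eq, e.cst_symm.le_of_cst_eq.le_trans hl⟩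

theorem UTy.Sat.pair_zero {A : UTy} {v : Tm} (h : A.Sat θ Δ' Γ Ψ v) (hA : A.WF Δ)
    (hθ : HIx.Maps Δ θ Δ' Γ) : A.SatE (.num 0) (.num 0) θ Δ' Γ Ψ (.pair v .zero) :=
  h.pair hA hθ .zero (HOL.le_numeral h.2.wf.1 0).1 (HOL.le_numeral h.2.wf.1 0).2

theorem RTy.Sat.pair {τ : RTy} {l : Idx} {v v' c c' : Tm} (h : τ.Sat θ Δ' Γ Ψ v v') (hτ : τ.WF Δ)
    (hθ : HIx.Maps Δ θ Δ' Γ) (hc : HasTy Γ c .nat) (hc' : HasTy Γ c' .nat)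
    (hl : HOL Δ' Γ Ψ (.cst (.le (.sub (HIx.tm c) (HIx.tm c')) (l.bind θ)))) :
    τ.SatE l θ Δ' Γ Ψ (.pair v c) (.pair v' c') := by
  have hΨ := h.2.2.wf.1
  have e := (HOL.snd_pair_eq hΨ h.1 hc).cst_of_eq
  have e' := (HOL.snd_pair_eq hΨ h.2.1 hc').cst_of_eq
  exact ⟨.pair h.1 hc, .pair h.2.1 hc', (h.rew hτ hθ (HOL.fst_pair_eq hΨ h.1 hc)
    (HOL.fst_pair_eq hΨ h.2.1 hc')).2.2,
    hl.le_congr (e.cst_sub_congr e') (.cst_refl hΨ hl.le_sorts.2)⟩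

theorem RTy.Sat.pair_zero {τ : RTy} {v v' : Tm} (h : τ.Sat θ Δ' Γ Ψ v v') (hτ : τ.WF Δ)
    (hθ : HIx.Maps Δ θ Δ' Γ) : τ.SatE (.num 0) θ Δ' Γ Ψ (.pair v .zero) (.pair v' .zero) := by
  refine h.pair hτ hθ .zero .zero ?_
  refine .arith [.nat] [] (.le (.sub (.leaf 0) (.leaf 0)) (.num 0)) (HIx.tm .zero ;; HIx.ivar)
    h.2.2.wf.1 (by simp) (by simp [ICst.WF, Cst.AllLeaves, Ix.AllLeaves]) (fun δ hδ _ => ?_)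
    (HIx.Maps.nil.cons_tm .zero) (by simp)
  obtain ⟨a, ha⟩ := hδ 0 .nat rfl
  simp only [Cst.Holds, Ix.eval, ha]
  simp only [← EReal.coe_natCast, ← EReal.coe_sub, sub_self]; simp

section

variable {κ : CostModel} {Δ Δ' Δ'' : ICtx} {Φ : List ICst} {Γ Γ' Γ₀ : Ctx} {Ψ Ψ' : List Fml}
  {θ θ' : ℕ → HIx} {σ : ℕ → Tm}

/-! ## Satisfaction and index substitution -/

theorem inst_bind (J : Idx) (θ : ℕ → HIx) :
    (fun i => ((J ;; Ix.leaf) i).bind θ) = (J.bind θ ;; θ) := by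
  funext i; cases i <;> rfl

theorem Idx.shift_bind (k : ℕ) (I : Idx) (θ : ℕ → HIx) :
    (I.shift k).bind θ = I.bind fun i => θ (i + k) := by
  simp only [Idx.shift, Ix.map, Ix.bind_bind]; rfl

theorem UTy.sub_sat (A : UTy) (φ : ℕ → Idx) (θ : ℕ → HIx) (x : Tm) :
    (A.sub φ).Sat θ Δ Γ Ψ x ↔ A.Sat (fun i => (φ i).bind θ) Δ Γ Ψ x := by
  rw [UTy.Sat, UTy.Sat, UTy.erase_sub, UTy.sub_fml]

theorem UTy.sub_satE (A : UTy) (k l : Idx) (φ : ℕ → Idx) (θ : ℕ → HIx) (x : Tm) :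
    (A.sub φ).SatE (k.bind φ) (l.bind φ) θ Δ Γ Ψ x ↔
      A.SatE k l (fun i => (φ i).bind θ) Δ Γ Ψ x := by
  rw [UTy.SatE, UTy.SatE, UTy.erase_sub, UTy.sub_fml, Ix.bind_bind, Ix.bind_bind]

theorem RTy.sub_sat (τ : RTy) (φ : ℕ → Idx) (θ : ℕ → HIx) (x y : Tm) :
    (τ.sub φ).Sat θ Δ Γ Ψ x y ↔ τ.Sat (fun i => (φ i).bind θ) Δ Γ Ψ x y := by
  rw [RTy.Sat, RTy.Sat, RTy.erase_sub, RTy.sub_fml]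

theorem RTy.sub_satE (τ : RTy) (l : Idx) (φ : ℕ → Idx) (θ : ℕ → HIx) (x y : Tm) :
    (τ.sub φ).SatE (l.bind φ) θ Δ Γ Ψ x y ↔ τ.SatE l (fun i => (φ i).bind θ) Δ Γ Ψ x y := by
  rw [RTy.SatE, RTy.SatE, RTy.erase_sub, RTy.sub_fml, Ix.bind_bind]

theorem Fml.le_bind_sub (k : Idx) (t : Tm) (θ θ' : ℕ → HIx) (σ : ℕ → Tm) :
    (Fml.cst (.le (k.bind θ) (HIx.tm t))).sub σ θ' =
      .cst (.le (k.bind fun i => (θ i).sub σ θ') (HIx.tm (t.subst σ))) := by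
  rw [← Idx.bind_sub]; rfl

theorem Fml.bind_le_sub (k : Idx) (t : Tm) (θ θ' : ℕ → HIx) (σ : ℕ → Tm) :
    (Fml.cst (.le (HIx.tm t) (k.bind θ))).sub σ θ' =
      .cst (.le (HIx.tm (t.subst σ)) (k.bind fun i => (θ i).sub σ θ')) := by
  rw [← Idx.bind_sub]; rfl

/-! ## Lists -/

theorem UTy.Sat.nil {A : UTy} (hΨ : CWF Δ' Γ Ψ) (hA : A.WF Δ) (hθ : HIx.Maps Δ θ Δ' Γ) :
    (UTy.list (.num 0) A).Sat θ Δ' Γ Ψ .nil :=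
  ⟨.nil, .listU_nil hΨ (UTy.fml_wf hA (hθ.tlift _) (.var rfl))⟩

theorem UTy.Sat.cons {A : UTy} {n : Idx} {w ws : Tm} (h : A.Sat θ Δ Γ Ψ w)
    (h' : (UTy.list n A).Sat θ Δ Γ Ψ ws) :
    (UTy.list (.add n (.num 1)) A).Sat θ Δ Γ Ψ (.cons w ws) := by
  refine ⟨.cons h.1 h'.1, .listU_cons h.1 ?_ h'.2⟩
  simp only [Fml.inst, Fml.tsub, UTy.fml_sub, Fml.tlift_comp, HIx.comp_id]
  exact h.2

/-- Case analysis on a list. -/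
theorem UTy.Sat.list_cases {A B : UTy} {n k l : Idx} {x y : Tm}
    (h : (UTy.list n A).Sat θ Δ' Γ Ψ x) (m : Model Δ Φ θ Δ' Γ Ψ) (hB : B.WF Δ)
    (sk : Idx.HasSort Δ k .real) (sl : Idx.HasSort Δ l .real) (hy : HasTy Γ y B.erase.costE)
    (h₀ : ∀ {Ψ'}, HOL.Ext Δ' Γ Ψ Tm.var HIx.ivar Δ' Γ Ψ' →
      HOL Δ' Γ Ψ' (.eq (.list A.erase.costV) x .nil) →
      HOL Δ' Γ Ψ' (.cst (.eq (n.bind θ) (.num 0))) → B.SatE k l θ Δ' Γ Ψ' y)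
    (h₁ : ∀ {Δ'' Γ' Ψ' σ θ' i w ws}, HOL.Ext Δ' Γ Ψ σ θ' Δ'' Γ' Ψ' → HIx.HasSort Δ'' Γ' i .nat →
      HOL Δ'' Γ' Ψ' (.eq (.list A.erase.costV) (x.subst σ) (.cons w ws)) →
      A.Sat (fun i => (θ i).sub σ θ') Δ'' Γ' Ψ' w →
      (UTy.list (.leaf 0) (A.shift 1)).Sat (i ;; fun i => (θ i).sub σ θ') Δ'' Γ' Ψ' ws →
      HOL Δ'' Γ' Ψ' (.cst (.eq (n.bind fun i => (θ i).sub σ θ') (.add i (.num 1)))) →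
      B.SatE k l (fun i => (θ i).sub σ θ') Δ'' Γ' Ψ' (y.subst σ)) :
    B.SatE k l θ Δ' Γ Ψ y := by
  have key : HOL Δ' Γ Ψ (.and (B.fml θ (.fst y)) (.and (.cst (.le (k.bind θ) (HIx.tm (.snd y))))
      (.cst (.le (HIx.tm (.snd y)) (l.bind θ))))) := by
    refine HOL.listU_cases' ⟨UTy.fml_wf hB m.ix (.fst hy), ⟨sk.bind m.ix, HasTy.snd hy⟩,
      HasTy.snd hy, sl.bind m.ix⟩ h.2 ?_ ?_
    · intro Ψ' e e' hn
      have := h₀ e e' hn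
      exact .andI this.2.1 (.andI this.2.2.1 this.2.2.2)
    · intro Δ'' Γ' Ψ' σ θ' i w ws e e' hP hn hws
      have hc : HasTy Γ' w A.erase.costV := by
        cases e'.wf.2.2 with
        | cons h _ => exact h
      rw [UTy.fml_sub, Fml.tlift_comp] at hP
      rw [Idx.bind_sub] at hn
      have hws' : (UTy.list (.leaf 0) (A.shift 1)).Sat (i ;; fun i => (θ i).sub σ θ') Δ'' Γ' Ψ' ws := by
        refine ⟨?_, ?_⟩
        · rw [UTy.erase, UTy.erase_shift]; exact hws.wf.2.2.1
        · rw [UTy.fml, UTy.erase_shift, UTy.shift, UTy.sub_fml]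
          rw [UTy.fml_sub, Fml.tlift_sub] at hws
          exact hws
      have := h₁ e hws.wf.2.1 e' ⟨hc, hP⟩ hws' hn
      have r := HOL.andI this.2.1 (.andI this.2.2.1 this.2.2.2)
      rw [Fml.and_sub, Fml.and_sub, UTy.fml_sub, Fml.le_bind_sub, Fml.bind_le_sub]
      exact r
  exact ⟨hy, key.andE₁, key.andE₂.andE₁, key.andE₂.andE₂⟩

/-! ## The translation, up to provable equality -/

theorem HasTy.caseNil {t : Ex} {ρ ρ' : Ty} (h : HasTy Γ (t.cost κ) (.prod ρ .nat)) :
    HasTy (.prod ρ' .nat :: Γ) (Ex.caseNil κ t) (.prod ρ .nat) :=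
  .letIn (h.weaken _) (.pair (.fst (.var rfl))
    (Tm.add_hasTy (Tm.add_hasTy (.snd (.var rfl)) (.snd (.var rfl))) (Tm.numeral_hasTy _ _)))

theorem HasTy.caseCons {t : Ex} {τ ρ ρ' : Ty}
    (h : HasTy (.list τ :: τ :: Γ) (t.cost κ) (.prod ρ .nat)) :
    HasTy (.prod ρ' .nat :: Γ) (Ex.caseCons κ t) (.arr τ (.arr (.list τ) (.prod ρ .nat))) := by
  refine .lam (.lam (.letIn (σ := .prod ρ .nat) ?_ (.pair (.fst (.var rfl)) (Tm.add_hasTy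
    (Tm.add_hasTy (.snd (.var (τ := .prod ρ' .nat) rfl)) (.snd (.var rfl)))
    (Tm.numeral_hasTy _ _)))))
  refine h.rename fun n τ hn => ?_
  rcases n with _ | _ | n <;> exact hn

theorem HOL.cost_app_eq {t u : Ex} {ρ ρ' : Ty} (hΨ : CWF Δ Γ Ψ)
    (ht : HasTy Γ ((t.cost κ).subst σ) (.prod (.arr ρ (.prod ρ' .nat)) .nat))
    (hu : HasTy Γ ((u.cost κ).subst σ) (.prod ρ .nat))
    (h : HasTy Γ (((Ex.app t u).cost κ).subst σ) (.prod ρ' .nat)) :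
    HOL Δ Γ Ψ (.eq (.prod ρ' .nat)
      (.pair (.fst (.app (.fst ((t.cost κ).subst σ)) (.fst ((u.cost κ).subst σ))))
        (Tm.add (Tm.add (Tm.add (.snd ((t.cost κ).subst σ)) (.snd ((u.cost κ).subst σ)))
          (.snd (.app (.fst ((t.cost κ).subst σ)) (.fst ((u.cost κ).subst σ)))))
          (Tm.numeral κ.app))) (((Ex.app t u).cost κ).subst σ)) :=
  .eq_conv hΨ (.pair (.fst (.app (.fst ht) (.fst hu))) (Tm.add_hasTy (Tm.add_hasTy
    (Tm.add_hasTy (.snd ht) (.snd hu)) (.snd (.app (.fst ht) (.fst hu)))) (Tm.numeral_hasTy _ _))) h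
    (Ex.cost_app_conv t u σ).symm

theorem HOL.cost_iapp_eq {t : Ex} {ρ : Ty} (hΨ : CWF Δ Γ Ψ)
    (ht : HasTy Γ ((t.cost κ).subst σ) (.prod (.arr .nat (.prod ρ .nat)) .nat))
    (h : HasTy Γ (((Ex.iapp t).cost κ).subst σ) (.prod ρ .nat)) :
    HOL Δ Γ Ψ (.eq (.prod ρ .nat) (.pair (.fst (.app (.fst ((t.cost κ).subst σ)) .zero))
      (Tm.add (Tm.add (.snd ((t.cost κ).subst σ)) (.snd (.app (.fst ((t.cost κ).subst σ)) .zero)))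
        (Tm.numeral κ.iapp))) (((Ex.iapp t).cost κ).subst σ)) :=
  .eq_conv hΨ (.pair (.fst (.app (.fst ht) .zero)) (Tm.add_hasTy (Tm.add_hasTy (.snd ht)
    (.snd (.app (.fst ht) .zero))) (Tm.numeral_hasTy _ _))) h (Ex.cost_iapp_conv t σ).symm

theorem HOL.cost_cons_eq {t u : Ex} {ρ : Ty} (hΨ : CWF Δ Γ Ψ)
    (ht : HasTy Γ ((t.cost κ).subst σ) (.prod ρ .nat))
    (hu : HasTy Γ ((u.cost κ).subst σ) (.prod (.list ρ) .nat))
    (h : HasTy Γ (((Ex.cons t u).cost κ).subst σ) (.prod (.list ρ) .nat)) :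
    HOL Δ Γ Ψ (.eq (.prod (.list ρ) .nat)
      (.pair (.cons (.fst ((t.cost κ).subst σ)) (.fst ((u.cost κ).subst σ)))
        (Tm.add (.snd ((t.cost κ).subst σ)) (.snd ((u.cost κ).subst σ))))
      (((Ex.cons t u).cost κ).subst σ)) :=
  .eq_conv hΨ (.pair (.cons (.fst ht) (.fst hu)) (Tm.add_hasTy (.snd ht) (.snd hu))) h
    (Ex.cost_cons_conv t u σ).symm

theorem HOL.cost_case_eq {t t₁ t₂ : Ex} {τ ρ : Ty}
    (ht : HasTy Γ₀ (t.cost κ) (.prod (.list τ) .nat)) (h₁ : HasTy Γ₀ (t₁.cost κ) (.prod ρ .nat))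
    (h₂ : HasTy (.list τ :: τ :: Γ₀) (t₂.cost κ) (.prod ρ .nat)) (hσ : Tm.Maps Γ₀ σ Γ)
    (hΨ : CWF Δ Γ Ψ) (h : HasTy Γ (((Ex.case t t₁ t₂).cost κ).subst σ) (.prod ρ .nat)) :
    HOL Δ Γ Ψ (.eq (.prod ρ .nat) (((Ex.case t t₁ t₂).cost κ).subst σ)
      (.listCase (.fst ((t.cost κ).subst σ)) ((Ex.caseNil κ t₁).subst ((t.cost κ).subst σ ;; σ))
        ((Ex.caseCons κ t₂).subst ((t.cost κ).subst σ ;; σ)))) :=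
  have hT := ht.subst hσ
  .eq_conv hΨ h (.listCase (.fst hT) (h₁.caseNil.subst (hσ.cons hT))
    (h₂.caseCons.subst (hσ.cons hT))) (Ex.cost_case_conv t t₁ t₂ σ)

theorem HOL.cost_case_nil_eq {t t₁ t₂ : Ex} {τ ρ : Ty}
    (ht : HasTy Γ₀ (t.cost κ) (.prod (.list τ) .nat)) (h₁ : HasTy Γ₀ (t₁.cost κ) (.prod ρ .nat))
    (h₂ : HasTy (.list τ :: τ :: Γ₀) (t₂.cost κ) (.prod ρ .nat)) (hσ : Tm.Maps Γ₀ σ Γ)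
    (h : HasTy Γ (((Ex.case t t₁ t₂).cost κ).subst σ) (.prod ρ .nat))
    (e : HOL Δ Γ Ψ (.eq (.list τ) (.fst ((t.cost κ).subst σ)) .nil)) :
    HOL Δ Γ Ψ (.eq (.prod ρ .nat) (.pair (.fst ((t₁.cost κ).subst σ))
      (Tm.add (Tm.add (.snd ((t.cost κ).subst σ)) (.snd ((t₁.cost κ).subst σ)))
        (Tm.numeral κ.case))) (((Ex.case t t₁ t₂).cost κ).subst σ)) := by
  have hT := ht.subst hσ
  have hY := h₁.subst hσ
  refine ((cost_case_eq ht h₁ h₂ hσ e.wf.1 h).eq_trans ((e.case_nil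
    (h₁.caseNil.subst (hσ.cons hT)) (h₂.caseCons.subst (hσ.cons hT))).eq_trans
    (.eq_conv e.wf.1 (h₁.caseNil.subst (hσ.cons hT)) (.pair (.fst hY) (Tm.add_hasTy
      (Tm.add_hasTy (.snd hT) (.snd hY)) (Tm.numeral_hasTy _ _))) (Ex.caseNil_conv t₁ σ _)))).eq_symm

theorem HOL.cost_case_cons_eq {t t₁ t₂ : Ex} {τ ρ : Ty} {w ws : Tm}
    (ht : HasTy Γ₀ (t.cost κ) (.prod (.list τ) .nat)) (h₁ : HasTy Γ₀ (t₁.cost κ) (.prod ρ .nat))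
    (h₂ : HasTy (.list τ :: τ :: Γ₀) (t₂.cost κ) (.prod ρ .nat)) (hσ : Tm.Maps Γ₀ σ Γ)
    (h : HasTy Γ (((Ex.case t t₁ t₂).cost κ).subst σ) (.prod ρ .nat)) (hw : HasTy Γ w τ)
    (hws : HasTy Γ ws (.list τ))
    (e : HOL Δ Γ Ψ (.eq (.list τ) (.fst ((t.cost κ).subst σ)) (.cons w ws))) :
    HOL Δ Γ Ψ (.eq (.prod ρ .nat) (.pair (.fst ((t₂.cost κ).subst (ws ;; w ;; σ)))
      (Tm.add (Tm.add (.snd ((t.cost κ).subst σ)) (.snd ((t₂.cost κ).subst (ws ;; w ;; σ))))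
        (Tm.numeral κ.case))) (((Ex.case t t₁ t₂).cost κ).subst σ)) := by
  have hT := ht.subst hσ
  have hY := h₂.subst ((hσ.cons hw).cons hws)
  refine ((cost_case_eq ht h₁ h₂ hσ e.wf.1 h).eq_trans ((e.case_cons hw hws
    (h₁.caseNil.subst (hσ.cons hT)) (h₂.caseCons.subst (hσ.cons hT))).eq_trans
    (.eq_conv e.wf.1 (.app (.app (h₂.caseCons.subst (hσ.cons hT)) hw) hws) (.pair (.fst hY)
      (Tm.add_hasTy (Tm.add_hasTy (.snd hT) (.snd hY)) (Tm.numeral_hasTy _ _)))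
      (Ex.caseCons_conv t₂ σ _ w ws)))).eq_symm

/-! ## The unary embedding -/

/-- A substitution whose terms satisfy the assertions of a unary context. -/
def UEnv (Ω : List UTy) (θ : ℕ → HIx) (Δ : ICtx) (Γ : Ctx) (Ψ : List Fml) (σ : ℕ → Tm) : Prop :=
  ∀ (n : ℕ) (B : UTy), (Ω)[n]? = some B → B.Sat θ Δ Γ Ψ (σ n)

namespace UEnv

variable {Ω : List UTy}

theorem maps (h : UEnv Ω θ Δ Γ Ψ σ) : Tm.Maps (valCtx Ω) σ Γ := by
  intro n τ hn
  rw [valCtx, List.getElem?_map, Option.map_eq_some_iff] at hn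
  obtain ⟨B, hB, rfl⟩ := hn
  exact (h n B hB).1

theorem ext {σ' : ℕ → Tm} (h : UEnv Ω θ Δ Γ Ψ σ) (e : HOL.Ext Δ Γ Ψ σ' θ' Δ' Γ' Ψ') :
    UEnv Ω (fun i => (θ i).sub σ' θ') Δ' Γ' Ψ' (fun n => (σ n).subst σ') :=
  fun n B hB => (h n B hB).ext e

theorem cons (h : UEnv Ω θ Δ Γ Ψ σ) {A : UTy} {w : Tm} (hw : A.Sat θ Δ Γ Ψ w) :
    UEnv (A :: Ω) θ Δ Γ Ψ (w ;; σ) := by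
  intro n B hB
  cases n with
  | zero => simp at hB; exact hB ▸ hw
  | succ n => exact h n B hB

theorem shift (h : UEnv Ω θ Δ Γ Ψ σ) (I : HIx) : UEnv (Ω.map (UTy.shift 1)) (I ;; θ) Δ Γ Ψ σ := by
  intro n B hB
  rw [List.getElem?_map, Option.map_eq_some_iff] at hB
  obtain ⟨A, hA, rfl⟩ := hB
  exact (A.sub_sat _ _ _).2 (h n A hA)

end UEnv

theorem Model.mono {Ψ' : List Fml} (m : Model Δ Φ θ Δ' Γ Ψ)
    (e : HOL.Ext Δ' Γ Ψ Tm.var HIx.ivar Δ' Γ Ψ') : Model Δ Φ θ Δ' Γ Ψ' := by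
  have := m.ext e
  rwa [HIx.comp_id] at this

theorem UEnv.mono {Ω : List UTy} {Ψ' : List Fml} (h : UEnv Ω θ Δ Γ Ψ σ)
    (e : HOL.Ext Δ Γ Ψ Tm.var HIx.ivar Δ Γ Ψ') : UEnv Ω θ Δ Γ Ψ' σ := by
  have := h.ext e
  simp only [HIx.comp_id, Tm.subst_var] at this
  exact this

theorem UTy.SatE.mono_ext {A : UTy} {k l : Idx} {x : Tm} {Ψ' : List Fml}
    (h : A.SatE k l θ Δ Γ Ψ x) (e : HOL.Ext Δ Γ Ψ Tm.var HIx.ivar Δ Γ Ψ') :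
    A.SatE k l θ Δ Γ Ψ' x := by
  have h₁ := e.hol h.2.1
  have h₂ := e.hol h.2.2.1
  have h₃ := e.hol h.2.2.2
  rw [Fml.sub_id] at h₁ h₂ h₃
  exact ⟨h.1, h₁, h₂, h₃⟩

theorem UTy.SatE.ext {A : UTy} {k l : Idx} {x : Tm} (h : A.SatE k l θ Δ Γ Ψ x)
    (e : HOL.Ext Δ Γ Ψ σ θ' Δ' Γ' Ψ') :
    A.SatE k l (fun i => (θ i).sub σ θ') Δ' Γ' Ψ' (x.subst σ) := by
  have h₁ := e.hol h.2.1
  have h₂ := e.hol h.2.2.1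
  have h₃ := e.hol h.2.2.2
  rw [UTy.fml_sub] at h₁
  rw [Fml.le_bind_sub] at h₂
  rw [Fml.bind_le_sub] at h₃
  exact ⟨h.1.subst e.tm, h₁, h₂, h₃⟩

/-- The translation of a well-typed expression satisfies the assertion of its unary type. -/
theorem UTypingN.sat {Ω : List UTy} {k l : Idx} {t : Ex} {A : UTy}
    (h : UTypingN κ Δ Φ Ω k l t A) : (∀ B ∈ Ω, B.WF Δ) →
    ∀ {θ : ℕ → HIx} {Δ' : ICtx} {Γ : Ctx} {Ψ : List Fml} {σ : ℕ → Tm}, Model Δ Φ θ Δ' Γ Ψ →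
      UEnv Ω θ Δ' Γ Ψ σ → A.SatE k l θ Δ' Γ Ψ ((t.cost κ).subst σ) := by
  induction h with
  | var h => intro hΩ θ Δ' Γ Ψ σ m E; exact (E _ _ h).pair_zero (hΩ _ (List.mem_of_getElem? h)) m.ix
  | @num Δ Φ Ω n =>
    intro hΩ θ Δ' Γ Ψ σ m E
    rw [Ex.cost, Tm.subst, Tm.numeral_subst]
    exact UTy.Sat.pair_zero (A := .nat) ⟨Tm.numeral_hasTy _ _, .topI m.wf⟩ (Δ := Δ) trivial m.ix
  | @lam Δ Φ Ω A₁ A₂ k l t hA h ih =>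
    intro hΩ θ Δ' Γ Ψ σ m E
    have hΩ' := List.forall_mem_cons.2 ⟨hA, hΩ⟩
    have hr := (UTypingN.lam hA h).regular hΩ
    refine UTy.Sat.pair_zero (UTy.arrI m.ix m.wf hA ?_ ?_) hr.1 m.ix
    · cases (UTypingN.lam hA h).cost_hasTy.subst E.maps with
      | pair h _ => exact h
    · intro Δ'' Γ' Ψ' σ' θ' w e hw
      have hs := ih hΩ' (m.ext e) ((E.ext e).cons hw)
      refine hs.rew (h.regular hΩ').1 (m.ext e).ix (.eq_conv e.wf hs.1 ?_ ?_)
      · refine .app (σ := A₁.erase.costV) ?_ hw.1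
        exact HasTy.subst (Γ := Γ) (.lam (h.cost_hasTy.subst (E.maps.up _))) e.tm
      · have := Tm.Conv.lam_subst (t.cost κ) w (fun n => (σ n).subst σ')
        rw [← Tm.subst_subst] at this
        exact this.symm
  | @app Δ Φ Ω A₁ A₂ k l k₁ l₁ k₂ l₂ t₁ t₂ h₁ h₂ ih₁ ih₂ =>
    intro hΩ θ Δ' Γ Ψ σ m E
    have hT := ih₁ hΩ m E
    have hU := ih₂ hΩ m E
    have hZ := hT.val.app hU.val
    have hr := (h₁.app h₂).regular hΩ
    have hn := HOL.le_numeral m.wf κ.app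
    have c₁ := Tm.add_hasTy (.snd hT.1) (.snd hU.1)
    have c₂ := Tm.add_hasTy c₁ (.snd hZ.1)
    have c₃ := Tm.numeral_hasTy Γ κ.app
    refine (hZ.val.pair hr.1 m.ix (Tm.add_hasTy c₂ c₃) ?_ ?_).rew hr.1 m.ix
      (HOL.cost_app_eq m.wf hT.1 hU.1 ((h₁.app h₂).cost_hasTy.subst E.maps))
    · exact HOL.le_tm_add c₂ c₃ (.le_tm_add c₁ (.snd hZ.1) (.le_tm_add (.snd hT.1) (.snd hU.1)
        hT.2.2.1 hU.2.2.1) hZ.2.2.1) hn.1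
    · exact HOL.tm_add_le c₂ c₃ (.tm_add_le c₁ (.snd hZ.1) (.tm_add_le (.snd hT.1) (.snd hU.1)
        hT.2.2.2 hU.2.2.2) hZ.2.2.2) hn.2
  | @nil Δ Φ Ω A hA =>
    intro hΩ θ Δ' Γ Ψ σ m E
    exact (UTy.Sat.nil m.wf hA m.ix).pair_zero ⟨trivial, hA⟩ m.ix
  | @cons Δ Φ Ω A n k₁ l₁ k₂ l₂ t₁ t₂ h₁ h₂ ih₁ ih₂ =>
    intro hΩ θ Δ' Γ Ψ σ m E
    have hT := ih₁ hΩ m E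
    have hU := ih₂ hΩ m E
    have hr := (h₁.cons h₂).regular hΩ
    refine ((hT.val.cons hU.val).pair hr.1 m.ix (Tm.add_hasTy (.snd hT.1) (.snd hU.1)) ?_ ?_).rew
      hr.1 m.ix (HOL.cost_cons_eq m.wf hT.1 hU.1 ((h₁.cons h₂).cost_hasTy.subst E.maps))
    · exact .le_tm_add (.snd hT.1) (.snd hU.1) hT.2.2.1 hU.2.2.1
    · exact .tm_add_le (.snd hT.1) (.snd hU.1) hT.2.2.2 hU.2.2.2
  | @case Δ Φ Ω A A' n k l k' l' t t₁ t₂ h₁ h₂ h₃ ih₁ ih₂ ih₃ =>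
    intro hΩ θ Δ' Γ Ψ σ m E
    have hr := (h₁.case h₂ h₃).regular hΩ
    have hr₁ := (h₁.regular hΩ).1
    have hT := ih₁ hΩ m E
    have ht₃ : HasTy (.list A.erase.costV :: A.erase.costV :: valCtx Ω) (t₂.cost κ)
        A'.erase.costE := by
      have := h₃.cost_hasTy
      simp only [valCtx_cons, valCtx_shift, UTy.erase, UTy.erase_shift, Ty.costV] at this
      exact this
    have hty := (h₁.case h₂ h₃).cost_hasTy
    -- the value of the branch that is taken and its cost
    have branch : ∀ {θ : ℕ → HIx} {Δ' : ICtx} {Γ : Ctx} {Ψ : List Fml} {T Y : Tm},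
        HIx.Maps Δ θ Δ' Γ → (UTy.list n A).SatE k l θ Δ' Γ Ψ T → A'.SatE k' l' θ Δ' Γ Ψ Y →
        A'.SatE (.add (.add k k') (.num κ.case)) (.add (.add l l') (.num κ.case)) θ Δ' Γ Ψ
          (.pair (.fst Y) (Tm.add (Tm.add (.snd T) (.snd Y)) (Tm.numeral κ.case))) := by
      intro θ Δ' Γ Ψ T Y hθ hT hY
      have hn := HOL.le_numeral hY.2.1.wf.1 κ.case
      have c₁ := Tm.add_hasTy (.snd hT.1) (.snd hY.1)
      have c₂ := Tm.numeral_hasTy Γ κ.case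
      refine hY.val.pair hr.1 hθ (Tm.add_hasTy c₁ c₂) ?_ ?_
      · exact HOL.le_tm_add c₁ c₂ (.le_tm_add (.snd hT.1) (.snd hY.1) hT.2.2.1 hY.2.2.1) hn.1
      · exact HOL.tm_add_le c₁ c₂ (.tm_add_le (.snd hT.1) (.snd hY.1) hT.2.2.2 hY.2.2.2) hn.2
    refine hT.val.list_cases m hr.1 hr.2.1 hr.2.2 (hty.subst E.maps) ?_ ?_
    · intro Ψ' e ex en
      have m' := m.mono e
      have E' := E.mono e
      have hY := ih₂ hΩ (m'.hyp (C := .eq n (.num 0)) ⟨hr₁.1.real, trivial⟩ en) E'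
      exact (branch m.ix (hT.mono_ext e) hY).rew hr.1 m.ix
        (HOL.cost_case_nil_eq h₁.cost_hasTy h₂.cost_hasTy ht₃ E.maps (hty.subst E.maps) ex)
    · intro Δ'' Γ' Ψ' σ' θ' i w ws e hi ex hw hws en
      have E' := E.ext e
      have m' := (m.ext e).cons (S := .nat) hi
      have hC : ICst.WF (.nat :: Δ) (.eq (n.shift 1) (.add (.leaf 0) (.num 1))) :=
        ⟨(hr₁.1.subst (leaf_hasSort Δ .nat)).real, Nat.succ_pos _, trivial⟩
      have hΩ' : ∀ B ∈ UTy.list (.leaf 0) (A.shift 1) :: A.shift 1 :: Ω.map (UTy.shift 1),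
          B.WF (.nat :: Δ) :=
        List.forall_mem_cons.2 ⟨⟨rfl, hr₁.2.subst (leaf_hasSort Δ .nat)⟩, List.forall_mem_cons.2
          ⟨hr₁.2.subst (leaf_hasSort Δ .nat), UTy.wf_map_shift .nat hΩ⟩⟩
      have hY := ih₃ hΩ' (m'.hyp hC (by rw [Cst.bind, Idx.shift_bind]; exact en))
        (((E'.shift i).cons (A := A.shift 1) ((A.sub_sat _ _ _).2 hw)).cons hws)
      have hY' := (A'.sub_satE k' l' _ _ _).1 hY
      have hT' := hT.ext e
      rw [Tm.subst_subst] at hT' ⊢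
      rw [Tm.subst, Tm.subst_subst] at ex
      exact (branch (m.ext e).ix hT' hY').rew hr.1 (m.ext e).ix
        (HOL.cost_case_cons_eq h₁.cost_hasTy h₂.cost_hasTy ht₃ E'.maps (hty.subst E'.maps) hw.1
          (by have := hws.1; rw [UTy.erase, UTy.erase_shift] at this; exact this) ex)
  | @ilam Δ Φ Ω S A k l t h ih =>
    intro hΩ θ Δ' Γ Ψ σ m E
    have hr := h.ilam.regular hΩ
    refine UTy.Sat.pair_zero (UTy.allI m.wf ?_ ?_) hr.1 m.ix
    · cases h.ilam.cost_hasTy.subst E.maps with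
      | pair h _ => exact h
    · intro Δ'' Γ' Ψ' σ' θ' w I e hw hI
      have hs := ih (UTy.wf_map_shift S hΩ) ((m.ext e).cons hI) ((E.ext e).shift I)
      refine hs.rew (h.regular (UTy.wf_map_shift S hΩ)).1 ((m.ext e).cons hI).ix
        (.eq_conv e.wf hs.1 ?_ ?_)
      · refine .app (σ := .nat) ?_ hw
        have := h.cost_hasTy
        rw [valCtx_shift] at this
        exact HasTy.subst (Γ := Γ) (.lam ((this.weaken .nat).subst (E.maps.up _))) e.tm
      · have := Tm.Conv.lam_subst ((t.cost κ).shift 1) w (fun n => (σ n).subst σ')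
        rw [← Tm.subst_subst, Tm.subst_shift_cons] at this
        exact this.symm
  | @iapp Δ Φ Ω S A J k l k' l' t h hJ ih =>
    intro hΩ θ Δ' Γ Ψ σ m E
    have hT := ih hΩ m E
    have hr := (h.iapp hJ).regular hΩ
    have hZ := hT.val.iapp .zero (hJ.bind m.ix)
    rw [← inst_bind] at hZ
    have hZ := (A.sub_satE k' l' _ _ _).2 hZ
    have hn := HOL.le_numeral m.wf κ.iapp
    have c₁ := Tm.add_hasTy (.snd hT.1) (.snd hZ.1)
    have c₂ := Tm.numeral_hasTy Γ κ.iapp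
    have hty := (h.iapp hJ).cost_hasTy.subst E.maps
    refine (hZ.val.pair hr.1 m.ix (Tm.add_hasTy c₁ c₂) ?_ ?_).rew hr.1 m.ix ?_
    · exact HOL.le_tm_add c₁ c₂ (.le_tm_add (.snd hT.1) (.snd hZ.1) hT.2.2.1 hZ.2.2.1) hn.1
    · exact HOL.tm_add_le c₁ c₂ (.tm_add_le (.snd hT.1) (.snd hZ.1) hT.2.2.2 hZ.2.2.2) hn.2
    · have he : (A.inst J).erase = A.erase := A.erase_sub _
      rw [he] at hty
      rw [UTy.erase_sub]
      exact HOL.cost_iapp_eq m.wf hT.1 hty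
  | sub h hA hs ih =>
    intro hΩ θ Δ' Γ Ψ σ m E
    have hT := ih hΩ m E
    have hT₁ := hT.1
    rw [hs.erase_eq] at hT₁
    exact ⟨hT₁, (hs.sat (h.regular hΩ).1 hA m hT.val).2, hT.2.2⟩
  | bounds h hk hl ek el ih =>
    intro hΩ θ Δ' Γ Ψ σ m E
    have hr := h.regular hΩ
    have hT := ih hΩ m E
    exact hT.mono m hT.val rfl ek el hr.2.1 hk hr.2.2 hl
  | rename ξ hξ h ih =>
    intro hΩ θ Δ' Γ Ψ σ m E
    rw [Ex.cost_rename, Tm.rename_subst]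
    refine ih (fun B hB => ?_) m fun n B hB => E _ _ (hξ n B hB)
    obtain ⟨n, hn⟩ := List.mem_iff_getElem?.1 hB
    exact hΩ B (List.mem_of_getElem? (hξ n B hn))

end

section

variable {κ : CostModel} {Δ Δ' Δ'' : ICtx} {Φ : List ICst} {Γ Γ' : Ctx} {Ψ Ψ' : List Fml}
  {θ θ' : ℕ → HIx} {σ σ₁ σ₂ : ℕ → Tm}

/-! ## Related lists -/

theorem RTy.erase_shift (τ : RTy) (k : ℕ) : (τ.shift k).erase = τ.erase := τ.erase_sub _

theorem RTy.Sat.nil {τ : RTy} {α : Idx} (hΨ : CWF Δ' Γ Ψ) (hα : Idx.HasSort Δ α .nat)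
    (hτ : τ.WF Δ) (hθ : HIx.Maps Δ θ Δ' Γ) :
    (RTy.list (.num 0) α τ).Sat θ Δ' Γ Ψ .nil .nil :=
  ⟨.nil, .nil, .listR_nil hΨ (hα.bind hθ) (RTy.fml_wf hτ (hθ.tlift₂ _ _) (.var rfl) (.var rfl))⟩

theorem RTy.Sat.inst {τ : RTy} {w z : Tm} (h : τ.Sat θ Δ Γ Ψ w z) :
    HOL Δ Γ Ψ ((τ.fml (Fml.tlift θ 2) (.var 1) (.var 0)).sub (z ;; w ;; Tm.var) HIx.ivar) := by
  rw [RTy.fml_sub, Fml.tlift_comp₂, HIx.comp_id]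
  exact h.2.2

theorem RTy.Sat.cons {τ : RTy} {n α : Idx} {w z ws zs : Tm} (h : τ.Sat θ Δ Γ Ψ w z)
    (h' : (RTy.list n α τ).Sat θ Δ Γ Ψ ws zs) :
    (RTy.list (.add n (.num 1)) (.add α (.num 1)) τ).Sat θ Δ Γ Ψ (.cons w ws) (.cons z zs) :=
  ⟨.cons h.1 h'.1, .cons h.2.1 h'.2.1, .listR_cons_add h.inst h.1 h.2.1 h'.2.2⟩

theorem RTy.Sat.cons_eq {τ : RTy} {n α : Idx} {w z ws zs : Tm}
    (h : (RTy.box τ).Sat θ Δ Γ Ψ w z) (h' : (RTy.list n α τ).Sat θ Δ Γ Ψ ws zs) :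
    (RTy.list (.add n (.num 1)) α τ).Sat θ Δ Γ Ψ (.cons w ws) (.cons z zs) :=
  ⟨.cons h.1 h'.1, .cons h.2.1 h'.2.1,
    .listR_cons_eq (RTy.Sat.inst ⟨h.1, h.2.1, h.2.2.andE₂⟩) h.2.2.andE₁ h'.2.2⟩

theorem HasTy.of_cons {w ws : Tm} {τ : Ty} (h : HasTy Γ (.cons w ws) (.list τ)) :
    HasTy Γ w τ ∧ HasTy Γ ws (.list τ) := by
  cases h with
  | cons h h' => exact ⟨h, h'⟩

/-- Synchronous case analysis on related lists. -/
theorem RTy.Sat.list_cases {τ τ' : RTy} {n α l : Idx} {x x' y y' : Tm}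
    (h : (RTy.list n α τ).Sat θ Δ' Γ Ψ x x') (m : Model Δ Φ θ Δ' Γ Ψ) (hτ' : τ'.WF Δ)
    (sl : Idx.HasSort Δ l .real) (hy : HasTy Γ y τ'.erase.costE) (hy' : HasTy Γ y' τ'.erase.costE)
    (h₀ : ∀ {Ψ'}, HOL.Ext Δ' Γ Ψ Tm.var HIx.ivar Δ' Γ Ψ' →
      HOL Δ' Γ Ψ' (.eq (.list τ.erase.costV) x .nil) →
      HOL Δ' Γ Ψ' (.eq (.list τ.erase.costV) x' .nil) →
      HOL Δ' Γ Ψ' (.cst (.eq (n.bind θ) (.num 0))) → τ'.SatE l θ Δ' Γ Ψ' y y')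
    (h₁ : ∀ {Δ'' Γ' Ψ' σ θ' i w z ws zs}, HOL.Ext Δ' Γ Ψ σ θ' Δ'' Γ' Ψ' →
      HIx.HasSort Δ'' Γ' i .nat →
      HOL Δ'' Γ' Ψ' (.eq (.list τ.erase.costV) (x.subst σ) (.cons w ws)) →
      HOL Δ'' Γ' Ψ' (.eq (.list τ.erase.costV) (x'.subst σ) (.cons z zs)) →
      (RTy.box τ).Sat (fun i => (θ i).sub σ θ') Δ'' Γ' Ψ' w z →
      (RTy.list (.leaf 0) (α.shift 1) (τ.shift 1)).Sat (i ;; fun i => (θ i).sub σ θ') Δ'' Γ' Ψ'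
        ws zs →
      HOL Δ'' Γ' Ψ' (.cst (.eq (n.bind fun i => (θ i).sub σ θ') (.add i (.num 1)))) →
      τ'.SatE l (fun i => (θ i).sub σ θ') Δ'' Γ' Ψ' (y.subst σ) (y'.subst σ))
    (h₂ : ∀ {Δ'' Γ' Ψ' σ θ' i b w z ws zs}, HOL.Ext Δ' Γ Ψ σ θ' Δ'' Γ' Ψ' →
      HIx.HasSort Δ'' Γ' i .nat → HIx.HasSort Δ'' Γ' b .nat →
      HOL Δ'' Γ' Ψ' (.eq (.list τ.erase.costV) (x.subst σ) (.cons w ws)) →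
      HOL Δ'' Γ' Ψ' (.eq (.list τ.erase.costV) (x'.subst σ) (.cons z zs)) →
      τ.Sat (fun i => (θ i).sub σ θ') Δ'' Γ' Ψ' w z →
      (RTy.list (.leaf 0) (.leaf 1) (τ.shift 2)).Sat (i ;; b ;; fun i => (θ i).sub σ θ') Δ'' Γ' Ψ'
        ws zs →
      HOL Δ'' Γ' Ψ' (.cst (.eq (n.bind fun i => (θ i).sub σ θ') (.add i (.num 1)))) →
      HOL Δ'' Γ' Ψ' (.cst (.eq (α.bind fun i => (θ i).sub σ θ') (.add b (.num 1)))) →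
      τ'.SatE l (fun i => (θ i).sub σ θ') Δ'' Γ' Ψ' (y.subst σ) (y'.subst σ)) :
    τ'.SatE l θ Δ' Γ Ψ y y' := by
  have key : HOL Δ' Γ Ψ (.and (τ'.fml θ (.fst y) (.fst y')) (Fml.dif (l.bind θ) y y')) := by
    refine HOL.listR_cases ⟨RTy.fml_wf hτ' m.ix (.fst hy) (.fst hy'),
      ⟨HasTy.snd hy, HasTy.snd hy'⟩, sl.bind m.ix⟩ h.2.2 ?_ ?_ ?_
    · intro Ψ' e e₁ e₂ hn
      have := h₀ e e₁ e₂ hn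
      exact .andI this.2.2.1 this.2.2.2
    · intro Δ'' Γ' Ψ' σ θ' i w z ws zs e e₁ e₂ hP ew hn hws
      have hw := HasTy.of_cons e₁.wf.2.2
      have hz := HasTy.of_cons e₂.wf.2.2
      rw [RTy.fml_sub, Fml.tlift_comp₂] at hP
      rw [Idx.bind_sub] at hn
      have hws' : (RTy.list (.leaf 0) (α.shift 1) (τ.shift 1)).Sat
          (i ;; fun i => (θ i).sub σ θ') Δ'' Γ' Ψ' ws zs := by
        refine ⟨?_, ?_, ?_⟩
        · rw [RTy.erase, RTy.erase_shift]; exact hw.2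
        · rw [RTy.erase, RTy.erase_shift]; exact hz.2
        · rw [RTy.fml, RTy.erase_shift, RTy.shift, RTy.sub_fml, Idx.shift_bind]
          rw [RTy.fml_sub, Fml.tlift_sub₂, Idx.bind_sub] at hws
          exact hws
      have := h₁ e hws.wf.2.1 e₁ e₂ ⟨hw.1, hz.1, .andI ew hP⟩ hws' hn
      have r := HOL.andI this.2.2.1 this.2.2.2
      rw [Fml.and_sub, RTy.fml_sub, Fml.dif_sub, Idx.bind_sub]
      exact r
    · intro Δ'' Γ' Ψ' σ θ' i b w z ws zs e e₁ e₂ hP hn ha hws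
      have hw := HasTy.of_cons e₁.wf.2.2
      have hz := HasTy.of_cons e₂.wf.2.2
      rw [RTy.fml_sub, Fml.tlift_comp₂] at hP
      rw [Idx.bind_sub] at hn ha
      have hws' : (RTy.list (.leaf 0) (.leaf 1) (τ.shift 2)).Sat
          (i ;; b ;; fun i => (θ i).sub σ θ') Δ'' Γ' Ψ' ws zs := by
        refine ⟨?_, ?_, ?_⟩
        · rw [RTy.erase, RTy.erase_shift]; exact hw.2
        · rw [RTy.erase, RTy.erase_shift]; exact hz.2
        · rw [RTy.fml, RTy.erase_shift, RTy.shift, RTy.sub_fml]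
          rw [RTy.fml_sub, Fml.tlift_sub₂] at hws
          exact hws
      have := h₂ e hws.wf.2.1 hws.wf.2.2.2.2.1 e₁ e₂ ⟨hw.1, hz.1, hP⟩ hws' hn ha
      have r := HOL.andI this.2.2.1 this.2.2.2
      rw [Fml.and_sub, RTy.fml_sub, Fml.dif_sub, Idx.bind_sub]
      exact r
  exact ⟨hy, hy', key.andE₁, key.andE₂⟩

/-! ## The relational embedding -/

/-- Two substitutions whose terms satisfy the assertions of a relational context. -/
def REnv (G : List RTy) (θ : ℕ → HIx) (Δ : ICtx) (Γ : Ctx) (Ψ : List Fml) (σ₁ σ₂ : ℕ → Tm) : Prop :=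
  ∀ (n : ℕ) (τ : RTy), G[n]? = some τ → τ.Sat θ Δ Γ Ψ (σ₁ n) (σ₂ n)

namespace REnv

variable {G : List RTy}

theorem ext (h : REnv G θ Δ Γ Ψ σ₁ σ₂) (e : HOL.Ext Δ Γ Ψ σ θ' Δ' Γ' Ψ') :
    REnv G (fun i => (θ i).sub σ θ') Δ' Γ' Ψ' (fun n => (σ₁ n).subst σ)
      (fun n => (σ₂ n).subst σ) :=
  fun n B hB => (h n B hB).ext e

theorem cons (h : REnv G θ Δ Γ Ψ σ₁ σ₂) {τ : RTy} {w z : Tm} (hw : τ.Sat θ Δ Γ Ψ w z) :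
    REnv (τ :: G) θ Δ Γ Ψ (w ;; σ₁) (z ;; σ₂) := by
  intro n B hB
  cases n with
  | zero => simp at hB; exact hB ▸ hw
  | succ n => exact h n B hB

theorem shift (h : REnv G θ Δ Γ Ψ σ₁ σ₂) (I : HIx) :
    REnv (G.map (RTy.shift 1)) (I ;; θ) Δ Γ Ψ σ₁ σ₂ := by
  intro n B hB
  rw [List.getElem?_map, Option.map_eq_some_iff] at hB
  obtain ⟨A, hA, rfl⟩ := hB
  exact (A.sub_sat _ _ _ _).2 (h n A hA)

theorem shift₂ (h : REnv G θ Δ Γ Ψ σ₁ σ₂) (I J : HIx) :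
    REnv (G.map (RTy.shift 2)) (I ;; J ;; θ) Δ Γ Ψ σ₁ σ₂ := by
  intro n B hB
  rw [List.getElem?_map, Option.map_eq_some_iff] at hB
  obtain ⟨A, hA, rfl⟩ := hB
  exact (A.sub_sat _ _ _ _).2 (h n A hA)

theorem mono {Ψ' : List Fml} (h : REnv G θ Δ Γ Ψ σ₁ σ₂)
    (e : HOL.Ext Δ Γ Ψ Tm.var HIx.ivar Δ Γ Ψ') : REnv G θ Δ Γ Ψ' σ₁ σ₂ := by
  have := h.ext e
  simp only [HIx.comp_id, Tm.subst_var] at this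
  exact this

theorem bar (h : REnv G θ Δ' Γ Ψ σ₁ σ₂) (hG : ∀ τ ∈ G, τ.WF Δ) (hθ : HIx.Maps Δ θ Δ' Γ) :
    UEnv (G.map RTy.bar) θ Δ' Γ Ψ σ₁ ∧ UEnv (G.map RTy.bar) θ Δ' Γ Ψ σ₂ := by
  refine ⟨fun n B hB => ?_, fun n B hB => ?_⟩ <;>
  · rw [List.getElem?_map, Option.map_eq_some_iff] at hB
    obtain ⟨τ, hτ, rfl⟩ := hB
    have := (h n τ hτ).bar (hG τ (List.mem_of_getElem? hτ)) hθ
    first | exact this.1 | exact this.2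

end REnv

theorem RTy.SatE.mono_ext {τ : RTy} {l : Idx} {x y : Tm} {Ψ' : List Fml}
    (h : τ.SatE l θ Δ Γ Ψ x y) (e : HOL.Ext Δ Γ Ψ Tm.var HIx.ivar Δ Γ Ψ') :
    τ.SatE l θ Δ Γ Ψ' x y := by
  have h₁ := e.hol h.2.2.1
  have h₂ := e.hol h.2.2.2
  rw [Fml.sub_id] at h₁ h₂
  exact ⟨h.1, h.2.1, h₁, h₂⟩

theorem RTy.SatE.ext {τ : RTy} {l : Idx} {x y : Tm} (h : τ.SatE l θ Δ Γ Ψ x y)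
    (e : HOL.Ext Δ Γ Ψ σ θ' Δ' Γ' Ψ') :
    τ.SatE l (fun i => (θ i).sub σ θ') Δ' Γ' Ψ' (x.subst σ) (y.subst σ) := by
  have h₁ := e.hol h.2.2.1
  have h₂ := e.hol h.2.2.2
  rw [RTy.fml_sub] at h₁
  rw [Fml.dif_sub, Idx.bind_sub] at h₂
  exact ⟨h.1.subst e.tm, h.2.1.subst e.tm, h₁, h₂⟩

theorem Model.cons₂ (m : Model Δ Φ θ Δ' Γ Ψ) {S S' : Srt} {I J : HIx}
    (hI : HIx.HasSort Δ' Γ I S) (hJ : HIx.HasSort Δ' Γ J S') :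
    Model (S :: S' :: Δ) (Φ.map (ICst.shift 2)) (I ;; J ;; θ) Δ' Γ Ψ := by
  have := (m.cons hJ).cons hI
  have e : ICst.shift 1 ∘ ICst.shift 1 = ICst.shift 2 := by
    funext C
    simp only [Function.comp, ICst.shift, Cst.map, Cst.bind_bind]; rfl
  rwa [List.map_map, e] at this

theorem RTy.wf_map_shift₂ {G : List RTy} (S S' : Srt) (h : ∀ τ ∈ G, τ.WF Δ) :
    ∀ τ ∈ G.map (RTy.shift 2), τ.WF (S :: S' :: Δ) := by
  intro A hA
  obtain ⟨B, hB, rfl⟩ := List.mem_map.1 hA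
  exact (h B hB).subst (leaf_hasSort₂ Δ S S')

/-- Both translations of related expressions are typed. -/
theorem RTyping.cost_hasTy {G : List RTy} {l : Idx} {t₁ t₂ : Ex} {τ : RTy}
    (h : RTyping κ Δ Φ G l t₁ t₂ τ) : HasTy (valCtx (G.map RTy.bar)) (t₁.cost κ) τ.erase.costE ∧
      HasTy (valCtx (G.map RTy.bar)) (t₂.cost κ) τ.erase.costE := by
  rw [← τ.bar_erase]
  exact ⟨h.unary.1.cost_hasTy, h.unary.2.cost_hasTy⟩

/-- The translations of related expressions satisfy the assertion of their relational type. -/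
theorem RTyping.sat {G : List RTy} {l : Idx} {t₁ t₂ : Ex} {τ : RTy}
    (h : RTyping κ Δ Φ G l t₁ t₂ τ) : (∀ τ ∈ G, τ.WF Δ) →
    ∀ {θ : ℕ → HIx} {Δ' : ICtx} {Γ : Ctx} {Ψ : List Fml} {σ₁ σ₂ : ℕ → Tm},
      Model Δ Φ θ Δ' Γ Ψ → REnv G θ Δ' Γ Ψ σ₁ σ₂ →
      τ.SatE l θ Δ' Γ Ψ ((t₁.cost κ).subst σ₁) ((t₂.cost κ).subst σ₂) := by
  induction h with
  | var h =>
    intro hG θ Δ' Γ Ψ σ₁ σ₂ m E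
    exact (E _ _ h).pair_zero (hG _ (List.mem_of_getElem? h)) m.ix
  | @num Δ Φ G n =>
    intro hG θ Δ' Γ Ψ σ₁ σ₂ m E
    rw [Ex.cost, Tm.subst, Tm.subst, Tm.numeral_subst, Tm.numeral_subst]
    have hn := Tm.numeral_hasTy Γ n
    exact RTy.Sat.pair_zero (τ := .nat) ⟨hn, hn, .eq_refl m.wf hn⟩ (Δ := Δ) trivial m.ix
  | nil hα hτ =>
    intro hG θ Δ' Γ Ψ σ₁ σ₂ m E
    exact (RTy.Sat.nil m.wf hα hτ m.ix).pair_zero ⟨trivial, hα, hτ⟩ m.ix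
  | @cons₁ Δ Φ G n α τ l₁ l₂ t₁ t₁' t₂ t₂' h₁ h₂ ih₁ ih₂ =>
    intro hG θ Δ' Γ Ψ σ₁ σ₂ m E
    have hT := ih₁ hG m E
    have hU := ih₂ hG m E
    have hr := (h₁.cons₁ h₂).regular hG
    have hE := E.bar hG m.ix
    have hty := (h₁.cons₁ h₂).cost_hasTy
    refine ((hT.val.cons hU.val).pair hr.1 m.ix (Tm.add_hasTy (.snd hT.1) (.snd hU.1))
      (Tm.add_hasTy (.snd hT.2.1) (.snd hU.2.1)) ?_).rew hr.1 m.ix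
      (HOL.cost_cons_eq m.wf hT.1 hU.1 (hty.1.subst hE.1.maps))
      (HOL.cost_cons_eq m.wf hT.2.1 hU.2.1 (hty.2.subst hE.2.maps))
    exact .sub_add_le (.snd hT.1) (.snd hU.1) (.snd hT.2.1) (.snd hU.2.1) hT.2.2.2 hU.2.2.2
  | @cons₂ Δ Φ G n α τ l₁ l₂ t₁ t₁' t₂ t₂' h₁ h₂ ih₁ ih₂ =>
    intro hG θ Δ' Γ Ψ σ₁ σ₂ m E
    have hT := ih₁ hG m E
    have hU := ih₂ hG m E
    have hr := (h₁.cons₂ h₂).regular hG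
    have hE := E.bar hG m.ix
    have hty := (h₁.cons₂ h₂).cost_hasTy
    refine ((hT.val.cons_eq hU.val).pair hr.1 m.ix (Tm.add_hasTy (.snd hT.1) (.snd hU.1))
      (Tm.add_hasTy (.snd hT.2.1) (.snd hU.2.1)) ?_).rew hr.1 m.ix
      (HOL.cost_cons_eq m.wf hT.1 hU.1 (hty.1.subst hE.1.maps))
      (HOL.cost_cons_eq m.wf hT.2.1 hU.2.1 (hty.2.subst hE.2.maps))
    exact .sub_add_le (.snd hT.1) (.snd hU.1) (.snd hT.2.1) (.snd hU.2.1) hT.2.2.2 hU.2.2.2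
  | @case Δ Φ G n α τ τ' l l' t t' t₁ t₁' t₂ t₂' h₁ h₂ h₃ h₄ ih₁ ih₂ ih₃ ih₄ =>
    intro hG θ Δ' Γ Ψ σ₁ σ₂ m E
    have hr := (h₁.case h₂ h₃ h₄).regular hG
    have hr₁ := (h₁.regular hG).1
    have hT := ih₁ hG m E
    have hE := E.bar hG m.ix
    have hty := (h₁.case h₂ h₃ h₄).cost_hasTy
    have ht₁ := h₁.cost_hasTy
    have ht₂ := h₂.cost_hasTy
    have ht₃ := h₃.cost_hasTy
    simp only [List.map_cons, RTy.map_shift_bar, valCtx_cons, valCtx_shift, RTy.bar_erase,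
      RTy.erase, RTy.erase_shift, Ty.costV] at ht₃
    have branch : ∀ {θ : ℕ → HIx} {Δ' : ICtx} {Γ : Ctx} {Ψ : List Fml} {T T' Y Y' : Tm},
        HIx.Maps Δ θ Δ' Γ → (RTy.list n α τ).SatE l θ Δ' Γ Ψ T T' → τ'.SatE l' θ Δ' Γ Ψ Y Y' →
        τ'.SatE (.add l l') θ Δ' Γ Ψ
          (.pair (.fst Y) (Tm.add (Tm.add (.snd T) (.snd Y)) (Tm.numeral κ.case)))
          (.pair (.fst Y') (Tm.add (Tm.add (.snd T') (.snd Y')) (Tm.numeral κ.case))) := by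
      intro θ Δ' Γ Ψ T T' Y Y' hθ hT hY
      have c₁ := Tm.add_hasTy (.snd hT.1) (.snd hY.1)
      have c₂ := Tm.add_hasTy (.snd hT.2.1) (.snd hY.2.1)
      have c₃ := Tm.numeral_hasTy Γ κ.case
      exact hY.val.pair hr.1 hθ (Tm.add_hasTy c₁ c₃) (Tm.add_hasTy c₂ c₃)
        (.sub_add_numeral_le c₁ c₂ (.sub_add_le (.snd hT.1) (.snd hY.1) (.snd hT.2.1) (.snd hY.2.1)
          hT.2.2.2 hY.2.2.2) _)
    refine hT.val.list_cases m hr.1 hr.2 (hty.1.subst hE.1.maps) (hty.2.subst hE.2.maps) ?_ ?_ ?_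
    · intro Ψ' e ex ex' en
      have hY := ih₂ hG ((m.mono e).hyp (C := .eq n (.num 0)) ⟨hr₁.1.real, trivial⟩ en) (E.mono e)
      exact (branch m.ix (hT.mono_ext e) hY).rew hr.1 m.ix
        (HOL.cost_case_nil_eq ht₁.1 ht₂.1 ht₃.1 hE.1.maps (hty.1.subst hE.1.maps) ex)
        (HOL.cost_case_nil_eq ht₁.2 ht₂.2 ht₃.2 hE.2.maps (hty.2.subst hE.2.maps) ex')
    · intro Δ'' Γ' Ψ' σ' θ' i w z ws zs e hi ex ex' hw hws en
      have E' := E.ext e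
      have hE' := E'.bar hG (m.ext e).ix
      have hs := leaf_hasSort Δ .nat
      have hC : ICst.WF (.nat :: Δ) (.eq (n.shift 1) (.add (.leaf 0) (.num 1))) :=
        ⟨(hr₁.1.subst hs).real, Nat.succ_pos _, trivial⟩
      have hG' : ∀ σ ∈ RTy.list (.leaf 0) (α.shift 1) (τ.shift 1) :: .box (τ.shift 1) ::
          G.map (RTy.shift 1), σ.WF (.nat :: Δ) :=
        List.forall_mem_cons.2 ⟨⟨rfl, hr₁.2.1.subst hs, hr₁.2.2.subst hs⟩, List.forall_mem_cons.2
          ⟨hr₁.2.2.subst hs, RTy.wf_map_shift .nat hG⟩⟩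
      have hw' : (RTy.box (τ.shift 1)).Sat (i ;; fun i => (θ i).sub σ' θ') Δ'' Γ' Ψ' w z :=
        (RTy.sub_sat (.box τ) _ _ _ _).2 hw
      have hY := ih₃ hG' (((m.ext e).cons (S := .nat) hi).hyp hC
        (by rw [Cst.bind, Idx.shift_bind]; exact en)) (((E'.shift i).cons hw').cons hws)
      have hY' := (τ'.sub_satE l' _ _ _ _).1 hY
      have hT' := hT.ext e
      have hws₁ := (HasTy.of_cons ex.wf.2.2)
      have hws₂ := (HasTy.of_cons ex'.wf.2.2)
      rw [Tm.subst_subst, Tm.subst_subst] at hT' ⊢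
      rw [Tm.subst, Tm.subst_subst] at ex ex'
      exact (branch (m.ext e).ix hT' hY').rew hr.1 (m.ext e).ix
        (HOL.cost_case_cons_eq ht₁.1 ht₂.1 ht₃.1 hE'.1.maps (hty.1.subst hE'.1.maps) hws₁.1 hws₁.2 ex)
        (HOL.cost_case_cons_eq ht₁.2 ht₂.2 ht₃.2 hE'.2.maps (hty.2.subst hE'.2.maps) hws₂.1 hws₂.2 ex')
    · intro Δ'' Γ' Ψ' σ' θ' i b w z ws zs e hi hb ex ex' hw hws en ea
      have E' := E.ext e
      have hE' := E'.bar hG (m.ext e).ix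
      have hs := leaf_hasSort₂ Δ .nat .nat
      have hC : ICst.WF (.nat :: .nat :: Δ) (.eq (n.shift 2) (.add (.leaf 0) (.num 1))) :=
        ⟨(hr₁.1.subst hs).real, Nat.succ_pos _, trivial⟩
      have hC' : ICst.WF (.nat :: .nat :: Δ) (.eq (α.shift 2) (.add (.leaf 1) (.num 1))) :=
        ⟨(hr₁.2.1.subst hs).real, Nat.succ_lt_succ (Nat.succ_pos _), trivial⟩
      have hG' : ∀ σ ∈ RTy.list (.leaf 0) (.leaf 1) (τ.shift 2) :: τ.shift 2 ::
          G.map (RTy.shift 2), σ.WF (.nat :: .nat :: Δ) :=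
        List.forall_mem_cons.2 ⟨⟨rfl, rfl, hr₁.2.2.subst hs⟩, List.forall_mem_cons.2
          ⟨hr₁.2.2.subst hs, RTy.wf_map_shift₂ .nat .nat hG⟩⟩
      have hw' : (τ.shift 2).Sat (i ;; b ;; fun i => (θ i).sub σ' θ') Δ'' Γ' Ψ' w z :=
        (τ.sub_sat _ _ _ _).2 hw
      have hY := ih₄ hG' ((((m.ext e).cons₂ (S := .nat) (S' := .nat) hi hb).hyp hC
        (by rw [Cst.bind, Idx.shift_bind]; exact en)).hyp hC'
        (by rw [Cst.bind, Idx.shift_bind]; exact ea)) (((E'.shift₂ i b).cons hw').cons hws)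
      have hY' := (τ'.sub_satE l' _ _ _ _).1 hY
      have hT' := hT.ext e
      have hws₁ := (HasTy.of_cons ex.wf.2.2)
      have hws₂ := (HasTy.of_cons ex'.wf.2.2)
      rw [Tm.subst_subst, Tm.subst_subst] at hT' ⊢
      rw [Tm.subst, Tm.subst_subst] at ex ex'
      exact (branch (m.ext e).ix hT' hY').rew hr.1 (m.ext e).ix
        (HOL.cost_case_cons_eq ht₁.1 ht₂.1 ht₃.1 hE'.1.maps (hty.1.subst hE'.1.maps) hws₁.1 hws₁.2 ex)
        (HOL.cost_case_cons_eq ht₁.2 ht₂.2 ht₃.2 hE'.2.maps (hty.2.subst hE'.2.maps) hws₂.1 hws₂.2 ex')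
  | @lam Δ Φ G τ₁ τ₂ l t₁ t₂ hτ h ih =>
    intro hG θ Δ' Γ Ψ σ₁ σ₂ m E
    have hG' := List.forall_mem_cons.2 ⟨hτ, hG⟩
    have hr := (RTyping.lam hτ h).regular hG
    have hE := E.bar hG m.ix
    have hb := RTy.wf_map_bar hG
    have hA := τ₁.bar_wf hτ
    have hu := h.unary
    have bar₁ := (UTypingN.lam hA hu.1).sat hb m hE.1
    have bar₂ := (UTypingN.lam hA hu.2).sat hb m hE.2
    have hrb := ((UTypingN.lam hA hu.1).regular hb).1
    have fp : ∀ {t : Ex} {σ : ℕ → Tm}, HasTy Γ (((Ex.lam t).cost κ).subst σ)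
        (UTy.arr τ₁.bar (.num 0) .inf τ₂.bar).erase.costE → HOL Δ' Γ Ψ
        (.eq (UTy.arr τ₁.bar (.num 0) .inf τ₂.bar).erase.costV
          (.fst (((Ex.lam t).cost κ).subst σ)) ((Tm.lam (t.cost κ)).subst σ)) := by
      intro t σ hty
      cases hty with
      | pair h h' => exact (HOL.fst_pair_eq m.wf h h').eq_symm
    refine RTy.Sat.pair_zero (RTy.arrI m.ix m.wf hτ (bar₁.val.rew hrb m.ix (fp bar₁.1))
      (bar₂.val.rew hrb m.ix (fp bar₂.1)) ?_) hr.1 m.ix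
    intro Δ'' Γ' Ψ' σ θ' w z e hw
    have hs := ih hG' (m.ext e) ((E.ext e).cons hw)
    have hty := h.cost_hasTy
    simp only [List.map_cons, valCtx_cons, RTy.bar_erase] at hty
    refine hs.rew (h.regular hG').1 (m.ext e).ix (.eq_conv e.wf hs.1 ?_ ?_)
      (.eq_conv e.wf hs.2.1 ?_ ?_)
    · exact .app (HasTy.subst (Γ := Γ) (.lam (hty.1.subst (hE.1.maps.up _))) e.tm) hw.1
    · have := Tm.Conv.lam_subst (t₁.cost κ) w (fun n => (σ₁ n).subst σ)
      rw [← Tm.subst_subst] at this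
      exact this.symm
    · exact .app (HasTy.subst (Γ := Γ) (.lam (hty.2.subst (hE.2.maps.up _))) e.tm) hw.2.1
    · have := Tm.Conv.lam_subst (t₂.cost κ) z (fun n => (σ₂ n).subst σ)
      rw [← Tm.subst_subst] at this
      exact this.symm
  | @app Δ Φ G τ₁ τ₂ l l₁ l₂ t₁ t₁' t₂ t₂' h₁ h₂ ih₁ ih₂ =>
    intro hG θ Δ' Γ Ψ σ₁ σ₂ m E
    have hT := ih₁ hG m E
    have hU := ih₂ hG m E
    have hZ := hT.val.app hU.val
    have hr := (h₁.app h₂).regular hG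
    have hE := E.bar hG m.ix
    have hty := (h₁.app h₂).cost_hasTy
    have c₁ := Tm.add_hasTy (.snd hT.1) (.snd hU.1)
    have c₁' := Tm.add_hasTy (.snd hT.2.1) (.snd hU.2.1)
    have c₂ := Tm.add_hasTy c₁ (.snd hZ.1)
    have c₂' := Tm.add_hasTy c₁' (.snd hZ.2.1)
    have c₃ := Tm.numeral_hasTy Γ κ.app
    refine (hZ.val.pair hr.1 m.ix (Tm.add_hasTy c₂ c₃) (Tm.add_hasTy c₂' c₃) ?_).rew hr.1 m.ix
      (HOL.cost_app_eq m.wf hT.1 hU.1 (hty.1.subst hE.1.maps))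
      (HOL.cost_app_eq m.wf hT.2.1 hU.2.1 (hty.2.subst hE.2.maps))
    exact .sub_add_numeral_le c₂ c₂' (.sub_add_le c₁ (.snd hZ.1) c₁' (.snd hZ.2.1)
      (.sub_add_le (.snd hT.1) (.snd hU.1) (.snd hT.2.1) (.snd hU.2.1) hT.2.2.2 hU.2.2.2)
      hZ.2.2.2) _
  | @ilam Δ Φ G S τ l t t' h ih =>
    intro hG θ Δ' Γ Ψ σ₁ σ₂ m E
    have hG' := RTy.wf_map_shift S hG
    have hr := h.ilam.regular hG
    have hE := E.bar hG m.ix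
    have hb := RTy.wf_map_bar hG
    have hu := h.unary
    rw [RTy.map_shift_bar] at hu
    have bar₁ := (UTypingN.ilam hu.1).sat hb m hE.1
    have bar₂ := (UTypingN.ilam hu.2).sat hb m hE.2
    have hrb := ((UTypingN.ilam hu.1).regular hb).1
    have fp : ∀ {t : Ex} {σ : ℕ → Tm}, HasTy Γ (((Ex.ilam t).cost κ).subst σ)
        (UTy.all S (.num 0) .inf τ.bar).erase.costE → HOL Δ' Γ Ψ
        (.eq (UTy.all S (.num 0) .inf τ.bar).erase.costV
          (.fst (((Ex.ilam t).cost κ).subst σ)) ((Tm.lam ((t.cost κ).shift 1)).subst σ)) := by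
      intro t σ hty
      cases hty with
      | pair h h' => exact (HOL.fst_pair_eq m.wf h h').eq_symm
    refine RTy.Sat.pair_zero (RTy.allI m.wf (bar₁.val.rew hrb m.ix (fp bar₁.1))
      (bar₂.val.rew hrb m.ix (fp bar₂.1)) ?_) hr.1 m.ix
    intro Δ'' Γ' Ψ' σ θ' w z I e hw hz hI
    have hs := ih hG' ((m.ext e).cons hI) ((E.ext e).shift I)
    have hty := h.cost_hasTy
    rw [RTy.map_shift_bar, valCtx_shift] at hty
    refine hs.rew (h.regular hG').1 ((m.ext e).cons hI).ix (.eq_conv e.wf hs.1 ?_ ?_)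
      (.eq_conv e.wf hs.2.1 ?_ ?_)
    · exact .app (HasTy.subst (Γ := Γ) (.lam ((hty.1.weaken .nat).subst (hE.1.maps.up _))) e.tm) hw
    · have := Tm.Conv.lam_subst ((t.cost κ).shift 1) w (fun n => (σ₁ n).subst σ)
      rw [← Tm.subst_subst, Tm.subst_shift_cons] at this
      exact this.symm
    · exact .app (HasTy.subst (Γ := Γ) (.lam ((hty.2.weaken .nat).subst (hE.2.maps.up _))) e.tm) hz
    · have := Tm.Conv.lam_subst ((t'.cost κ).shift 1) z (fun n => (σ₂ n).subst σ)
      rw [← Tm.subst_subst, Tm.subst_shift_cons] at this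
      exact this.symm
  | @iapp Δ Φ G S τ J l l' t t' h hJ ih =>
    intro hG θ Δ' Γ Ψ σ₁ σ₂ m E
    have hT := ih hG m E
    have hr := (h.iapp hJ).regular hG
    have hE := E.bar hG m.ix
    have hZ := hT.val.iapp .zero .zero (hJ.bind m.ix)
    rw [← inst_bind] at hZ
    have hZ := (τ.sub_satE l' _ _ _ _).2 hZ
    have c₁ := Tm.add_hasTy (.snd hT.1) (.snd hZ.1)
    have c₁' := Tm.add_hasTy (.snd hT.2.1) (.snd hZ.2.1)
    have c₂ := Tm.numeral_hasTy Γ κ.iapp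
    have hty := (h.iapp hJ).cost_hasTy
    have he : (τ.inst J).erase = τ.erase := τ.erase_sub _
    rw [he] at hty
    refine (hZ.val.pair hr.1 m.ix (Tm.add_hasTy c₁ c₂) (Tm.add_hasTy c₁' c₂) ?_).rew hr.1 m.ix ?_ ?_
    · exact HOL.sub_add_numeral_le c₁ c₁' (.sub_add_le (.snd hT.1) (.snd hZ.1) (.snd hT.2.1)
        (.snd hZ.2.1) hT.2.2.2 hZ.2.2.2) _
    · rw [RTy.erase_sub]
      exact HOL.cost_iapp_eq m.wf hT.1 (hty.1.subst hE.1.maps)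
    · rw [RTy.erase_sub]
      exact HOL.cost_iapp_eq m.wf hT.2.1 (hty.2.subst hE.2.maps)
  | @nochange Δ Φ G G' τ l t ξ hi hξ h hs ih =>
    intro hG θ Δ' Γ Ψ σ₁ σ₂ m E
    have hG' : ∀ σ ∈ G, σ.WF Δ := by
      intro σ hσ
      obtain ⟨n, hn⟩ := List.mem_iff_getElem?.1 hσ
      exact hG σ (List.mem_of_getElem? (hξ n σ hn))
    have E' : REnv G θ Δ' Γ Ψ (fun n => σ₁ (ξ n)) (fun n => σ₂ (ξ n)) :=
      fun n σ hn => E _ _ (hξ n σ hn)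
    rw [Ex.cost_rename, Tm.rename_subst, Tm.rename_subst]
    refine (ih hG' m E').box (.eq_subst h.cost_hasTy.1 m.wf fun n ρ hn => ?_)
    rw [valCtx, List.map_map, List.getElem?_map, Option.map_eq_some_iff] at hn
    obtain ⟨σ, hσ, rfl⟩ := hn
    have hm := List.mem_of_getElem? hσ
    have hw := hG' σ hm
    have := ((hs σ hm).sat hw hw m (E' n σ hσ)).2.2.andE₁
    rw [Function.comp, RTy.bar_erase]
    exact this
  | switch h₁ h₂ =>
    intro hG θ Δ' Γ Ψ σ₁ σ₂ m E
    have hE := E.bar hG m.ix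
    have hb := RTy.wf_map_bar hG
    exact (h₁.toN.sat hb m hE.1).switch (h₂.toN.sat hb m hE.2)
  | sub h hτ' hl hs el ih =>
    intro hG θ Δ' Γ Ψ σ₁ σ₂ m E
    have hr := h.regular hG
    have hT := ih hG m E
    exact hT.mono m (hs.sat hr.1 hτ' m hT.val) hs.erase_eq el hr.2 hl

end

/-! ## The embedding in the logic -/

theorem relCtx_getElem? (G : List RTy) : ∀ n : ℕ,
    (relCtx G)[2 * n + 1]? = (G[n]?).map (fun τ => τ.erase.costV) ∧
      (relCtx G)[2 * n]? = (G[n]?).map (fun τ => τ.erase.costV) := by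
  induction G with
  | nil => intro n; simp [relCtx]
  | cons τ G ih =>
    intro n
    cases n with
    | zero => exact ⟨rfl, rfl⟩
    | succ n => exact ih n

theorem relHyps_mem {G : List RTy} {ψ : Fml} : ψ ∈ relHyps G ↔ ∃ (n : ℕ) (τ : RTy),
    G[n]? = some τ ∧ τ.fmlV (.var (2 * n + 1)) (.var (2 * n)) = ψ := by
  simp only [relHyps, List.mem_mapIdx, List.getElem?_eq_some_iff]
  constructor
  · rintro ⟨n, h, e⟩; exact ⟨n, _, ⟨h, rfl⟩, e⟩
  · rintro ⟨n, _, ⟨h, rfl⟩, e⟩; exact ⟨n, h, e⟩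

theorem relCtx_var {G : List RTy} {n : ℕ} {τ : RTy} (h : G[n]? = some τ) :
    HasTy (relCtx G) (.var (2 * n + 1)) τ.erase.costV ∧
      HasTy (relCtx G) (.var (2 * n)) τ.erase.costV :=
  ⟨.var (by rw [(relCtx_getElem? G n).1, h]; rfl), .var (by rw [(relCtx_getElem? G n).2, h]; rfl)⟩

theorem relHyps_wf {Δ : ICtx} {Φ : List ICst} {G : List RTy} (hΦ : ∀ C ∈ Φ, C.WF Δ)
    (hG : ∀ τ ∈ G, τ.WF Δ) :
    CWF Δ (relCtx G) (Φ.map (fun C => Fml.cst C.toH) ++ relHyps G) := by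
  intro ψ hψ
  rcases List.mem_append.1 hψ with hψ | hψ
  · obtain ⟨C, hC, rfl⟩ := List.mem_map.1 hψ
    exact Cst.AllLeaves.bind (fun _ hi => hi) (hΦ C hC)
  · obtain ⟨n, τ, h, rfl⟩ := relHyps_mem.1 hψ
    rw [RTy.fmlV_eq]
    exact RTy.fml_wf (hG τ (List.mem_of_getElem? h)) (HIx.Maps.ivar _ _) (relCtx_var h).1
      (relCtx_var h).2

/-- The relational embedding. -/
theorem RTyping.rhol {κ : CostModel} {Δ : ICtx} {Φ : List ICst} {G : List RTy} {l : Idx}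
    {t₁ t₂ : Ex} {τ : RTy} (h : RTyping κ Δ Φ G l t₁ t₂ τ) (hΦ : ∀ C ∈ Φ, C.WF Δ)
    (hG : ∀ σ ∈ G, σ.WF Δ) :
    RHOL Δ (relCtx G) (Φ.map (fun C => Fml.cst C.toH) ++ relHyps G)
      (t₁.cost κ).copyL τ.erase.costE (t₂.cost κ).copyR τ.erase.costE
      (τ.fmlE l (.var 1) (.var 0)) := by
  have hΨ := relHyps_wf hΦ hG
  have m : Model Δ Φ HIx.ivar Δ (relCtx G) (Φ.map (fun C => Fml.cst C.toH) ++ relHyps G) :=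
    ⟨HIx.Maps.ivar _ _, hΨ, hΦ, fun D hD =>
      .ax hΨ (List.mem_append_left _ (List.mem_map.2 ⟨D, hD, rfl⟩))⟩
  have E : REnv G HIx.ivar Δ (relCtx G) (Φ.map (fun C => Fml.cst C.toH) ++ relHyps G)
      (fun n => .var (2 * n + 1)) (fun n => .var (2 * n)) := fun n τ hn =>
    ⟨(relCtx_var hn).1, (relCtx_var hn).2, by
      rw [← RTy.fmlV_eq]
      exact .ax hΨ (List.mem_append_right _ (relHyps_mem.2 ⟨n, τ, hn, rfl⟩))⟩
  have hs := h.sat hG m E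
  have hr := h.regular hG
  have e : τ.fmlE l (.var 1) (.var 0) =
      .and (τ.fml HIx.ivar (.fst (.var 1)) (.fst (.var 0))) (Fml.dif (l.bind HIx.ivar) (.var 1) (.var 0)) := by
    rw [RTy.fmlE, RTy.fmlV_eq]; rfl
  rw [Tm.copyL, Tm.copyR, Tm.rename_eq_subst, Tm.rename_eq_subst, e]
  refine .of_hol hs.1 hs.2.1 ⟨?_, ?_⟩ ?_
  · exact RTy.fml_wf hr.1 (HIx.Maps.ivar _ _) (.fst (.var rfl)) (.fst (.var rfl))
  · exact ⟨⟨HasTy.snd (.var rfl), HasTy.snd (.var rfl)⟩, hr.2.bind (HIx.Maps.ivar _ _)⟩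
  · rw [Fml.inst2, Fml.tsub, Fml.and_sub, RTy.fml_sub, Fml.dif_sub, Idx.bind_sub]
    exact .andI hs.2.2.1 hs.2.2.2

/-! ## Evaluation -/

namespace Ex

theorem up_var_comp (ξ : ℕ → ℕ) : up (fun n => var (ξ n)) = fun n => var (upr ξ n) := by
  funext n; cases n <;> rfl

theorem rename_eq_subst (t : Ex) : ∀ ξ : ℕ → ℕ, t.rename ξ = t.subst (fun n => var (ξ n)) := by
  induction t <;> intro ξ <;> simp_all [rename, subst, up_var_comp]

theorem up_comp_upr (σ : ℕ → Ex) (ξ : ℕ → ℕ) :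
    (fun n => up σ (upr ξ n)) = up (fun n => σ (ξ n)) := by
  funext n; cases n <;> rfl

theorem rename_subst (t : Ex) : ∀ (ξ : ℕ → ℕ) (σ : ℕ → Ex),
    (t.rename ξ).subst σ = t.subst (fun n => σ (ξ n)) := by
  induction t <;> intro ξ σ <;> simp_all [rename, subst, up_comp_upr]

theorem rename_rename (t : Ex) (ξ ξ' : ℕ → ℕ) :
    (t.rename ξ).rename ξ' = t.rename (fun n => ξ' (ξ n)) := by
  rw [rename_eq_subst _ ξ', rename_subst, rename_eq_subst]

theorem up_rename (σ : ℕ → Ex) (ξ : ℕ → ℕ) :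
    (fun n => (up σ n).rename (upr ξ)) = up (fun n => (σ n).rename ξ) := by
  funext n
  cases n with
  | zero => rfl
  | succ n => simp only [up, scons_succ, rename_rename]; rfl

theorem subst_rename (t : Ex) : ∀ (σ : ℕ → Ex) (ξ : ℕ → ℕ),
    (t.subst σ).rename ξ = t.subst (fun n => (σ n).rename ξ) := by
  induction t <;> intro σ ξ <;> simp_all [rename, subst, up_rename]

theorem up_subst (σ τ : ℕ → Ex) :
    (fun n => (up σ n).subst (up τ)) = up (fun n => (σ n).subst τ) := by
  funext n
  cases n with
  | zero => rfl
  | succ n => simp only [up, scons_succ, rename_subst, subst_rename]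

theorem subst_subst (t : Ex) : ∀ (σ τ : ℕ → Ex),
    (t.subst σ).subst τ = t.subst (fun n => (σ n).subst τ) := by
  induction t <;> intro σ τ <;> simp_all [subst, up_subst]

theorem up_var : up var = var := by funext n; cases n <;> rfl

theorem subst_var (t : Ex) : t.subst var = t := by
  induction t <;> simp_all [subst, up_var]

theorem subst_up_inst (t w : Ex) (γ : ℕ → Ex) :
    (t.subst (up γ)).subst (w ;; var) = t.subst (w ;; γ) := by
  rw [subst_subst]
  congr 1; funext n
  cases n with
  | zero => rfl
  | succ n => rw [up, scons_succ, rename_subst]; exact subst_var _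

theorem subst_up_up_inst (t w ws : Ex) (γ : ℕ → Ex) :
    (t.subst (up (up γ))).subst (ws ;; w ;; var) = t.subst (ws ;; w ;; γ) := by
  rw [subst_subst]
  congr 1; funext n
  rcases n with _ | _ | n
  · rfl
  · rfl
  · rw [up, scons_succ, up, scons_succ, rename_rename, rename_subst]; exact subst_var _

variable {κ : CostModel}

theorem Eval.det {t v v' : Ex} {c c' : ℕ} (h : Eval κ t v c) (h' : Eval κ t v' c') :
    v = v' ∧ c = c' := by
  induction h generalizing v' c' with
  | num | lam | ilam | nil => cases h'; exact ⟨rfl, rfl⟩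
  | cons _ _ ih₁ ih₂ =>
    cases h' with
    | cons h₁ h₂ =>
      obtain ⟨rfl, rfl⟩ := ih₁ h₁
      obtain ⟨rfl, rfl⟩ := ih₂ h₂
      exact ⟨rfl, rfl⟩
  | app _ _ _ ih₁ ih₂ ih₃ =>
    cases h' with
    | app h₁ h₂ h₃ =>
      obtain ⟨e, rfl⟩ := ih₁ h₁
      cases e
      obtain ⟨rfl, rfl⟩ := ih₂ h₂
      obtain ⟨rfl, rfl⟩ := ih₃ h₃
      exact ⟨rfl, rfl⟩
  | iapp _ _ ih₁ ih₂ =>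
    cases h' with
    | iapp h₁ h₂ =>
      obtain ⟨e, rfl⟩ := ih₁ h₁
      cases e
      obtain ⟨rfl, rfl⟩ := ih₂ h₂
      exact ⟨rfl, rfl⟩
  | case_nil _ _ ih₁ ih₂ =>
    cases h' with
    | case_nil h₁ h₂ =>
      obtain ⟨_, rfl⟩ := ih₁ h₁
      obtain ⟨rfl, rfl⟩ := ih₂ h₂
      exact ⟨rfl, rfl⟩
    | case_cons h₁ h₂ => cases (ih₁ h₁).1
  | case_cons _ _ ih₁ ih₂ =>
    cases h' with
    | case_nil h₁ h₂ => cases (ih₁ h₁).1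
    | case_cons h₁ h₂ =>
      obtain ⟨e, rfl⟩ := ih₁ h₁
      cases e
      obtain ⟨rfl, rfl⟩ := ih₂ h₂
      exact ⟨rfl, rfl⟩

end Ex

/-! ## Values -/

variable {κ : CostModel}

theorem ListU.mono {P Q : Ex → Prop} (h : ∀ v, P v → Q v) : ∀ {n : ℕ} {v : Ex}, ListU P n v →
    ListU Q n v
  | 0, _, hv => hv
  | _ + 1, _, ⟨w, ws, e, hw, hws⟩ => ⟨w, ws, e, h w hw, ListU.mono h hws⟩

theorem ListU.congr {P Q : Ex → Prop} (h : ∀ v, P v ↔ Q v) (n : ℕ) (v : Ex) :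
    ListU P n v ↔ ListU Q n v :=
  ⟨ListU.mono fun v => (h v).1, ListU.mono fun v => (h v).2⟩

theorem ListU.eval {P : Ex → Prop} (h : ∀ v, P v → Ex.Eval κ v v 0) : ∀ {n : ℕ} {v : Ex},
    ListU P n v → Ex.Eval κ v v 0
  | 0, _, rfl => .nil
  | _ + 1, _, ⟨w, ws, rfl, hw, hws⟩ => .cons (h w hw) (ListU.eval h hws)

theorem ListR.mono {R R' : Ex → Ex → Prop} (h : ∀ v z, R v z → R' v z) : ∀ {n a a' : ℕ} {v z : Ex},
    a ≤ a' → ListR R n a v z → ListR R' n a' v z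
  | 0, _, _, _, _, _, hv => hv
  | n + 1, a, a', _, _, ha, ⟨w, ws, z, zs, e, e', hw, hws⟩ => by
    refine ⟨w, ws, z, zs, e, e', h w z hw, ?_⟩
    rcases hws with ⟨rfl, hws⟩ | ⟨b, rfl, hws⟩
    · exact .inl ⟨rfl, ListR.mono h ha hws⟩
    · obtain ⟨b', rfl⟩ : ∃ b', a' = b' + 1 := ⟨a' - 1, by omega⟩
      exact .inr ⟨b', rfl, ListR.mono h (by omega) hws⟩

theorem ListR.congr {R R' : Ex → Ex → Prop} (h : ∀ v z, R v z ↔ R' v z) (n a : ℕ) (v z : Ex) :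
    ListR R n a v z ↔ ListR R' n a v z :=
  ⟨ListR.mono (fun v z => (h v z).1) le_rfl, ListR.mono (fun v z => (h v z).2) le_rfl⟩

theorem ListR.unary {R : Ex → Ex → Prop} {P : Ex → Prop} (h : ∀ v z, R v z → P v ∧ P z) :
    ∀ {n a : ℕ} {v z : Ex}, ListR R n a v z → ListU P n v ∧ ListU P n z
  | 0, _, _, _, hv => hv
  | n + 1, a, _, _, ⟨w, ws, z, zs, e, e', hw, hws⟩ => by
    have : ListU P n ws ∧ ListU P n zs := by
      rcases hws with ⟨_, hws⟩ | ⟨b, _, hws⟩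
      · exact ListR.unary h hws
      · exact ListR.unary h hws
    exact ⟨⟨w, ws, e, (h w z hw).1, this.1⟩, z, zs, e', (h w z hw).2, this.2⟩

theorem ListR.eq_of_diag {R : Ex → Ex → Prop} (h : ∀ v z, R v z → v = z) :
    ∀ {n a : ℕ} {v z : Ex}, ListR R n a v z → v = z
  | 0, _, _, _, ⟨rfl, rfl⟩ => rfl
  | n + 1, a, _, _, ⟨w, ws, z, zs, e, e', hw, hws⟩ => by
    have : ws = zs := by
      rcases hws with ⟨_, hws⟩ | ⟨b, _, hws⟩
      · exact ListR.eq_of_diag h hws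
      · exact ListR.eq_of_diag h hws
    rw [e, e', h w z hw, this]

theorem ListR.zero_diag {R : Ex → Ex → Prop} : ∀ {n : ℕ} {v z : Ex}, ListR R n 0 v z →
    ListR (fun v z => v = z ∧ R v z) n 0 v z
  | 0, _, _, hv => hv
  | n + 1, _, _, ⟨w, ws, z, zs, e, e', hw, hws⟩ => by
    rcases hws with ⟨rfl, hws⟩ | ⟨b, h, _⟩
    · exact ⟨w, ws, w, zs, e, e', ⟨rfl, hw⟩, .inl ⟨rfl, ListR.zero_diag hws⟩⟩
    · omega

theorem iup_eval (φ : ℕ → Idx) (δ : ℕ → EReal) (a : EReal) :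
    (fun i => (iup φ i).eval (a ;; δ)) = (a ;; fun i => (φ i).eval δ) := by
  funext i
  cases i with
  | zero => rfl
  | succ i => simp only [iup, scons_succ, Idx.shift, Ix.map, Ix.eval_bind]; rfl

theorem UTy.sub_val (A : UTy) : ∀ (φ : ℕ → Idx) (δ : ℕ → EReal) (v : Ex),
    (A.sub φ).Val κ δ v ↔ A.Val κ (fun i => (φ i).eval δ) v := by
  induction A with
  | nat => intro φ δ v; exact Iff.rfl
  | list n A ih =>
    intro φ δ v
    simp only [sub, Val, Ix.eval_bind, ListU.congr (ih φ δ)]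
  | arr A k l B ih₁ ih₂ =>
    intro φ δ v
    simp only [sub, Val, Ix.eval_bind, ih₁, ih₂]
  | all S k l A ih =>
    intro φ δ v
    simp only [sub, Val, Ix.eval_bind, ih, iup_eval]

theorem RTy.sub_val (τ : RTy) : ∀ (φ : ℕ → Idx) (δ : ℕ → EReal) (v v' : Ex),
    (τ.sub φ).Val κ δ v v' ↔ τ.Val κ (fun i => (φ i).eval δ) v v' := by
  induction τ with
  | nat => intro φ δ v v'; exact Iff.rfl
  | list n α τ ih =>
    intro φ δ v v'
    simp only [sub, Val, Ix.eval_bind, ListR.congr (ih φ δ)]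
  | arr τ l σ ih₁ ih₂ =>
    intro φ δ v v'
    have e := fun v => UTy.sub_val (κ := κ) (.arr τ.bar (.num 0) .inf σ.bar) φ δ v
    simp only [UTy.sub, Ix.bind] at e
    simp only [sub, Val, bar_sub, e, Ix.eval_bind, ih₁, ih₂]
  | all S l τ ih =>
    intro φ δ v v'
    have e := fun v => UTy.sub_val (κ := κ) (.all S (.num 0) .inf τ.bar) φ δ v
    simp only [UTy.sub, Ix.bind] at e
    simp only [sub, Val, bar_sub, e, Ix.eval_bind, ih, iup_eval]
  | u A => intro φ δ v v'; simp only [sub, Val, UTy.sub_val]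
  | box τ ih => intro φ δ v v'; simp only [sub, Val, ih]

theorem UTy.Val.eval {A : UTy} : ∀ {δ : ℕ → EReal} {v : Ex}, A.Val κ δ v → Ex.Eval κ v v 0 := by
  induction A with
  | nat => rintro δ v ⟨n, rfl⟩; exact .num n
  | list n A ih => rintro δ v ⟨m, _, h⟩; exact h.eval fun _ => ih
  | arr A k l B _ _ => rintro δ v ⟨t, rfl, _⟩; exact .lam t
  | all S k l A _ => rintro δ v ⟨t, rfl, _⟩; exact .ilam t

theorem RTy.Val.bar {τ : RTy} : ∀ {δ : ℕ → EReal} {v v' : Ex}, τ.Val κ δ v v' →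
    τ.bar.Val κ δ v ∧ τ.bar.Val κ δ v' := by
  induction τ with
  | nat => rintro δ v v' ⟨n, rfl, rfl⟩; exact ⟨⟨n, rfl⟩, n, rfl⟩
  | list n α τ ih =>
    rintro δ v v' ⟨m, a, hm, _, h⟩
    have := h.unary fun v z h => ih h
    exact ⟨⟨m, hm, this.1⟩, m, hm, this.2⟩
  | arr τ l σ _ _ => rintro δ v v' ⟨h, h', _⟩; exact ⟨h, h'⟩
  | all S l τ _ => rintro δ v v' ⟨h, h', _⟩; exact ⟨h, h'⟩
  | u A => rintro δ v v' h; exact h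
  | box τ ih => rintro δ v v' ⟨_, h⟩; exact ih h

theorem RTy.Val.eval {τ : RTy} {δ : ℕ → EReal} {v v' : Ex} (h : τ.Val κ δ v v') :
    Ex.Eval κ v v 0 ∧ Ex.Eval κ v' v' 0 := ⟨h.bar.1.eval, h.bar.2.eval⟩

/-- A valuation of the index context that satisfies the constraints. -/
structure Valuation (Δ : ICtx) (Φ : List ICst) (δ : ℕ → EReal) : Prop where
  valid : Δ.Valid δ
  holds : ∀ C ∈ Φ, C.Holds δ

namespace Valuation

variable {Δ : ICtx} {Φ : List ICst} {δ : ℕ → EReal}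

theorem cons (h : Valuation Δ Φ δ) {S : Srt} {a : EReal} (ha : S.Mem a) :
    Valuation (S :: Δ) (Φ.map (ICst.shift 1)) (a ;; δ) where
  valid i S' hi := by
    cases i with
    | zero => simp at hi; exact hi ▸ ha
    | succ i => exact h.valid i S' hi
  holds C hC := by
    obtain ⟨D, hD, rfl⟩ := List.mem_map.1 hC
    exact (Cst.holds_bind _ _ _).2 (h.holds D hD)

theorem cons₂ (h : Valuation Δ Φ δ) {S S' : Srt} {a b : EReal} (ha : S.Mem a) (hb : S'.Mem b) :
    Valuation (S :: S' :: Δ) (Φ.map (ICst.shift 2)) (a ;; b ;; δ) where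
  valid := ((h.cons hb).cons ha).valid
  holds C hC := by
    obtain ⟨D, hD, rfl⟩ := List.mem_map.1 hC
    exact (Cst.holds_bind _ _ _).2 (h.holds D hD)

theorem hyp (h : Valuation Δ Φ δ) {C : ICst} (hC : C.Holds δ) : Valuation Δ (C :: Φ) δ :=
  ⟨h.valid, List.forall_mem_cons.2 ⟨hC, h.holds⟩⟩

theorem entails (h : Valuation Δ Φ δ) {C : ICst} (hC : Entails Δ Φ C) : C.Holds δ :=
  hC δ h.valid h.holds

end Valuation

theorem Ix.IsNat.eval {L : Type} {p : L → Prop} {ρ : L → EReal}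
    (hρ : ∀ x, p x → ∃ n : ℕ, ρ x = (n : EReal)) {I : Ix L} (h : I.IsNat p) :
    ∃ n : ℕ, I.eval ρ = (n : EReal) := by
  induction I with
  | leaf x => exact hρ x h
  | num n => exact ⟨n, rfl⟩
  | inf => exact h.elim
  | sub _ _ => exact h.elim
  | add I J ih₁ ih₂ =>
    obtain ⟨n, hn⟩ := ih₁ h.1
    obtain ⟨m, hm⟩ := ih₂ h.2
    exact ⟨n + m, by simp only [Ix.eval, hn, hm]; push_cast; rfl⟩
  | mul I J ih₁ ih₂ =>
    obtain ⟨n, hn⟩ := ih₁ h.1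
    obtain ⟨m, hm⟩ := ih₂ h.2
    exact ⟨n * m, by simp only [Ix.eval, hn, hm]; push_cast; rfl⟩
  | min I J ih₁ ih₂ =>
    obtain ⟨n, hn⟩ := ih₁ h.1
    obtain ⟨m, hm⟩ := ih₂ h.2
    rcases le_total (I.eval ρ) (J.eval ρ) with h | h
    · exact ⟨n, by rw [Ix.eval, min_eq_left h, hn]⟩
    · exact ⟨m, by rw [Ix.eval, min_eq_right h, hm]⟩
  | max I J ih₁ ih₂ =>
    obtain ⟨n, hn⟩ := ih₁ h.1
    obtain ⟨m, hm⟩ := ih₂ h.2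
    rcases le_total (I.eval ρ) (J.eval ρ) with h | h
    · exact ⟨m, by rw [Ix.eval, max_eq_right h, hm]⟩
    · exact ⟨n, by rw [Ix.eval, max_eq_left h, hn]⟩

theorem Idx.HasSort.mem {Δ : ICtx} {δ : ℕ → EReal} {J : Idx} {S : Srt} (h : Idx.HasSort Δ J S)
    (hδ : Δ.Valid δ) : S.Mem (J.eval δ) := by
  cases S with
  | real => trivial
  | nat => exact Ix.IsNat.eval (fun i hi => hδ i .nat hi) h

variable {κ : CostModel} {Δ : ICtx} {Φ : List ICst}

/-! ## Soundness of subtyping -/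

theorem max_cost_le {k k' : EReal} {c : ℕ} (h : k' ≤ max k ((0 : ℕ) : EReal)) (hk : k ≤ (c : EReal)) :
    k' ≤ (c : EReal) :=
  h.trans (max_le hk (by exact_mod_cast Nat.zero_le c))

theorem USubN.val {A A' : UTy} (h : USubN Δ Φ A A') : ∀ {δ : ℕ → EReal} {v : Ex},
    Valuation Δ Φ δ → A.Val κ δ v → A'.Val κ δ v := by
  induction h with
  | refl => intro δ v _ h; exact h
  | trans _ _ _ ih₁ ih₂ => intro δ v m h; exact ih₂ m (ih₁ m h)
  | list hn _ ih =>
    rintro δ v m ⟨n, hn', h⟩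
    exact ⟨n, (m.entails hn).symm.trans hn', h.mono fun _ => ih m⟩
  | arr _ _ hk hl ih₁ ih₂ =>
    rintro δ v m ⟨t, rfl, h⟩
    refine ⟨t, rfl, fun w hw => ?_⟩
    obtain ⟨r, c, he, hr, hc, hc'⟩ := h w (ih₁ m hw)
    exact ⟨r, c, he, ih₂ m hr, max_cost_le (m.entails hk) hc, hc'.trans (m.entails hl)⟩
  | all _ hk hl ih =>
    rintro δ v m ⟨t, rfl, h⟩
    refine ⟨t, rfl, fun a ha => ?_⟩
    obtain ⟨r, c, he, hr, hc, hc'⟩ := h a ha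
    have m' := m.cons ha
    exact ⟨r, c, he, ih m' hr, max_cost_le (m'.entails hk) hc, hc'.trans (m'.entails hl)⟩

theorem cost_sub_self_le (c : ℕ) : (c : EReal) - (c : EReal) ≤ ((0 : ℕ) : EReal) := by
  rw [EReal.sub_self (EReal.natCast_ne_top c) (EReal.natCast_ne_bot c)]; simp

theorem RSub.val {τ τ' : RTy} (h : RSub Δ Φ τ τ') : τ.WF Δ → τ'.WF Δ →
    ∀ {δ : ℕ → EReal} {v v' : Ex}, Valuation Δ Φ δ → τ.Val κ δ v v' → τ'.Val κ δ v v' := by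
  induction h with
  | refl => intro _ _ δ v v' _ h; exact h
  | trans hw _ _ ih₁ ih₂ => intro h₁ h₃ δ v v' m h; exact ih₂ hw h₃ m (ih₁ h₁ hw m h)
  | @list Δ Φ n n' α α' τ τ' hn hα _ ih =>
    rintro h₁ h₂ δ v v' m ⟨k, a, hk, ha, h⟩
    obtain ⟨a', ha'⟩ := Idx.HasSort.mem (δ := δ) h₂.2.1 m.valid
    refine ⟨k, a', (m.entails hn).symm.trans hk, ha',
      h.mono (fun _ _ => ih h₁.2.2 h₂.2.2 m) ?_⟩
    have : α.eval δ ≤ α'.eval δ := m.entails hα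
    rw [ha, ha'] at this
    exact_mod_cast this
  | listZero hα =>
    rintro _ _ δ v v' m ⟨k, a, hk, ha, h⟩
    obtain rfl : a = 0 := by
      have := ha.symm.trans (m.entails hα)
      simpa [Ix.eval] using this
    exact ⟨k, 0, hk, ha, h.zero_diag⟩
  | listBox =>
    rintro _ _ δ v v' m ⟨k, a, hk, ha, h⟩
    exact ⟨h.eq_of_diag fun _ _ h => h.1, k, a, hk, ha, h.mono (fun _ _ h => h.2) le_rfl⟩
  | arr hs₁ hs₂ hl ih₁ ih₂ =>
    rintro h₁ h₂ δ v v' m ⟨hv, hv', t, t', rfl, rfl, h⟩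
    have hb := (RSub.arr hs₁ hs₂ hl).bar
    refine ⟨hb.val m hv, hb.val m hv', t, t', rfl, rfl, fun w w' hw => ?_⟩
    obtain ⟨r, c, r', c', he, he', hr, hc⟩ := h w w' (ih₁ h₂.1 h₁.1 m hw)
    exact ⟨r, c, r', c', he, he', ih₂ h₁.2.2 h₂.2.2 m hr, hc.trans (m.entails hl)⟩
  | arrBox =>
    rintro _ _ δ v v' m ⟨rfl, hv, hv', t, t', rfl, e, h⟩
    cases e
    refine ⟨hv, hv', t, t, rfl, rfl, fun w w' hw => ?_⟩
    obtain ⟨rfl, hw⟩ := hw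
    obtain ⟨r, c, r', c', he, he', hr, hc⟩ := h w w hw
    obtain ⟨rfl, rfl⟩ := he.det he'
    exact ⟨r, c, r, c, he, he', ⟨rfl, hr⟩, cost_sub_self_le c⟩
  | @arrU Δ Φ A B k l =>
    rintro _ _ δ v v' m ⟨hv, hv'⟩
    have hb : USubN Δ Φ (.arr A k l B) (.arr A (.num 0) .inf B) :=
      .arr .refl .refl (.zero_le_max _ _ _) (.le_inf _ _ _)
    have b := hb.val m hv
    have b' := hb.val m hv'
    obtain ⟨t, rfl, h⟩ := hv
    obtain ⟨t', rfl, h'⟩ := hv'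
    refine ⟨b, b', t, t', rfl, rfl, fun w w' hw => ?_⟩
    obtain ⟨r, c, he, hr, _, hc⟩ := h w hw.1
    obtain ⟨r', c', he', hr', hc', _⟩ := h' w' hw.2
    exact ⟨r, c, r', c', he, he', ⟨hr, hr'⟩, EReal.sub_le_sub hc hc'⟩
  | all hs hl ih =>
    rintro h₁ h₂ δ v v' m ⟨hv, hv', t, t', rfl, rfl, h⟩
    have hb := (RSub.all hs hl).bar
    refine ⟨hb.val m hv, hb.val m hv', t, t', rfl, rfl, fun a ha => ?_⟩
    obtain ⟨r, c, r', c', he, he', hr, hc⟩ := h a ha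
    exact ⟨r, c, r', c', he, he', ih h₁.2 h₂.2 (m.cons ha) hr, hc.trans ((m.cons ha).entails hl)⟩
  | @allU Δ Φ S A k l =>
    rintro _ _ δ v v' m ⟨hv, hv'⟩
    have hb : USubN Δ Φ (.all S k l A) (.all S (.num 0) .inf A) :=
      .all .refl (.zero_le_max _ _ _) (.le_inf _ _ _)
    have b := hb.val m hv
    have b' := hb.val m hv'
    obtain ⟨t, rfl, h⟩ := hv
    obtain ⟨t', rfl, h'⟩ := hv'
    refine ⟨b, b', t, t', rfl, rfl, fun a ha => ?_⟩
    obtain ⟨r, c, he, hr, _, hc⟩ := h a ha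
    obtain ⟨r', c', he', hr', hc', _⟩ := h' a ha
    exact ⟨r, c, r', c', he, he', ⟨hr, hr'⟩, EReal.sub_le_sub hc hc'⟩
  | u hs => rintro _ _ δ v v' m ⟨hv, hv'⟩; exact ⟨hs.toN.val m hv, hs.toN.val m hv'⟩
  | weak => intro _ _ δ v v' m h; exact h.bar
  | natBox => rintro _ _ δ v v' m ⟨n, rfl, rfl⟩; exact ⟨rfl, n, rfl, rfl⟩
  | boxE => rintro _ _ δ v v' m ⟨_, h⟩; exact h
  | boxBox => rintro _ _ δ v v' m ⟨e, h⟩; exact ⟨e, e, h⟩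
  | box _ ih => rintro h₁ h₂ δ v v' m ⟨e, h⟩; exact ⟨e, ih h₁ h₂ m h⟩

/-! ## Soundness of typing -/

/-- The expression `t` evaluates to a value of type `A` with cost between `k` and `l`. -/
def UTy.Comp (κ : CostModel) (A : UTy) (k l : Idx) (δ : ℕ → EReal) (t : Ex) : Prop :=
  ∃ r c, Ex.Eval κ t r c ∧ A.Val κ δ r ∧ k.eval δ ≤ (c : EReal) ∧ (c : EReal) ≤ l.eval δ

/-- The expressions `t` and `t'` evaluate to values related by `τ`, and the difference of the costs
is at most `l`. -/
def RTy.Comp (κ : CostModel) (τ : RTy) (l : Idx) (δ : ℕ → EReal) (t t' : Ex) : Prop :=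
  ∃ r c r' c', Ex.Eval κ t r c ∧ Ex.Eval κ t' r' c' ∧ τ.Val κ δ r r' ∧
    (c : EReal) - (c' : EReal) ≤ l.eval δ

theorem UTy.Val.comp {A : UTy} {δ : ℕ → EReal} {v : Ex} (h : A.Val κ δ v) :
    A.Comp κ (.num 0) (.num 0) δ v := ⟨v, 0, h.eval, h, le_rfl, le_rfl⟩

theorem RTy.Val.comp {τ : RTy} {δ : ℕ → EReal} {v v' : Ex} (h : τ.Val κ δ v v') :
    τ.Comp κ (.num 0) δ v v' :=
  ⟨v, 0, v', 0, h.eval.1, h.eval.2, h, cost_sub_self_le 0⟩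

theorem UTy.sub_comp (A : UTy) (k l : Idx) (φ : ℕ → Idx) (δ : ℕ → EReal) (t : Ex) :
    (A.sub φ).Comp κ (k.bind φ) (l.bind φ) δ t ↔ A.Comp κ k l (fun i => (φ i).eval δ) t := by
  simp only [UTy.Comp, UTy.sub_val, Ix.eval_bind]

theorem RTy.sub_comp (τ : RTy) (l : Idx) (φ : ℕ → Idx) (δ : ℕ → EReal) (t t' : Ex) :
    (τ.sub φ).Comp κ (l.bind φ) δ t t' ↔ τ.Comp κ l (fun i => (φ i).eval δ) t t' := by
  simp only [RTy.Comp, RTy.sub_val, Ix.eval_bind]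

theorem inst_eval (J : Idx) (δ : ℕ → EReal) :
    (fun i => ((J ;; Ix.leaf) i).eval δ) = (J.eval δ ;; δ) := by
  funext i; cases i <;> rfl

/-- A substitution by values of the types of a unary context. -/
def UVals (κ : CostModel) (Ω : List UTy) (δ : ℕ → EReal) (γ : ℕ → Ex) : Prop :=
  ∀ (n : ℕ) (B : UTy), (Ω)[n]? = some B → B.Val κ δ (γ n)

theorem UVals.cons {Ω : List UTy} {δ : ℕ → EReal} {γ : ℕ → Ex} (h : UVals κ Ω δ γ) {A : UTy}
    {w : Ex} (hw : A.Val κ δ w) : UVals κ (A :: Ω) δ (w ;; γ) := by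
  intro n B hB
  cases n with
  | zero => simp at hB; exact hB ▸ hw
  | succ n => exact h n B hB

theorem UVals.shift {Ω : List UTy} {δ : ℕ → EReal} {γ : ℕ → Ex} (h : UVals κ Ω δ γ) (a : EReal) :
    UVals κ (Ω.map (UTy.shift 1)) (a ;; δ) γ := by
  intro n B hB
  rw [List.getElem?_map, Option.map_eq_some_iff] at hB
  obtain ⟨A, hA, rfl⟩ := hB
  exact (A.sub_val _ _ _).2 (h n A hA)

theorem UTypingN.sound {Ω : List UTy} {k l : Idx} {t : Ex} {A : UTy}
    (h : UTypingN κ Δ Φ Ω k l t A) : ∀ {δ : ℕ → EReal} {γ : ℕ → Ex}, Valuation Δ Φ δ →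
      UVals κ Ω δ γ → A.Comp κ k l δ (t.subst γ) := by
  induction h with
  | var h => intro δ γ m E; exact (E _ _ h).comp
  | num => intro δ γ m E; exact UTy.Val.comp (A := .nat) ⟨_, rfl⟩
  | lam _ _ ih =>
    intro δ γ m E
    refine UTy.Val.comp ⟨_, rfl, fun w hw => ?_⟩
    rw [Ex.subst_up_inst]
    exact ih m (E.cons hw)
  | app _ _ ih₁ ih₂ =>
    intro δ γ m E
    obtain ⟨v, c, he, ⟨b, rfl, h⟩, hk, hl⟩ := ih₁ m E
    obtain ⟨w, d, he', hw, hk', hl'⟩ := ih₂ m E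
    obtain ⟨r, e, he'', hr, hk'', hl''⟩ := h w hw
    refine ⟨r, _, .app he he' he'', hr, ?_, ?_⟩
    · push_cast
      exact add_le_add (add_le_add (add_le_add hk hk') hk'') le_rfl
    · push_cast
      exact add_le_add (add_le_add (add_le_add hl hl') hl'') le_rfl
  | nil _ => intro δ γ m E; exact UTy.Val.comp ⟨0, rfl, rfl⟩
  | cons _ _ ih₁ ih₂ =>
    intro δ γ m E
    obtain ⟨v, c, he, hv, hk, hl⟩ := ih₁ m E
    obtain ⟨w, d, he', ⟨n, hn, hw⟩, hk', hl'⟩ := ih₂ m E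
    refine ⟨_, _, .cons he he', ⟨n + 1, ?_, v, w, rfl, hv, hw⟩, ?_, ?_⟩
    · rw [Ix.eval, Ix.eval, hn]; push_cast; rfl
    · push_cast; exact add_le_add hk hk'
    · push_cast; exact add_le_add hl hl'
  | @case Δ Φ Ω A A' n k l k' l' t t₁ t₂ _ _ _ ih₁ ih₂ ih₃ =>
    intro δ γ m E
    obtain ⟨v, c, he, ⟨j, hj, hv⟩, hk, hl⟩ := ih₁ m E
    cases j with
    | zero =>
      obtain ⟨r, d, he', hr, hk', hl'⟩ := ih₂ (m.hyp (C := .eq n (.num 0)) hj) E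
      cases hv
      refine ⟨r, _, .case_nil he he', hr, ?_, ?_⟩
      · push_cast; exact add_le_add (add_le_add hk hk') le_rfl
      · push_cast; exact add_le_add (add_le_add hl hl') le_rfl
    | succ j =>
      obtain ⟨w, ws, rfl, hw, hws⟩ := hv
      have m' := m.cons (S := .nat) (a := (j : EReal)) ⟨j, rfl⟩
      have hC : Cst.Holds ((j : EReal) ;; δ) (.eq (n.shift 1) (.add (.leaf 0) (.num 1))) := by
        simp only [Cst.Holds, Idx.shift, Ix.map, Ix.eval_bind, Ix.eval, scons_zero, scons_succ]
        rw [hj]; push_cast; rfl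
      have hw' : (A.shift 1).Val κ ((j : EReal) ;; δ) w := (A.sub_val _ _ _).2 hw
      have hws' : (UTy.list (.leaf 0) (A.shift 1)).Val κ ((j : EReal) ;; δ) ws :=
        ⟨j, rfl, hws.mono fun _ h => (A.sub_val _ _ _).2 h⟩
      have := (A'.sub_comp k' l' _ _ _).1 (ih₃ (m'.hyp hC) (((E.shift _).cons hw').cons hws'))
      obtain ⟨r, d, he', hr, hk', hl'⟩ := this
      rw [← Ex.subst_up_up_inst] at he'
      refine ⟨r, _, .case_cons he he', hr, ?_, ?_⟩
      · push_cast; exact add_le_add (add_le_add hk hk') le_rfl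
      · push_cast; exact add_le_add (add_le_add hl hl') le_rfl
  | ilam _ ih =>
    intro δ γ m E
    exact UTy.Val.comp ⟨_, rfl, fun a ha => ih (m.cons ha) (E.shift a)⟩
  | @iapp Δ Φ Ω S A J k l k' l' t _ hJ ih =>
    intro δ γ m E
    obtain ⟨v, c, he, ⟨b, rfl, h⟩, hk, hl⟩ := ih m E
    have := h _ (hJ.mem m.valid)
    rw [← inst_eval] at this
    obtain ⟨r, d, he', hr, hk', hl'⟩ := (A.sub_comp k' l' _ _ _).2 this
    refine ⟨r, _, .iapp he he', hr, ?_, ?_⟩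
    · push_cast; exact add_le_add (add_le_add hk hk') le_rfl
    · push_cast; exact add_le_add (add_le_add hl hl') le_rfl
  | sub _ _ hs ih =>
    intro δ γ m E
    obtain ⟨r, c, he, hr, hk, hl⟩ := ih m E
    exact ⟨r, c, he, hs.val m hr, hk, hl⟩
  | bounds _ _ _ ek el ih =>
    intro δ γ m E
    obtain ⟨r, c, he, hr, hk, hl⟩ := ih m E
    exact ⟨r, c, he, hr, max_cost_le (m.entails ek) hk, hl.trans (m.entails el)⟩
  | rename ξ hξ _ ih =>
    intro δ γ m E
    rw [Ex.rename_subst]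
    exact ih m fun n B hB => E _ _ (hξ n B hB)

/-- The free variables of a typed expression belong to the context. -/
theorem UTypingN.subst_congr {Ω : List UTy} {k l : Idx} {t : Ex} {A : UTy}
    (h : UTypingN κ Δ Φ Ω k l t A) : ∀ {γ γ' : ℕ → Ex}, (∀ n < Ω.length, γ n = γ' n) →
      t.subst γ = t.subst γ' := by
  have hup : ∀ {m : ℕ} {γ γ' : ℕ → Ex}, (∀ n < m, γ n = γ' n) →
      ∀ n < m + 1, Ex.up γ n = Ex.up γ' n := by
    intro m γ γ' h n hn
    cases n with
    | zero => rfl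
    | succ n => simp only [Ex.up, scons_succ, h n (by omega)]
  induction h with
  | var h => intro γ γ' e; exact e _ (List.getElem?_eq_some_iff.1 h).1
  | num => intros; rfl
  | nil => intros; rfl
  | lam _ _ ih => intro γ γ' e; rw [Ex.subst, Ex.subst, ih (hup e)]
  | app _ _ ih₁ ih₂ => intro γ γ' e; rw [Ex.subst, Ex.subst, ih₁ e, ih₂ e]
  | cons _ _ ih₁ ih₂ => intro γ γ' e; rw [Ex.subst, Ex.subst, ih₁ e, ih₂ e]
  | case _ _ _ ih₁ ih₂ ih₃ =>
    intro γ γ' e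
    rw [Ex.subst, Ex.subst, ih₁ e, ih₂ e, ih₃]
    simpa using hup (hup e)
  | ilam _ ih => intro γ γ' e; rw [Ex.subst, Ex.subst, ih (by simpa using e)]
  | iapp _ _ ih => intro γ γ' e; rw [Ex.subst, Ex.subst, ih e]
  | sub _ _ _ ih => intro γ γ' e; exact ih e
  | bounds _ _ _ _ _ ih => intro γ γ' e; exact ih e
  | rename ξ hξ _ ih =>
    intro γ γ' e
    rw [Ex.rename_subst, Ex.rename_subst]
    exact ih fun n hn => e _
      (List.getElem?_eq_some_iff.1 (hξ n _ (List.getElem?_eq_getElem hn))).1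

/-- Two substitutions by values related by the types of a relational context. -/
def RVals (κ : CostModel) (G : List RTy) (δ : ℕ → EReal) (γ γ' : ℕ → Ex) : Prop :=
  ∀ (n : ℕ) (τ : RTy), G[n]? = some τ → τ.Val κ δ (γ n) (γ' n)

namespace RVals

variable {G : List RTy} {δ : ℕ → EReal} {γ γ' : ℕ → Ex}

theorem cons (h : RVals κ G δ γ γ') {τ : RTy} {w w' : Ex} (hw : τ.Val κ δ w w') :
    RVals κ (τ :: G) δ (w ;; γ) (w' ;; γ') := by
  intro n B hB
  cases n with
  | zero => simp at hB; exact hB ▸ hw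
  | succ n => exact h n B hB

theorem shift (h : RVals κ G δ γ γ') (a : EReal) :
    RVals κ (G.map (RTy.shift 1)) (a ;; δ) γ γ' := by
  intro n B hB
  rw [List.getElem?_map, Option.map_eq_some_iff] at hB
  obtain ⟨A, hA, rfl⟩ := hB
  exact (A.sub_val _ _ _ _).2 (h n A hA)

theorem shift₂ (h : RVals κ G δ γ γ') (a b : EReal) :
    RVals κ (G.map (RTy.shift 2)) (a ;; b ;; δ) γ γ' := by
  intro n B hB
  rw [List.getElem?_map, Option.map_eq_some_iff] at hB
  obtain ⟨A, hA, rfl⟩ := hB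
  exact (A.sub_val _ _ _ _).2 (h n A hA)

theorem bar (h : RVals κ G δ γ γ') :
    UVals κ (G.map RTy.bar) δ γ ∧ UVals κ (G.map RTy.bar) δ γ' := by
  refine ⟨fun n B hB => ?_, fun n B hB => ?_⟩ <;>
  · rw [List.getElem?_map, Option.map_eq_some_iff] at hB
    obtain ⟨τ, hτ, rfl⟩ := hB
    first | exact (h n τ hτ).bar.1 | exact (h n τ hτ).bar.2

end RVals

theorem cost_diff_add {a a' b b' : ℕ} {l l' : EReal} (h : (a : EReal) - (a' : EReal) ≤ l)
    (h' : (b : EReal) - (b' : EReal) ≤ l') :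
    ((a + b : ℕ) : EReal) - ((a' + b' : ℕ) : EReal) ≤ l + l' := by
  refine le_trans (le_of_eq ?_) (add_le_add h h')
  simp only [← EReal.coe_natCast, ← EReal.coe_add, ← EReal.coe_sub]
  congr 1; push_cast; ring

theorem cost_diff_add_const {a a' : ℕ} {l : EReal} (h : (a : EReal) - (a' : EReal) ≤ l) (n : ℕ) :
    ((a + n : ℕ) : EReal) - ((a' + n : ℕ) : EReal) ≤ l := by
  have := cost_diff_add h (cost_sub_self_le n)
  simpa using this

theorem RTyping.sound {G : List RTy} {l : Idx} {t₁ t₂ : Ex} {τ : RTy}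
    (h : RTyping κ Δ Φ G l t₁ t₂ τ) : (∀ τ ∈ G, τ.WF Δ) → ∀ {δ : ℕ → EReal} {γ γ' : ℕ → Ex},
      Valuation Δ Φ δ → RVals κ G δ γ γ' → τ.Comp κ l δ (t₁.subst γ) (t₂.subst γ') := by
  induction h with
  | var h => intro hG δ γ γ' m E; exact (E _ _ h).comp
  | num => intro hG δ γ γ' m E; exact RTy.Val.comp (τ := .nat) ⟨_, rfl, rfl⟩
  | nil hα _ =>
    intro hG δ γ γ' m E
    obtain ⟨a, ha⟩ := hα.mem m.valid
    exact RTy.Val.comp ⟨0, a, rfl, ha, rfl, rfl⟩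
  | cons₁ _ _ ih₁ ih₂ =>
    intro hG δ γ γ' m E
    obtain ⟨v, c, v', c', he, he', hv, hc⟩ := ih₁ hG m E
    obtain ⟨w, d, w', d', hf, hf', ⟨n, a, hn, ha, hw⟩, hd⟩ := ih₂ hG m E
    refine ⟨_, _, _, _, .cons he hf, .cons he' hf',
      ⟨n + 1, a + 1, ?_, ?_, v, w, v', w', rfl, rfl, hv, .inr ⟨a, rfl, hw⟩⟩, cost_diff_add hc hd⟩
    · rw [Ix.eval, Ix.eval, hn]; push_cast; rfl
    · rw [Ix.eval, Ix.eval, ha]; push_cast; rfl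
  | cons₂ _ _ ih₁ ih₂ =>
    intro hG δ γ γ' m E
    obtain ⟨v, c, v', c', he, he', ⟨rfl, hv⟩, hc⟩ := ih₁ hG m E
    obtain ⟨w, d, w', d', hf, hf', ⟨n, a, hn, ha, hw⟩, hd⟩ := ih₂ hG m E
    refine ⟨_, _, _, _, .cons he hf, .cons he' hf',
      ⟨n + 1, a, ?_, ha, v, w, v, w', rfl, rfl, hv, .inl ⟨rfl, hw⟩⟩, cost_diff_add hc hd⟩
    rw [Ix.eval, Ix.eval, hn]; push_cast; rfl
  | @case Δ Φ G n α τ τ' l l' t t' t₁ t₁' t₂ t₂' h₁ _ _ _ ih₁ ih₂ ih₃ ih₄ =>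
    intro hG δ γ γ' m E
    have hr₁ := (h₁.regular hG).1
    obtain ⟨v, c, v', c', he, he', ⟨j, a, hj, ha, hv⟩, hc⟩ := ih₁ hG m E
    cases j with
    | zero =>
      obtain ⟨r, d, r', d', hf, hf', hr, hd⟩ := ih₂ hG (m.hyp (C := .eq n (.num 0)) hj) E
      obtain ⟨rfl, rfl⟩ := hv
      exact ⟨r, _, r', _, .case_nil he hf, .case_nil he' hf', hr,
        cost_diff_add_const (cost_diff_add hc hd) _⟩
    | succ j =>
      obtain ⟨w, ws, z, zs, rfl, rfl, hw, hws⟩ := hv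
      rcases hws with ⟨rfl, hws⟩ | ⟨b, rfl, hws⟩
      · have hs := leaf_hasSort Δ .nat
        have hG' : ∀ σ ∈ RTy.list (.leaf 0) (α.shift 1) (τ.shift 1) :: .box (τ.shift 1) ::
            G.map (RTy.shift 1), σ.WF (.nat :: Δ) :=
          List.forall_mem_cons.2 ⟨⟨rfl, hr₁.2.1.subst hs, hr₁.2.2.subst hs⟩,
            List.forall_mem_cons.2 ⟨hr₁.2.2.subst hs, RTy.wf_map_shift .nat hG⟩⟩
        have m' := m.cons (S := .nat) (a := (j : EReal)) ⟨j, rfl⟩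
        have hC : Cst.Holds ((j : EReal) ;; δ) (.eq (n.shift 1) (.add (.leaf 0) (.num 1))) := by
          simp only [Cst.Holds, Idx.shift, Ix.map, Ix.eval_bind, Ix.eval, scons_zero, scons_succ]
          rw [hj]; push_cast; rfl
        have hw' : (RTy.box (τ.shift 1)).Val κ ((j : EReal) ;; δ) w w :=
          ⟨rfl, (τ.sub_val _ _ _ _).2 hw⟩
        have hws' : (RTy.list (.leaf 0) (α.shift 1) (τ.shift 1)).Val κ ((j : EReal) ;; δ) ws zs :=
          ⟨j, a, rfl, by rw [← ha, Idx.shift, Ix.map, Ix.eval_bind]; rfl,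
            hws.mono (fun _ _ h => (τ.sub_val _ _ _ _).2 h) le_rfl⟩
        obtain ⟨r, d, r', d', hf, hf', hr, hd⟩ := (τ'.sub_comp l' _ _ _ _).1
          (ih₃ hG' (m'.hyp hC) (((E.shift _).cons hw').cons hws'))
        rw [← Ex.subst_up_up_inst] at hf hf'
        exact ⟨r, _, r', _, .case_cons he hf, .case_cons he' hf', hr,
          cost_diff_add_const (cost_diff_add hc hd) _⟩
      · have hs := leaf_hasSort₂ Δ .nat .nat
        have hG' : ∀ σ ∈ RTy.list (.leaf 0) (.leaf 1) (τ.shift 2) :: τ.shift 2 ::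
            G.map (RTy.shift 2), σ.WF (.nat :: .nat :: Δ) :=
          List.forall_mem_cons.2 ⟨⟨rfl, rfl, hr₁.2.2.subst hs⟩, List.forall_mem_cons.2
            ⟨hr₁.2.2.subst hs, RTy.wf_map_shift₂ .nat .nat hG⟩⟩
        have m' := m.cons₂ (S := .nat) (S' := .nat) (a := (j : EReal)) (b := (b : EReal))
          ⟨j, rfl⟩ ⟨b, rfl⟩
        have hC : Cst.Holds ((j : EReal) ;; (b : EReal) ;; δ)
            (.eq (n.shift 2) (.add (.leaf 0) (.num 1))) := by
          simp only [Cst.Holds, Idx.shift, Ix.map, Ix.eval_bind, Ix.eval, scons_zero, scons_succ]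
          rw [hj]; push_cast; rfl
        have hC' : Cst.Holds ((j : EReal) ;; (b : EReal) ;; δ)
            (.eq (α.shift 2) (.add (.leaf 1) (.num 1))) := by
          simp only [Cst.Holds, Idx.shift, Ix.map, Ix.eval_bind, Ix.eval, scons_zero,
            scons_succ]
          rw [ha]; push_cast; rfl
        have hw' : (τ.shift 2).Val κ ((j : EReal) ;; (b : EReal) ;; δ) w z :=
          (τ.sub_val _ _ _ _).2 hw
        have hws' : (RTy.list (.leaf 0) (.leaf 1) (τ.shift 2)).Val κ
            ((j : EReal) ;; (b : EReal) ;; δ) ws zs :=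
          ⟨j, b, rfl, rfl, hws.mono (fun _ _ h => (τ.sub_val _ _ _ _).2 h) le_rfl⟩
        obtain ⟨r, d, r', d', hf, hf', hr, hd⟩ := (τ'.sub_comp l' _ _ _ _).1
          (ih₄ hG' ((m'.hyp hC).hyp hC') (((E.shift₂ _ _).cons hw').cons hws'))
        rw [← Ex.subst_up_up_inst] at hf hf'
        exact ⟨r, _, r', _, .case_cons he hf, .case_cons he' hf', hr,
          cost_diff_add_const (cost_diff_add hc hd) _⟩
  | lam hτ h ih =>
    intro hG δ γ γ' m E
    have hu := h.unary
    have hA := RTy.bar_wf _ hτ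
    have bar : ∀ {t : Ex} {γ : ℕ → Ex} {k l : Idx} {A : UTy},
        A.Comp κ k l δ ((Ex.lam t).subst γ) → A.Val κ δ (.lam (t.subst (Ex.up γ))) := by
      rintro t γ k l A ⟨r, c, he, hr, _⟩
      cases he
      exact hr
    refine RTy.Val.comp ⟨bar ((UTypingN.lam hA hu.1).sound m E.bar.1),
      bar ((UTypingN.lam hA hu.2).sound m E.bar.2), _, _, rfl, rfl, fun w w' hw => ?_⟩
    rw [Ex.subst_up_inst, Ex.subst_up_inst]
    exact ih (List.forall_mem_cons.2 ⟨hτ, hG⟩) m (E.cons hw)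
  | app _ _ ih₁ ih₂ =>
    intro hG δ γ γ' m E
    obtain ⟨v, c, v', c', he, he', ⟨_, _, b, b', rfl, rfl, h⟩, hc⟩ := ih₁ hG m E
    obtain ⟨w, d, w', d', hf, hf', hw, hd⟩ := ih₂ hG m E
    obtain ⟨r, e, r', e', hg, hg', hr, he₃⟩ := h w w' hw
    exact ⟨r, _, r', _, .app he hf hg, .app he' hf' hg', hr,
      cost_diff_add_const (cost_diff_add (cost_diff_add hc hd) he₃) _⟩
  | @ilam Δ Φ G S τ l t t' h ih =>
    intro hG δ γ γ' m E
    have hu := h.unary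
    rw [RTy.map_shift_bar] at hu
    have bar : ∀ {t : Ex} {γ : ℕ → Ex} {k l : Idx} {A : UTy},
        A.Comp κ k l δ ((Ex.ilam t).subst γ) → A.Val κ δ (.ilam (t.subst γ)) := by
      rintro t γ k l A ⟨r, c, he, hr, _⟩
      cases he
      exact hr
    exact RTy.Val.comp ⟨bar ((UTypingN.ilam hu.1).sound m E.bar.1),
      bar ((UTypingN.ilam hu.2).sound m E.bar.2), _, _, rfl, rfl, fun a ha =>
      ih (RTy.wf_map_shift S hG) (m.cons ha) (E.shift a)⟩
  | @iapp Δ Φ G S τ J l l' t t' _ hJ ih =>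
    intro hG δ γ γ' m E
    obtain ⟨v, c, v', c', he, he', ⟨_, _, b, b', rfl, rfl, h⟩, hc⟩ := ih hG m E
    have := h _ (hJ.mem m.valid)
    rw [← inst_eval] at this
    obtain ⟨r, d, r', d', hf, hf', hr, hd⟩ := (τ.sub_comp l' _ _ _ _).2 this
    exact ⟨r, _, r', _, .iapp he hf, .iapp he' hf', hr,
      cost_diff_add_const (cost_diff_add hc hd) _⟩
  | @nochange Δ Φ G G' τ l t ξ _ hξ h hs ih =>
    intro hG δ γ γ' m E
    have hG' : ∀ σ ∈ G, σ.WF Δ := by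
      intro σ hσ
      obtain ⟨n, hn⟩ := List.mem_iff_getElem?.1 hσ
      exact hG σ (List.mem_of_getElem? (hξ n σ hn))
    have E' : RVals κ G δ (fun n => γ (ξ n)) (fun n => γ' (ξ n)) :=
      fun n σ hn => E _ _ (hξ n σ hn)
    have e : t.subst (fun n => γ (ξ n)) = t.subst (fun n => γ' (ξ n)) := by
      refine h.unary.1.subst_congr fun n hn => ?_
      have hn' := List.getElem?_eq_getElem (l := G) (i := n) (by simpa using hn)
      have hm := List.mem_of_getElem? hn'
      have hw := hG' _ hm
      exact ((hs _ hm).val hw (by exact hw) m (E' n _ hn')).1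
    obtain ⟨r, c, r', c', he, he', hr, hc⟩ := ih hG' m E'
    rw [Ex.rename_subst, Ex.rename_subst]
    rw [e] at he ⊢
    obtain ⟨rfl, rfl⟩ := he.det he'
    exact ⟨r, c, r, c, he, he', ⟨rfl, hr⟩, cost_sub_self_le c⟩
  | switch h₁ h₂ =>
    intro hG δ γ γ' m E
    obtain ⟨r, c, he, hr, _, hc⟩ := h₁.toN.sound m E.bar.1
    obtain ⟨r', c', he', hr', hc', _⟩ := h₂.toN.sound m E.bar.2
    exact ⟨r, c, r', c', he, he', ⟨hr, hr'⟩, EReal.sub_le_sub hc hc'⟩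
  | sub h hτ' _ hs el ih =>
    intro hG δ γ γ' m E
    obtain ⟨r, c, r', c', he, he', hr, hc⟩ := ih hG m E
    exact ⟨r, c, r', c', he, he', hs.val (h.regular hG).1 hτ' m hr, hc.trans (m.entails el)⟩

end RelCost

theorem mainTheorem8 (κ : CostModel) (Δ : ICtx) (Φ : List ICst) (Γ : List RTy) (l : Idx)
    (t₁ t₂ : Ex) (τ : RTy) (hΦ : ∀ C ∈ Φ, C.WF Δ) (hΓ : ∀ σ ∈ Γ, σ.WF Δ)
    (h : RTyping κ Δ Φ Γ l t₁ t₂ τ) :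
    RHOL Δ (relCtx Γ) (Φ.map (fun C => Fml.cst C.toH) ++ relHyps Γ)
        (t₁.cost κ).copyL τ.erase.costE (t₂.cost κ).copyR τ.erase.costE
        (τ.fmlE l (.var 1) (.var 0)) ∧
      (Γ = [] → ∀ δ : ℕ → EReal, Δ.Valid δ → (∀ C ∈ Φ, C.Holds δ) →
        (∃ v₁ c₁ v₂ c₂, Ex.Eval κ t₁ v₁ c₁ ∧ Ex.Eval κ t₂ v₂ c₂) ∧
        ∀ v₁ c₁ v₂ c₂, Ex.Eval κ t₁ v₁ c₁ → Ex.Eval κ t₂ v₂ c₂ →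
          τ.Val κ δ v₁ v₂ ∧ (c₁ : EReal) - (c₂ : EReal) ≤ l.eval δ) := by
  refine ⟨h.rhol hΦ hΓ, ?_⟩
  rintro rfl δ hδ hC
  have E : RVals κ [] δ Ex.var Ex.var := fun n τ hn => by simp at hn
  obtain ⟨r, c, r', c', he, he', hr, hc⟩ := h.sound hΓ ⟨hδ, hC⟩ E
  rw [Ex.subst_var] at he he'
  refine ⟨⟨r, c, r', c', he, he'⟩, fun v₁ c₁ v₂ c₂ h₁ h₂ => ?_⟩
  obtain ⟨rfl, rfl⟩ := he.det h₁
  obtain ⟨rfl, rfl⟩ := he'.det h₂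
  exact ⟨hr, hc⟩
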